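/- **Theorem.** Let $\varepsilon>0$, $y_0\in(-1,0]$, $c_1,c_2>0$, $\nu\in C^2([-1,1])$, $\bar\lambda\in C^1([-1,1])$. Consider $$\partial_t\bar u=\varepsilon\,\partial_y^2\bar u+\nu(y)\,\partial_y\bar u+\bar\lambda(y)\,\bar u\ \text{ on }(-1,1),\qquad \bar u(-1,t)=\bar{\mathcal U}_1(t),\quad \bar u(1,t)=\bar{\mathcal U}_2(t).$$ Put $\varphi(y)=\int_{-1}^y\frac{\nu(z)}{2\varepsilon}dz$, $\lambda=\bar\lambda-\frac{\nu'}2-\frac{\nu^2}{4\varepsilon}$ (so $\varphi=0$, $\lambda=\bar\lambda$ if $\nu=0$), and $$a=\tfrac{1+y_0}{1-y_0},\quad \varepsilon_1=\tfrac{\varepsilon}{(1+y_0)^2},\quad \varepsilon_2=\tfrac{\varepsilon}{(1-y_0)^2},\quad E=\mathrm{diag}(\varepsilon_1,\varepsilon_2),\quad C=\mathrm{diag}(c_1,c_2),$$ $$\Lambda(x)=\mathrm{diag}\big(\lambda(y_0-(1+y_0)x),\,\lambda(y_0+(1-y_0)x)\big),\quad \alpha=\begin{pmatrix}1&a\\0&0\end{pmatrix},\quad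 \beta=\begin{pmatrix}0&0\\1&-1\end{pmatrix},$$ $\mathcal T=\{0\le y\le x\le 1\}$, $\mathcal T_{\rm u}=\{0\le x\le y\le 1\}$. *Kernel equations.* A $2\times2$ matrix kernel $K=(k_{ij})$ on $\mathcal T$ satisfies, with $g(x)=(\varepsilon_1-\varepsilon_2)\,\partial_yk_{21}(x,x)$ and $G(x)=\begin{pmatrix}0&0\\g(x)&0\end{pmatrix}$, $$E\,\partial_x^2K-\partial_y^2K\,E=K\Lambda(y)+CK-G(x)K,$$ $$\partial_yK(x,x)E+E\,\partial_xK(x,x)=-E\tfrac{d}{dx}K(x,x)-\Lambda(x)-C+G(x),\qquad k_{12}(x,x)=k_{21}(x,x)=0,$$ $$K(x,0)\,E\,V'=\partial_yK(x,0)\,E\,V\quad\text{for all }V,V'\in\mathbb R^2\text{ with }\alpha V'=-\beta V .$$ Here $k_{11},k_{21},k_{22}\in C^2(\mathcal T)$, and $k_{12}$ is continuous on $\mathcal T$ and $C^2$ on each of the two closed parts into which the line $y=ax$ cuts $\mathcal T$. Kernels $q$ on $\mathcal T$, $r$ on $\mathcal T_{\rm u}$ and $p$ on $[0,1]$ satisfy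 $$p(x)=a^{-1}q(x,0),\qquad \varepsilon_2\partial_x^2q-\varepsilon_1\partial_y^2q=(c_2-c_1)q+g(y)\,p(x-y),\qquad \varepsilon_2\partial_x^2r-\varepsilon_1\partial_y^2r=(c_2-c_1)r,$$ $$r(x,x)=q(x,x),\quad (\varepsilon_2-\varepsilon_1)\big(\partial_yq(x,x)-\partial_yr(x,x)\big)=g(x),\quad \partial_yq(x,0)=a\,\partial_xq(x,0),$$ $$r(x,1)=0,\quad r(0,y)=0,\quad \partial_xr(0,y)=0\ \ (0<y<1).$$ Here $q$ and $r$ are continuous and are $C^2$ on each of the closed parts into which the line $x+ay=2a$ cuts $\mathcal T$, respectively the lines $x=ay$ and $x+ay=2a$ cut $\mathcal T_{\rm u}$. (Each line is a characteristic of the equation concerned; the conditions that involve derivatives are required off these lines.) *Gains.* With $$h_1(y)=k_{21}(1,y)+q(1,y)-\int_y^1\big[p(1-z)k_{21}(z,y)+q(1,z)k_{11}(z,y)\big]dz,$$ $$h_2(y)=k_{22}(1,y)+p(1-y)-\int_y^1\big[p(1-z)k_{22}(z,y)+q(1,z)k_{12}(z,y)\big]dz,$$ $$F_1(y)=\begin{cases}\frac{1}{1+y_0}\,k_{11}\big(1,\frac{y_0-y}{1+y_0}\big)&y\le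 y_0\\[2pt] \frac1{1-y_0}\,k_{12}\big(1,\frac{y-y_0}{1-y_0}\big)&y>y_0\end{cases}\qquad F_2(y)=\begin{cases}\frac{1}{1+y_0}\,h_1\big(\frac{y_0-y}{1+y_0}\big)&y\le y_0\\[2pt] \frac1{1-y_0}\,h_2\big(\frac{y-y_0}{1-y_0}\big)&y>y_0\end{cases}$$ apply the state feedback $$\bar{\mathcal U}_1(t)=\int_{-1}^1e^{\varphi(y)}F_1(y)\,\bar u(y,t)\,dy,\qquad \bar{\mathcal U}_2(t)=\int_{-1}^1e^{\varphi(y)-\varphi(1)}F_2(y)\,\bar u(y,t)\,dy$$ (so $\bar{\mathcal U}_i=\int_{-1}^1F_i\,\bar u\,dy$ when $\nu=0$). *Conclusion.* Kernels $K,p,q,r$ as above exist. For any such kernels the zero solution of the closed loop is exponentially stable in $L^2(-1,1)$ with rate $$\gamma=\min\{a^3c_1,c_2\}+\tfrac{\varepsilon_2}{4}>0 :$$ there is a constant $\bar\Pi>0$ such that for every $t_0$ and every solution $\bar u$ on $[t_0,\infty)$ (of class $C^{2,1}$ on $[-1,1]\times(t_0,\infty)$, with $\bar u(\cdot,t_0)\in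 L^2$ attained in the $L^2$ sense as $t\downarrow t_0$), $$\|\bar u(\cdot,t)\|_{L^2}\le\bar\Pi\,e^{-\gamma(t-t_0)}\,\|\bar u(\cdot,t_0)\|_{L^2}\qquad(t\ge t_0).$$ -/

import Mathlib

noncomputable section

namespace Folding

/-- The triangle `0 ≤ y ≤ x ≤ 1`. -/
def triL : Set (ℝ × ℝ) := {z | 0 ≤ z.2 ∧ z.2 ≤ z.1 ∧ z.1 ≤ 1}

/-- The triangle `0 ≤ x ≤ y ≤ 1`. -/
def triU : Set (ℝ × ℝ) := {z | 0 ≤ z.1 ∧ z.1 ≤ z.2 ∧ z.2 ≤ 1}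

/-- Partial derivative in the first variable, relative to the set `S` (one-sided on its boundary). -/
def dX (S : Set (ℝ × ℝ)) (f : ℝ → ℝ → ℝ) (x y : ℝ) : ℝ :=
  fderivWithin ℝ (fun z : ℝ × ℝ => f z.1 z.2) S (x, y) (1, 0)

/-- Partial derivative in the second variable, relative to the set `S`. -/
def dY (S : Set (ℝ × ℝ)) (f : ℝ → ℝ → ℝ) (x y : ℝ) : ℝ :=
  fderivWithin ℝ (fun z : ℝ × ℝ => f z.1 z.2) S (x, y) (0, 1)

/-- Twice continuously differentiable on `S`, up to the boundary points belonging to `S`. -/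
def C2On (f : ℝ → ℝ → ℝ) (S : Set (ℝ × ℝ)) : Prop :=
  ContDiffOn ℝ 2 (fun z : ℝ × ℝ => f z.1 z.2) S

/-- Entrywise partial derivatives of a matrix kernel on the triangle `triL`. -/
def matDX (K : ℝ → ℝ → Matrix (Fin 2) (Fin 2) ℝ) (x y : ℝ) : Matrix (Fin 2) (Fin 2) ℝ :=
  Matrix.of fun i j => dX triL (fun x' y' => K x' y' i j) x y

def matDY (K : ℝ → ℝ → Matrix (Fin 2) (Fin 2) ℝ) (x y : ℝ) : Matrix (Fin 2) (Fin 2) ℝ :=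
  Matrix.of fun i j => dY triL (fun x' y' => K x' y' i j) x y

/-- The derivative `d/dx K(x,x)` along the diagonal. -/
def matDiagDeriv (K : ℝ → ℝ → Matrix (Fin 2) (Fin 2) ℝ) (x : ℝ) : Matrix (Fin 2) (Fin 2) ℝ :=
  Matrix.of fun i j => deriv (fun s => K s s i j) x

/-! Parameters of the folded system. -/

def eps1 (ε y₀ : ℝ) : ℝ := ε / (1 + y₀) ^ 2

def eps2 (ε y₀ : ℝ) : ℝ := ε / (1 - y₀) ^ 2

def aCoef (y₀ : ℝ) : ℝ := (1 + y₀) / (1 - y₀)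

def matE (ε y₀ : ℝ) : Matrix (Fin 2) (Fin 2) ℝ := !![eps1 ε y₀, 0; 0, eps2 ε y₀]

def matC (c₁ c₂ : ℝ) : Matrix (Fin 2) (Fin 2) ℝ := !![c₁, 0; 0, c₂]

def matAlpha (y₀ : ℝ) : Matrix (Fin 2) (Fin 2) ℝ := !![1, aCoef y₀; 0, 0]

def matBeta : Matrix (Fin 2) (Fin 2) ℝ := !![0, 0; 1, -1]

/-- The folded reaction matrix of the advection-free equation `u_t = ε u_yy + ℓ u`. -/
def matLambda (y₀ : ℝ) (ℓ : ℝ → ℝ) (x : ℝ) : Matrix (Fin 2) (Fin 2) ℝ :=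
  !![ℓ (y₀ - (1 + y₀) * x), 0; 0, ℓ (y₀ + (1 - y₀) * x)]

/-- The coupling coefficient `g(x) = (ε₁ - ε₂) ∂_y k₂₁(x,x)`. -/
def gCoef (ε y₀ : ℝ) (K : ℝ → ℝ → Matrix (Fin 2) (Fin 2) ℝ) (x : ℝ) : ℝ :=
  (eps1 ε y₀ - eps2 ε y₀) * dY triL (fun x' y' => K x' y' 1 0) x x

def matG (ε y₀ : ℝ) (K : ℝ → ℝ → Matrix (Fin 2) (Fin 2) ℝ) (x : ℝ) :
    Matrix (Fin 2) (Fin 2) ℝ := !![0, 0; gCoef ε y₀ K x, 0]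

/-- The kernel equations of the first (Volterra) backstepping transformation
`W(x) = U(x) - ∫₀ˣ K(x,y) U(y) dy`.  The entry `k₁₂` is `C²` on either side of the characteristic
line `y = a x` through the corner, and continuous across it. -/
structure IsFirstKernel (ε y₀ c₁ c₂ : ℝ) (ℓ : ℝ → ℝ)
    (K : ℝ → ℝ → Matrix (Fin 2) (Fin 2) ℝ) : Prop where
  reg11 : C2On (fun x y => K x y 0 0) triL
  reg21 : C2On (fun x y => K x y 1 0) triL
  reg22 : C2On (fun x y => K x y 1 1) triL
  cont12 : ContinuousOn (fun z : ℝ × ℝ => K z.1 z.2 0 1) triL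
  reg12_lower : C2On (fun x y => K x y 0 1) {z ∈ triL | z.2 ≤ aCoef y₀ * z.1}
  reg12_upper : C2On (fun x y => K x y 0 1) {z ∈ triL | aCoef y₀ * z.1 ≤ z.2}
  pde : ∀ x y : ℝ, 0 < y → y < x → x < 1 → y ≠ aCoef y₀ * x →
    matE ε y₀ * matDX (matDX K) x y - matDY (matDY K) x y * matE ε y₀
      = K x y * matLambda y₀ ℓ y + matC c₁ c₂ * K x y - matG ε y₀ K x * K x y
  diag : ∀ x ∈ Set.Ioo (0 : ℝ) 1,
    matDY K x x * matE ε y₀ + matE ε y₀ * matDX K x x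
      = -(matE ε y₀ * matDiagDeriv K x) - matLambda y₀ ℓ x - matC c₁ c₂ + matG ε y₀ K x
  /-- For `y₀ < 0` these two conditions say exactly that `E K(x,x) = K(x,x) E`. -/
  offdiag12 : ∀ x ∈ Set.Icc (0 : ℝ) 1, K x x 0 1 = 0
  offdiag21 : ∀ x ∈ Set.Icc (0 : ℝ) 1, K x x 1 0 = 0
  /-- `K(x,0) E U'(0) = ∂_y K(x,0) E U(0)` for all boundary data `(U(0), U'(0)) = (V, V')`
  that satisfy the folding condition `α U'(0) = -β U(0)`. -/
  fold : ∀ x ∈ Set.Ioo (0 : ℝ) 1, ∀ V V' : Fin 2 → ℝ,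
    (matAlpha y₀).mulVec V' = -(matBeta.mulVec V) →
      (K x 0 * matE ε y₀).mulVec V' = (matDY K x 0 * matE ε y₀).mulVec V

/-- The kernel equations of the second transformation
`ω₁ = w₁`, `ω₂(x) = w₂(x) - ∫₀ˣ (q(x,y) w₁(y) + p(x-y) w₂(y)) dy - ∫ₓ¹ r(x,y) w₁(y) dy`,
for a given coupling coefficient `g`.  The kernels `q`, `r` are continuous and are `C²` between the
characteristic line `x = a y` from the corner and its reflection `x + a y = 2 a` at `y = 1`. -/
structure IsSecondKernel (ε y₀ c₁ c₂ : ℝ) (g : ℝ → ℝ) (p : ℝ → ℝ) (q r : ℝ → ℝ → ℝ) : Prop where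
  cont_q : ContinuousOn (fun z : ℝ × ℝ => q z.1 z.2) triL
  reg_q_left : C2On q {z ∈ triL | z.1 + aCoef y₀ * z.2 ≤ 2 * aCoef y₀}
  reg_q_right : C2On q {z ∈ triL | 2 * aCoef y₀ ≤ z.1 + aCoef y₀ * z.2}
  cont_r : ContinuousOn (fun z : ℝ × ℝ => r z.1 z.2) triU
  reg_r_left : C2On r {z ∈ triU | z.1 ≤ aCoef y₀ * z.2}
  reg_r_mid : C2On r
    {z ∈ triU | aCoef y₀ * z.2 ≤ z.1 ∧ z.1 + aCoef y₀ * z.2 ≤ 2 * aCoef y₀}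
  reg_r_right : C2On r {z ∈ triU | 2 * aCoef y₀ ≤ z.1 + aCoef y₀ * z.2}
  p_eq : ∀ x ∈ Set.Icc (0 : ℝ) 1, p x = (aCoef y₀)⁻¹ * q x 0
  pde_q : ∀ x y : ℝ, 0 < y → y < x → x < 1 → x + aCoef y₀ * y ≠ 2 * aCoef y₀ →
    eps2 ε y₀ * dX triL (dX triL q) x y - eps1 ε y₀ * dY triL (dY triL q) x y
      = (c₂ - c₁) * q x y + g y * p (x - y)
  pde_r : ∀ x y : ℝ, 0 < x → x < y → y < 1 → x ≠ aCoef y₀ * y →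
    x + aCoef y₀ * y ≠ 2 * aCoef y₀ →
    eps2 ε y₀ * dX triU (dX triU r) x y - eps1 ε y₀ * dY triU (dY triU r) x y
      = (c₂ - c₁) * r x y
  /-- `∂_y q(x,x) = ∂_y r(x,x) + g(x) / (ε₂ - ε₁)`, multiplied by `ε₂ - ε₁`. -/
  jump : ∀ x ∈ Set.Ioo (0 : ℝ) 1, x + aCoef y₀ * x ≠ 2 * aCoef y₀ →
    (eps2 ε y₀ - eps1 ε y₀) * (dY triL q x x - dY triU r x x) = g x
  interface : ∀ x ∈ Set.Icc (0 : ℝ) 1, r x x = q x x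
  fold : ∀ x ∈ Set.Ioo (0 : ℝ) 1, x ≠ 2 * aCoef y₀ →
    dY triL q x 0 = aCoef y₀ * dX triL q x 0
  r_end : ∀ x ∈ Set.Icc (0 : ℝ) 1, r x 1 = 0
  r_init : ∀ y ∈ Set.Icc (0 : ℝ) 1, r 0 y = 0
  r_init_deriv : ∀ y ∈ Set.Ioo (0 : ℝ) 1, dX triU r 0 y = 0

/-- All kernels of the design. -/
structure IsKernelFamily (ε y₀ c₁ c₂ : ℝ) (ℓ : ℝ → ℝ)
    (K : ℝ → ℝ → Matrix (Fin 2) (Fin 2) ℝ) (p : ℝ → ℝ) (q r : ℝ → ℝ → ℝ) : Prop where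
  first : IsFirstKernel ε y₀ c₁ c₂ ℓ K
  second : IsSecondKernel ε y₀ c₁ c₂ (gCoef ε y₀ K) p q r

/-! Feedback gains. -/

def h1 (K : ℝ → ℝ → Matrix (Fin 2) (Fin 2) ℝ) (p : ℝ → ℝ) (q : ℝ → ℝ → ℝ) (y : ℝ) : ℝ :=
  K 1 y 1 0 + q 1 y - ∫ z in y..1, (p (1 - z) * K z y 1 0 + q 1 z * K z y 0 0)

def h2 (K : ℝ → ℝ → Matrix (Fin 2) (Fin 2) ℝ) (p : ℝ → ℝ) (q : ℝ → ℝ → ℝ) (y : ℝ) : ℝ :=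
  K 1 y 1 1 + p (1 - y) - ∫ z in y..1, (p (1 - z) * K z y 1 1 + q 1 z * K z y 0 1)

def gain1 (y₀ : ℝ) (K : ℝ → ℝ → Matrix (Fin 2) (Fin 2) ℝ) (y : ℝ) : ℝ :=
  if y ≤ y₀ then (1 + y₀)⁻¹ * K 1 ((y₀ - y) / (1 + y₀)) 0 0
  else (1 - y₀)⁻¹ * K 1 ((y - y₀) / (1 - y₀)) 0 1

def gain2 (y₀ : ℝ) (K : ℝ → ℝ → Matrix (Fin 2) (Fin 2) ℝ) (p : ℝ → ℝ) (q : ℝ → ℝ → ℝ)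
    (y : ℝ) : ℝ :=
  if y ≤ y₀ then (1 + y₀)⁻¹ * h1 K p q ((y₀ - y) / (1 + y₀))
  else (1 - y₀)⁻¹ * h2 K p q ((y - y₀) / (1 - y₀))

/-! Removal of the advection term by `u(y,t) = exp (φ(y)) ū(y,t)`. -/

/-- `φ(y) = ∫_{-1}^y ν(z) / (2 ε) dz`. -/
def advPhase (ε : ℝ) (ν : ℝ → ℝ) (y : ℝ) : ℝ := ∫ z in (-1)..y, ν z / (2 * ε)

/-- The reaction coefficient of the equation for `u`; it is `lam` itself when `ν = 0`. -/
def reducedReaction (ε : ℝ) (ν lam : ℝ → ℝ) (y : ℝ) : ℝ :=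
  lam y - derivWithin ν (Set.Icc (-1) 1) y / 2 - ν y ^ 2 / (4 * ε)

/-- The gains acting on the original state `ū`, where `u(-1) = ū(-1)` and
`u(1) = exp (φ(1)) ū(1)`; they are `gain1` and `gain2` themselves when `ν = 0`. -/
def origGain1 (ε y₀ : ℝ) (ν : ℝ → ℝ) (K : ℝ → ℝ → Matrix (Fin 2) (Fin 2) ℝ) (y : ℝ) : ℝ :=
  Real.exp (advPhase ε ν y) * gain1 y₀ K y

def origGain2 (ε y₀ : ℝ) (ν : ℝ → ℝ) (K : ℝ → ℝ → Matrix (Fin 2) (Fin 2) ℝ) (p : ℝ → ℝ)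
    (q : ℝ → ℝ → ℝ) (y : ℝ) : ℝ :=
  Real.exp (advPhase ε ν y - advPhase ε ν 1) * gain2 y₀ K p q y

/-- The `L²(-1,1)` norm. -/
def l2norm (f : ℝ → ℝ) : ℝ := Real.sqrt (∫ y in (-1)..1, f y ^ 2)

/-- `u(y,t)` solves, from time `t₀` on and with an arbitrary initial state in `L²(-1,1)`,
`u_t = ε u_yy + ν u_y + lam u` on `(-1,1)` with `u(-1,t) = ∫ F₁ u` and `u(1,t) = ∫ F₂ u`:
it is of class `C^{2,1}` on `[-1,1] × (t₀,∞)` and attains its initial state in `L²`. -/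
structure IsClosedLoopSolution (ε : ℝ) (ν lam F₁ F₂ : ℝ → ℝ) (t₀ : ℝ) (u : ℝ → ℝ → ℝ) :
    Prop where
  evolution : ∃ ut uy uyy : ℝ → ℝ → ℝ,
    ContinuousOn (fun z : ℝ × ℝ => ut z.1 z.2) (Set.Icc (-1) 1 ×ˢ Set.Ioi t₀) ∧
    ContinuousOn (fun z : ℝ × ℝ => uy z.1 z.2) (Set.Icc (-1) 1 ×ˢ Set.Ioi t₀) ∧
    ContinuousOn (fun z : ℝ × ℝ => uyy z.1 z.2) (Set.Icc (-1) 1 ×ˢ Set.Ioi t₀) ∧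
    ∀ y ∈ Set.Icc (-1 : ℝ) 1, ∀ t > t₀,
      HasDerivAt (fun s => u y s) (ut y t) t ∧
      HasDerivWithinAt (fun z => u z t) (uy y t) (Set.Icc (-1) 1) y ∧
      HasDerivWithinAt (fun z => uy z t) (uyy y t) (Set.Icc (-1) 1) y ∧
      ut y t = ε * uyy y t + ν y * uy y t + lam y * u y t
  left_control : ∀ t > t₀, u (-1) t = ∫ y in (-1)..1, F₁ y * u y t
  right_control : ∀ t > t₀, u 1 t = ∫ y in (-1)..1, F₂ y * u y t
  initial_mem : MeasureTheory.MemLp (fun y => u y t₀) 2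
    (MeasureTheory.volume.restrict (Set.Icc (-1) 1))
  initial_lim : Filter.Tendsto (fun t => l2norm (fun y => u y t - u y t₀))
    (nhdsWithin t₀ (Set.Ioi t₀)) (nhds 0)

/-- The decay rate `γ = min {a³ c₁, c₂} + ε₂ / 4`. -/
def decayRate (ε y₀ c₁ c₂ : ℝ) : ℝ := min (aCoef y₀ ^ 3 * c₁) c₂ + eps2 ε y₀ / 4

end Folding

end

open Set Filter Topology MeasureTheory intervalIntegral

namespace Folding

noncomputable section

/-! Calculus in the plane. -/

/-! Multiplication by `exp φ` removes the advection, and folding the interval at `y₀` gives two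
reaction-diffusion equations on `[0,1]` with `ε₂ = a² ε₁`, tied together at `x = 0` by equality of
values and balance of fluxes. Two integral transformations simplify this system. The first
(`IsFirstKernel.transform`) replaces the reactions by the damping `-c₁`, `-c₂` and leaves only a
coupling term `g(x) w₁` in the second equation; the second (`IsSecondKernel.transform`) removes that
coupling. The feedback laws say exactly that both target states vanish at `x = 1`
(`IsKernelFamily.secondState_one` for the second one). In the target system the energy with weights
`1 + y₀` and `1 - y₀`, which is the squared `L²` norm in the unfolded variable, has no net flux
through the fold, so integration by parts and Poincaré's inequality yield the decay
(`target_energy_decay`). Both transformations are bounded with bounded inverse in `L²`, by a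
Grönwall argument, and so the decay carries over to the original state.

Existence of the first kernel: the fold conditions say that the two entries in a row of `K` are the
two halves of one function of the unfolded variable. In characteristic coordinates each row becomes
a Goursat problem `∂_ξ ∂_ζ u = F` in a sector. In the second row `F` contains `g`, which is the
trace of `∂_ζ u` on an edge, so the unknown is taken to be `ψ = ∂_ζ u`; it solves a Volterra
equation that contracts an exponentially weighted supremum norm (`exists_goursat`). Second
derivatives come from a bootstrap: the source has kinks only along a line oblique to both
characteristic directions, and integrating across such a line in either coordinate direction
restores one derivative (`GoodSource.cut`).

Existence of the second kernel: `q`, and `r` where `a y ≤ x`, are one function `Q` of `ξ = x - a y`,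
`ζ = x + a y`. The prescribed jump of its derivative across the diagonal is carried by an explicit
function `S`, and the rest solves a fixed point equation (`exists_charFixed`). Kinks of the source
along oblique lines are harmless as before; the one along the characteristic `ζ = 2a` comes from a
term depending on `ζ` alone and is split off explicitly, which gives separate `C²` representations
on the two sides (`exists_characteristicKernel`).

The stability part concerns arbitrary kernels with the stated piecewise regularity, so the
transformed equations are derived by a Leibniz rule on each piece (`piece_second_deriv`). The terms
on a separating line cancel because the line is characteristic: the conormal derivative is then
tangential, and tangential derivatives of a continuous kernel agree from both sides
(`HasPartials.edge_eq`). At the few abscissae where the arrangement of pieces changes, the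
identities extend by continuity (`hasDerivIcc_of_off_countable`).

A solution is regular only for `t > t₀`. The decay is therefore proved from each `s > t₀`, and `s ↓
t₀` uses the `L²` attainment of the initial state. -/

/-- The linear form `(u, v) ↦ A u + B v`. -/
def planeForm (A B : ℝ) : ℝ × ℝ →L[ℝ] ℝ :=
  A • ContinuousLinearMap.fst ℝ ℝ ℝ + B • ContinuousLinearMap.snd ℝ ℝ ℝ

@[simp] lemma planeForm_apply (A B : ℝ) (z : ℝ × ℝ) : planeForm A B z = A * z.1 + B * z.2 := by
  simp [planeForm]

lemma eq_planeForm (L : ℝ × ℝ →L[ℝ] ℝ) : L = planeForm (L (1, 0)) (L (0, 1)) := by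
  ext <;> simp

lemma hasFDerivAt_of_partials {f f1 f2 : ℝ × ℝ → ℝ}
    (h1 : ∀ x y, HasDerivAt (fun s => f (s, y)) (f1 (x, y)) x)
    (h2 : ∀ x y, HasDerivAt (fun s => f (x, s)) (f2 (x, y)) y)
    (c1 : Continuous f1) (c2 : Continuous f2) (z : ℝ × ℝ) :
    HasFDerivAt f (planeForm (f1 z) (f2 z)) z := by
  have key := hasStrictFDerivAt_uncurry_coprod (𝕜 := ℝ) (u := z) (f := fun a b => f (a, b))
    (f₁ := fun a b => ContinuousLinearMap.toSpanSingleton ℝ (f1 (a, b)))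
    (f₂ := fun a b => ContinuousLinearMap.toSpanSingleton ℝ (f2 (a, b)))
    (Eventually.of_forall fun v => (h1 v.1 v.2).hasFDerivAt)
    (Eventually.of_forall fun v => (h2 v.1 v.2).hasFDerivAt)
    (by
      have : Continuous fun v : ℝ × ℝ =>
        ContinuousLinearMap.toSpanSingletonCLE (𝕜 := ℝ) (E := ℝ) (f1 v) := by fun_prop
      exact this.continuousAt)
    (by
      have : Continuous fun v : ℝ × ℝ =>
        ContinuousLinearMap.toSpanSingletonCLE (𝕜 := ℝ) (E := ℝ) (f2 v) := by fun_prop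
      exact this.continuousAt)
  have h := key.hasFDerivAt
  refine h.congr_fderiv ?_
  have e1 : (↿fun a b => ContinuousLinearMap.toSpanSingleton ℝ (f1 (a, b))) z
      = ContinuousLinearMap.toSpanSingleton ℝ (f1 z) := rfl
  have e2 : (↿fun a b => ContinuousLinearMap.toSpanSingleton ℝ (f2 (a, b))) z
      = ContinuousLinearMap.toSpanSingleton ℝ (f2 z) := rfl
  rw [e1, e2]
  ext <;> simp

lemma contDiff_planeForm {n : WithTop ℕ∞} {f1 f2 : ℝ × ℝ → ℝ} (c1 : ContDiff ℝ n f1)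
    (c2 : ContDiff ℝ n f2) : ContDiff ℝ n (fun z => planeForm (f1 z) (f2 z)) := by
  unfold planeForm; fun_prop

/-- The kernels are explicit integrals whose partial derivatives are visible while the total
derivative is not, so their smoothness is always read off from the partials. -/
lemma contDiff_succ_of_partials {n : ℕ} {f f1 f2 : ℝ × ℝ → ℝ}
    (h1 : ∀ x y, HasDerivAt (fun s => f (s, y)) (f1 (x, y)) x)
    (h2 : ∀ x y, HasDerivAt (fun s => f (x, s)) (f2 (x, y)) y)
    (c1 : ContDiff ℝ n f1) (c2 : ContDiff ℝ n f2) : ContDiff ℝ (n + 1) f :=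
  contDiff_succ_iff_hasFDerivAt.2 ⟨_, contDiff_planeForm c1 c2,
    hasFDerivAt_of_partials h1 h2 c1.continuous c2.continuous⟩

lemma contDiff_one_of_partials {f f1 f2 : ℝ × ℝ → ℝ}
    (h1 : ∀ x y, HasDerivAt (fun s => f (s, y)) (f1 (x, y)) x)
    (h2 : ∀ x y, HasDerivAt (fun s => f (x, s)) (f2 (x, y)) y)
    (c1 : Continuous f1) (c2 : Continuous f2) : ContDiff ℝ 1 f :=
  contDiff_succ_of_partials (n := 0) h1 h2 (contDiff_zero.2 c1) (contDiff_zero.2 c2)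

lemma contDiff_two_of_partials {f f1 f2 : ℝ × ℝ → ℝ}
    (h1 : ∀ x y, HasDerivAt (fun s => f (s, y)) (f1 (x, y)) x)
    (h2 : ∀ x y, HasDerivAt (fun s => f (x, s)) (f2 (x, y)) y)
    (c1 : ContDiff ℝ 1 f1) (c2 : ContDiff ℝ 1 f2) : ContDiff ℝ 2 f :=
  contDiff_succ_of_partials (n := 1) h1 h2 c1 c2

/-- First partial derivative. -/
def pd1 (f : ℝ × ℝ → ℝ) (z : ℝ × ℝ) : ℝ := fderiv ℝ f z (1, 0)

/-- Second partial derivative. -/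
def pd2 (f : ℝ × ℝ → ℝ) (z : ℝ × ℝ) : ℝ := fderiv ℝ f z (0, 1)

lemma hasDerivAt_pd1 {f : ℝ × ℝ → ℝ} (hf : Differentiable ℝ f) (x y : ℝ) :
    HasDerivAt (fun s => f (s, y)) (pd1 f (x, y)) x := by
  have h : HasDerivAt (fun s : ℝ => (s, y)) ((1 : ℝ), (0 : ℝ)) x :=
    (hasDerivAt_id x).prodMk (hasDerivAt_const x y)
  exact (hf (x, y)).hasFDerivAt.comp_hasDerivAt x h

lemma hasDerivAt_pd2 {f : ℝ × ℝ → ℝ} (hf : Differentiable ℝ f) (x y : ℝ) :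
    HasDerivAt (fun s => f (x, s)) (pd2 f (x, y)) y := by
  have h : HasDerivAt (fun s : ℝ => (x, s)) ((0 : ℝ), (1 : ℝ)) y :=
    (hasDerivAt_const y x).prodMk (hasDerivAt_id y)
  exact (hf (x, y)).hasFDerivAt.comp_hasDerivAt y h

lemma contDiff_pd1 {n : WithTop ℕ∞} {f : ℝ × ℝ → ℝ} (hf : ContDiff ℝ (n + 1) f) :
    ContDiff ℝ n (pd1 f) := by
  have := hf.fderiv_right (m := n) le_rfl
  unfold pd1; fun_prop

lemma contDiff_pd2 {n : WithTop ℕ∞} {f : ℝ × ℝ → ℝ} (hf : ContDiff ℝ (n + 1) f) :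
    ContDiff ℝ n (pd2 f) := by
  have := hf.fderiv_right (m := n) le_rfl
  unfold pd2; fun_prop

lemma hasFDerivAt_pd {f : ℝ × ℝ → ℝ} (hf : Differentiable ℝ f) (z : ℝ × ℝ) :
    HasFDerivAt f (planeForm (pd1 f z) (pd2 f z)) z := by
  have := (hf z).hasFDerivAt
  rwa [eq_planeForm (fderiv ℝ f z)] at this

/-- Chain rule along a curve. -/
lemma hasDerivAt_comp_pd {f : ℝ × ℝ → ℝ} (hf : Differentiable ℝ f) {a b : ℝ → ℝ} {a' b' t : ℝ}
    (ha : HasDerivAt a a' t) (hb : HasDerivAt b b' t) :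
    HasDerivAt (fun s => f (a s, b s)) (pd1 f (a t, b t) * a' + pd2 f (a t, b t) * b') t := by
  have := (hasFDerivAt_pd hf (a t, b t)).comp_hasDerivAt t (ha.prodMk hb)
  exact this.congr_deriv (by simp)

/-! Integrals depending on a parameter. -/

lemma hasDerivAt_integral_param {H H' : ℝ × ℝ → ℝ} (hH : Continuous H) (hH' : Continuous H')
    (hd : ∀ t s, HasDerivAt (fun t => H (t, s)) (H' (t, s)) t) (a b t₀ : ℝ) :
    HasDerivAt (fun t => ∫ s in a..b, H (t, s)) (∫ s in a..b, H' (t₀, s)) t₀ := by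
  obtain ⟨M, hM⟩ := ((isCompact_Icc (a := t₀ - 1) (b := t₀ + 1)).prod
    (isCompact_uIcc (a := a) (b := b))).exists_bound_of_continuousOn hH'.continuousOn
  refine (intervalIntegral.hasDerivAt_integral_of_dominated_loc_of_deriv_le
    (F := fun t s => H (t, s)) (F' := fun t s => H' (t, s))
    (μ := volume) (bound := fun _ => M) (Icc_mem_nhds (by linarith : t₀ - 1 < t₀) (by linarith : t₀ < t₀ + 1))
    (Eventually.of_forall fun t => ?_) ?_ ?_ ?_ ?_ ?_).2
  · exact Continuous.aestronglyMeasurable (by fun_prop)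
  · exact Continuous.intervalIntegrable (by fun_prop) _ _
  · exact Continuous.aestronglyMeasurable (by fun_prop)
  · exact Eventually.of_forall fun s hs t ht => hM (t, s) ⟨ht, uIoc_subset_uIcc hs⟩
  · exact intervalIntegrable_const
  · exact Eventually.of_forall fun s _ t _ => hd t s

lemma continuous_integral_param {H : ℝ × ℝ → ℝ} (hH : Continuous H) {X : Type*}
    [TopologicalSpace X] {p a b : X → ℝ} (hp : Continuous p) (ha : Continuous a)
    (hb : Continuous b) : Continuous fun x => ∫ s in (a x)..(b x), H (p x, s) := by
  have h : ∀ x, ∫ s in (a x)..(b x), H (p x, s) =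
      (∫ s in (0 : ℝ)..(b x), H (p x, s)) - ∫ s in (0 : ℝ)..(a x), H (p x, s) := fun x => by
    rw [intervalIntegral.integral_interval_sub_left] <;>
      exact Continuous.intervalIntegrable (by fun_prop) _ _
  simp_rw [h]
  apply Continuous.sub <;> refine continuous_parametric_intervalIntegral_of_continuous ?_ ?_
  all_goals first | assumption | (unfold Function.uncurry; fun_prop)

/-- Leibniz rule with variable limits. -/
lemma hasDerivAt_integral_limits {H H' : ℝ × ℝ → ℝ} (hH : Continuous H) (hH' : Continuous H')
    (hd : ∀ t s, HasDerivAt (fun t => H (t, s)) (H' (t, s)) t) {a b : ℝ → ℝ} {a' b' t₀ : ℝ}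
    (ha : HasDerivAt a a' t₀) (hb : HasDerivAt b b' t₀) :
    HasDerivAt (fun t => ∫ s in (a t)..(b t), H (t, s))
      (H (t₀, b t₀) * b' - H (t₀, a t₀) * a' + ∫ s in (a t₀)..(b t₀), H' (t₀, s)) t₀ := by
  have hcH : ∀ t, Continuous fun s => H (t, s) := fun t => by fun_prop
  have hcH' : ∀ t, Continuous fun s => H' (t, s) := fun t => by fun_prop
  have hP : ∀ z : ℝ × ℝ, HasFDerivAt (fun z : ℝ × ℝ => ∫ s in (0 : ℝ)..z.2, H (z.1, s))
      (planeForm (∫ s in (0 : ℝ)..z.2, H' (z.1, s)) (H z)) z := by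
    intro z
    refine hasFDerivAt_of_partials (f1 := fun z : ℝ × ℝ => ∫ s in (0 : ℝ)..z.2, H' (z.1, s))
      (fun x y => hasDerivAt_integral_param hH hH' hd 0 y x)
      (fun x y => integral_hasDerivAt_right ((hcH x).intervalIntegrable _ _)
        ((hcH x).stronglyMeasurableAtFilter _ _) (hcH x).continuousAt)
      (continuous_integral_param hH' continuous_fst continuous_const continuous_snd) hH z
  have hB := (hP (t₀, b t₀)).comp_hasDerivAt t₀ ((hasDerivAt_id t₀).prodMk hb)
  have hA := (hP (t₀, a t₀)).comp_hasDerivAt t₀ ((hasDerivAt_id t₀).prodMk ha)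
  refine ((hB.sub hA).congr_of_eventuallyEq (Eventually.of_forall fun t => ?_)).congr_deriv ?_
  · change _ = (∫ s in (0 : ℝ)..(b t), H (t, s)) - ∫ s in (0 : ℝ)..(a t), H (t, s)
    rw [intervalIntegral.integral_interval_sub_left] <;> exact (hcH _).intervalIntegrable _ _
  · rw [← intervalIntegral.integral_interval_sub_left ((hcH' _).intervalIntegrable 0 (b t₀))
      ((hcH' _).intervalIntegrable 0 (a t₀))]
    simp only [planeForm_apply, mul_one]
    ring

lemma hasDerivAt_integral_upper {f : ℝ → ℝ} (hf : Continuous f) (a x : ℝ) :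
    HasDerivAt (fun x => ∫ s in a..x, f s) (f x) x :=
  integral_hasDerivAt_right (hf.intervalIntegrable _ _) (hf.stronglyMeasurableAtFilter _ _)
    hf.continuousAt

lemma contDiff_integral_upper {n : ℕ} {f : ℝ → ℝ} (hf : ContDiff ℝ n f) (a : ℝ) :
    ContDiff ℝ (n + 1) (fun x => ∫ s in a..x, f s) := by
  refine contDiff_succ_iff_hasFDerivAt.2 ⟨fun x => ContinuousLinearMap.toSpanSingleton ℝ (f x),
    ?_, fun x => (hasDerivAt_integral_upper hf.continuous a x).hasFDerivAt⟩
  have : ContDiff ℝ n fun v : ℝ =>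
    ContinuousLinearMap.toSpanSingletonCLE (𝕜 := ℝ) (E := ℝ) (f v) := by fun_prop
  exact this

lemma contDiff_one_of_hasDerivAt {f f' : ℝ → ℝ} (h : ∀ x, HasDerivAt f (f' x) x)
    (hf' : Continuous f') : ContDiff ℝ 1 f := by
  rw [contDiff_one_iff_deriv]
  exact ⟨fun x => (h x).differentiableAt, by rwa [funext fun x => (h x).deriv]⟩

/-- `∫_{a}^{b} H(ξ, s) ds` with `a, b` of class `C¹`. -/
lemma contDiff_one_integral_snd {H : ℝ × ℝ → ℝ} (hH : ContDiff ℝ 1 H) {p a b : ℝ × ℝ → ℝ}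
    (hp : ContDiff ℝ 1 p) (ha : ContDiff ℝ 1 a) (hb : ContDiff ℝ 1 b) :
    ContDiff ℝ 1 (fun z => ∫ s in (a z)..(b z), H (p z, s)) := by
  have hHd : Differentiable ℝ H := hH.differentiable one_ne_zero
  have h1 : ContDiff ℝ 1 (fun z : ℝ × ℝ => ∫ s in (0 : ℝ)..z.2, H (z.1, s)) := by
    refine contDiff_one_of_partials (f1 := fun z => ∫ s in (0 : ℝ)..z.2, pd1 H (z.1, s))
      (f2 := H) (fun x y => hasDerivAt_integral_param hH.continuous
        (contDiff_pd1 (n := 0) hH).continuous (fun t s => hasDerivAt_pd1 hHd t s) 0 y x)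
      (fun x y => hasDerivAt_integral_upper (f := fun s => H (x, s))
        (hH.continuous.comp (by fun_prop)) 0 y)
      (continuous_integral_param (contDiff_pd1 (n := 0) hH).continuous continuous_fst
        continuous_const continuous_snd) hH.continuous
  have h : ∀ z, ∫ s in (a z)..(b z), H (p z, s) =
      (∫ s in (0 : ℝ)..(b z), H (p z, s)) - ∫ s in (0 : ℝ)..(a z), H (p z, s) := fun z => by
    have hc : Continuous fun s => H (p z, s) := hH.continuous.comp (by fun_prop)
    rw [intervalIntegral.integral_interval_sub_left] <;> exact hc.intervalIntegrable _ _
  simp_rw [h]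
  exact (h1.comp (hp.prodMk hb)).sub (h1.comp (hp.prodMk ha))

lemma contDiff_one_integral_fst {H : ℝ × ℝ → ℝ} (hH : ContDiff ℝ 1 H) {p a b : ℝ × ℝ → ℝ}
    (hp : ContDiff ℝ 1 p) (ha : ContDiff ℝ 1 a) (hb : ContDiff ℝ 1 b) :
    ContDiff ℝ 1 (fun z => ∫ s in (a z)..(b z), H (s, p z)) :=
  contDiff_one_integral_snd (H := fun z => H (z.2, z.1)) (hH.comp (by fun_prop)) hp ha hb

/-! Gluing along a curve. -/

lemma continuous_ite_zero {X : Type*} [TopologicalSpace X] {ℓ G : X → ℝ} (hℓ : Continuous ℓ)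
    (hG : Continuous G) (h0 : ∀ z, ℓ z = 0 → G z = 0) :
    Continuous fun z => if 0 ≤ ℓ z then G z else 0 :=
  Continuous.if_le hG continuous_const continuous_const hℓ fun z hz => h0 z hz.symm

/-- On `{ℓ = 0}` both `G` and its derivative vanish, so the derivatives relative to `{0 ≤ ℓ}` and
`{ℓ ≤ 0}` are both zero there. Nothing is needed about the shape of the zero set. -/
lemma contDiff_one_ite_zero {E : Type*} [NormedAddCommGroup E] [NormedSpace ℝ E]
    {ℓ G : E → ℝ} (hℓ : Continuous ℓ) (hG : ContDiff ℝ 1 G)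
    (h0 : ∀ z, ℓ z = 0 → G z = 0) (h1 : ∀ z, ℓ z = 0 → fderiv ℝ G z = 0) :
    ContDiff ℝ 1 (fun z => if 0 ≤ ℓ z then G z else 0) := by
  have hGd : Differentiable ℝ G := hG.differentiable one_ne_zero
  refine contDiff_one_iff_hasFDerivAt.2 ⟨fun z => if 0 ≤ ℓ z then fderiv ℝ G z else 0, ?_, ?_⟩
  · exact Continuous.if_le (hG.continuous_fderiv one_ne_zero) continuous_const continuous_const hℓ
      fun z hz => h1 z hz.symm
  · intro z
    rcases lt_trichotomy (ℓ z) 0 with h | h | h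
    · have e : (fun z => if 0 ≤ ℓ z then G z else 0) =ᶠ[𝓝 z] fun _ => 0 := by
        filter_upwards [hℓ.continuousAt.eventually_lt continuousAt_const h] with w hw
        exact if_neg (not_le.2 hw)
      simp only [not_le.2 h, if_false]
      exact (hasFDerivAt_const (0 : ℝ) z).congr_of_eventuallyEq e
    · have a1 : HasFDerivWithinAt (fun z => if 0 ≤ ℓ z then G z else 0) (0 : E →L[ℝ] ℝ)
          {w | 0 ≤ ℓ w} z := by
        have := (hGd z).hasFDerivAt.hasFDerivWithinAt (s := {w | 0 ≤ ℓ w})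
        rw [h1 z h] at this
        exact this.congr (fun w hw => if_pos hw) (if_pos h.ge)
      have a2 : HasFDerivWithinAt (fun z => if 0 ≤ ℓ z then G z else 0) (0 : E →L[ℝ] ℝ)
          {w | ℓ w ≤ 0} z := by
        refine (hasFDerivWithinAt_const (0 : ℝ) z _).congr (fun w hw => ?_) ?_
        · split_ifs with h'
          · exact h0 w (le_antisymm hw h')
          · rfl
        · rw [if_pos h.ge, h0 z h]
      have := a1.union a2
      have hu : {w | 0 ≤ ℓ w} ∪ {w | ℓ w ≤ 0} = univ := by
        ext w; simp [le_total]
      rw [hu, hasFDerivWithinAt_univ] at this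
      simpa [h.ge, h1 z h] using this
    · have e : (fun z => if 0 ≤ ℓ z then G z else 0) =ᶠ[𝓝 z] G := by
        filter_upwards [continuousAt_const.eventually_lt hℓ.continuousAt h] with w hw
        exact if_pos hw.le
      simp only [h.le, if_true]
      exact (hGd z).hasFDerivAt.congr_of_eventuallyEq e

lemma fderiv_eq_zero_of_partials {f : ℝ × ℝ → ℝ} (hf : Differentiable ℝ f) {z : ℝ × ℝ}
    (h1 : HasDerivAt (fun s => f (s, z.2)) 0 z.1) (h2 : HasDerivAt (fun s => f (z.1, s)) 0 z.2) :
    fderiv ℝ f z = 0 := by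
  have e1 := (hasDerivAt_pd1 hf z.1 z.2).unique h1
  have e2 := (hasDerivAt_pd2 hf z.1 z.2).unique h2
  rw [eq_planeForm (fderiv ℝ f z)]
  change planeForm (pd1 f (z.1, z.2)) (pd2 f (z.1, z.2)) = 0
  rw [e1, e2]; ext <;> simp

/-! The potential `w` of `F`: `∂_ξ ∂_ζ w = F`. -/

/-- `∫₀^ξ ∫₀^ζ F`. -/
def pot (F : ℝ × ℝ → ℝ) (z : ℝ × ℝ) : ℝ := ∫ s in (0 : ℝ)..z.1, ∫ t in (0 : ℝ)..z.2, F (s, t)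

lemma hasDerivAt_pot_fst {F : ℝ × ℝ → ℝ} (hF : Continuous F) (x y : ℝ) :
    HasDerivAt (fun s => pot F (s, y)) (∫ t in (0 : ℝ)..y, F (x, t)) x :=
  hasDerivAt_integral_upper (f := fun s => ∫ t in (0 : ℝ)..y, F (s, t))
    (continuous_integral_param hF continuous_id continuous_const continuous_const) 0 x

lemma hasDerivAt_pot_snd {F : ℝ × ℝ → ℝ} (hF : Continuous F) (x y : ℝ) :
    HasDerivAt (fun t => pot F (x, t)) (∫ s in (0 : ℝ)..x, F (s, y)) y :=
  hasDerivAt_integral_param (H := fun p => ∫ t in (0 : ℝ)..p.1, F (p.2, t))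
    (H' := fun p => F (p.2, p.1))
    (continuous_integral_param hF continuous_snd continuous_const continuous_fst)
    (by fun_prop)
    (fun t s => hasDerivAt_integral_upper (f := fun r => F (s, r)) (by fun_prop) 0 t) 0 x y

lemma contDiff_one_pot {F : ℝ × ℝ → ℝ} (hF : Continuous F) : ContDiff ℝ 1 (pot F) :=
  contDiff_one_of_partials (f1 := fun z => ∫ t in (0 : ℝ)..z.2, F (z.1, t))
    (f2 := fun z => ∫ s in (0 : ℝ)..z.1, F (s, z.2))
    (hasDerivAt_pot_fst hF) (hasDerivAt_pot_snd hF)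
    (continuous_integral_param hF continuous_fst continuous_const continuous_snd)
    (continuous_integral_param (H := fun z => F (z.2, z.1)) (by fun_prop)
      continuous_snd continuous_const continuous_fst)

lemma contDiff_two_pot {F : ℝ × ℝ → ℝ} (hF : Continuous F)
    (h1 : ContDiff ℝ 1 (fun z : ℝ × ℝ => ∫ t in (0 : ℝ)..z.2, F (z.1, t)))
    (h2 : ContDiff ℝ 1 (fun z : ℝ × ℝ => ∫ s in (0 : ℝ)..z.1, F (s, z.2))) :
    ContDiff ℝ 2 (pot F) :=
  contDiff_two_of_partials (hasDerivAt_pot_fst hF) (hasDerivAt_pot_snd hF) h1 h2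

/-- Sources whose potential is twice continuously differentiable. -/
structure GoodSource (F : ℝ × ℝ → ℝ) : Prop where
  cont : Continuous F
  fst : ContDiff ℝ 1 (fun z : ℝ × ℝ => ∫ t in (0 : ℝ)..z.2, F (z.1, t))
  snd : ContDiff ℝ 1 (fun z : ℝ × ℝ => ∫ s in (0 : ℝ)..z.1, F (s, z.2))

lemma GoodSource.of_contDiff {F : ℝ × ℝ → ℝ} (hF : ContDiff ℝ 1 F) : GoodSource F where
  cont := hF.continuous
  fst := contDiff_one_integral_snd hF contDiff_fst contDiff_const contDiff_snd
  snd := contDiff_one_integral_fst hF contDiff_snd contDiff_const contDiff_fst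

lemma GoodSource.add {F G : ℝ × ℝ → ℝ} (hF : GoodSource F) (hG : GoodSource G) :
    GoodSource (fun z => F z + G z) where
  cont := hF.cont.add hG.cont
  fst := by
    have := hF.cont; have := hG.cont
    convert hF.fst.add hG.fst using 2 with z
    exact intervalIntegral.integral_add (Continuous.intervalIntegrable (by fun_prop) _ _)
      (Continuous.intervalIntegrable (by fun_prop) _ _)
  snd := by
    have := hF.cont; have := hG.cont
    convert hF.snd.add hG.snd using 2 with z
    exact intervalIntegral.integral_add (Continuous.intervalIntegrable (by fun_prop) _ _)
      (Continuous.intervalIntegrable (by fun_prop) _ _)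

/-- The lower limit is the cut itself, so the interval lies either wholly in the region that is kept
or, up to one endpoint, in the region that is discarded. -/
lemma integral_ite_ge {φ : ℝ → ℝ} {e x : ℝ} :
    ∫ t in e..x, (if 0 ≤ t - e then φ t else 0) = if 0 ≤ x - e then ∫ t in e..x, φ t else 0 := by
  split_ifs with h
  · refine intervalIntegral.integral_congr fun t ht => ?_
    rw [uIcc_of_le (by linarith)] at ht
    exact if_pos (by linarith [ht.1])
  · have : ∫ t in e..x, (if 0 ≤ t - e then φ t else 0) = ∫ t in e..x, (0 : ℝ) := by
      refine intervalIntegral.integral_congr_ae ?_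
      have h0 : ∀ᵐ t : ℝ, t ≠ e := by simp [ae_iff]
      filter_upwards [h0] with t hte ht
      rw [uIoc_of_ge (by linarith)] at ht
      exact if_neg (fun h' => hte (le_antisymm ht.2 (by linarith)))
    simpa using this

lemma integral_ite_le {φ : ℝ → ℝ} {e x : ℝ} :
    ∫ t in e..x, (if 0 ≤ e - t then φ t else 0) = if 0 ≤ e - x then ∫ t in e..x, φ t else 0 := by
  have h := integral_ite_ge (φ := fun t => φ (-t)) (e := -e) (x := -x)
  have e1 := intervalIntegral.integral_comp_neg (a := -e) (b := -x)
    (fun t => if 0 ≤ e - t then φ t else 0)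
  have e2 := intervalIntegral.integral_comp_neg (a := -e) (b := -x) φ
  simp only [neg_neg] at e1 e2
  rw [intervalIntegral.integral_symm, ← e1]
  have : ∀ t : ℝ, e - -t = t - -e := fun t => by ring
  simp only [this, h]
  rw [show -x - -e = e - x by ring, e2, intervalIntegral.integral_symm e x]
  split_ifs <;> simp

/-- A `C¹` function vanishing on an oblique line, cut off on one side of the line. -/
lemma GoodSource.cut {h : ℝ × ℝ → ℝ} (hh : ContDiff ℝ 1 h) {κ d : ℝ} (hκ : 0 < κ)
    (h0 : ∀ x, h (x, κ * x + d) = 0) :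
    GoodSource (fun z => if 0 ≤ z.2 - (κ * z.1 + d) then h z else 0) := by
  have hhd := hh.differentiable one_ne_zero
  have hc := hh.continuous
  have hc1 := (contDiff_pd1 (n := 0) hh).continuous
  have hc2 := (contDiff_pd2 (n := 0) hh).continuous
  have hline : ∀ z : ℝ × ℝ, z.2 - (κ * z.1 + d) = 0 → z.2 = κ * z.1 + d := fun z hz => by
    linarith
  have hcont : Continuous (fun z : ℝ × ℝ => if 0 ≤ z.2 - (κ * z.1 + d) then h z else 0) :=
    continuous_ite_zero (by fun_prop) hc fun z hz => by
      have := h0 z.1; rwa [← hline z hz] at this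
  refine ⟨hcont, ?_, ?_⟩
  -- Integrating from the line makes the integral vanish together with its gradient on the line,
  -- since `h` vanishes there; hence it can be continued by zero in a `C¹` way.
  · have hN : ContDiff ℝ 1 (fun z : ℝ × ℝ => if 0 ≤ z.2 - (κ * z.1 + d) then
        ∫ s in (κ * z.1 + d)..z.2, h (z.1, s) else 0) := by
      have hG : ContDiff ℝ 1 (fun z : ℝ × ℝ => ∫ s in (κ * z.1 + d)..z.2, h (z.1, s)) :=
        contDiff_one_integral_snd hh contDiff_fst (by fun_prop) contDiff_snd
      refine contDiff_one_ite_zero (by fun_prop) hG (fun z hz => ?_) (fun z hz => ?_)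
      · rw [hline z hz]; simp
      · refine fderiv_eq_zero_of_partials (hG.differentiable one_ne_zero) ?_ ?_
        · have := hasDerivAt_integral_limits hc hc1 (fun t s => hasDerivAt_pd1 hhd t s)
            (((hasDerivAt_id z.1).const_mul κ).add_const d) (hasDerivAt_const z.1 z.2)
          refine this.congr_deriv ?_
          simp [hline z hz, h0]
        · have := hasDerivAt_integral_upper (f := fun s => h (z.1, s)) (by fun_prop)
            (κ * z.1 + d) z.2
          refine this.congr_deriv ?_
          simp [hline z hz, h0]
    have h2 := hN.comp (f := fun z : ℝ × ℝ => (z.1, (0 : ℝ))) (by fun_prop)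
    convert hN.sub h2 using 2 with z
    simp only [Function.comp]
    rw [← integral_ite_ge (φ := fun s => h (z.1, s)), ← integral_ite_ge (φ := fun s => h (z.1, s)),
      intervalIntegral.integral_interval_sub_left] <;>
    exact (hcont.comp (f := fun t => (z.1, t)) (by fun_prop)).intervalIntegrable _ _
  -- For the integral in the other variable the line must be a graph over the second coordinate as
  -- well. This is where `κ > 0` is used: the line is not characteristic.
  · have hcut : ∀ s t : ℝ, (0 ≤ t - (κ * s + d)) ↔ 0 ≤ (t - d) / κ - s := fun s t => by
      rw [sub_nonneg, sub_nonneg, le_div_iff₀ hκ]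
      constructor <;> intro <;> linarith
    have hN : ContDiff ℝ 1 (fun z : ℝ × ℝ => if 0 ≤ (z.2 - d) / κ - z.1 then
        ∫ s in ((z.2 - d) / κ)..z.1, h (s, z.2) else 0) := by
      have hG : ContDiff ℝ 1 (fun z : ℝ × ℝ => ∫ s in ((z.2 - d) / κ)..z.1, h (s, z.2)) :=
        contDiff_one_integral_fst hh contDiff_snd (by fun_prop) contDiff_fst
      have h0' : ∀ z : ℝ × ℝ, (z.2 - d) / κ - z.1 = 0 → z.1 = (z.2 - d) / κ ∧ h (z.1, z.2) = 0 := by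
        intro z hz
        have e : z.1 = (z.2 - d) / κ := by linarith
        refine ⟨e, ?_⟩
        have e' : z.2 = κ * z.1 + d := by rw [e]; field_simp; ring
        rw [e']; exact h0 _
      refine contDiff_one_ite_zero (by fun_prop) hG (fun z hz => ?_) (fun z hz => ?_)
      · rw [← (h0' z hz).1]; simp
      · refine fderiv_eq_zero_of_partials (hG.differentiable one_ne_zero) ?_ ?_
        · have := hasDerivAt_integral_upper (f := fun s => h (s, z.2)) (by fun_prop)
            ((z.2 - d) / κ) z.1
          exact this.congr_deriv (h0' z hz).2
        · have := hasDerivAt_integral_limits (H := fun p => h (p.2, p.1))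
            (H' := fun p => pd2 h (p.2, p.1)) (by fun_prop) (by fun_prop)
            (fun t s => hasDerivAt_pd2 hhd s t)
            (((hasDerivAt_id z.2).sub_const d).div_const κ) (hasDerivAt_const z.2 z.1)
          refine this.congr_deriv ?_
          simp only [id]
          rw [← (h0' z hz).1]
          simp [(h0' z hz).2]
    have h2 := hN.comp (f := fun z : ℝ × ℝ => ((0 : ℝ), z.2)) (by fun_prop)
    convert hN.sub h2 using 2 with z
    simp only [Function.comp, hcut]
    rw [← integral_ite_le (φ := fun s => h (s, z.2)), ← integral_ite_le (φ := fun s => h (s, z.2)),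
      intervalIntegral.integral_interval_sub_left] <;>
    · have := hcont.comp (f := fun t => (t, z.2)) (by fun_prop)
      simp only [Function.comp_def, hcut] at this
      exact this.intervalIntegrable _ _

/-! ### Tietze extension and fixed points in weighted supremum norms. -/

/-- Data on compact or closed regions are replaced by globally continuous functions, so that
continuity of integrals with parameters can be used without tracking domains. -/
lemma exists_continuous_extension {X : Type*} [TopologicalSpace X] [NormalSpace X] {D : Set X}
    (hD : IsClosed D) {f : X → ℝ} (hf : ContinuousOn f D) :
    ∃ g : X → ℝ, Continuous g ∧ EqOn g f D := by
  obtain ⟨g, hg⟩ := ContinuousMap.exists_restrict_eq hD ⟨_, hf.domRestrict⟩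
  exact ⟨g, g.continuous, fun z hz => congrFun (congrArg DFunLike.coe hg) ⟨z, hz⟩⟩

/-- Fixed points of operators that contract a weighted supremum norm on a compact set. -/
lemma exists_fixed_point {X : Type*} [TopologicalSpace X] [T4Space X] {D : Set X}
    (hD : IsCompact D) (T : (X → ℝ) → X → ℝ) (hT : ∀ u, Continuous u → Continuous (T u))
    (w : X → ℝ) (hw : ∀ z ∈ D, 1 ≤ w z) {B : ℝ} (hB : ∀ z ∈ D, w z ≤ B)
    (hc : ∀ u v, Continuous u → Continuous v → ∀ N, 0 ≤ N → (∀ z ∈ D, |u z - v z| ≤ N * w z) →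
      ∀ z ∈ D, |T u z - T v z| ≤ N / 2 * w z) :
    ∃ u, Continuous u ∧ ∀ z ∈ D, u z = T u z := by
  -- Picard iteration from zero. The iterates are functions on all of `X`, but they are compared
  -- only on `D`.
  set U : ℕ → X → ℝ := fun n => T^[n] fun _ => 0 with hU
  have hUs : ∀ n, U (n + 1) = T (U n) := fun n => Function.iterate_succ_apply' T n _
  have hUc : ∀ n, Continuous (U n) := by
    intro n
    induction n with
    | zero => exact continuous_const
    | succ n ih => rw [hUs]; exact hT _ ih
  obtain ⟨N, hN⟩ := hD.exists_bound_of_continuousOn (hUc 1).continuousOn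
  rcases D.eq_empty_or_nonempty with rfl | ⟨z₀, hz₀⟩
  · exact ⟨fun _ => 0, continuous_const, by simp⟩
  have hN0 : 0 ≤ N := (norm_nonneg _).trans (hN z₀ hz₀)
  have hB0 : 0 ≤ B := zero_le_one.trans ((hw z₀ hz₀).trans (hB z₀ hz₀))
  have hstep : ∀ n, ∀ z ∈ D, |U (n + 1) z - U n z| ≤ N * (1 / 2) ^ n * w z := by
    intro n
    induction n with
    | zero =>
      intro z hz
      have h1 := hN z hz
      have : U 0 z = 0 := rfl
      rw [zero_add, this, sub_zero, pow_zero, mul_one]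
      exact h1.trans (le_mul_of_one_le_right hN0 (hw z hz))
    | succ n ih =>
      intro z hz
      have := hc _ _ (hUc (n + 1)) (hUc n) _ (by positivity) ih z hz
      rw [← hUs, ← hUs] at this
      refine this.trans (le_of_eq ?_)
      rw [pow_succ]; ring
  have hstep' : ∀ z ∈ D, ∀ n, dist (U n z) (U (n + 1) z) ≤ N * B * (1 / 2) ^ n := by
    intro z hz n
    rw [dist_comm, Real.dist_eq]
    refine (hstep n z hz).trans ?_
    have := hB z hz
    calc N * (1 / 2) ^ n * w z ≤ N * (1 / 2) ^ n * B := by gcongr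
      _ = _ := by ring
  have hlim : ∀ z ∈ D, ∃ l, Tendsto (fun n => U n z) atTop (𝓝 l) := fun z hz =>
    cauchySeq_tendsto_of_complete (cauchySeq_of_le_geometric _ _ (by norm_num) (hstep' z hz))
  choose! u hu using hlim
  have hdist : ∀ n, ∀ z ∈ D, |U n z - u z| ≤ N * B * (1 / 2) ^ n * 2 := by
    intro n z hz
    have := dist_le_of_le_geometric_of_tendsto _ _ (by norm_num) (hstep' z hz) (hu z hz) n
    rw [Real.dist_eq] at this
    refine this.trans (le_of_eq ?_)
    norm_num; ring
  have hgeo : ∀ c : ℝ, Tendsto (fun n : ℕ => c * (1 / 2 : ℝ) ^ n) atTop (𝓝 0) := fun c => by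
    simpa using (tendsto_pow_atTop_nhds_zero_of_lt_one (r := (1 / 2 : ℝ)) (by norm_num)
      (by norm_num)).const_mul c
  have hunif : TendstoUniformlyOn U u atTop D := by
    rw [Metric.tendstoUniformlyOn_iff]
    intro ε hε
    filter_upwards [(hgeo (N * B * 2)).eventually_lt_const hε] with n hn z hz
    rw [dist_comm, Real.dist_eq]
    refine (hdist n z hz).trans_lt ?_
    linarith
  have huc : ContinuousOn u D :=
    hunif.continuousOn (Eventually.of_forall fun n => (hUc n).continuousOn).frequently
  -- `T` accepts only globally continuous arguments, so the limit on `D` is extended before `T` is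
  -- applied; the contraction sees only values on `D`.
  obtain ⟨g, hgc, hgu⟩ := exists_continuous_extension hD.isClosed huc
  refine ⟨g, hgc, fun z hz => ?_⟩
  -- Both `g` and `T g` are close to the iterate `U (n + 1) = T (U n)`.
  have key : ∀ n, |g z - T g z| ≤ (N * B * 2 + N * B * B) * (1 / 2) ^ n := by
    intro n
    have a1 : |U (n + 1) z - g z| ≤ N * B * (1 / 2) ^ n * 2 := by
      rw [hgu hz]
      refine (hdist (n + 1) z hz).trans ?_
      rw [pow_succ]
      have : 0 ≤ N * B * (1 / 2) ^ n := by positivity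
      linarith
    have a2 := hc (U n) g (hUc n) hgc (N * B * (1 / 2) ^ n * 2) (by positivity) (fun y hy => by
      rw [hgu hy]
      exact (hdist n y hy).trans (le_mul_of_one_le_right (by positivity) (hw y hy))) z hz
    rw [← hUs] at a2
    have a3 : N * B * (1 / 2) ^ n * 2 / 2 * w z ≤ N * B * (1 / 2) ^ n * B := by
      have := hB z hz
      have h' : N * B * (1 / 2) ^ n * 2 / 2 = N * B * (1 / 2) ^ n := by ring
      rw [h']; gcongr
    rw [abs_le] at *
    constructor <;> linarith [a1.1, a1.2, a2.1, a2.2]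
  have h0 : |g z - T g z| ≤ 0 := ge_of_tendsto' (hgeo _) key
  linarith [abs_nonpos_iff.1 h0]

/-- Integrating the weight `exp (L (p + s))` gains a factor `1 / L`. This is what makes the Volterra
operators below contractions for large `L`. -/
lemma abs_integral_le_exp {φ : ℝ → ℝ} {a b p K L : ℝ} (hL : 0 < L) (hK : 0 ≤ K) (hab : a ≤ b)
    (h : ∀ s ∈ Icc a b, |φ s| ≤ K * Real.exp (L * (p + s))) :
    |∫ s in a..b, φ s| ≤ K * Real.exp (L * (p + b)) / L := by
  have hd : ∀ s : ℝ, HasDerivAt (fun s => K * Real.exp (L * (p + s)) / L)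
      (K * Real.exp (L * (p + s))) s := by
    intro s
    have h1 : HasDerivAt (fun s : ℝ => L * (p + s)) (L * 1) s :=
      ((hasDerivAt_id s).const_add p).const_mul L
    refine ((h1.exp.const_mul K).div_const L).congr_deriv ?_
    field_simp
  have e := intervalIntegral.integral_eq_sub_of_hasDerivAt (a := a) (b := b) (fun s _ => hd s)
    (Continuous.intervalIntegrable (by fun_prop) _ _)
  have h2 := intervalIntegral.norm_integral_le_of_norm_le hab
    (f := φ) (g := fun s => K * Real.exp (L * (p + s))) (μ := volume)
    (Eventually.of_forall fun s hs => h s ⟨hs.1.le, hs.2⟩)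
    (Continuous.intervalIntegrable (by fun_prop) _ _)
  rw [e, Real.norm_eq_abs] at h2
  refine h2.trans ?_
  have : 0 ≤ K * Real.exp (L * (p + a)) / L := by positivity
  linarith

/-! Functions of the form `pot F + A(ξ) + B(ζ)`. -/

section DAlembert

variable {F u : ℝ × ℝ → ℝ} {A B : ℝ → ℝ}

lemma pd1_dAlembert (hF : Continuous F) (hu : Differentiable ℝ u)
    (h : ∀ z, u z = pot F z + A z.1 + B z.2) {x : ℝ} (hA : DifferentiableAt ℝ A x) (y : ℝ) :
    pd1 u (x, y) = (∫ t in (0 : ℝ)..y, F (x, t)) + deriv A x := by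
  refine (hasDerivAt_pd1 hu x y).unique ?_
  have := ((hasDerivAt_pot_fst hF x y).add hA.hasDerivAt).add_const (B y)
  exact this.congr_of_eventuallyEq (Eventually.of_forall fun s => h (s, y))

lemma pd2_dAlembert (hF : Continuous F) (hu : Differentiable ℝ u)
    (h : ∀ z, u z = pot F z + A z.1 + B z.2) (x : ℝ) {y : ℝ} (hB : DifferentiableAt ℝ B y) :
    pd2 u (x, y) = (∫ s in (0 : ℝ)..x, F (s, y)) + deriv B y := by
  refine (hasDerivAt_pd2 hu x y).unique ?_
  have := ((hasDerivAt_pot_snd hF x y).add_const (A x)).add hB.hasDerivAt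
  exact this.congr_of_eventuallyEq (Eventually.of_forall fun s => h (x, s))

/-- `B` drops out of the first derivative and `A` contributes a constant in the second variable, so
the mixed derivative exists and equals the merely continuous `F`. -/
lemma hasDerivAt_pd1_dAlembert (hF : Continuous F) (hu : Differentiable ℝ u)
    (h : ∀ z, u z = pot F z + A z.1 + B z.2) {x : ℝ} (hA : DifferentiableAt ℝ A x) (y : ℝ) :
    HasDerivAt (fun t => pd1 u (x, t)) (F (x, y)) y :=
  ((hasDerivAt_integral_upper (f := fun t => F (x, t)) (by fun_prop) 0 y).add_const
    (deriv A x)).congr_of_eventuallyEq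
    (Eventually.of_forall fun t => pd1_dAlembert hF hu h hA t)

end DAlembert

/-! ### The Goursat problem behind the first kernel. -/

/-- The solution of `∂_ξ ∂_ζ u = F`, `u(0, ζ) = f(ζ) - f(0)`, `u(ξ, m ξ) = 0`. -/
def mixedSol (m : ℝ) (f : ℝ → ℝ) (F : ℝ × ℝ → ℝ) (z : ℝ × ℝ) : ℝ :=
  pot F z + (-f (m * z.1) - pot F (z.1, m * z.1)) + f z.2

lemma contDiff_mixedSol {n : WithTop ℕ∞} {m : ℝ} {f : ℝ → ℝ} {F : ℝ × ℝ → ℝ} (hf : ContDiff ℝ n f)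
    (hF : ContDiff ℝ n (pot F)) : ContDiff ℝ n (mixedSol m f F) := by
  unfold mixedSol; fun_prop

/-- The Goursat problem is solved for `ψ = ∂_ζ u`. Integrating `ψ = f' + ∫₀^ξ F` upwards from the
edge `ζ = m ξ`, where `u` vanishes, recovers `u`. -/
lemma mixedSol_eq_integral {m : ℝ} {f : ℝ → ℝ} (hf : ContDiff ℝ 2 f) {F ψ : ℝ × ℝ → ℝ}
    (hF : Continuous F) {x y : ℝ} (hxy : m * x ≤ y)
    (hψ : ∀ s ∈ Icc (m * x) y, ψ (x, s) = deriv f s + ∫ t in (0 : ℝ)..x, F (t, s)) :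
    ∫ s in (m * x)..y, ψ (x, s) = mixedSol m f F (x, y) := by
  have hf' : Continuous (deriv f) := hf.continuous_deriv (by norm_num)
  have hd : ∀ s : ℝ, HasDerivAt (fun s => f s + pot F (x, s))
      (deriv f s + ∫ t in (0 : ℝ)..x, F (t, s)) s := fun s =>
    ((hf.differentiable two_ne_zero) s).hasDerivAt.add (hasDerivAt_pot_snd hF x s)
  have hc : Continuous fun s => deriv f s + ∫ t in (0 : ℝ)..x, F (t, s) :=
    hf'.add (continuous_integral_param (H := fun z => F (z.2, z.1)) (by fun_prop) continuous_id
      continuous_const continuous_const)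
  have e := intervalIntegral.integral_eq_sub_of_hasDerivAt (a := m * x) (b := y)
    (fun s _ => hd s) (hc.intervalIntegrable _ _)
  rw [intervalIntegral.integral_congr (g := fun s => deriv f s + ∫ t in (0 : ℝ)..x, F (t, s)), e]
  · unfold mixedSol; ring
  · intro s hs
    rw [uIcc_of_le hxy] at hs
    exact hψ s hs

/-- A Goursat problem on the sector `0 ≤ ξ`, `m ξ ≤ ζ`, with a source that involves the
trace `g` of `∂_ζ u` on the edge `ζ = m ξ` and is supported in `m ζ ≤ ξ`. -/
theorem exists_goursat {m : ℝ} (hm0 : 0 ≤ m) (hm1' : m < 1) {c v : ℝ × ℝ → ℝ} {f : ℝ → ℝ}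
    (hc : ContDiff ℝ 1 c) (hv : ContDiff ℝ 1 v) (hv0 : ∀ y, v (m * y, y) = 0)
    (hf : ContDiff ℝ 2 f) {δ : ℝ} (hδ : δ = 0 ∨ 0 < m) {R : ℝ} :
    ∃ (u : ℝ × ℝ → ℝ) (g : ℝ → ℝ), ContDiff ℝ 2 u ∧ ContDiff ℝ 1 g ∧
      (∀ y, u (0, y) = f y - f 0) ∧ (∀ x, u (x, m * x) = 0) ∧
      (∀ x y, 0 ≤ x → m * x ≤ y → x + y ≤ R → HasDerivAt (fun t => pd1 u (x, t))
        (c (x, y) * u (x, y) - δ * g (x + y) * (if 0 ≤ x - m * y then v (x, y) else 0)) y) ∧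
      (∀ x, 0 ≤ x → x + m * x ≤ R → g (x + m * x) = pd2 u (x, m * x)) := by
  have hm1 : 0 < 1 + m := by linarith
  -- The cut-off coefficient of the trace term; it is continuous because `v` vanishes on the cutting
  -- line.
  set κ₁ : ℝ × ℝ → ℝ := fun z => if 0 ≤ z.1 - m * z.2 then v z else 0 with hκ₁
  have hκc : Continuous κ₁ := continuous_ite_zero (by fun_prop) hv.continuous fun z hz => by
    have := hv0 z.2
    rwa [show m * z.2 = z.1 by linarith] at this
  have hcc := hc.continuous
  have hf' : Continuous (deriv f) := hf.continuous_deriv (by norm_num)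
  set D : Set (ℝ × ℝ) := {z | 0 ≤ z.1 ∧ m * z.1 ≤ z.2 ∧ z.1 + z.2 ≤ R} with hD
  have hDc : IsCompact D := by
    refine (isCompact_Icc (a := ((0 : ℝ), (0 : ℝ))) (b := (R, R))).of_isClosed_subset ?_ ?_
    · have e : D = {z | 0 ≤ z.1} ∩ ({z | m * z.1 ≤ z.2} ∩ {z | z.1 + z.2 ≤ R}) := rfl
      rw [e]
      exact (isClosed_le (by fun_prop) (by fun_prop)).inter
        ((isClosed_le (by fun_prop) (by fun_prop)).inter
          (isClosed_le (by fun_prop) (by fun_prop)))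
    · rintro ⟨x, y⟩ ⟨h1, h2, h3⟩
      simp only at h1 h2 h3
      have : 0 ≤ m * x := by positivity
      exact ⟨⟨h1, by simp; linarith⟩, ⟨by simp; linarith, by simp; linarith⟩⟩
  have hseg : ∀ x y s, (x, y) ∈ D → s ∈ Icc 0 x → (s, y) ∈ D := by
    rintro x y s ⟨h1, h2, h3⟩ ⟨h4, h5⟩
    simp only at h1 h2 h3
    have : m * s ≤ m * x := by gcongr
    exact ⟨h4, by simp; linarith, by simp; linarith⟩
  have hseg' : ∀ x y s, (x, y) ∈ D → s ∈ Icc (m * x) y → (x, s) ∈ D := by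
    rintro x y s ⟨h1, h2, h3⟩ ⟨h4, h5⟩
    exact ⟨h1, h4, by simp at h3 ⊢; linarith⟩
  -- `τ σ` is the point of the edge `ζ = m ξ` with coordinate sum `σ`, at which the trace of `ψ` is
  -- taken.
  set τ : ℝ → ℝ × ℝ := fun σ => (σ / (1 + m), m * (σ / (1 + m))) with hτ
  have hτc : Continuous τ := by fun_prop
  have hτD : ∀ σ, 0 ≤ σ → σ ≤ R → τ σ ∈ D := by
    intro σ h0 h1
    refine ⟨by positivity, le_rfl, ?_⟩
    have : σ / (1 + m) + m * (σ / (1 + m)) = σ := by field_simp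
    simpa [hτ, this] using h1
  have hτs : ∀ σ, (τ σ).1 + (τ σ).2 = σ := fun σ => by simp only [hτ]; field_simp
  -- `V ψ` is `u`, `Φ ψ` is the source and `ψ = T ψ` is the Goursat problem, all expressed through
  -- `ψ = ∂_ζ u`.
  set V : (ℝ × ℝ → ℝ) → ℝ × ℝ → ℝ := fun ψ z => ∫ s in (m * z.1)..z.2, ψ (z.1, s) with hV
  set Φ : (ℝ × ℝ → ℝ) → ℝ × ℝ → ℝ :=
    fun ψ z => c z * V ψ z - δ * ψ (τ (z.1 + z.2)) * κ₁ z with hΦ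
  set T : (ℝ × ℝ → ℝ) → ℝ × ℝ → ℝ :=
    fun ψ z => deriv f z.2 + ∫ s in (0 : ℝ)..z.1, Φ ψ (s, z.2) with hT
  have hVc : ∀ ψ, Continuous ψ → Continuous (V ψ) := fun ψ h =>
    continuous_integral_param h continuous_fst (by fun_prop) continuous_snd
  have hΦc : ∀ ψ, Continuous ψ → Continuous (Φ ψ) := fun ψ h => by
    have := hVc ψ h
    fun_prop
  have hTc : ∀ ψ, Continuous ψ → Continuous (T ψ) := fun ψ h => by
    have := hΦc ψ h
    exact (hf'.comp continuous_snd).add (continuous_integral_param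
      (H := fun z => Φ ψ (z.2, z.1)) (by fun_prop) continuous_snd continuous_const continuous_fst)
  obtain ⟨Mc, hMc⟩ := hDc.exists_bound_of_continuousOn hcc.continuousOn
  obtain ⟨Mk, hMk⟩ := hDc.exists_bound_of_continuousOn hκc.continuousOn
  set K : ℝ := |Mc| + |δ| * |Mk| with hK
  have hK0 : 0 ≤ K := by positivity
  -- `1 ≤ L` makes the integral in `V` harmless, and `K ≤ L / 2` turns the outer integral into a
  -- contraction by one half.
  set L : ℝ := 2 * K + 1 with hL
  have hL1 : 1 ≤ L := by linarith
  have hL0 : 0 < L := by linarith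
  obtain ⟨ψ, hψc, hψ⟩ := exists_fixed_point hDc T hTc (fun z => Real.exp (L * (z.1 + z.2)))
    (fun z hz => by
      have : 0 ≤ m * z.1 := mul_nonneg hm0 hz.1
      have h1 : 0 ≤ z.1 + z.2 := by linarith [hz.1, hz.2.1]
      exact Real.one_le_exp (by positivity))
    (B := Real.exp (L * R))
    (fun z hz => Real.exp_le_exp.2 (mul_le_mul_of_nonneg_left hz.2.2 hL0.le))
    (by
      intro ψ₁ ψ₂ h1 h2 N hN h
      have hΦd : ∀ z ∈ D, |Φ ψ₁ z - Φ ψ₂ z| ≤ K * N * Real.exp (L * (z.1 + z.2)) := by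
        rintro ⟨x, y⟩ hz
        have a1 : |V ψ₁ (x, y) - V ψ₂ (x, y)| ≤ N * Real.exp (L * (x + y)) := by
          simp only [hV]
          rw [← intervalIntegral.integral_sub (Continuous.intervalIntegrable (by fun_prop) _ _)
            (Continuous.intervalIntegrable (by fun_prop) _ _)]
          refine (abs_integral_le_exp (p := x) hL0 hN hz.2.1
            (fun s hs => h (x, s) (hseg' x y s hz hs))).trans ?_
          exact div_le_self (by positivity) hL1
        have hs0 : 0 ≤ x + y := by
          have : 0 ≤ m * x := mul_nonneg hm0 hz.1
          have := hz.1; have := hz.2.1; simp only at *; linarith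
        -- `τ` keeps the coordinate sum, so the trace term carries exactly the weight of the point
        -- `(x, y)`.
        have a2 : |ψ₁ (τ (x + y)) - ψ₂ (τ (x + y))| ≤ N * Real.exp (L * (x + y)) := by
          have := h _ (hτD (x + y) hs0 hz.2.2)
          rwa [hτs] at this
        have b1 : |c (x, y)| ≤ |Mc| := (hMc _ hz).trans (le_abs_self _)
        have b2 : |κ₁ (x, y)| ≤ |Mk| := (hMk _ hz).trans (le_abs_self _)
        have e : Φ ψ₁ (x, y) - Φ ψ₂ (x, y) = c (x, y) * (V ψ₁ (x, y) - V ψ₂ (x, y)) -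
            δ * (ψ₁ (τ (x + y)) - ψ₂ (τ (x + y))) * κ₁ (x, y) := by simp only [hΦ]; ring
        rw [e]
        refine (abs_sub _ _).trans ?_
        rw [abs_mul, abs_mul, abs_mul]
        calc _ ≤ |Mc| * (N * Real.exp (L * (x + y))) +
              |δ| * (N * Real.exp (L * (x + y))) * |Mk| := by gcongr
          _ = _ := by rw [hK]; ring
      rintro ⟨x, y⟩ hz
      have c1 := hΦc ψ₁ h1
      have c2 := hΦc ψ₂ h2
      have e : T ψ₁ (x, y) - T ψ₂ (x, y) = ∫ s in (0 : ℝ)..x, (Φ ψ₁ (s, y) - Φ ψ₂ (s, y)) := by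
        rw [intervalIntegral.integral_sub (Continuous.intervalIntegrable (by fun_prop) _ _)
            (Continuous.intervalIntegrable (by fun_prop) _ _)]
        simp only [hT]; ring
      rw [e]
      refine (abs_integral_le_exp (p := y) (K := K * N) hL0 (by positivity) hz.1
        (fun s hs => (hΦd (s, y) (hseg x y s hz hs)).trans (by simp [add_comm]))).trans ?_
      rw [div_le_iff₀ hL0, add_comm y x]
      have : 0 ≤ N * Real.exp (L * (x + y)) := by positivity
      calc K * N * Real.exp (L * (x + y)) = K * (N * Real.exp (L * (x + y))) := by ring
        _ ≤ (L / 2) * (N * Real.exp (L * (x + y))) := by gcongr; linarith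
        _ = _ := by ring)
  have hψc' := hΦc ψ hψc
  have hψ' : ∀ F : ℝ × ℝ → ℝ, EqOn F (Φ ψ) D → ∀ x y, (x, y) ∈ D →
      ψ (x, y) = deriv f y + ∫ s in (0 : ℝ)..x, F (s, y) := by
    intro F hF x y hz
    rw [hψ _ hz]
    simp only [hT]
    congr 1
    refine intervalIntegral.integral_congr fun s hs => ?_
    rw [uIcc_of_le hz.1] at hs
    exact (hF (hseg x y s hz hs)).symm
  have hVsol : ∀ F : ℝ × ℝ → ℝ, Continuous F → EqOn F (Φ ψ) D → EqOn (V ψ) (mixedSol m f F) D := by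
    rintro F hFc hF ⟨x, y⟩ hz
    exact mixedSol_eq_integral hf hFc hz.2.1 fun s hs => hψ' F hF x s (hseg' x y s hz hs)
  -- First regularity pass: the source is only continuous, so `u₁` is `C¹`.
  set u₁ : ℝ × ℝ → ℝ := mixedSol m f (Φ ψ) with hu₁
  have hu₁c : ContDiff ℝ 1 u₁ :=
    contDiff_mixedSol (hf.of_le (by norm_num)) (contDiff_one_pot hψc')
  have hu₁V : EqOn (V ψ) u₁ D := hVsol _ hψc' (fun _ _ => rfl)
  set γ : ℝ → ℝ := fun σ => ψ (τ σ) with hγ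
  have hγc : Continuous γ := hψc.comp hτc
  set e₁ : ℝ → ℝ := fun σ => m * (σ / (1 + m)) with he₁
  have he₁d : ∀ σ, HasDerivAt e₁ (m * (1 / (1 + m))) σ := fun σ =>
    ((hasDerivAt_id σ).div_const _).const_mul m
  -- The trace term integrated along the horizontal segment to `τ σ`, after the substitution `t = s
  -- + e₁ σ`. Now `γ`, so far only continuous, does not depend on `σ`, and differentiation falls on
  -- `v` and on the limits. The lower limit `m σ` is the point where the cut-off switches on.
  set Q₂ : ℝ → ℝ := fun σ => ∫ t in (m * σ)..σ, γ t * v (t - e₁ σ, e₁ σ) with hQ₂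
  have hQ₂c : ContDiff ℝ 1 Q₂ := by
    have hvd := hv.differentiable one_ne_zero
    have hvc := hv.continuous
    have hv1 := (contDiff_pd1 (n := 0) hv).continuous
    have hv2 := (contDiff_pd2 (n := 0) hv).continuous
    have he₁c : Continuous e₁ := by fun_prop
    set H' : ℝ × ℝ → ℝ := fun p => γ p.2 * (pd1 v (p.2 - e₁ p.1, e₁ p.1) * (-(m * (1 / (1 + m)))) +
      pd2 v (p.2 - e₁ p.1, e₁ p.1) * (m * (1 / (1 + m)))) with hH'
    have hH'c : Continuous H' := by fun_prop
    refine contDiff_one_of_hasDerivAt (fun σ => hasDerivAt_integral_limits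
      (H := fun p => γ p.2 * v (p.2 - e₁ p.1, e₁ p.1)) (H' := H') (by fun_prop) hH'c
      (fun σ t => ?_) ((hasDerivAt_id σ).const_mul m) (hasDerivAt_id σ)) ?_
    · exact (hasDerivAt_comp_pd hvd ((he₁d σ).const_sub t) (he₁d σ)).const_mul (γ t)
    · refine Continuous.add (by fun_prop) (continuous_integral_param hH'c continuous_id
        (by fun_prop) continuous_id)
  set g : ℝ → ℝ := fun σ => deriv f (e₁ σ) +
    (∫ s in (0 : ℝ)..(σ / (1 + m)), c (s, e₁ σ) * u₁ (s, e₁ σ)) - δ * Q₂ σ with hg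
  have hgC : ContDiff ℝ 1 g := by
    have h1 : ContDiff ℝ 1 (deriv f) := (contDiff_succ_iff_deriv.1 hf).2.2
    have h2 : ContDiff ℝ 1 e₁ := by rw [he₁]; fun_prop
    have h3 : ContDiff ℝ 1 (fun σ => ∫ s in (0 : ℝ)..(σ / (1 + m)), c (s, e₁ σ) * u₁ (s, e₁ σ)) := by
      have := contDiff_one_integral_fst (H := fun z => c z * u₁ z) (hc.mul hu₁c)
        (p := fun z => e₁ z.1) (a := fun _ => 0) (b := fun z => z.1 / (1 + m))
        (h2.comp contDiff_fst) contDiff_const (by fun_prop)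
      exact this.comp (f := fun σ : ℝ => (σ, (0 : ℝ))) (by fun_prop)
    exact ((h1.comp h2).add h3).sub (contDiff_const.mul hQ₂c)
  -- The trace of `ψ` on the edge agrees with the `C¹` expression `g`, which gains one derivative
  -- over continuity of `ψ`.
  have hgγ : ∀ σ, 0 ≤ σ → σ ≤ R → γ σ = g σ := by
    intro σ h0 h1
    have hz := hτD σ h0 h1
    have e := hψ' (Φ ψ) (fun _ _ => rfl) (σ / (1 + m)) (e₁ σ) hz
    have hx0 : 0 ≤ σ / (1 + m) := by positivity
    have hVc' := hVc ψ hψc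
    have hκs : Continuous fun s => κ₁ (s, e₁ σ) := by fun_prop
    have hsplit : ∫ s in (0 : ℝ)..(σ / (1 + m)), Φ ψ (s, e₁ σ) =
        (∫ s in (0 : ℝ)..(σ / (1 + m)), c (s, e₁ σ) * u₁ (s, e₁ σ)) -
          δ * ∫ s in (0 : ℝ)..(σ / (1 + m)), γ (s + e₁ σ) * κ₁ (s, e₁ σ) := by
      rw [← intervalIntegral.integral_const_mul, ← intervalIntegral.integral_sub]
      · refine intervalIntegral.integral_congr fun s hs => ?_
        rw [uIcc_of_le hx0] at hs
        simp only [hΦ, hγ]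
        rw [hu₁V (hseg _ _ s hz hs)]
        ring
      · have := hu₁c.continuous
        exact Continuous.intervalIntegrable (by fun_prop) _ _
      · exact Continuous.intervalIntegrable (by fun_prop) _ _
    have hQ : ∫ s in (0 : ℝ)..(σ / (1 + m)), γ (s + e₁ σ) * κ₁ (s, e₁ σ) = Q₂ σ := by
      have hsum : σ / (1 + m) + e₁ σ = σ := hτs σ
      have s1 := intervalIntegral.integral_comp_add_right (a := 0) (b := σ / (1 + m))
        (fun t => γ t * κ₁ (t - e₁ σ, e₁ σ)) (e₁ σ)
      simp only [add_sub_cancel_right, zero_add, hsum] at s1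
      rw [s1]
      have hcont : Continuous fun t => γ t * κ₁ (t - e₁ σ, e₁ σ) := by fun_prop
      rw [← intervalIntegral.integral_add_adjacent_intervals (b := m * σ)
        (hcont.intervalIntegrable _ _) (hcont.intervalIntegrable _ _)]
      have hmσ : m * σ = e₁ σ + m * e₁ σ := by simp only [he₁]; field_simp
      have hme : 0 ≤ m * e₁ σ := mul_nonneg hm0 (mul_nonneg hm0 hx0)
      have hi1 : ∫ t in (e₁ σ)..(m * σ), γ t * κ₁ (t - e₁ σ, e₁ σ) = 0 := by
        rw [intervalIntegral.integral_congr (g := fun _ => 0)]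
        · simp
        · intro t ht
          rw [uIcc_of_le (by linarith)] at ht
          simp only [hκ₁]
          split_ifs with h
          · have ht' : t - e₁ σ = m * e₁ σ := by linarith [ht.2]
            rw [ht', hv0, mul_zero]
          · simp
      have hmσ' : m * σ ≤ σ := by
        have : m * e₁ σ = m * (m * (σ / (1 + m))) := rfl
        have h3 : e₁ σ ≤ σ := by linarith
        by_contra hcon
        have hlt : 1 < m := by
          by_contra hm; push Not at hm
          exact hcon (mul_le_of_le_one_left h0 hm)
        exact absurd hlt (not_lt.2 hm1'.le)
      rw [hi1, zero_add]
      refine intervalIntegral.integral_congr fun t ht => ?_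
      rw [uIcc_of_le hmσ'] at ht
      simp only [hκ₁]
      rw [if_pos (by linarith [ht.1])]
    rw [hsplit, hQ] at e
    simp only [hγ, hg]
    rw [show ψ (τ σ) = _ from e]
    ring
  -- Second pass: on `D` the source is unchanged, but it is now written with the `C¹` functions `u₁`
  -- and `g`.
  set F₁ : ℝ × ℝ → ℝ := fun z => c z * u₁ z - δ * g (z.1 + z.2) * κ₁ z with hF₁
  have hF₁eq : EqOn F₁ (Φ ψ) D := by
    rintro ⟨x, y⟩ hz
    have hs0 : 0 ≤ x + y := by
      have : 0 ≤ m * x := mul_nonneg hm0 hz.1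
      have := hz.1; have := hz.2.1; simp only at *; linarith
    simp only [hF₁, hΦ]
    rw [hu₁V hz, ← hgγ _ hs0 hz.2.2]
  have hF₁good : GoodSource F₁ := by
    -- Either there is no cut-off term, or `m > 0` and the cutting line `ξ = m ζ` is oblique.
    rcases hδ with h0 | hmp
    · have : F₁ = fun z => c z * u₁ z := by ext z; simp [hF₁, h0]
      rw [this]
      exact GoodSource.of_contDiff (hc.mul hu₁c)
    · have hG : ContDiff ℝ 1 (fun z : ℝ × ℝ => δ * g (z.1 + z.2) * v z) := by fun_prop
      -- The term supported in `m ζ ≤ ξ` equals the uncut term minus its part in `ζ ≥ ξ / m`; this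
      -- is the side on which `GoodSource.cut` keeps the function.
      have g1 := GoodSource.of_contDiff ((hc.mul hu₁c).sub hG)
      have g2 := GoodSource.cut hG (κ := 1 / m) (d := 0) (by positivity) (fun x => by
        have := hv0 (1 / m * x + 0)
        rw [show m * (1 / m * x + 0) = x by field_simp; ring] at this
        rw [this, mul_zero])
      convert g1.add g2 using 2 with z
      have hiff : (0 ≤ z.2 - (1 / m * z.1 + 0)) ↔ z.1 - m * z.2 ≤ 0 := by
        rw [add_zero, sub_nonneg, sub_nonpos, one_div_mul_eq_div, div_le_iff₀' hmp]
      simp only [hF₁, hκ₁, hiff]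
      rcases lt_trichotomy (z.1 - m * z.2) 0 with h | h | h
      · simp [h.le, not_le.2 h]
      · have hv' : v z = 0 := by
          have := hv0 z.2
          rwa [show m * z.2 = z.1 by linarith] at this
        simp [hv']
      · simp [h.le, not_le.2 h]
  have hu₂V := hVsol F₁ hF₁good.cont hF₁eq
  have hu₂c : ContDiff ℝ 2 (mixedSol m f F₁) :=
    contDiff_mixedSol hf (contDiff_two_pot hF₁good.cont hF₁good.fst hF₁good.snd)
  have hpotc := contDiff_one_pot hF₁good.cont
  have hu₂d := hu₂c.differentiable two_ne_zero
  have hA : Differentiable ℝ (fun x => -f (m * x) - pot F₁ (x, m * x)) := by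
    have h1 := hf.differentiable two_ne_zero
    have h2 := hpotc.differentiable one_ne_zero
    fun_prop
  refine ⟨mixedSol m f F₁, g, hu₂c, hgC, fun y => ?_, fun x => ?_, fun x y h1 h2 h3 => ?_,
    fun x h1 h2 => ?_⟩
  · simp [mixedSol, pot]; ring
  · simp [mixedSol]
  · have hz : (x, y) ∈ D := ⟨h1, h2, h3⟩
    have := hasDerivAt_pd1_dAlembert hF₁good.cont hu₂d (A := fun x => -f (m * x) -
      pot F₁ (x, m * x)) (B := f) (fun z => rfl) (hA x) y
    refine this.congr_deriv ?_
    simp only [hF₁]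
    rw [← hu₂V hz, hu₁V hz]
  · have hz : (x, m * x) ∈ D := ⟨h1, le_rfl, h2⟩
    have e := hψ' F₁ hF₁eq x (m * x) hz
    rw [pd2_dAlembert hF₁good.cont hu₂d (A := fun x => -f (m * x) -
      pot F₁ (x, m * x)) (B := f) (fun z => rfl) x (hf.differentiable two_ne_zero _)]
    have hτx : τ (x + m * x) = (x, m * x) := by
      simp only [hτ]
      have : (x + m * x) / (1 + m) = x := by field_simp
      rw [this]
    rw [← hgγ _ (by positivity) h2]
    simp only [hγ]
    rw [hτx, e, add_comm]

/-! Scalar form of the matrix equations. -/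

/-- The entry `(i, j)` of a matrix kernel as a scalar kernel. -/
abbrev entry (K : ℝ → ℝ → Matrix (Fin 2) (Fin 2) ℝ) (i j : Fin 2) : ℝ → ℝ → ℝ :=
  fun x y => K x y i j

lemma pde_iff {ε y₀ c₁ c₂ : ℝ} {ℓ : ℝ → ℝ} {K : ℝ → ℝ → Matrix (Fin 2) (Fin 2) ℝ} {x y : ℝ} :
    matE ε y₀ * matDX (matDX K) x y - matDY (matDY K) x y * matE ε y₀
      = K x y * matLambda y₀ ℓ y + matC c₁ c₂ * K x y - matG ε y₀ K x * K x y ↔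
    (eps1 ε y₀ * dX triL (dX triL (entry K 0 0)) x y
        - eps1 ε y₀ * dY triL (dY triL (entry K 0 0)) x y
        = (ℓ (y₀ - (1 + y₀) * y) + c₁) * K x y 0 0) ∧
    (eps1 ε y₀ * dX triL (dX triL (entry K 0 1)) x y
        - eps2 ε y₀ * dY triL (dY triL (entry K 0 1)) x y
        = (ℓ (y₀ + (1 - y₀) * y) + c₁) * K x y 0 1) ∧
    (eps2 ε y₀ * dX triL (dX triL (entry K 1 0)) x y
        - eps1 ε y₀ * dY triL (dY triL (entry K 1 0)) x y
        = (ℓ (y₀ - (1 + y₀) * y) + c₂) * K x y 1 0 - gCoef ε y₀ K x * K x y 0 0) ∧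
    (eps2 ε y₀ * dX triL (dX triL (entry K 1 1)) x y
        - eps2 ε y₀ * dY triL (dY triL (entry K 1 1)) x y
        = (ℓ (y₀ + (1 - y₀) * y) + c₂) * K x y 1 1 - gCoef ε y₀ K x * K x y 0 1) := by
  rw [← Matrix.ext_iff]
  simp only [Fin.forall_fin_two, matE, matLambda, matC, matG, matDX, matDY, Matrix.sub_apply,
    Matrix.add_apply, Matrix.mul_apply, Fin.sum_univ_two, Matrix.of_apply, Matrix.cons_val', Matrix.cons_val_zero, Matrix.cons_val_one,
    Matrix.cons_val_fin_one]
  constructor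
  · rintro ⟨⟨h1, h2⟩, h3, h4⟩
    refine ⟨?_, ?_, ?_, ?_⟩ <;> linarith
  · rintro ⟨h1, h2, h3, h4⟩
    refine ⟨⟨?_, ?_⟩, ?_, ?_⟩ <;> linarith

lemma diag_iff {ε y₀ c₁ c₂ : ℝ} {ℓ : ℝ → ℝ} {K : ℝ → ℝ → Matrix (Fin 2) (Fin 2) ℝ} {x : ℝ} :
    matDY K x x * matE ε y₀ + matE ε y₀ * matDX K x x
      = -(matE ε y₀ * matDiagDeriv K x) - matLambda y₀ ℓ x - matC c₁ c₂ + matG ε y₀ K x ↔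
    (eps1 ε y₀ * dY triL (entry K 0 0) x x + eps1 ε y₀ * dX triL (entry K 0 0) x x
      = -(eps1 ε y₀ * deriv (fun s => K s s 0 0) x) - ℓ (y₀ - (1 + y₀) * x) - c₁) ∧
    (eps2 ε y₀ * dY triL (entry K 0 1) x x + eps1 ε y₀ * dX triL (entry K 0 1) x x
      = -(eps1 ε y₀ * deriv (fun s => K s s 0 1) x)) ∧
    (eps1 ε y₀ * dY triL (entry K 1 0) x x + eps2 ε y₀ * dX triL (entry K 1 0) x x
      = -(eps2 ε y₀ * deriv (fun s => K s s 1 0) x) + gCoef ε y₀ K x) ∧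
    (eps2 ε y₀ * dY triL (entry K 1 1) x x + eps2 ε y₀ * dX triL (entry K 1 1) x x
      = -(eps2 ε y₀ * deriv (fun s => K s s 1 1) x) - ℓ (y₀ + (1 - y₀) * x) - c₂) := by
  rw [← Matrix.ext_iff]
  simp only [Fin.forall_fin_two, matE, matLambda, matC, matG, matDX, matDY, Matrix.sub_apply,
    Matrix.add_apply, Matrix.mul_apply, Fin.sum_univ_two, Matrix.of_apply, Matrix.cons_val', Matrix.cons_val_zero, Matrix.cons_val_one,
    Matrix.cons_val_fin_one, matDiagDeriv, Matrix.neg_apply]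
  constructor
  · rintro ⟨⟨h1, h2⟩, h3, h4⟩
    refine ⟨?_, ?_, ?_, ?_⟩ <;> linarith
  · rintro ⟨h1, h2, h3, h4⟩
    refine ⟨⟨?_, ?_⟩, ?_, ?_⟩ <;> linarith

lemma eps2_eq {ε y₀ : ℝ} (hy : y₀ ∈ Ioc (-1 : ℝ) 0) :
    eps2 ε y₀ = aCoef y₀ ^ 2 * eps1 ε y₀ := by
  have h1 : 1 + y₀ ≠ 0 := by linarith [hy.1]
  have h2 : 1 - y₀ ≠ 0 := by linarith [hy.2]
  unfold eps1 eps2 aCoef; field_simp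

lemma eps1_pos {ε y₀ : ℝ} (hε : 0 < ε) (hy : y₀ ∈ Ioc (-1 : ℝ) 0) : 0 < eps1 ε y₀ := by
  have h1 : 0 < 1 + y₀ := by linarith [hy.1]
  unfold eps1; positivity

lemma eps2_pos {ε y₀ : ℝ} (hε : 0 < ε) (hy : y₀ ∈ Ioc (-1 : ℝ) 0) : 0 < eps2 ε y₀ := by
  have h1 : 0 < 1 - y₀ := by linarith [hy.2]
  unfold eps2; positivity

lemma aCoef_pos {y₀ : ℝ} (hy : y₀ ∈ Ioc (-1 : ℝ) 0) : 0 < aCoef y₀ :=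
  div_pos (by linarith [hy.1]) (by linarith [hy.2])

lemma aCoef_le_one {y₀ : ℝ} (hy : y₀ ∈ Ioc (-1 : ℝ) 0) : aCoef y₀ ≤ 1 := by
  unfold aCoef
  rw [div_le_one (by linarith [hy.2])]
  linarith [hy.2]

/-- The admissible boundary data form a two-dimensional space, so two test vectors per row determine
everything; `ε₂ = a² ε₁` puts the result in a form free of `ε`. -/
lemma fold_iff {ε y₀ : ℝ} (hε : 0 < ε) (hy : y₀ ∈ Ioc (-1 : ℝ) 0)
    {K : ℝ → ℝ → Matrix (Fin 2) (Fin 2) ℝ} {x : ℝ} :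
    (∀ V V' : Fin 2 → ℝ, (matAlpha y₀).mulVec V' = -(matBeta.mulVec V) →
      (K x 0 * matE ε y₀).mulVec V' = (matDY K x 0 * matE ε y₀).mulVec V) ↔
    ∀ i, K x 0 i 0 = aCoef y₀ * K x 0 i 1 ∧
      dY triL (entry K i 0) x 0 + aCoef y₀ ^ 2 * dY triL (entry K i 1) x 0 = 0 := by
  have ha := aCoef_pos hy
  have h1 := eps1_pos hε hy
  have key : ∀ V V' : Fin 2 → ℝ, (matAlpha y₀).mulVec V' = -(matBeta.mulVec V) ↔
      V' 0 + aCoef y₀ * V' 1 = 0 ∧ V 0 = V 1 := by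
    intro V V'
    rw [funext_iff]
    simp only [Fin.forall_fin_two, matAlpha, matBeta, Matrix.mulVec, dotProduct,
      Fin.sum_univ_two, Matrix.of_apply, Matrix.cons_val', Matrix.cons_val_zero,
      Matrix.cons_val_one, Matrix.cons_val_fin_one, Pi.neg_apply]
    constructor
    · rintro ⟨a1, a2⟩; constructor <;> linarith
    · rintro ⟨a1, a2⟩; constructor <;> linarith
  have key2 : ∀ V V' : Fin 2 → ℝ,
      (K x 0 * matE ε y₀).mulVec V' = (matDY K x 0 * matE ε y₀).mulVec V ↔
      ∀ i, K x 0 i 0 * eps1 ε y₀ * V' 0 + K x 0 i 1 * eps2 ε y₀ * V' 1 =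
        dY triL (entry K i 0) x 0 * eps1 ε y₀ * V 0 +
          dY triL (entry K i 1) x 0 * eps2 ε y₀ * V 1 := by
    intro V V'
    rw [funext_iff]
    refine forall_congr' fun i => ?_
    simp only [matE, matDY, Matrix.mulVec, dotProduct, Matrix.mul_apply,
      Fin.sum_univ_two, Matrix.of_apply, Matrix.cons_val', Matrix.cons_val_zero,
      Matrix.cons_val_one, Matrix.cons_val_fin_one, mul_zero, add_zero, zero_add]
  simp only [key, key2, eps2_eq hy]
  constructor
  · intro h i
    -- A basis of the solutions of `V'₀ + a V'₁ = 0`, `V₀ = V₁`.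
    have hA := h ![0, 0] ![aCoef y₀, -1] (by simp) i
    have hB := h ![1, 1] ![0, 0] (by simp) i
    simp only [Matrix.cons_val_zero, Matrix.cons_val_one] at hA hB
    constructor
    · have : aCoef y₀ * eps1 ε y₀ * (K x 0 i 0 - aCoef y₀ * K x 0 i 1) = 0 := by linarith
      have := (mul_eq_zero.1 this).resolve_left (by positivity)
      linarith
    · have : eps1 ε y₀ * (dY triL (entry K i 0) x 0 +
          aCoef y₀ ^ 2 * dY triL (entry K i 1) x 0) = 0 := by linarith
      exact (mul_eq_zero.1 this).resolve_left (by positivity)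
  · rintro h V V' ⟨e1, e2⟩ i
    obtain ⟨hA, hB⟩ := h i
    have e3 : V' 0 = -aCoef y₀ * V' 1 := by linarith
    have e4 : dY triL (entry K i 0) x 0 = -aCoef y₀ ^ 2 * dY triL (entry K i 1) x 0 := by linarith
    rw [hA, e3, e2, e4]; ring

/-! Relative partial derivatives of globally defined functions. -/

lemma interior_triL_nonempty : (interior triL).Nonempty := by
  refine ⟨(1 / 2, 1 / 4), mem_interior.2 ⟨{z | 0 < z.2} ∩ ({z | z.2 < z.1} ∩ {z | z.1 < 1}),
    fun z hz => ⟨hz.1.le, hz.2.1.le, hz.2.2.le⟩, ?_, ?_⟩⟩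
  · exact (isOpen_lt (by fun_prop) (by fun_prop)).inter
      ((isOpen_lt (by fun_prop) (by fun_prop)).inter (isOpen_lt (by fun_prop) (by fun_prop)))
  · norm_num

lemma interior_triU_nonempty : (interior triU).Nonempty := by
  refine ⟨(1 / 4, 1 / 2), mem_interior.2 ⟨{z | 0 < z.1} ∩ ({z | z.1 < z.2} ∩ {z | z.2 < 1}),
    fun z hz => ⟨hz.1.le, hz.2.1.le, hz.2.2.le⟩, ?_, ?_⟩⟩
  · exact (isOpen_lt (by fun_prop) (by fun_prop)).inter
      ((isOpen_lt (by fun_prop) (by fun_prop)).inter (isOpen_lt (by fun_prop) (by fun_prop)))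
  · norm_num

lemma convex_triL : Convex ℝ triL := by
  rintro ⟨x, y⟩ ⟨h1, h2, h3⟩ ⟨x', y'⟩ ⟨h1', h2', h3'⟩ s t hs ht hst
  simp only [triL, mem_ofPred_eq, Prod.smul_mk, Prod.mk_add_mk, smul_eq_mul] at *
  have := mul_le_mul_of_nonneg_left h2 hs
  have := mul_le_mul_of_nonneg_left h2' ht
  have := mul_le_mul_of_nonneg_left h3 hs
  have := mul_le_mul_of_nonneg_left h3' ht
  refine ⟨by positivity, by linarith, by linarith⟩

lemma convex_triU : Convex ℝ triU := by
  rintro ⟨x, y⟩ ⟨h1, h2, h3⟩ ⟨x', y'⟩ ⟨h1', h2', h3'⟩ s t hs ht hst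
  simp only [triU, mem_ofPred_eq, Prod.smul_mk, Prod.mk_add_mk, smul_eq_mul] at *
  have := mul_le_mul_of_nonneg_left h2 hs
  have := mul_le_mul_of_nonneg_left h2' ht
  have := mul_le_mul_of_nonneg_left h3 hs
  have := mul_le_mul_of_nonneg_left h3' ht
  refine ⟨by positivity, by linarith, by linarith⟩

lemma uniqueDiffOn_triL : UniqueDiffOn ℝ triL :=
  uniqueDiffOn_convex convex_triL interior_triL_nonempty

lemma uniqueDiffOn_triU : UniqueDiffOn ℝ triU :=
  uniqueDiffOn_convex convex_triU interior_triU_nonempty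

section Relative

variable {S : Set (ℝ × ℝ)} {f : ℝ → ℝ → ℝ} {G : ℝ × ℝ → ℝ} {x y : ℝ}

/-- The kernels are constructed as restrictions of globally smooth functions; this passes from
derivatives relative to a triangle, one-sided on its boundary, to ordinary ones. -/
lemma fderivWithin_of_eventuallyEq (hS : UniqueDiffOn ℝ S) (hz : (x, y) ∈ S)
    (hG : DifferentiableAt ℝ G (x, y)) (h : (fun z : ℝ × ℝ => f z.1 z.2) =ᶠ[𝓝[S] (x, y)] G) :
    fderivWithin ℝ (fun z : ℝ × ℝ => f z.1 z.2) S (x, y) = fderiv ℝ G (x, y) := by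
  rw [h.fderivWithin_eq (h.eq_of_nhdsWithin hz)]
  exact hG.hasFDerivAt.hasFDerivWithinAt.fderivWithin (hS _ hz)

lemma dX_eq_pd1 (hS : UniqueDiffOn ℝ S) (hz : (x, y) ∈ S)
    (hG : Differentiable ℝ G) (h : (fun z : ℝ × ℝ => f z.1 z.2) =ᶠ[𝓝[S] (x, y)] G) :
    dX S f x y = pd1 G (x, y) := by
  unfold dX pd1; rw [fderivWithin_of_eventuallyEq hS hz (hG _) h]

lemma dY_eq_pd2 (hS : UniqueDiffOn ℝ S) (hz : (x, y) ∈ S)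
    (hG : Differentiable ℝ G) (h : (fun z : ℝ × ℝ => f z.1 z.2) =ᶠ[𝓝[S] (x, y)] G) :
    dY S f x y = pd2 G (x, y) := by
  unfold dY pd2; rw [fderivWithin_of_eventuallyEq hS hz (hG _) h]

lemma dX_dX_eq (hS : UniqueDiffOn ℝ S) (hz : S ∈ 𝓝 (x, y))
    (hG : ContDiff ℝ 2 G) (h : (fun z : ℝ × ℝ => f z.1 z.2) =ᶠ[𝓝 (x, y)] G) :
    dX S (dX S f) x y = pd1 (pd1 G) (x, y) := by
  have hG1 : ContDiff ℝ 1 (pd1 G) := contDiff_pd1 hG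
  refine dX_eq_pd1 hS (mem_of_mem_nhds hz) (hG1.differentiable one_ne_zero)
    (Filter.Eventually.filter_mono nhdsWithin_le_nhds ?_)
  filter_upwards [h.eventuallyEq_nhds, eventually_mem_nhds_iff.2 hz] with z h1 h2
  exact dX_eq_pd1 (x := z.1) (y := z.2) hS (mem_of_mem_nhds h2) (hG.differentiable two_ne_zero)
    (h1.filter_mono nhdsWithin_le_nhds)

lemma dY_dY_eq (hS : UniqueDiffOn ℝ S) (hz : S ∈ 𝓝 (x, y))
    (hG : ContDiff ℝ 2 G) (h : (fun z : ℝ × ℝ => f z.1 z.2) =ᶠ[𝓝 (x, y)] G) :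
    dY S (dY S f) x y = pd2 (pd2 G) (x, y) := by
  have hG1 : ContDiff ℝ 1 (pd2 G) := contDiff_pd2 hG
  refine dY_eq_pd2 hS (mem_of_mem_nhds hz) (hG1.differentiable one_ne_zero)
    (Filter.Eventually.filter_mono nhdsWithin_le_nhds ?_)
  filter_upwards [h.eventuallyEq_nhds, eventually_mem_nhds_iff.2 hz] with z h1 h2
  exact dY_eq_pd2 (x := z.1) (y := z.2) hS (mem_of_mem_nhds h2) (hG.differentiable two_ne_zero)
    (h1.filter_mono nhdsWithin_le_nhds)

end Relative

/-! ### Mixed derivatives and the wave operator in linear coordinates. -/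

lemma pd2_pd1_comm {h : ℝ × ℝ → ℝ} (hh : ContDiff ℝ 2 h) (z : ℝ × ℝ) :
    pd1 (pd2 h) z = pd2 (pd1 h) z := by
  have hd : DifferentiableAt ℝ (fderiv ℝ h) z :=
    ((hh.fderiv_right (m := 1) (by norm_num)).differentiable one_ne_zero) z
  have hs : IsSymmSndFDerivAt ℝ h z := hh.contDiffAt.isSymmSndFDerivAt (by simp)
  have e : ∀ v w : ℝ × ℝ, fderiv ℝ (fun y => fderiv ℝ h y v) z w = fderiv ℝ (fderiv ℝ h) z w v := by
    intro v w
    have := (hd.hasFDerivAt.clm_apply (hasFDerivAt_const v z)).fderiv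
    rw [this]; simp
  change fderiv ℝ (fun y => fderiv ℝ h y (0, 1)) z (1, 0) =
    fderiv ℝ (fun y => fderiv ℝ h y (1, 0)) z (0, 1)
  rw [e, e]; exact hs _ _

/-- `h` in new linear coordinates. -/
def linComp (A : ℝ) (h : ℝ × ℝ → ℝ) (p q r s : ℝ) (z : ℝ × ℝ) : ℝ :=
  A * h (p * z.1 + q * z.2, r * z.1 + s * z.2)

section LinComp

variable {A p q r s : ℝ} {h : ℝ × ℝ → ℝ}

lemma contDiff_linComp {n : WithTop ℕ∞} (hh : ContDiff ℝ n h) :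
    ContDiff ℝ n (linComp A h p q r s) := by
  unfold linComp; fun_prop

lemma pd1_linComp (hh : Differentiable ℝ h) :
    pd1 (linComp A h p q r s) =
      fun z => linComp (A * p) (pd1 h) p q r s z + linComp (A * r) (pd2 h) p q r s z := by
  ext ⟨x, y⟩
  have hd : Differentiable ℝ (linComp A h p q r s) := by unfold linComp; fun_prop
  refine (hasDerivAt_pd1 hd x y).unique ?_
  have := (hasDerivAt_comp_pd hh (((hasDerivAt_id x).const_mul p).add_const (q * y))
    (((hasDerivAt_id x).const_mul r).add_const (s * y))).const_mul A
  refine this.congr_deriv ?_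
  simp only [linComp, id]; ring

lemma pd2_linComp (hh : Differentiable ℝ h) :
    pd2 (linComp A h p q r s) =
      fun z => linComp (A * q) (pd1 h) p q r s z + linComp (A * s) (pd2 h) p q r s z := by
  ext ⟨x, y⟩
  have hd : Differentiable ℝ (linComp A h p q r s) := by unfold linComp; fun_prop
  refine (hasDerivAt_pd2 hd x y).unique ?_
  have := (hasDerivAt_comp_pd hh (((hasDerivAt_id y).const_mul q).const_add (p * x))
    (((hasDerivAt_id y).const_mul s).const_add (r * x))).const_mul A
  refine this.congr_deriv ?_
  simp only [linComp, id]; ring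

lemma pd1_add {f g : ℝ × ℝ → ℝ} (hf : Differentiable ℝ f) (hg : Differentiable ℝ g) (z : ℝ × ℝ) :
    pd1 (fun z => f z + g z) z = pd1 f z + pd1 g z := by
  unfold pd1; rw [fderiv_fun_add (hf z) (hg z)]; rfl

lemma pd2_add {f g : ℝ × ℝ → ℝ} (hf : Differentiable ℝ f) (hg : Differentiable ℝ g) (z : ℝ × ℝ) :
    pd2 (fun z => f z + g z) z = pd2 f z + pd2 g z := by
  unfold pd2; rw [fderiv_fun_add (hf z) (hg z)]; rfl

/-- The wave operator in characteristic coordinates. -/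
lemma wave_linComp (hh : ContDiff ℝ 2 h) {e₁ e₂ : ℝ} (h1 : e₁ * p ^ 2 = e₂ * q ^ 2)
    (h2 : e₁ * r ^ 2 = e₂ * s ^ 2) (z : ℝ × ℝ) :
    e₁ * pd1 (pd1 (linComp A h p q r s)) z - e₂ * pd2 (pd2 (linComp A h p q r s)) z =
      A * (2 * (e₁ * p * r - e₂ * q * s)) *
        pd2 (pd1 h) (p * z.1 + q * z.2, r * z.1 + s * z.2) := by
  have hd := hh.differentiable two_ne_zero
  have c1 : ContDiff ℝ 1 (pd1 h) := contDiff_pd1 hh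
  have c2 : ContDiff ℝ 1 (pd2 h) := contDiff_pd2 hh
  have d1 := c1.differentiable one_ne_zero
  have d2 := c2.differentiable one_ne_zero
  have l1 : ∀ B, Differentiable ℝ (linComp B (pd1 h) p q r s) := fun B =>
    (contDiff_linComp c1).differentiable one_ne_zero
  have l2 : ∀ B, Differentiable ℝ (linComp B (pd2 h) p q r s) := fun B =>
    (contDiff_linComp c2).differentiable one_ne_zero
  rw [pd1_linComp hd, pd2_linComp hd, pd1_add (l1 _) (l2 _), pd2_add (l1 _) (l2 _),
    pd1_linComp d1, pd1_linComp d2, pd2_linComp d1, pd2_linComp d2]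
  simp only [linComp, pd2_pd1_comm hh]
  linear_combination A * pd1 (pd1 h) (p * z.1 + q * z.2, r * z.1 + s * z.2) * h1 +
    A * pd2 (pd2 h) (p * z.1 + q * z.2, r * z.1 + s * z.2) * h2

end LinComp

lemma hasDerivAt_diagonal {G : ℝ × ℝ → ℝ} (hG : Differentiable ℝ G) (x : ℝ) :
    HasDerivAt (fun s => G (s, s)) (pd1 G (x, x) + pd2 G (x, x)) x := by
  simpa using hasDerivAt_comp_pd hG (hasDerivAt_id x) (hasDerivAt_id x)

/-- A `C¹` function on an interval extends to the line. -/
lemma exists_contDiff_one_extension {f : ℝ → ℝ} {a b : ℝ} (hab : a < b)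
    (hf : ContDiffOn ℝ 1 f (Icc a b)) : ∃ F : ℝ → ℝ, ContDiff ℝ 1 F ∧ EqOn F f (Icc a b) := by
  have hc : ContinuousOn (derivWithin f (Icc a b)) (Icc a b) :=
    hf.continuousOn_derivWithin (uniqueDiffOn_Icc hab) le_rfl
  -- Only the derivative is extended, as a continuous function; its integral is then `C¹` on the
  -- whole line.
  obtain ⟨φ, hφ, hφf⟩ := exists_continuous_extension isClosed_Icc hc
  refine ⟨fun x => f a + ∫ s in a..x, φ s, ?_, fun x hx => ?_⟩
  · exact contDiff_const.add (contDiff_integral_upper (n := 0) (contDiff_zero.2 hφ) a)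
  · have e := intervalIntegral.integral_eq_sub_of_hasDerivAt_of_le (f := f) (f' := φ) hx.1
      (hf.continuousOn.mono (Icc_subset_Icc_right hx.2)) (fun t ht => by
        have htI : t ∈ Icc a b := ⟨ht.1.le, ht.2.le.trans hx.2⟩
        rw [hφf htI]
        exact ((hf.differentiableOn one_ne_zero t htI).hasDerivWithinAt).hasDerivAt
          (Icc_mem_nhds ht.1 (ht.2.trans_le hx.2))) (hφ.intervalIntegrable _ _)
    change f a + ∫ s in a..x, φ s = f x
    rw [e]; ring

lemma mem_nhds_triL {x y : ℝ} (h1 : 0 < y) (h2 : y < x) (h3 : x < 1) : triL ∈ 𝓝 (x, y) := by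
  have hO : IsOpen ({z : ℝ × ℝ | 0 < z.2} ∩ ({z | z.2 < z.1} ∩ {z | z.1 < 1})) :=
    (isOpen_lt (by fun_prop) (by fun_prop)).inter
      ((isOpen_lt (by fun_prop) (by fun_prop)).inter (isOpen_lt (by fun_prop) (by fun_prop)))
  exact mem_of_superset (hO.mem_nhds ⟨h1, h2, h3⟩) fun z hz => ⟨hz.1.le, hz.2.1.le, hz.2.2.le⟩

lemma mem_nhds_triU {x y : ℝ} (h1 : 0 < x) (h2 : x < y) (h3 : y < 1) : triU ∈ 𝓝 (x, y) := by
  have hO : IsOpen ({z : ℝ × ℝ | 0 < z.1} ∩ ({z | z.1 < z.2} ∩ {z | z.2 < 1})) :=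
    (isOpen_lt (by fun_prop) (by fun_prop)).inter
      ((isOpen_lt (by fun_prop) (by fun_prop)).inter (isOpen_lt (by fun_prop) (by fun_prop)))
  exact mem_of_superset (hO.mem_nhds ⟨h1, h2, h3⟩) fun z hz => ⟨hz.1.le, hz.2.1.le, hz.2.2.le⟩

/-! ### Existence of the first kernel. -/

/-- The profile of a characteristic boundary datum. -/
lemma exists_profile {φ : ℝ → ℝ} (hφ : ContDiff ℝ 1 φ) {P : ℝ} (hP : 0 < P) :
    ∃ f : ℝ → ℝ, ContDiff ℝ 2 f ∧ ∀ x, P * (f (2 * P * x) - f 0) = ∫ s in (0 : ℝ)..x, φ s := by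
  -- The diagonal point `(x, x)` has characteristic coordinates `(0, 2 P x)` and the kernel entry
  -- carries the prefactor `P`; both scalings are undone here.
  refine ⟨fun z => 1 / P * ∫ s in (0 : ℝ)..(z / (2 * P)), φ s, ?_, fun x => ?_⟩
  · have := contDiff_integral_upper (n := 1) hφ 0
    exact contDiff_const.mul (ContDiff.comp (g := fun x => ∫ s in (0 : ℝ)..x, φ s) this (by fun_prop))
  · have : 2 * P * x / (2 * P) = x := by field_simp
    simp only [this, zero_div, intervalIntegral.integral_same]
    field_simp; ring

/-- Existence of the first kernel, together with the regularity of its coupling coefficient. -/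
theorem exists_firstKernel {ε y₀ c₁ c₂ : ℝ} (hε : 0 < ε) (hy : y₀ ∈ Ioc (-1 : ℝ) 0) {ℓ : ℝ → ℝ}
    (hℓ : ContDiff ℝ 1 ℓ) :
    ∃ K : ℝ → ℝ → Matrix (Fin 2) (Fin 2) ℝ, IsFirstKernel ε y₀ c₁ c₂ ℓ K ∧
      ∃ g : ℝ → ℝ, ContDiff ℝ 1 g ∧ EqOn (gCoef ε y₀ K) g (Icc 0 1) := by
  set P : ℝ := 1 + y₀ with hPdef
  set M : ℝ := 1 - y₀ with hMdef
  have hP : 0 < P := by linarith [hy.1]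
  have hM : 0 < M := by linarith [hy.2]
  have hPM : P ≤ M := by linarith [hy.2]
  have hPM2 : P + M = 2 := by ring
  have ha : aCoef y₀ = P / M := rfl
  have hE1 : eps1 ε y₀ * P ^ 2 = ε := by unfold eps1; rw [← hPdef]; field_simp
  have hE2 : eps2 ε y₀ * M ^ 2 = ε := by unfold eps2; rw [← hMdef]; field_simp
  set ε₁ := eps1 ε y₀ with hε₁
  set ε₂ := eps2 ε y₀ with hε₂
  have he1 : 0 < ε₁ := eps1_pos hε hy
  have he2 : 0 < ε₂ := eps2_pos hε hy
  -- On the diagonal `∂_x k + ∂_y k = d/dx k(x,x)`, so the diagonal condition reads `2 ε₁ d/dx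
  -- k₁₁(x,x) = -(ℓ + c₁)`; similarly for `k₂₂`.
  obtain ⟨f₁, hf₁, hf₁'⟩ := exists_profile (P := P)
    (φ := fun s => -(ℓ (y₀ - P * s) + c₁) / (2 * ε₁)) (by fun_prop) hP
  obtain ⟨f₂, hf₂, hf₂'⟩ := exists_profile (P := M)
    (φ := fun s => -(ℓ (y₀ + M * s) + c₂) / (2 * ε₂)) (by fun_prop) hM
  -- The first row: a sector with `m = 0` and no trace term. The argument of `ℓ` is the physical
  -- point, half the coordinate difference being its signed distance from `y₀`.
  obtain ⟨u₁, _, hu₁, _, hu₁b, hu₁0, hu₁p, _⟩ := exists_goursat (m := 0) le_rfl one_pos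
    (c := fun z => (ℓ (y₀ + (z.1 - z.2) / 2) + c₁) / (4 * ε)) (v := fun _ => 0) (f := f₁)
    (by fun_prop) contDiff_const (fun _ => rfl) hf₁ (δ := 0) (Or.inl rfl) (R := 2 * P)
  have hu₁0' : ∀ x, u₁ (x, 0) = 0 := fun x => by simpa using hu₁0 x
  set m : ℝ := -y₀ with hm
  have hm0 : 0 ≤ m := by linarith [hy.2]
  have hm1 : m < 1 := by linarith [hy.1]
  -- The first row in the characteristic coordinates of the second: `(ξ + ζ) / (2 M)` is `x` and `(ζ
  -- - ξ) / 2` is the unfolded second variable.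
  set v : ℝ × ℝ → ℝ := fun z => u₁ (P * ((z.1 + z.2) / (2 * M)) + (z.2 - z.1) / 2,
    P * ((z.1 + z.2) / (2 * M)) - (z.2 - z.1) / 2) with hv
  have hMm : M = 1 + m := by ring
  have hPm : P = 1 - m := by ring
  obtain ⟨u₂, γ, hu₂, hγ, hu₂b, hu₂0, hu₂p, hu₂t⟩ := exists_goursat (m := m) hm0 hm1
    (c := fun z => (ℓ (y₀ + (z.2 - z.1) / 2) + c₂) / (4 * ε)) (v := v) (f := f₂)
    (by fun_prop) ((hu₁.of_le (by norm_num)).comp (by fun_prop))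
    (fun t => by
      have e : P * ((m * t + t) / (2 * M)) - (t - m * t) / 2 = 0 := by
        rw [hPm, hMm]; field_simp; ring
      simp only [hv]
      rw [e]; exact hu₁0' _) hf₂
    -- The wave operator becomes `4 ε ∂_ξ ∂_ζ`, and on the edge, where `u₂` vanishes, `∂_y k₂₁(x,x)`
    -- equals `-P² M ∂_ζ u₂`. The coefficient vanishes for `y₀ = 0`, the only case in which `m = 0`.
    (δ := -(ε₁ - ε₂) * P ^ 2 * M / (4 * ε))
    (by
      rcases hm0.eq_or_lt with h | h
      · left
        have hPM' : P = M := by rw [hPm, hMm, ← h]; ring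
        have : ε₁ = ε₂ := by
          have : ε₁ * M ^ 2 = ε₂ * M ^ 2 := by rw [hE2, ← hPM', hE1]
          exact mul_right_cancel₀ (by positivity) this
        rw [this]; simp
      · exact Or.inr h) (R := 2 * M)
  have hu₁d := hu₁.differentiable two_ne_zero
  have hu₂d := hu₂.differentiable two_ne_zero
  have hp₁ : ∀ x y, 0 ≤ x → 0 ≤ y → x + y ≤ 2 * P → pd2 (pd1 u₁) (x, y) =
      (ℓ (y₀ + (x - y) / 2) + c₁) / (4 * ε) * u₁ (x, y) := by
    intro x y h1 h2 h3
    have := hu₁p x y h1 (by simpa using h2) h3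
    have h' := (hasDerivAt_pd2 ((contDiff_pd1 (n := 1) hu₁).differentiable one_ne_zero) x y).unique
      this
    simpa using h'
  have hp₂ : ∀ x y, 0 ≤ x → m * x ≤ y → x + y ≤ 2 * M → 4 * ε * pd2 (pd1 u₂) (x, y) =
      (ℓ (y₀ + (y - x) / 2) + c₂) * u₂ (x, y) - -(ε₁ - ε₂) * P ^ 2 * M * γ (x + y) *
        (if 0 ≤ x - m * y then v (x, y) else 0) := by
    intro x y h1 h2 h3
    have h' := (hasDerivAt_pd2 ((contDiff_pd1 (n := 1) hu₂).differentiable one_ne_zero) x y).unique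
      (hu₂p x y h1 h2 h3)
    rw [h']
    field_simp
  -- Each row is one function of the unfolded variable, which is `-P y` for the first entry and `M
  -- y` for the second. The fold conditions at `y = 0` therefore hold by construction, with the
  -- Jacobians `P`, `M` of the folding as prefactors.
  set G11 := linComp P u₁ P (-P) P P with hG11
  set G12 := linComp M u₁ P M P (-M) with hG12
  set G21 := linComp P u₂ M P M (-P) with hG21
  set G22 := linComp M u₂ M (-M) M M with hG22
  have c11 : ContDiff ℝ 2 G11 := contDiff_linComp hu₁
  have c12 : ContDiff ℝ 2 G12 := contDiff_linComp hu₁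
  have c21 : ContDiff ℝ 2 G21 := contDiff_linComp hu₂
  have c22 : ContDiff ℝ 2 G22 := contDiff_linComp hu₂
  have d11 := c11.differentiable two_ne_zero
  have d12 := c12.differentiable two_ne_zero
  have d21 := c21.differentiable two_ne_zero
  have d22 := c22.differentiable two_ne_zero
  -- Above the line `y = a x` the coordinate `P x - M y` is negative and `k₁₂` is set to zero;
  -- continuity holds because `u₁` vanishes where this coordinate does.
  set H12 : ℝ × ℝ → ℝ := fun z => if 0 ≤ P * z.1 - M * z.2 then G12 z else 0 with hH12
  have hline : ∀ z : ℝ × ℝ, P * z.1 - M * z.2 = 0 → G12 z = 0 := by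
    intro z hz
    simp only [hG12, linComp]
    rw [show P * z.1 + -M * z.2 = 0 by linarith, hu₁0', mul_zero]
  have hH12c : Continuous H12 := continuous_ite_zero (by fun_prop) c12.continuous hline
  set K : ℝ → ℝ → Matrix (Fin 2) (Fin 2) ℝ :=
    fun x y => !![G11 (x, y), H12 (x, y); G21 (x, y), G22 (x, y)] with hK
  have ev : ∀ (G : ℝ × ℝ → ℝ) (l : Filter (ℝ × ℝ)), G =ᶠ[l] G := fun _ _ => EventuallyEq.rfl
  have hdiagmem : ∀ x ∈ Icc (0 : ℝ) 1, (x, x) ∈ triL := fun x hx => ⟨hx.1, le_rfl, hx.2⟩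
  have hbotmem : ∀ x ∈ Icc (0 : ℝ) 1, (x, (0 : ℝ)) ∈ triL := fun x hx => ⟨le_rfl, hx.1, hx.2⟩
  have hK21 : ∀ x, G21 (x, x) = 0 := by
    intro x
    simp only [hG21, linComp]
    have := hu₂0 (M * x + P * x)
    rw [show m * (M * x + P * x) = M * x + -P * x by rw [hMm, hPm]; ring] at this
    rw [this, mul_zero]
  have hdiagG : ∀ {G : ℝ × ℝ → ℝ}, Differentiable ℝ G → ∀ x,
      deriv (fun s => G (s, s)) x = pd1 G (x, x) + pd2 G (x, x) := fun hG x =>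
    (hasDerivAt_diagonal hG x).deriv
  have hg : EqOn (gCoef ε y₀ K) (fun x => -(ε₁ - ε₂) * P ^ 2 * M * γ (2 * M * x)) (Icc 0 1) := by
    intro x hx
    have e := dY_eq_pd2 uniqueDiffOn_triL (hdiagmem x hx) d21 (f := entry K 1 0) (ev _ _)
    have e' : gCoef ε y₀ K x = (ε₁ - ε₂) * dY triL (entry K 1 0) x x := rfl
    rw [e', e, hG21, pd2_linComp hu₂d]
    simp only [linComp]
    have p1 : M * x + P * x = 2 * x := by rw [← add_mul, add_comm, hPM2]
    have p2 : M * x + -P * x = m * (2 * x) := by rw [hMm, hPm]; ring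
    rw [p1, p2]
    -- The derivative of `u₂` along the edge vanishes, so the trace of `∂_ζ u₂` alone determines
    -- `∂_y k₂₁` there.
    have t1 : pd1 u₂ (2 * x, m * (2 * x)) + m * pd2 u₂ (2 * x, m * (2 * x)) = 0 := by
      have h1 := hasDerivAt_comp_pd hu₂d (hasDerivAt_id (2 * x))
        ((hasDerivAt_id (2 * x)).const_mul m)
      have h2 : HasDerivAt (fun s : ℝ => u₂ (id s, m * id s)) 0 (2 * x) :=
        (hasDerivAt_const (2 * x) (0 : ℝ)).congr_of_eventuallyEq
          (Eventually.of_forall fun s => hu₂0 s)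
      have := h1.unique h2
      simp only [id] at this
      linarith
    have t2 := hu₂t (2 * x) (by linarith [hx.1]) (by
      have : 2 * x + m * (2 * x) = 2 * M * x := by rw [hMm]; ring
      rw [this]
      have := mul_le_mul_of_nonneg_left hx.2 (by positivity : 0 ≤ 2 * M)
      linarith)
    rw [show 2 * x + m * (2 * x) = 2 * M * x by rw [hMm]; ring] at t2
    change _ = -(ε₁ - ε₂) * P ^ 2 * M * γ (2 * M * x)
    rw [t2, show pd1 u₂ (2 * x, m * (2 * x)) = -m * pd2 u₂ (2 * x, m * (2 * x)) by linarith, hMm]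
    ring
  have hPy : ∀ {x y : ℝ}, y ≤ aCoef y₀ * x ↔ 0 ≤ P * x - M * y := by
    intro x y
    rw [ha, div_mul_eq_mul_div, le_div_iff₀ hM, sub_nonneg, mul_comm y M]
  have hPy' : ∀ {x y : ℝ}, aCoef y₀ * x ≤ y ↔ P * x - M * y ≤ 0 := by
    intro x y
    rw [ha, div_mul_eq_mul_div, div_le_iff₀ hM, sub_nonpos, mul_comm y M]
  have near_pos : ∀ z : ℝ × ℝ, 0 < P * z.1 - M * z.2 → H12 =ᶠ[𝓝 z] G12 := by
    intro z hz
    have hc : Continuous fun z : ℝ × ℝ => P * z.1 - M * z.2 := by fun_prop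
    filter_upwards [continuousAt_const.eventually_lt hc.continuousAt hz] with w hw
    exact if_pos hw.le
  have near_neg : ∀ z : ℝ × ℝ, P * z.1 - M * z.2 < 0 → H12 =ᶠ[𝓝 z] fun _ => 0 := by
    intro z hz
    have hc : Continuous fun z : ℝ × ℝ => P * z.1 - M * z.2 := by fun_prop
    filter_upwards [hc.continuousAt.eventually_lt continuousAt_const hz] with w hw
    exact if_neg (not_le.2 hw)
  refine ⟨K, ?_, _, ?_, hg⟩
  swap
  · fun_prop
  constructor
  · exact c11.contDiffOn
  · exact c21.contDiffOn
  · exact c22.contDiffOn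
  · exact hH12c.continuousOn
  · refine (c12.contDiffOn (s := {z ∈ triL | z.2 ≤ aCoef y₀ * z.1})).congr fun z hz => ?_
    exact if_pos (hPy.1 hz.2)
  · refine (contDiff_const (c := (0 : ℝ))).contDiffOn.congr fun z hz => ?_
    change H12 z = 0
    simp only [hH12]
    split_ifs with h
    · exact hline z (le_antisymm (hPy'.1 hz.2) h)
    · rfl
  · intro x y h1 h2 h3 h4
    have hxy := mem_nhds_triL h1 h2 h3
    rw [pde_iff]
    simp only [← hε₁, ← hε₂]
    have hx0 : 0 < x := h1.trans h2
    have gx := hg (show x ∈ Icc (0 : ℝ) 1 from ⟨by linarith, h3.le⟩)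
    have hyx : M * y ≤ M * x := by gcongr
    have hyx' : P * y ≤ P * x := by gcongr
    have hPx : P * x ≤ P := mul_le_of_le_one_right hP.le h3.le
    have hMx : M * x ≤ M := mul_le_of_le_one_right hM.le h3.le
    have hPy0 : 0 < P * y := by positivity
    have hMy0 : 0 < M * y := by positivity
    refine ⟨?_, ?_, ?_, ?_⟩
    · rw [dX_dX_eq uniqueDiffOn_triL hxy c11 (ev _ _), dY_dY_eq uniqueDiffOn_triL hxy c11 (ev _ _),
        hG11, wave_linComp hu₁ (by ring) (by ring)]
      simp only
      rw [hp₁ _ _ (by linarith) (by positivity) (by linarith)]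
      have : y₀ + (P * x + -P * y - (P * x + P * y)) / 2 = y₀ - (1 + y₀) * y := by ring
      have e : K x y 0 0 = P * u₁ (P * x + -P * y, P * x + P * y) := rfl
      rw [this, e]
      rw [show ε₁ * P * P - ε₁ * -P * P = 2 * ε by linear_combination 2 * hE1]
      field_simp
      ring
    · rcases lt_or_gt_of_ne h4 with h | h
      · have hlt : 0 < P * x - M * y := by
          have := (not_congr hPy').1 (not_le.2 h); push Not at this; exact this
        have hn := near_pos (x, y) hlt
        rw [dX_dX_eq uniqueDiffOn_triL hxy c12 hn, dY_dY_eq uniqueDiffOn_triL hxy c12 hn,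
          hG12, wave_linComp hu₁ (by rw [hE1, hE2]) (by rw [neg_sq, hE1, hE2])]
        simp only
        rw [hp₁ _ _ (by positivity) (by linarith) (by linarith)]
        have : y₀ + (P * x + M * y - (P * x + -M * y)) / 2 = y₀ + (1 - y₀) * y := by ring
        have e : K x y 0 1 = M * u₁ (P * x + M * y, P * x + -M * y) := by
          change H12 (x, y) = _
          simp only [hH12]; rw [if_pos hlt.le]
          simp [hG12, linComp]
        rw [this, e]
        have e4 : ε₁ * P * P - ε₂ * M * -M = 2 * ε := by linear_combination hE1 + hE2
        rw [e4]
        field_simp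
        ring
      · have hlt : P * x - M * y < 0 := by
          have := (not_congr hPy).1 (not_le.2 h); push Not at this; exact this
        have hn := near_neg (x, y) hlt
        have c0 : ContDiff ℝ 2 (fun _ : ℝ × ℝ => (0 : ℝ)) := contDiff_const
        have z1 : pd1 (fun _ : ℝ × ℝ => (0 : ℝ)) = fun _ => 0 := by ext; simp [pd1]
        have z2 : pd2 (fun _ : ℝ × ℝ => (0 : ℝ)) = fun _ => 0 := by ext; simp [pd2]
        rw [dX_dX_eq uniqueDiffOn_triL hxy c0 hn, dY_dY_eq uniqueDiffOn_triL hxy c0 hn, z1, z2,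
          z1, z2]
        have e : K x y 0 1 = 0 := if_neg (not_le.2 hlt)
        rw [e]; ring
    · rw [dX_dX_eq uniqueDiffOn_triL hxy c21 (ev _ _), dY_dY_eq uniqueDiffOn_triL hxy c21 (ev _ _),
        hG21, wave_linComp hu₂ (by rw [hE1, hE2]) (by rw [neg_sq, hE1, hE2])]
      simp only
      have e4 : ε₂ * M * M - ε₁ * P * -P = 2 * ε := by linear_combination hE1 + hE2
      -- The triangle of `k₂₁` is mapped into the sector, and entirely into the support of the trace
      -- term: there the partner `k₁₁` is never cut off.
      have hle : m * (M * x + P * y) ≤ M * x + -P * y := by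
        have : M * x + -P * y - m * (M * x + P * y) = P * M * (x - y) := by
          rw [hMm, hPm]; ring
        have : 0 ≤ P * M * (x - y) := mul_nonneg (by positivity) (by linarith)
        linarith
      have hcut : 0 ≤ M * x + P * y - m * (M * x + -P * y) := by
        have : M * x + P * y - m * (M * x + -P * y) = P * M * (x + y) := by
          rw [hMm, hPm]; ring
        rw [this]
        exact mul_nonneg (by positivity) (by linarith)
      have hpde := hp₂ (M * x + P * y) (M * x + -P * y) (by linarith) hle (by linarith)
      rw [if_pos hcut] at hpde
      have hv' : v (M * x + P * y, M * x + -P * y) = u₁ (P * x + -P * y, P * x + P * y) := by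
        simp only [hv]
        congr 2 <;> (field_simp; ring)
      rw [hv', show y₀ + (M * x + -P * y - (M * x + P * y)) / 2 = y₀ - (1 + y₀) * y by ring,
        show M * x + P * y + (M * x + -P * y) = 2 * M * x by ring] at hpde
      rw [e4, gx]
      have e : K x y 1 0 = P * u₂ (M * x + P * y, M * x + -P * y) := rfl
      have e' : K x y 0 0 = P * u₁ (P * x + -P * y, P * x + P * y) := rfl
      rw [e, e']
      linear_combination P * hpde
    · rw [dX_dX_eq uniqueDiffOn_triL hxy c22 (ev _ _), dY_dY_eq uniqueDiffOn_triL hxy c22 (ev _ _),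
        hG22, wave_linComp hu₂ (by ring) (by ring)]
      simp only
      have e4 : ε₂ * M * M - ε₂ * -M * M = 2 * ε := by linear_combination 2 * hE2
      have hle : m * (M * x + -M * y) ≤ M * x + M * y := by
        have h5 : m * (M * x + -M * y) ≤ 1 * (M * x + -M * y) :=
          mul_le_mul_of_nonneg_right hm1.le (by linarith)
        linarith
      have hpde := hp₂ (M * x + -M * y) (M * x + M * y) (by linarith) hle (by linarith)
      -- For `k₂₂` the cut-off of the trace term is exactly that of its partner `k₁₂`, at `y = a x`.
      have hiff : 0 ≤ M * x + -M * y - m * (M * x + M * y) ↔ 0 ≤ P * x - M * y := by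
        have : M * x + -M * y - m * (M * x + M * y) = M * (P * x - M * y) := by
          rw [hMm, hPm]; ring
        rw [this]
        exact mul_nonneg_iff_of_pos_left hM
      have hv' : v (M * x + -M * y, M * x + M * y) = u₁ (P * x + M * y, P * x + -M * y) := by
        simp only [hv]
        congr 2 <;> (field_simp; ring)
      simp only [hv', hiff] at hpde
      rw [show y₀ + (M * x + M * y - (M * x + -M * y)) / 2 = y₀ + (1 - y₀) * y by ring,
        show M * x + -M * y + (M * x + M * y) = 2 * M * x by ring] at hpde
      rw [e4, gx]
      have e : K x y 1 1 = M * u₂ (M * x + -M * y, M * x + M * y) := rfl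
      have e' : K x y 0 1 =
          M * (if 0 ≤ P * x - M * y then u₁ (P * x + M * y, P * x + -M * y) else 0) := by
        change (if 0 ≤ P * x - M * y then G12 (x, y) else 0) = _
        split_ifs
        · rfl
        · simp
      rw [e, e']
      linear_combination M * hpde
  · intro x hx
    rw [diag_iff]
    simp only [← hε₁, ← hε₂]
    have hxm := hdiagmem x ⟨hx.1.le, hx.2.le⟩
    refine ⟨?_, ?_, ?_, ?_⟩
    · rw [dX_eq_pd1 uniqueDiffOn_triL hxm d11 (ev _ _), dY_eq_pd2 uniqueDiffOn_triL hxm d11 (ev _ _)]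
      change _ = -(ε₁ * deriv (fun s => G11 (s, s)) x) - _ - _
      have h1 : deriv (fun s => G11 (s, s)) x = -(ℓ (y₀ - P * x) + c₁) / (2 * ε₁) := by
        have e : (fun s => G11 (s, s)) = fun s =>
            ∫ t in (0 : ℝ)..s, -(ℓ (y₀ - P * t) + c₁) / (2 * ε₁) := by
          ext s
          rw [← hf₁' s]
          simp only [hG11, linComp]
          rw [← hu₁b]
          congr 3 <;> ring
        rw [e]
        have hℓc := hℓ.continuous
        exact (hasDerivAt_integral_upper (f := fun t => -(ℓ (y₀ - P * t) + c₁) / (2 * ε₁))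
          (by fun_prop) 0 x).deriv
      have h2 := hdiagG d11 x
      rw [h1] at h2 ⊢
      have h3 : ε₁ * pd2 G11 (x, x) + ε₁ * pd1 G11 (x, x) = ε₁ * (-(ℓ (y₀ - P * x) + c₁) / (2 * ε₁)) := by
        rw [h2]; ring
      rw [h3, ← hPdef]
      field_simp
      ring
    -- For `P = M` the line `y = a x` is the diagonal itself and `G12` vanishes on it; otherwise
    -- `k₁₂` is zero near every diagonal point with `x > 0`.
    · by_cases hc : P = M
      · have hn : (fun z : ℝ × ℝ => entry K 0 1 z.1 z.2) =ᶠ[𝓝[triL] (x, x)] G12 := by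
          filter_upwards [self_mem_nhdsWithin] with z hz
          refine if_pos ?_
          rw [hc, ← mul_sub]
          exact mul_nonneg hM.le (by linarith [hz.2.1])
        rw [dX_eq_pd1 uniqueDiffOn_triL hxm d12 hn, dY_eq_pd2 uniqueDiffOn_triL hxm d12 hn]
        have h0 : ∀ s, G12 (s, s) = 0 := fun s => hline (s, s) (by rw [hc]; ring)
        have h1 : deriv (fun s => K s s 0 1) x = 0 := by
          have : (fun s => K s s 0 1) = fun _ => 0 := by
            ext s
            change (if 0 ≤ P * s - M * s then G12 (s, s) else 0) = 0
            rw [h0]; simp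
          rw [this]; simp
        have h2 := hdiagG d12 x
        rw [show (fun s => G12 (s, s)) = fun _ => 0 from funext h0, deriv_const] at h2
        have h3 : ε₁ = ε₂ := by
          have : ε₁ * M ^ 2 = ε₂ * M ^ 2 := by rw [hE2, ← hc, hE1]
          exact mul_right_cancel₀ (by positivity) this
        rw [h1, ← h3]
        linear_combination -ε₁ * h2
      · have hlt : P < M := lt_of_le_of_ne hPM hc
        have hneg : ∀ s, 0 < s → P * s - M * s < 0 := fun s hs => by
          have := mul_lt_mul_of_pos_right hlt hs
          linarith
        have hn := (near_neg (x, x) (hneg x hx.1)).filter_mono (nhdsWithin_le_nhds (s := triL))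
        have d0 : Differentiable ℝ (fun _ : ℝ × ℝ => (0 : ℝ)) := by fun_prop
        rw [dX_eq_pd1 uniqueDiffOn_triL hxm d0 hn, dY_eq_pd2 uniqueDiffOn_triL hxm d0 hn]
        have h1 : deriv (fun s => K s s 0 1) x = 0 := by
          have : (fun s => K s s 0 1) =ᶠ[𝓝 x] fun _ => 0 := by
            filter_upwards [lt_mem_nhds hx.1] with s hs
            exact if_neg (not_le.2 (hneg s hs))
          rw [this.deriv_eq]; simp
        rw [h1]; simp [pd1, pd2]
    · have e : gCoef ε y₀ K x = (ε₁ - ε₂) * dY triL (entry K 1 0) x x := rfl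
      rw [e, dX_eq_pd1 uniqueDiffOn_triL hxm d21 (ev _ _),
        dY_eq_pd2 uniqueDiffOn_triL hxm d21 (ev _ _)]
      have h2 := hdiagG d21 x
      rw [show (fun s => G21 (s, s)) = fun _ => 0 from funext hK21, deriv_const] at h2
      have h1 : deriv (fun s => K s s 1 0) x = 0 := by
        have : (fun s => K s s 1 0) = fun _ => 0 := funext hK21
        rw [this, deriv_const]
      rw [h1]
      linear_combination -ε₂ * h2
    · rw [dX_eq_pd1 uniqueDiffOn_triL hxm d22 (ev _ _), dY_eq_pd2 uniqueDiffOn_triL hxm d22 (ev _ _)]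
      change _ = -(ε₂ * deriv (fun s => G22 (s, s)) x) - _ - _
      have h1 : deriv (fun s => G22 (s, s)) x = -(ℓ (y₀ + M * x) + c₂) / (2 * ε₂) := by
        have e : (fun s => G22 (s, s)) = fun s =>
            ∫ t in (0 : ℝ)..s, -(ℓ (y₀ + M * t) + c₂) / (2 * ε₂) := by
          ext s
          rw [← hf₂' s]
          simp only [hG22, linComp]
          rw [← hu₂b]
          congr 3 <;> ring
        rw [e]
        have hℓc := hℓ.continuous
        exact (hasDerivAt_integral_upper (f := fun t => -(ℓ (y₀ + M * t) + c₂) / (2 * ε₂))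
          (by fun_prop) 0 x).deriv
      have h2 := hdiagG d22 x
      rw [h1] at h2 ⊢
      have h3 : ε₂ * pd2 G22 (x, x) + ε₂ * pd1 G22 (x, x) = ε₂ * (-(ℓ (y₀ + M * x) + c₂) / (2 * ε₂)) := by
        rw [h2]; ring
      rw [h3, ← hMdef]
      field_simp
      ring
  · intro x hx
    change (if 0 ≤ P * x - M * x then G12 (x, x) else 0) = 0
    split_ifs with h
    · have : P * x ≤ M * x := mul_le_mul_of_nonneg_right hPM hx.1
      exact hline (x, x) (le_antisymm (by simp; linarith) h)
    · rfl
  · intro x hx; exact hK21 x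
  · intro x hx
    rw [fold_iff hε hy]
    have hxm := hbotmem x ⟨hx.1.le, hx.2.le⟩
    have hpos : 0 < P * x - M * 0 := by have := mul_pos hP hx.1; linarith
    have hn := (near_pos (x, 0) hpos).filter_mono (nhdsWithin_le_nhds (s := triL))
    have hpos' : (0 : ℝ) ≤ P * x - M * 0 := hpos.le
    intro i
    fin_cases i
    · constructor
      · change G11 (x, 0) = aCoef y₀ * H12 (x, 0)
        have : H12 (x, 0) = G12 (x, 0) := if_pos hpos'
        rw [this, ha]
        simp only [hG11, hG12, linComp]
        rw [show P * x + -P * 0 = P * x + M * 0 by ring, show P * x + P * 0 = P * x + -M * 0 by ring]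
        field_simp
      · change dY triL (entry K 0 0) x 0 + aCoef y₀ ^ 2 * dY triL (entry K 0 1) x 0 = 0
        rw [dY_eq_pd2 uniqueDiffOn_triL hxm d11 (ev _ _), dY_eq_pd2 uniqueDiffOn_triL hxm d12 hn,
          hG11, hG12, pd2_linComp hu₁d, pd2_linComp hu₁d, ha]
        simp only [linComp]
        rw [show P * x + -P * 0 = P * x + M * 0 by ring, show P * x + P * 0 = P * x + -M * 0 by ring]
        field_simp
        ring
    · constructor
      · change G21 (x, 0) = aCoef y₀ * G22 (x, 0)
        rw [ha]
        simp only [hG21, hG22, linComp]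
        rw [show M * x + -P * 0 = M * x + M * 0 by ring, show M * x + P * 0 = M * x + -M * 0 by ring]
        field_simp
      · change dY triL (entry K 1 0) x 0 + aCoef y₀ ^ 2 * dY triL (entry K 1 1) x 0 = 0
        rw [dY_eq_pd2 uniqueDiffOn_triL hxm d21 (ev _ _),
          dY_eq_pd2 uniqueDiffOn_triL hxm d22 (ev _ _), hG21, hG22, pd2_linComp hu₂d,
          pd2_linComp hu₂d, ha]
        simp only [linComp]
        rw [show M * x + -P * 0 = M * x + M * 0 by ring, show M * x + P * 0 = M * x + -M * 0 by ring]
        field_simp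
        ring

/-! ### The second kernel in characteristic coordinates. -/

/-- Integration over a region with a slanted lower side splits into values of `pot` and a function
of one variable, the integral up to the diagonal. Regularity then reduces to these two. -/
lemma integral_integral_eq_pot {F : ℝ × ℝ → ℝ} (hF : Continuous F) (x₀ x y : ℝ) :
    ∫ s in x₀..x, ∫ t in s..y, F (s, t) = pot F (x, y) - pot F (x₀, y) -
      ((∫ s in (0 : ℝ)..x, ∫ t in (0 : ℝ)..s, F (s, t)) -
        ∫ s in (0 : ℝ)..x₀, ∫ t in (0 : ℝ)..s, F (s, t)) := by
  have c1 : Continuous fun s => ∫ t in (0 : ℝ)..y, F (s, t) :=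
    continuous_integral_param hF continuous_id continuous_const continuous_const
  have c2 : Continuous fun s => ∫ t in (0 : ℝ)..s, F (s, t) :=
    continuous_integral_param hF continuous_id continuous_const continuous_id
  have h : ∀ s, ∫ t in s..y, F (s, t) = (∫ t in (0 : ℝ)..y, F (s, t)) - ∫ t in (0 : ℝ)..s, F (s, t) := by
    intro s
    rw [intervalIntegral.integral_interval_sub_left] <;>
      exact Continuous.intervalIntegrable (by fun_prop) _ _
  simp_rw [h]
  rw [intervalIntegral.integral_sub (c1.intervalIntegrable _ _) (c2.intervalIntegrable _ _)]
  unfold pot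
  rw [intervalIntegral.integral_interval_sub_left (c1.intervalIntegrable _ _)
    (c1.intervalIntegrable _ _), intervalIntegral.integral_interval_sub_left
    (c2.intervalIntegrable _ _) (c2.intervalIntegrable _ _)]

/-- The image of `triL ∪ triU` without `x < a y` under `(x, y) ↦ (x - a y, x + a y)`. -/
def charDomain (a : ℝ) : Set (ℝ × ℝ) :=
  {z | 0 ≤ z.1 ∧ z.1 ≤ z.2 ∧ z.2 ≤ z.1 + 2 * a ∧ z.1 + z.2 ≤ 2}

lemma isCompact_charDomain (a : ℝ) : IsCompact (charDomain a) := by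
  have hc : IsClosed (charDomain a) := by
    have : charDomain a = {z : ℝ × ℝ | 0 ≤ z.1} ∩ ({z | z.1 ≤ z.2} ∩ ({z | z.2 ≤ z.1 + 2 * a} ∩
      {z | z.1 + z.2 ≤ 2})) := by
      ext z; rfl
    rw [this]
    exact (isClosed_le (by fun_prop) (by fun_prop)).inter ((isClosed_le (by fun_prop)
      (by fun_prop)).inter ((isClosed_le (by fun_prop) (by fun_prop)).inter
        (isClosed_le (by fun_prop) (by fun_prop))))
  refine (isCompact_Icc (a := ((0 : ℝ), (0 : ℝ))) (b := ((2 : ℝ), (2 : ℝ)))).of_isClosed_subset hc ?_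
  rintro ⟨x, y⟩ ⟨h1, h2, h3, h4⟩
  simp only at *
  exact ⟨⟨h1, by simp; linarith⟩, ⟨by simp; linarith, by simp; linarith⟩⟩

/-- `x - y` in characteristic coordinates. -/
def charDiff (a : ℝ) (z : ℝ × ℝ) : ℝ := (z.1 + z.2) / 2 - (z.2 - z.1) / (2 * a)

/-- `(x - y)⁺` in characteristic coordinates, as a diagonal point. -/
def charFoot (a : ℝ) (z : ℝ × ℝ) : ℝ × ℝ := (max (charDiff a z) 0, max (charDiff a z) 0)

lemma charFoot_mem {a : ℝ} (ha : 0 < a) {z : ℝ × ℝ} (hz : z ∈ charDomain a) :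
    charFoot a z ∈ charDomain a := by
  have h : (z.2 - z.1) / (2 * a) ≥ 0 := div_nonneg (by linarith [hz.2.1]) (by positivity)
  have h1 : max (charDiff a z) 0 ≤ 1 := max_le (by unfold charDiff; linarith [hz.2.2.2]) zero_le_one
  have h2 := le_max_right (charDiff a z) 0
  refine ⟨h2, le_rfl, ?_, ?_⟩ <;> simp only [charFoot] <;> linarith

/-- The source of the second kernel equations. -/
def charSource (a c b : ℝ) (g : ℝ → ℝ) (Q : ℝ × ℝ → ℝ) (z : ℝ × ℝ) : ℝ :=
  c * Q z + b * g ((z.2 - z.1) / (2 * a)) * Q (charFoot a z)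

lemma continuous_charSource {a c b : ℝ} {g : ℝ → ℝ} (hg : Continuous g) {Q : ℝ × ℝ → ℝ}
    (hQ : Continuous Q) : Continuous (charSource a c b g Q) := by
  unfold charSource charFoot charDiff; fun_prop

/-- The integral operator of the second kernel equations, with source `F`. -/
def charOp (a : ℝ) (S : ℝ → ℝ) (F : ℝ × ℝ → ℝ) (z : ℝ × ℝ) : ℝ :=
  S (min z.1 (z.2 / ((1 + a) / (1 - a)))) - S (max (z.2 - 2 * a) 0) +
    ∫ s in (max (z.2 - 2 * a) 0)..z.1, ∫ t in s..z.2, F (s, t)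

/-- The double integral gains `1 / L²` from the weight `exp (L (ξ + ζ))`. The nonlocal term does no
harm because `charFoot` does not increase `ξ + ζ` on the domain. -/
lemma exists_charFixed {a : ℝ} (ha : 0 < a) {g S : ℝ → ℝ} (hg : Continuous g)
    (hS : Continuous S) (c b : ℝ) :
    ∃ Q, Continuous Q ∧ ∀ z ∈ charDomain a, Q z = charOp a S (charSource a c b g Q) z := by
  obtain ⟨G, hG⟩ := (isCompact_Icc (a := (0 : ℝ)) (b := 1)).exists_bound_of_continuousOn
    hg.continuousOn
  have hG0 : 0 ≤ G := (norm_nonneg _).trans (hG 0 ⟨le_rfl, zero_le_one⟩)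
  set C : ℝ := |c| + |b| * G with hC
  have hC0 : 0 ≤ C := by positivity
  set L : ℝ := 2 * C + 1 with hL
  have hL0 : 0 < L := by positivity
  refine exists_fixed_point (isCompact_charDomain a) (fun Q => charOp a S (charSource a c b g Q))
    (fun Q hQ => ?_) (fun z => Real.exp (L * (z.1 + z.2))) (fun z hz => ?_)
    (B := Real.exp (L * 2)) (fun z hz => ?_) ?_
  · have hF := continuous_charSource (a := a) (c := c) (b := b) hg hQ
    have h1 : Continuous fun p : ℝ × ℝ => ∫ t in p.2..p.1, charSource a c b g Q (p.2, t) :=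
      continuous_integral_param hF continuous_snd continuous_snd continuous_fst
    have h2 : Continuous fun z : ℝ × ℝ => ∫ s in (max (z.2 - 2 * a) 0)..z.1, ∫ t in s..z.2,
        charSource a c b g Q (s, t) :=
      continuous_integral_param h1 continuous_snd (by fun_prop) continuous_fst
    unfold charOp
    fun_prop
  · exact Real.one_le_exp (mul_nonneg hL0.le (by linarith [hz.1, hz.2.1]))
  · exact Real.exp_le_exp.2 (mul_le_mul_of_nonneg_left hz.2.2.2 hL0.le)
  · intro u v hu hv N hN huv z hz
    set Fu := charSource a c b g u with hFu
    set Fv := charSource a c b g v with hFv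
    have cu : Continuous Fu := continuous_charSource hg hu
    have cv : Continuous Fv := continuous_charSource hg hv
    have hpt : ∀ w ∈ charDomain a, |Fu w - Fv w| ≤ C * N * Real.exp (L * (w.1 + w.2)) := by
      intro w hw
      have e1 := huv w hw
      have e2 := huv _ (charFoot_mem ha hw)
      have h : (w.2 - w.1) / (2 * a) ≥ 0 := div_nonneg (by linarith [hw.2.1]) (by positivity)
      have e3 : (charFoot a w).1 + (charFoot a w).2 ≤ w.1 + w.2 := by
        simp only [charFoot]
        have : max (charDiff a w) 0 ≤ (w.1 + w.2) / 2 :=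
          max_le (by unfold charDiff; linarith) (by linarith [hw.1, hw.2.1])
        linarith
      have e4 : |u (charFoot a w) - v (charFoot a w)| ≤ N * Real.exp (L * (w.1 + w.2)) :=
        e2.trans (by gcongr)
      have e5 := hG ((w.2 - w.1) / (2 * a)) ⟨h, by
        rw [div_le_one (by positivity)]; linarith [hw.2.2.1]⟩
      have : Fu w - Fv w = c * (u w - v w) +
          b * g ((w.2 - w.1) / (2 * a)) * (u (charFoot a w) - v (charFoot a w)) := by
        simp only [hFu, hFv, charSource]; ring
      rw [this]
      refine (abs_add_le _ _).trans ?_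
      rw [abs_mul, abs_mul, abs_mul]
      rw [Real.norm_eq_abs] at e5
      calc _ ≤ |c| * (N * Real.exp (L * (w.1 + w.2))) +
            |b| * G * (N * Real.exp (L * (w.1 + w.2))) := by gcongr
        _ = _ := by rw [hC]; ring
    obtain ⟨x, y⟩ := z
    have hz' := hz
    obtain ⟨hx0, hxy, hya, hxy2⟩ := hz'
    simp only at hx0 hxy hya hxy2
    have hx₀ : max (y - 2 * a) 0 ≤ x := max_le (by linarith) hx0
    -- The `S` terms are the inhomogeneity and cancel in the difference.
    have hdiff : charOp a S Fu (x, y) - charOp a S Fv (x, y) =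
        ∫ s in (max (y - 2 * a) 0)..x, ∫ t in s..y, (Fu (s, t) - Fv (s, t)) := by
      have i1 : ∀ s, ∫ t in s..y, (Fu (s, t) - Fv (s, t)) =
          (∫ t in s..y, Fu (s, t)) - ∫ t in s..y, Fv (s, t) := fun s =>
        intervalIntegral.integral_sub (Continuous.intervalIntegrable (by fun_prop) _ _)
          (Continuous.intervalIntegrable (by fun_prop) _ _)
      have k : ∀ {F : ℝ × ℝ → ℝ}, Continuous F → Continuous fun s => ∫ t in s..y, F (s, t) :=
        fun hF => continuous_integral_param hF continuous_id continuous_id continuous_const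
      simp_rw [i1]
      rw [intervalIntegral.integral_sub ((k cu).intervalIntegrable _ _)
        ((k cv).intervalIntegrable _ _)]
      unfold charOp; ring
    simp only [hdiff]
    have inner : ∀ s ∈ Icc (max (y - 2 * a) 0) x, |∫ t in s..y, (Fu (s, t) - Fv (s, t))| ≤
        C * N / L * Real.exp (L * (y + s)) := by
      intro s hs
      have hs1 := (le_max_left _ _).trans hs.1
      have hs2 := (le_max_right _ _).trans hs.1
      have := abs_integral_le_exp (φ := fun t => Fu (s, t) - Fv (s, t)) (a := s) (b := y) (p := s)
        (K := C * N) hL0 (by positivity) (hs.2.trans hxy) (fun t ht => hpt (s, t)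
          ⟨hs2, ht.1, by simp only; linarith [ht.2], by simp only; linarith [ht.2, hs.2]⟩)
      refine this.trans (le_of_eq ?_)
      rw [add_comm s y]; ring
    have outer := abs_integral_le_exp (p := y) hL0 (by positivity) hx₀ inner
    refine outer.trans ?_
    rw [add_comm y x]
    have h1 : C * N / L * Real.exp (L * (x + y)) / L =
        C / L ^ 2 * (N * Real.exp (L * (x + y))) := by
      field_simp
    have h2 : C / L ^ 2 ≤ 1 / 2 := by
      rw [div_le_div_iff₀ (by positivity) two_pos, hL]; nlinarith
    rw [h1, show N / 2 * Real.exp (L * (x + y)) = 1 / 2 * (N * Real.exp (L * (x + y))) by ring]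
    exact mul_le_mul_of_nonneg_right h2 (by positivity)

/-- The region of dependence of a point of `charDomain` stays in `charDomain`, so the source may be
replaced by any function equal to it there. -/
lemma charOp_congr {a : ℝ} {S : ℝ → ℝ} {F F' : ℝ × ℝ → ℝ} (h : EqOn F F' (charDomain a))
    {z : ℝ × ℝ} (hz : z ∈ charDomain a) : charOp a S F z = charOp a S F' z := by
  obtain ⟨hx0, hxy, hya, hxy2⟩ := hz
  unfold charOp
  congr 1
  refine intervalIntegral.integral_congr fun s hs => ?_
  rw [uIcc_of_le (max_le (by linarith) hx0)] at hs
  have hs1 := (le_max_left _ _).trans hs.1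
  have hs2 := (le_max_right _ _).trans hs.1
  refine intervalIntegral.integral_congr fun t ht => ?_
  rw [uIcc_of_le (hs.2.trans hxy)] at ht
  exact h ⟨hs2, ht.1, by simp only; linarith [ht.2], by simp only; linarith [ht.2, hs.2]⟩

/-- Representation of the second kernel by functions of class `C²`, in characteristic
coordinates. -/
theorem exists_characteristicKernel {a : ℝ} (ha : 0 < a) (ha1 : a < 1) {g S : ℝ → ℝ}
    (hg : ContDiff ℝ 1 g) (hS : ContDiff ℝ 2 S) (hS0 : S 0 = 0) (c b : ℝ) :
    ∃ Q Gl Gr : ℝ × ℝ → ℝ, ContDiff ℝ 2 Gl ∧ ContDiff ℝ 2 Gr ∧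
      (∀ z ∈ charDomain a, Q z = (if z.2 ≤ 2 * a then Gl z else Gr z) +
        if (1 + a) / (1 - a) * z.1 ≤ z.2 then S z.1 - S (z.2 / ((1 + a) / (1 - a))) else 0) ∧
      (∀ z ∈ charDomain a, z.2 ≤ 2 * a → pd2 (pd1 Gl) z = charSource a c b g Q z) ∧
      (∀ z ∈ charDomain a, 2 * a ≤ z.2 → pd2 (pd1 Gr) z = charSource a c b g Q z) ∧
      (∀ x, Gl (x, 2 * a) = Gr (x, 2 * a)) ∧
      (∀ s, s ≤ 2 * a → pd1 Gl (s, s) = 0) ∧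
      (∀ s, 2 * a ≤ s → pd1 Gr (s, s) = 0) ∧
      (∀ t, Gl (0, t) = S (t / ((1 + a) / (1 - a)))) ∧
      (∀ x, Gr (x, x + 2 * a) = S ((x + 2 * a) / ((1 + a) / (1 - a))) - S x) := by
  set κ : ℝ := (1 + a) / (1 - a) with hκdef
  have h1a : 0 < 1 - a := by linarith
  have hκ : 0 < κ := by positivity
  have hκ1 : 1 < κ := by rw [hκdef, one_lt_div h1a]; linarith
  obtain ⟨Q, hQc, hQ⟩ := exists_charFixed ha (hg.continuous) hS.continuous c b
  have diagC : ∀ {F : ℝ × ℝ → ℝ}, Continuous F → Continuous fun s => ∫ t in (0 : ℝ)..s, F (s, t) :=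
    fun hF => continuous_integral_param hF continuous_id continuous_const continuous_id
  -- the representation of `charOp` on the two sides of `ζ = 2 a`
  have repr : ∀ {F : ℝ × ℝ → ℝ} {Ω : ℝ → ℝ}, Continuous F →
      (∀ x, Ω x = ∫ s in (0 : ℝ)..x, ∫ t in (0 : ℝ)..s, F (s, t)) → ∀ z ∈ charDomain a,
      charOp a S F z = S (z.2 / κ) + pot F z - Ω z.1 +
        (if 0 ≤ z.2 - (κ * z.1 + 0) then S z.1 - S (z.2 / κ) else 0) +
        (if 0 ≤ z.2 - 2 * a then
          -S (z.2 - 2 * a) - pot F (z.2 - 2 * a, z.2) + Ω (z.2 - 2 * a) else 0) := by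
    intro F Ω hF hΩ z hz
    have hmin : S (min z.1 (z.2 / κ)) = S (z.2 / κ) +
        (if 0 ≤ z.2 - (κ * z.1 + 0) then S z.1 - S (z.2 / κ) else 0) := by
      split_ifs with h
      · rw [min_eq_left (by rw [le_div_iff₀ hκ]; linarith)]; ring
      · rw [min_eq_right (by rw [div_le_iff₀ hκ]; linarith)]; ring
    unfold charOp
    rw [← hκdef, hmin, integral_integral_eq_pot hF, ← hΩ, ← hΩ]
    by_cases h : 0 ≤ z.2 - 2 * a
    · rw [max_eq_left h, if_pos h]; ring
    · rw [max_eq_right (not_le.1 h).le, if_neg h, hS0]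
      have h0 : pot F (0, z.2) = 0 := by simp [pot]
      have h1 : Ω 0 = 0 := by rw [hΩ]; simp
      rw [h0, h1]; ring
  -- `x - y` is a positive multiple of `κ ξ - ζ`. The level lines of `charDiff` thus have slope `κ`
  -- and are oblique to both characteristic directions.
  have hfoot1 : ∀ z, charDiff a z * (2 * a / (1 - a)) = κ * z.1 - z.2 := by
    intro z; simp only [charDiff, hκdef]; field_simp; ring
  have hk0 : 0 < 2 * a / (1 - a) := by positivity
  have hcut1 : ∀ z, 0 ≤ z.2 - (κ * z.1 + 0) ↔ charDiff a z ≤ 0 := by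
    intro z
    have := hfoot1 z
    constructor
    · intro h
      by_contra h'
      have := mul_pos (not_le.1 h') hk0
      linarith
    · intro h
      have := mul_nonpos_of_nonpos_of_nonneg h hk0.le
      linarith
  -- Intercept of the line `x - y = 2a`, on which the foot of the nonlocal term crosses the
  -- characteristic `ζ = 2a`.
  set d : ℝ := -(2 * a / (1 - a) * (2 * a)) with hd
  have hcut3 : ∀ z, 0 ≤ z.2 - (κ * z.1 + d) ↔ charDiff a z ≤ 2 * a := by
    intro z
    have h1 := hfoot1 z
    have h2 : (charDiff a z - 2 * a) * (2 * a / (1 - a)) = -(z.2 - (κ * z.1 + d)) := by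
      rw [sub_mul, h1, hd]; ring
    constructor
    · intro h
      by_contra h'
      have := mul_pos (sub_pos.2 (not_le.1 h')) hk0
      linarith
    · intro h
      have := mul_nonpos_of_nonpos_of_nonneg (sub_nonpos.2 h) hk0.le
      linarith
  -- first stage
  set F : ℝ × ℝ → ℝ := charSource a c b g Q with hF
  have hFc : Continuous F := continuous_charSource hg.continuous hQc
  set Ω : ℝ → ℝ := fun x => ∫ s in (0 : ℝ)..x, ∫ t in (0 : ℝ)..s, F (s, t) with hΩ
  have hΩ1 : ContDiff ℝ 1 Ω :=
    contDiff_integral_upper (n := 0) (contDiff_zero.2 (diagC hFc)) 0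
  have hS1 : ContDiff ℝ 1 S := hS.of_le (by norm_num)
  have hpot1 := contDiff_one_pot hFc
  -- `B` is the part without cut-off; `R` is the correction for `ζ ≥ 2a`, caused by reflection at
  -- the side `y = 1`.
  set B : ℝ × ℝ → ℝ := fun z => S (z.2 / κ) + pot F z - Ω z.1 with hB
  have hB1 : ContDiff ℝ 1 B := by fun_prop
  set R : ℝ → ℝ := fun t => -S (t - 2 * a) - pot F (t - 2 * a, t) + Ω (t - 2 * a) with hR
  have hR1 : ContDiff ℝ 1 R := by fun_prop
  have hΩ0 : Ω 0 = 0 := by simp [hΩ]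
  have hR0 : R (2 * a) = 0 := by
    simp only [hR, sub_self, hS0, hΩ0]; simp [pot]
  have hB0 : B (0, 0) = 0 := by
    simp only [hB, hΩ0, zero_div, hS0]; simp [pot]
  have hQB : ∀ z ∈ charDomain a, Q z = B z +
      (if 0 ≤ z.2 - (κ * z.1 + 0) then S z.1 - S (z.2 / κ) else 0) +
      (if 0 ≤ z.2 - 2 * a then R z.2 else 0) := fun z hz => by
    rw [hQ z hz]; exact repr hFc (fun _ => rfl) z hz
  -- the decomposition of the source
  have hcd : ContDiff ℝ 1 (charDiff a) := by unfold charDiff; fun_prop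
  -- `F0` evaluates the nonlocal term as if no cut-off were present. The corrections are `h₁` where
  -- `x ≤ y` (the foot is the origin there), `h₃` where `x - y ≤ 2a` (no reflected part at the foot)
  -- and `h₂` where `ζ ≥ 2a`. Each vanishes on its own line.
  set h₁ : ℝ × ℝ → ℝ := fun z => c * (S z.1 - S (z.2 / κ)) -
    b * g ((z.2 - z.1) / (2 * a)) * B (charDiff a z, charDiff a z) with hh1
  set h₂ : ℝ → ℝ := fun t => c * R t with hh2
  set h₃ : ℝ × ℝ → ℝ := fun z => -(b * g ((z.2 - z.1) / (2 * a)) * R (charDiff a z)) with hh3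
  set F0 : ℝ × ℝ → ℝ := fun z => c * B z + b * g ((z.2 - z.1) / (2 * a)) *
    (B (charDiff a z, charDiff a z) + R (charDiff a z)) with hF0
  have c0 : ContDiff ℝ 1 F0 := by fun_prop
  have c1 : ContDiff ℝ 1 h₁ := by fun_prop
  have c2 : ContDiff ℝ 1 h₂ := by fun_prop
  have c3 : ContDiff ℝ 1 h₃ := by fun_prop
  have z1 : ∀ x, h₁ (x, κ * x + 0) = 0 := by
    intro x
    have : charDiff a (x, κ * x + 0) = 0 := by
      have := hfoot1 (x, κ * x + 0)
      simp only [add_zero, sub_self] at this ⊢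
      exact (mul_eq_zero.1 this).resolve_right hk0.ne'
    simp only [hh1]
    rw [this, hB0, show (κ * x + 0) / κ = x by field_simp; ring]
    ring
  have z3 : ∀ x, h₃ (x, κ * x + d) = 0 := by
    intro x
    have : charDiff a (x, κ * x + d) = 2 * a := by
      have := hfoot1 (x, κ * x + d)
      have h2 : (charDiff a (x, κ * x + d) - 2 * a) * (2 * a / (1 - a)) = 0 := by
        rw [sub_mul, this, hd]; ring
      linarith [(mul_eq_zero.1 h2).resolve_right hk0.ne']
    simp only [hh3]
    rw [this, hR0]; ring
  set Fm : ℝ × ℝ → ℝ := fun z => F0 z + (if 0 ≤ z.2 - (κ * z.1 + 0) then h₁ z else 0) +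
    (if 0 ≤ z.2 - (κ * z.1 + d) then h₃ z else 0) with hFm
  have gm : GoodSource Fm :=
    ((GoodSource.of_contDiff c0).add (GoodSource.cut c1 hκ z1)).add (GoodSource.cut c3 hκ z3)
  -- The one kink along a characteristic line. It cannot be smoothed by `GoodSource.cut`, but it
  -- depends on `ζ` alone.
  set χ : ℝ → ℝ := fun t => if 0 ≤ t - 2 * a then h₂ t else 0 with hχ
  have hχc : Continuous χ := continuous_ite_zero (by fun_prop) c2.continuous fun t ht => by
    rw [show t = 2 * a by linarith]; simp [hh2, hR0]
  set Ft : ℝ × ℝ → ℝ := fun z => Fm z + χ z.2 with hFt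
  have hFtc : Continuous Ft := by have := gm.cont; fun_prop
  have hFF : EqOn F Ft (charDomain a) := by
    intro z hz
    have e1 := hQB z hz
    have e4 : ∀ m : ℝ, 0 ≤ m → (if 0 ≤ m - (κ * m + 0) then S m - S (m / κ) else 0) = 0 := by
      intro m hm
      split_ifs with h
      · have : m = 0 := by nlinarith
        rw [this]; simp
      · rfl
    have e2 : Q (charFoot a z) = B (max (charDiff a z) 0, max (charDiff a z) 0) +
        (if 0 ≤ max (charDiff a z) 0 - 2 * a then R (max (charDiff a z) 0) else 0) := by
      have h := hQB (max (charDiff a z) 0, max (charDiff a z) 0) (charFoot_mem ha hz)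
      have h' := e4 _ (le_max_right (charDiff a z) 0)
      simp only at h
      rw [h', add_zero] at h
      exact h
    have e3 : F z = c * Q z + b * g ((z.2 - z.1) / (2 * a)) * Q (charFoot a z) := rfl
    rw [e3, e1, e2]
    simp only [hFt, hFm, hχ, hF0, hh1, hh2, hh3, hcut1 z, hcut3 z]
    rcases le_total (charDiff a z) 0 with h | h
    · rw [max_eq_right h, hB0, if_pos h, if_pos (by linarith : charDiff a z ≤ 2 * a),
        if_neg (by linarith : ¬ (0 : ℝ) ≤ 0 - 2 * a), if_pos h]
      split_ifs <;> ring
    · rw [max_eq_left h]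
      have e5 : (if charDiff a z ≤ 0 then S z.1 - S (z.2 / κ) else 0) = 0 ∧
          (if charDiff a z ≤ 0 then c * (S z.1 - S (z.2 / κ)) - b * g ((z.2 - z.1) / (2 * a)) *
            B (charDiff a z, charDiff a z) else 0) = 0 := by
        by_cases h' : charDiff a z ≤ 0
        · have h0 : charDiff a z = 0 := le_antisymm h' h
          have h5 := hfoot1 z
          rw [h0, zero_mul] at h5
          have h6 : z.2 / κ = z.1 := by rw [div_eq_iff hκ.ne']; linarith
          rw [if_pos h', if_pos h', h6, h0, hB0]; simp
        · simp [h']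
      rw [e5.1, e5.2]
      have e6 : (if 0 ≤ charDiff a z - 2 * a then R (charDiff a z) else 0) =
          R (charDiff a z) - if charDiff a z ≤ 2 * a then R (charDiff a z) else 0 := by
        rcases lt_trichotomy (charDiff a z) (2 * a) with h' | h' | h'
        · rw [if_neg (by linarith), if_pos h'.le]; ring
        · rw [h', hR0]; simp
        · rw [if_pos (by linarith), if_neg (by linarith)]; ring
      rw [e6]
      split_ifs <;> ring
  -- second stage
  set N : ℝ → ℝ := fun t => ∫ s in (2 * a)..t, h₂ s with hN
  have hN2 : ContDiff ℝ 2 N := contDiff_integral_upper (n := 1) c2 _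
  have hN0 : N (2 * a) = 0 := by simp [hN]
  have hχint : ∀ t, ∫ s in (0 : ℝ)..t, χ s = if 0 ≤ t - 2 * a then N t else 0 := by
    intro t
    have e1 := integral_ite_ge (φ := h₂) (e := 2 * a) (x := t)
    have e2 := integral_ite_ge (φ := h₂) (e := 2 * a) (x := 0)
    rw [if_neg (by linarith)] at e2
    rw [← e1, ← intervalIntegral.integral_interval_sub_left (a := 2 * a) (b := t) (c := 0)
      (hχc.intervalIntegrable _ _) (hχc.intervalIntegrable _ _), e2, sub_zero]
  have hNd : ∀ t, HasDerivAt N (h₂ t) t := fun t =>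
    hasDerivAt_integral_upper c2.continuous _ t
  have hχ1 : ContDiff ℝ 1 fun t => if 0 ≤ t - 2 * a then N t else 0 := by
    refine contDiff_one_ite_zero (by fun_prop) (hN2.of_le (by norm_num)) (fun t ht => ?_)
      (fun t ht => ?_)
    · rw [show t = 2 * a by linarith, hN0]
    · have := hNd t
      rw [show h₂ t = 0 by rw [show t = 2 * a by linarith]; simp [hh2, hR0]] at this
      have h' := this.hasFDerivAt.fderiv
      rw [h']; ext; simp
  have hinner : ∀ x y, ∫ t in (0 : ℝ)..y, Ft (x, t) =
      (∫ t in (0 : ℝ)..y, Fm (x, t)) + if 0 ≤ y - 2 * a then N y else 0 := by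
    intro x y
    have := gm.cont
    rw [← hχint]
    exact intervalIntegral.integral_add (Continuous.intervalIntegrable (by fun_prop) _ _)
      (hχc.intervalIntegrable _ _)
  -- The characteristic kink contributes `ξ N(ζ)` for `ζ ≥ 2a`, with `N` of class `C²`; everything
  -- else in the potential is `C²` across the line.
  have hpot : ∀ z, pot Ft z = pot Fm z + z.1 * if 0 ≤ z.2 - 2 * a then N z.2 else 0 := by
    intro z
    unfold pot
    simp_rw [hinner]
    have k : Continuous fun s => ∫ t in (0 : ℝ)..z.2, Fm (s, t) :=
      continuous_integral_param gm.cont continuous_id continuous_const continuous_const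
    rw [intervalIntegral.integral_add (k.intervalIntegrable _ _)
      (continuous_const.intervalIntegrable _ _)]
    simp
  set Ωt : ℝ → ℝ := fun x => ∫ s in (0 : ℝ)..x, ∫ t in (0 : ℝ)..s, Ft (s, t) with hΩt
  -- Along the diagonal the inner integral is `C¹`, so `Ωt` gains the derivative that `Ω` was
  -- missing.
  have hdiag1 : ContDiff ℝ 1 fun s => ∫ t in (0 : ℝ)..s, Ft (s, t) := by
    simp_rw [hinner]
    exact (gm.fst.comp (f := fun s : ℝ => (s, s)) (by fun_prop)).add hχ1
  have hΩt2 : ContDiff ℝ 2 Ωt := contDiff_integral_upper (n := 1) hdiag1 0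
  have hΩtd : ∀ s, deriv Ωt s = ∫ t in (0 : ℝ)..s, Ft (s, t) := fun s =>
    (hasDerivAt_integral_upper hdiag1.continuous 0 s).deriv
  have hΩt0 : Ωt 0 = 0 := by simp [hΩt]
  have hpm : ContDiff ℝ 2 (pot Fm) := contDiff_two_pot gm.cont gm.fst gm.snd
  -- `Gl` represents `Q` for `ζ ≤ 2a` and `Gr` for `ζ ≥ 2a`, both taken on the side `x ≥ y` of the
  -- diagonal; the other side differs by the explicit `S` terms.
  set Gl : ℝ × ℝ → ℝ := fun z => pot Fm z + -Ωt z.1 + S (z.2 / κ) with hGl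
  have hGl2 : ContDiff ℝ 2 Gl := by fun_prop
  set T : ℝ → ℝ := fun t => -S (t - 2 * a) - pot Fm (t - 2 * a, t) - (t - 2 * a) * N t +
    Ωt (t - 2 * a) with hT
  have hT2 : ContDiff ℝ 2 T := by fun_prop
  set Gr : ℝ × ℝ → ℝ := fun z => Gl z + (z.1 * N z.2 + T z.2) with hGr
  have hGr2 : ContDiff ℝ 2 Gr := by fun_prop
  have hGld := hGl2.differentiable two_ne_zero
  have hGrd := hGr2.differentiable two_ne_zero
  have hΩd : ∀ x, DifferentiableAt ℝ (fun x => -Ωt x) x := fun x =>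
    ((hΩt2.differentiable two_ne_zero) x).neg
  have p1l : ∀ x y, pd1 Gl (x, y) = (∫ t in (0 : ℝ)..y, Fm (x, t)) - ∫ t in (0 : ℝ)..x, Ft (x, t) := by
    intro x y
    rw [pd1_dAlembert (A := fun x => -Ωt x) (B := fun t => S (t / κ)) gm.cont hGld (fun _ => rfl) (hΩd x), deriv.fun_neg, hΩtd]; ring
  have p1r : ∀ x y, pd1 Gr (x, y) = pd1 Gl (x, y) + N y := by
    intro x y
    refine (hasDerivAt_pd1 hGrd x y).unique ?_
    refine ((hasDerivAt_pd1 hGld x y).add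
      (((hasDerivAt_id x).mul_const (N y)).add_const (T y))).congr_deriv ?_
    ring
  have p2l : ∀ x y, HasDerivAt (fun t => pd1 Gl (x, t)) (Fm (x, y)) y := fun x y =>
    hasDerivAt_pd1_dAlembert (A := fun x => -Ωt x) (B := fun t => S (t / κ)) gm.cont hGld (fun _ => rfl) (hΩd x) y
  have cl : ContDiff ℝ 1 (pd1 Gl) := contDiff_pd1 hGl2
  have cr : ContDiff ℝ 1 (pd1 Gr) := contDiff_pd1 hGr2
  have m1 : ∀ z, pd2 (pd1 Gl) z = Fm z := fun z =>
    (hasDerivAt_pd2 (cl.differentiable one_ne_zero) z.1 z.2).unique (p2l z.1 z.2)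
  have m2 : ∀ z, pd2 (pd1 Gr) z = Fm z + h₂ z.2 := fun z => by
    refine (hasDerivAt_pd2 (cr.differentiable one_ne_zero) z.1 z.2).unique ?_
    exact ((p2l z.1 z.2).add (hNd z.2)).congr_of_eventuallyEq
      (Eventually.of_forall fun t => p1r z.1 t)
  refine ⟨Q, Gl, Gr, hGl2, hGr2, ?_, ?_, ?_, ?_, ?_, ?_, ?_, ?_⟩
  · intro z hz
    rw [hQ z hz, charOp_congr hFF hz, repr hFtc (fun _ => rfl) z hz]
    have e : (if κ * z.1 ≤ z.2 then S z.1 - S (z.2 / κ) else 0) =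
        if 0 ≤ z.2 - (κ * z.1 + 0) then S z.1 - S (z.2 / κ) else 0 := by
      simp only [add_zero, sub_nonneg]
    rw [e, hpot, hpot]
    rcases lt_trichotomy z.2 (2 * a) with h | h | h
    · rw [if_neg (by linarith : ¬ 0 ≤ z.2 - 2 * a), if_neg (by linarith : ¬ 0 ≤ z.2 - 2 * a),
        if_pos h.le]
      simp only [hGl, hΩt]; ring
    · have hz2 : z = (z.1, 2 * a) := by rw [← h]
      simp only [h, le_refl, if_true, sub_self, hN0, hS0, mul_zero, ite_self]
      have k1 : pot Fm (0, 2 * a) = 0 := by simp [pot]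
      have k2 : (∫ s in (0 : ℝ)..0, ∫ t in (0 : ℝ)..s, Ft (s, t)) = 0 := by simp
      rw [k1, k2]
      simp only [hGl, hΩt, h]; ring
    · rw [if_pos (by linarith : 0 ≤ z.2 - 2 * a), if_pos (by linarith : 0 ≤ z.2 - 2 * a),
        if_neg (not_le.2 h)]
      simp only [hGr, hGl, hT, hΩt]
      ring
  · intro z hz h
    rw [m1, ← hF, hFF hz]
    simp only [hFt, hχ]
    split_ifs with h'
    · rw [show z.2 = 2 * a by linarith]; simp [hh2, hR0]
    · simp
  · intro z hz h
    rw [m2, ← hF, hFF hz]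
    simp only [hFt, hχ]
    rw [if_pos (by linarith)]
  · intro x
    have k1 : pot Fm (0, 2 * a) = 0 := by simp [pot]
    simp only [hGr, hT, hN0, sub_self, hS0, hΩt0, k1]; ring
  · intro s hs
    rw [p1l, hinner]
    split_ifs with h
    · rw [show s = 2 * a by linarith, hN0]; ring
    · ring
  · intro s hs
    rw [p1r, p1l, hinner, if_pos (by linarith)]; ring
  · intro t
    have k1 : pot Fm (0, t) = 0 := by simp [pot]
    simp only [hGl, k1, hΩt0]; ring
  · intro x
    simp only [hGr, hGl, hT, add_sub_cancel_right]; ring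

/-! ### Existence of the second kernel. -/

/-- For `y₀ = 0` the diffusion coefficients coincide and `g = (ε₁ - ε₂) ∂_y k₂₁` vanishes. There is
no coupling to remove and the second transformation is the identity. -/
lemma isSecondKernel_zero {ε c₁ c₂ : ℝ} {g : ℝ → ℝ} (hg : ∀ x ∈ Ioo (0 : ℝ) 1, g x = 0) :
    IsSecondKernel ε 0 c₁ c₂ g (fun _ => 0) (fun _ _ => 0) (fun _ _ => 0) := by
  have e1 : ∀ S : Set (ℝ × ℝ), dX S (fun _ _ => 0) = fun _ _ => 0 := fun S => by
    ext x y; simp [dX]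
  have e2 : ∀ S : Set (ℝ × ℝ), dY S (fun _ _ => 0) = fun _ _ => 0 := fun S => by
    ext x y; simp [dY]
  constructor
  case jump => intro x hx _; rw [hg x hx, e2, e2]; simp
  all_goals first
    | exact continuousOn_const
    | exact contDiffOn_const
    | (intros; simp [e1, e2])

/-- For `y₀ < 0` both `q` and `r` are read off from one solution in the coordinates `x - a y`, `x +
a y`; the interface condition is then automatic and the jump condition rests on `S` alone. -/
theorem exists_secondKernel {ε y₀ c₁ c₂ : ℝ} (hε : 0 < ε) (hy : y₀ ∈ Ioc (-1 : ℝ) 0)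
    {gc g : ℝ → ℝ} (hg : ContDiff ℝ 1 g) (hgc : EqOn gc g (Icc 0 1))
    (hg0 : y₀ = 0 → ∀ x ∈ Ioo (0 : ℝ) 1, gc x = 0) :
    ∃ (p : ℝ → ℝ) (q r : ℝ → ℝ → ℝ), IsSecondKernel ε y₀ c₁ c₂ gc p q r := by
  rcases hy.2.eq_or_lt with rfl | hy0
  · exact ⟨_, _, _, isSecondKernel_zero (hg0 rfl)⟩
  set a := aCoef y₀ with ha'
  have ha : 0 < a := aCoef_pos hy
  have ha1 : a < 1 := by
    rw [ha', aCoef, div_lt_one (by linarith)]; linarith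
  set ε₁ := eps1 ε y₀ with hε₁
  set ε₂ := eps2 ε y₀ with hε₂
  have he1 : 0 < ε₁ := eps1_pos hε hy
  have he2 : 0 < ε₂ := eps2_pos hε hy
  have he : ε₂ = a ^ 2 * ε₁ := eps2_eq hy
  have hlt : ε₂ < ε₁ := by
    rw [he]; exact mul_lt_of_lt_one_left he1 (by nlinarith)
  have h1a : 0 < 1 - a := by linarith
  set κ : ℝ := (1 + a) / (1 - a) with hκdef
  have hκ : 0 < κ := by positivity
  -- Chosen so that the jump of `∂_y` across the diagonal comes out right: there `∂_y D = -a (1 +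
  -- 1/κ) σ = -(2a / (1 + a)) σ`, evaluated at `ξ = (1 - a) x`.
  set σ : ℝ → ℝ := fun t => -((1 + a) / (2 * a)) / (ε₁ - ε₂) * g (t / (1 - a)) with hσ
  have hσ1 : ContDiff ℝ 1 σ := by fun_prop
  set S : ℝ → ℝ := fun t => ∫ s in (0 : ℝ)..t, σ s with hS
  have hS2 : ContDiff ℝ 2 S := contDiff_integral_upper (n := 1) hσ1 0
  have hSd : ∀ t, HasDerivAt S (σ t) t := fun t => hasDerivAt_integral_upper hσ1.continuous 0 t
  have hS0 : S 0 = 0 := by simp [hS]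
  obtain ⟨Q, Gl, Gr, hGl, hGr, hQ, hml, hmr, hGG, hfl, hfr, hbl, hbr⟩ :=
    exists_characteristicKernel ha ha1 hg hS2 hS0 ((c₂ - c₁) / (4 * ε₂)) (1 / (4 * ε₂ * a))
  rw [← hκdef] at hQ hbl hbr
  -- The difference between the branches `x ≤ y` and `x ≥ y`. It is a sum of functions of one
  -- characteristic variable each, hence invisible to the wave operator.
  set D : ℝ × ℝ → ℝ := fun z => S z.1 - S (z.2 / κ) with hD
  have hD2 : ContDiff ℝ 2 D := by fun_prop
  have hlin : ∀ (G : ℝ × ℝ → ℝ) x y, linComp 1 G 1 (-a) 1 a (x, y) = G (x - a * y, x + a * y) := by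
    intro G x y; simp only [linComp]; rw [one_mul]; congr 2 <;> ring
  set W : (ℝ × ℝ → ℝ) → ℝ × ℝ → ℝ := fun G => linComp 1 G 1 (-a) 1 a with hW
  have hW2 : ∀ {G}, ContDiff ℝ 2 G → ContDiff ℝ 2 (W G) := fun hG => contDiff_linComp hG
  have hWd : ∀ {G}, ContDiff ℝ 2 G → Differentiable ℝ (W G) := fun hG =>
    (hW2 hG).differentiable two_ne_zero
  have hWw : ∀ {G}, ContDiff ℝ 2 G → ∀ x y, ε₂ * pd1 (pd1 (W G)) (x, y) -
      ε₁ * pd2 (pd2 (W G)) (x, y) = 4 * ε₂ * pd2 (pd1 G) (x - a * y, x + a * y) := by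
    intro G hG x y
    rw [hW, wave_linComp hG (by rw [he]; ring) (by rw [he]; ring)]
    simp only
    rw [show (1 * x + -a * y, 1 * x + a * y) = (x - a * y, x + a * y) by congr 1 <;> ring]
    rw [he]; ring
  have hGD : ∀ {G}, ContDiff ℝ 2 G → ContDiff ℝ 2 (fun z => G z + D z) := fun hG => hG.add hD2
  have hmD : ∀ {G}, ContDiff ℝ 2 G → ∀ z, pd2 (pd1 fun z => G z + D z) z = pd2 (pd1 G) z := by
    intro G hG z
    have k1 : ContDiff ℝ 1 (pd1 fun z => G z + D z) := contDiff_pd1 (hGD hG)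
    have k2 : ContDiff ℝ 1 (pd1 G) := contDiff_pd1 hG
    have kD : ∀ t, pd1 D (z.1, t) = σ z.1 := fun t =>
      (hasDerivAt_pd1 (hD2.differentiable two_ne_zero) z.1 t).unique ((hSd z.1).sub_const (S (t / κ)))
    refine (hasDerivAt_pd2 (k1.differentiable one_ne_zero) z.1 z.2).unique ?_
    refine ((hasDerivAt_pd2 (k2.differentiable one_ne_zero) z.1 z.2).add_const
      (σ z.1)).congr_of_eventuallyEq (Eventually.of_forall fun t => ?_)
    change pd1 (fun z => G z + D z) (z.1, t) = _
    rw [pd1_add (hG.differentiable two_ne_zero) (hD2.differentiable two_ne_zero), kD]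
  -- the kernels
  set q : ℝ → ℝ → ℝ := fun x y => if x + a * y ≤ 2 * a then W Gl (x, y) else W Gr (x, y) with hq
  set Rf : ℝ × ℝ → ℝ := fun z => if z.2 ≤ 2 * a then Gl z + D z else Gr z + D z with hRf
  -- The maximum continues `r` into the sector `x < a y` by its value at `ξ = 0`, which is zero for
  -- `ζ ≤ 2a`.
  set r : ℝ → ℝ → ℝ := fun x y => Rf (max (x - a * y) 0, x + a * y) with hr
  have hG' : ∀ x y, x + a * y = 2 * a → W Gl (x, y) = W Gr (x, y) := by
    intro x y h
    simp only [hW, hlin, h]; exact hGG _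
  have hRfc : Continuous Rf := by
    refine Continuous.if_le (hGD hGl).continuous (hGD hGr).continuous continuous_snd
      continuous_const fun z hz => ?_
    have : z = (z.1, 2 * a) := by rw [← hz]
    rw [this, hGG]
  have hqc : Continuous fun z : ℝ × ℝ => q z.1 z.2 :=
    Continuous.if_le (hW2 hGl).continuous (hW2 hGr).continuous (by fun_prop) continuous_const
      fun z hz => hG' _ _ hz
  have hrc : Continuous fun z : ℝ × ℝ => r z.1 z.2 := hRfc.comp (by fun_prop)
  have hr0 : ∀ x y, x ≤ a * y → x + a * y ≤ 2 * a → r x y = 0 := by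
    intro x y h1 h2
    simp only [hr, hRf]
    rw [if_pos h2, max_eq_right (by linarith), hbl]
    simp only [hD, hS0]; ring
  have hrm : ∀ x y, a * y ≤ x → x + a * y ≤ 2 * a → r x y = W (fun z => Gl z + D z) (x, y) := by
    intro x y h1 h2
    simp only [hr, hRf, hW, hlin]
    rw [if_pos h2, max_eq_left (by linarith)]
  have hrr : ∀ x y, a * y ≤ x → 2 * a ≤ x + a * y → r x y = W (fun z => Gr z + D z) (x, y) := by
    intro x y h1 h2
    rcases h2.eq_or_lt with h | h
    · rw [hrm x y h1 h.ge]
      simp only [hW, hlin, ← h, hGG]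
    · simp only [hr, hRf, hW, hlin]
      rw [if_neg (not_le.2 h), max_eq_left (by linarith)]
  have hqr : ∀ x y, 2 * a ≤ x + a * y → q x y = W Gr (x, y) := by
    intro x y h2
    rcases h2.eq_or_lt with h | h
    · simp only [hq]; rw [if_pos h.ge]; exact hG' _ _ h.symm
    · exact if_neg (not_le.2 h)
  have hcq : Continuous fun z : ℝ × ℝ => z.1 + a * z.2 := by fun_prop
  have nql : ∀ z : ℝ × ℝ, z.1 + a * z.2 < 2 * a → (fun z : ℝ × ℝ => q z.1 z.2) =ᶠ[𝓝 z] W Gl := by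
    intro z hz
    filter_upwards [hcq.continuousAt.eventually_lt continuousAt_const hz] with w hw
    exact if_pos hw.le
  have nqr : ∀ z : ℝ × ℝ, 2 * a < z.1 + a * z.2 → (fun z : ℝ × ℝ => q z.1 z.2) =ᶠ[𝓝 z] W Gr := by
    intro z hz
    filter_upwards [continuousAt_const.eventually_lt hcq.continuousAt hz] with w hw
    exact if_neg (not_le.2 hw)
  have hcr : Continuous fun z : ℝ × ℝ => a * z.2 := by fun_prop
  have nr0 : ∀ z : ℝ × ℝ, z.1 < a * z.2 → z.1 + a * z.2 < 2 * a →
      (fun z : ℝ × ℝ => r z.1 z.2) =ᶠ[𝓝 z] fun _ => 0 := by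
    intro z h1 h2
    filter_upwards [hcq.continuousAt.eventually_lt continuousAt_const h2,
      continuous_fst.continuousAt.eventually_lt hcr.continuousAt h1] with w hw1 hw2
    exact hr0 _ _ hw2.le hw1.le
  have nrm : ∀ z : ℝ × ℝ, a * z.2 < z.1 → z.1 + a * z.2 < 2 * a →
      (fun z : ℝ × ℝ => r z.1 z.2) =ᶠ[𝓝 z] W (fun z => Gl z + D z) := by
    intro z h1 h2
    filter_upwards [hcq.continuousAt.eventually_lt continuousAt_const h2,
      hcr.continuousAt.eventually_lt continuous_fst.continuousAt h1] with w hw1 hw2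
    exact hrm _ _ hw2.le hw1.le
  have nrr : ∀ z : ℝ × ℝ, a * z.2 < z.1 → 2 * a < z.1 + a * z.2 →
      (fun z : ℝ × ℝ => r z.1 z.2) =ᶠ[𝓝 z] W (fun z => Gr z + D z) := by
    intro z h1 h2
    filter_upwards [continuousAt_const.eventually_lt hcq.continuousAt h2,
      hcr.continuousAt.eventually_lt continuous_fst.continuousAt h1] with w hw1 hw2
    exact hrr _ _ hw2.le hw1.le
  -- relation to the characteristic coordinates
  have hmem : ∀ x y, 0 ≤ y → y ≤ 1 → a * y ≤ x → x ≤ 1 →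
      (x - a * y, x + a * y) ∈ charDomain a := by
    intro x y h1 h2 h3 h4
    have := mul_nonneg ha.le h1
    have := mul_le_mul_of_nonneg_left h2 ha.le
    refine ⟨?_, ?_, ?_, ?_⟩ <;> simp only <;> linarith
  have hay : ∀ x y, 0 ≤ y → y ≤ x → a * y ≤ x := fun x y h1 h2 => by nlinarith
  -- The line `ζ = κ ξ` is the diagonal.
  have hκle : ∀ x y, κ * (x - a * y) ≤ x + a * y ↔ x ≤ y := by
    intro x y
    rw [hκdef, div_mul_eq_mul_div, div_le_iff₀ h1a]
    constructor <;> intro h <;> nlinarith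
  have hD0 : ∀ x, D (x - a * x, x + a * x) = 0 := by
    intro x
    have : (x + a * x) / κ = x - a * x := by rw [hκdef]; field_simp
    simp only [hD, this, sub_self]
  have hQq : ∀ x y, 0 ≤ y → y ≤ x → x ≤ 1 → Q (x - a * y, x + a * y) = q x y := by
    intro x y h1 h2 h3
    rw [hQ _ (hmem x y h1 (h2.trans h3) (hay x y h1 h2) h3)]
    simp only [hq, hW, hlin, hκle]
    split_ifs with k1 k2 k2
    · rw [le_antisymm h2 k2]
      have := hD0 x
      simp only [hD] at this
      rw [this, add_zero]
    · rw [add_zero]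
    · rw [le_antisymm h2 k2]
      have := hD0 x
      simp only [hD] at this
      rw [this, add_zero]
    · rw [add_zero]
  have hQr : ∀ x y, x ≤ y → y ≤ 1 → 0 ≤ y → a * y ≤ x → Q (x - a * y, x + a * y) = r x y := by
    intro x y h1 h2 h3 h4
    rw [hQ _ (hmem x y h3 h2 h4 (h1.trans h2))]
    simp only [hr, hRf]
    rw [max_eq_left (by linarith), if_pos ((hκle x y).2 h1)]
    split_ifs <;> simp [hD]
  have hcd : ∀ x y, charDiff a (x - a * y, x + a * y) = x - y := by
    intro x y; simp only [charDiff]; field_simp; ring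
  have hyy : ∀ x y, (x + a * y - (x - a * y)) / (2 * a) = y := by
    intro x y; field_simp; ring
  have hq00 : q 0 0 = 0 := by
    simp only [hq, hW, hlin]
    rw [if_pos (by linarith)]
    simp [hbl, hS0]
  set p : ℝ → ℝ := fun x => a⁻¹ * q x 0 with hp
  have hsq : ∀ x y, 0 ≤ y → y ≤ x → x ≤ 1 →
      4 * ε₂ * charSource a ((c₂ - c₁) / (4 * ε₂)) (1 / (4 * ε₂ * a)) g Q (x - a * y, x + a * y) =
        (c₂ - c₁) * q x y + gc y * p (x - y) := by
    intro x y h1 h2 h3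
    have e1 : charFoot a (x - a * y, x + a * y) = (x - y - a * 0, x - y + a * 0) := by
      simp only [charFoot, hcd]
      rw [max_eq_left (by linarith)]; simp
    simp only [charSource, e1, hyy]
    rw [hQq x y h1 h2 h3, hQq (x - y) 0 le_rfl (by linarith) (by linarith),
      hgc ⟨h1, h2.trans h3⟩]
    simp only [hp]
    field_simp
  -- For `x ≤ y` the foot is the origin, where `Q` vanishes, so the convolution term disappears and
  -- the equation of `r` remains.
  have hsr : ∀ x y, x ≤ y → y ≤ 1 → 0 ≤ y → a * y ≤ x →
      4 * ε₂ * charSource a ((c₂ - c₁) / (4 * ε₂)) (1 / (4 * ε₂ * a)) g Q (x - a * y, x + a * y) =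
        (c₂ - c₁) * r x y := by
    intro x y h1 h2 h3 h4
    have e1 : charFoot a (x - a * y, x + a * y) = ((0 : ℝ) - a * 0, (0 : ℝ) + a * 0) := by
      simp only [charFoot, hcd]
      rw [max_eq_right (by linarith)]; simp
    simp only [charSource, e1, hyy]
    rw [hQr x y h1 h2 h3 h4, hQq 0 0 le_rfl le_rfl zero_le_one, hq00]
    field_simp
    ring
  have dX0 : pd1 (fun _ : ℝ × ℝ => (0 : ℝ)) = fun _ => 0 := by ext; simp [pd1]
  have dY0 : pd2 (fun _ : ℝ × ℝ => (0 : ℝ)) = fun _ => 0 := by ext; simp [pd2]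
  have c0 : ContDiff ℝ 2 (fun _ : ℝ × ℝ => (0 : ℝ)) := contDiff_const
  -- The smooth representative `G` is common to `q` and `r`, so only `D` jumps.
  have jumpG : ∀ {G}, ContDiff ℝ 2 G → ∀ x, (ε₂ - ε₁) * (pd2 (W G) (x, x) -
      pd2 (W fun z => G z + D z) (x, x)) = g x := by
    intro G hG x
    have e1 : W (fun z => G z + D z) = fun z => W G z + W D z := by
      ext z; simp only [hW, linComp]; ring
    rw [e1, pd2_add (hWd hG) (hWd hD2)]
    have e2 : HasDerivAt (fun s => W D (x, s)) (σ (x - a * x) * -a - σ (x - a * x) * (a / κ)) x := by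
      have k1 : HasDerivAt (fun s : ℝ => x - a * s) (-a) x :=
        (((hasDerivAt_id x).const_mul a).const_sub x).congr_deriv (by ring)
      have k2 : HasDerivAt (fun s : ℝ => (x + a * s) / κ) (a / κ) x :=
        ((((hasDerivAt_id x).const_mul a).const_add x).div_const κ).congr_deriv (by ring)
      have k3 := (hSd (x - a * x)).comp x k1
      have k4 : (x + a * x) / κ = x - a * x := by rw [hκdef]; field_simp
      have k5 : HasDerivAt (fun s : ℝ => S ((x + a * s) / κ)) (σ (x - a * x) * (a / κ)) x := by
        have := hSd ((x + a * x) / κ)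
        have := this.comp x k2
        rw [k4] at this
        exact this
      exact (k3.sub k5).congr_of_eventuallyEq (Eventually.of_forall fun s => hlin D x s)
    rw [(hasDerivAt_pd2 (hWd hD2) x x).unique e2]
    simp only [hσ]
    rw [show (x - a * x) / (1 - a) = x by field_simp, hκdef]
    have : ε₁ - ε₂ ≠ 0 := by linarith
    field_simp
    ring
  -- In characteristic coordinates `∂_y - a ∂_x = -2a ∂_ξ`.
  have foldG : ∀ {G}, ContDiff ℝ 2 G → ∀ x, pd1 G (x, x) = 0 →
      pd2 (W G) (x, 0) = a * pd1 (W G) (x, 0) := by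
    intro G hG x h
    simp only [hW]
    rw [pd1_linComp (hG.differentiable two_ne_zero), pd2_linComp (hG.differentiable two_ne_zero)]
    simp only [linComp]
    rw [show (1 * x + -a * 0, 1 * x + a * 0) = (x, x) by congr 1 <;> ring, h]; ring
  refine ⟨p, q, r, ?_⟩
  constructor
  case cont_q => exact hqc.continuousOn
  case reg_q_left => exact (hW2 hGl).contDiffOn.congr fun z hz => if_pos hz.2
  case reg_q_right => exact (hW2 hGr).contDiffOn.congr fun z hz => hqr _ _ hz.2
  case cont_r => exact hrc.continuousOn
  case reg_r_left =>
    refine c0.contDiffOn.congr fun z hz => hr0 _ _ hz.2 ?_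
    have := mul_le_mul_of_nonneg_left hz.1.2.2 ha.le
    have := hz.2
    linarith
  case reg_r_mid => exact (hW2 (hGD hGl)).contDiffOn.congr fun z hz => hrm _ _ hz.2.1 hz.2.2
  case reg_r_right =>
    refine (hW2 (hGD hGr)).contDiffOn.congr fun z hz => hrr _ _ ?_ hz.2
    have := mul_le_mul_of_nonneg_left hz.1.2.2 ha.le
    have := hz.2
    linarith
  case p_eq => intro x _; rfl
  case pde_q =>
    intro x y h1 h2 h3 h4
    have hm := mem_nhds_triL h1 h2 h3
    have hch := hmem x y h1.le (h2.trans h3).le (hay x y h1.le h2.le) h3.le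
    rw [← hsq x y h1.le h2.le h3.le]
    rcases lt_or_gt_of_ne h4 with h | h
    · rw [dX_dX_eq uniqueDiffOn_triL hm (hW2 hGl) (nql (x, y) h),
        dY_dY_eq uniqueDiffOn_triL hm (hW2 hGl) (nql (x, y) h), ← hε₁, ← hε₂, hWw hGl,
        hml _ hch h.le]
    · rw [dX_dX_eq uniqueDiffOn_triL hm (hW2 hGr) (nqr (x, y) h),
        dY_dY_eq uniqueDiffOn_triL hm (hW2 hGr) (nqr (x, y) h), ← hε₁, ← hε₂, hWw hGr,
        hmr _ hch h.le]
  case pde_r =>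
    intro x y h1 h2 h3 h4 h5
    have hm := mem_nhds_triU h1 h2 h3
    rw [← hε₁, ← hε₂]
    have hy3 := mul_lt_mul_of_pos_left h3 ha
    rcases lt_or_gt_of_ne h4 with k | k
    · have hn := nr0 (x, y) k (by simp only; linarith)
      rw [dX_dX_eq uniqueDiffOn_triU hm c0 hn, dY_dY_eq uniqueDiffOn_triU hm c0 hn, dX0, dY0, dX0,
        dY0, hr0 x y k.le (by linarith)]
      ring
    · have hch := hmem x y (h1.trans h2).le h3.le k.le (h2.trans h3).le
      rw [← hsr x y h2.le h3.le (h1.trans h2).le k.le]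
      rcases lt_or_gt_of_ne h5 with h | h
      · have hn := nrm (x, y) k h
        rw [dX_dX_eq uniqueDiffOn_triU hm (hW2 (hGD hGl)) hn,
          dY_dY_eq uniqueDiffOn_triU hm (hW2 (hGD hGl)) hn, hWw (hGD hGl), hmD hGl,
          hml _ hch h.le]
      · have hn := nrr (x, y) k h
        rw [dX_dX_eq uniqueDiffOn_triU hm (hW2 (hGD hGr)) hn,
          dY_dY_eq uniqueDiffOn_triU hm (hW2 (hGD hGr)) hn, hWw (hGD hGr), hmD hGr,
          hmr _ hch h.le]
  case jump =>
    intro x hx h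
    have m1 : (x, x) ∈ triL := ⟨hx.1.le, le_rfl, hx.2.le⟩
    have m2 : (x, x) ∈ triU := ⟨hx.1.le, le_rfl, hx.2.le⟩
    have hax : a * x < x := mul_lt_of_lt_one_left hx.1 ha1
    rw [← hε₁, ← hε₂, hgc ⟨hx.1.le, hx.2.le⟩]
    rcases lt_or_gt_of_ne h with h | h
    · rw [dY_eq_pd2 uniqueDiffOn_triL m1 (hWd hGl)
          ((nql (x, x) h).filter_mono nhdsWithin_le_nhds),
        dY_eq_pd2 uniqueDiffOn_triU m2 (hWd (hGD hGl))
          ((nrm (x, x) hax h).filter_mono nhdsWithin_le_nhds)]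
      exact jumpG hGl x
    · rw [dY_eq_pd2 uniqueDiffOn_triL m1 (hWd hGr)
          ((nqr (x, x) h).filter_mono nhdsWithin_le_nhds),
        dY_eq_pd2 uniqueDiffOn_triU m2 (hWd (hGD hGr))
          ((nrr (x, x) hax h).filter_mono nhdsWithin_le_nhds)]
      exact jumpG hGr x
  case interface =>
    intro x hx
    have hax : a * x ≤ x := mul_le_of_le_one_left hx.1 ha1.le
    rw [← hQr x x le_rfl hx.2 hx.1 hax, hQq x x hx.1 le_rfl hx.2]
  case fold =>
    intro x hx h
    have m1 : (x, (0 : ℝ)) ∈ triL := ⟨le_rfl, hx.1.le, hx.2.le⟩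
    rcases lt_or_gt_of_ne h with h | h
    · have hn := (nql (x, 0) (by simpa using h)).filter_mono (nhdsWithin_le_nhds (s := triL))
      rw [dX_eq_pd1 uniqueDiffOn_triL m1 (hWd hGl) hn, dY_eq_pd2 uniqueDiffOn_triL m1 (hWd hGl) hn]
      exact foldG hGl x (hfl x h.le)
    · have hn := (nqr (x, 0) (by simpa using h)).filter_mono (nhdsWithin_le_nhds (s := triL))
      rw [dX_eq_pd1 uniqueDiffOn_triL m1 (hWd hGr) hn, dY_eq_pd2 uniqueDiffOn_triL m1 (hWd hGr) hn]
      exact foldG hGr x (hfr x h.le)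
  case r_end =>
    intro x hx
    rcases le_total x a with h | h
    · exact hr0 x 1 (by linarith) (by linarith)
    · rw [hrr x 1 (by linarith) (by linarith)]
      simp only [hW, hlin]
      rw [show (x - a * 1, x + a * 1) = (x - a * 1, x - a * 1 + 2 * a) by congr 1; ring, hbr]
      simp only [hD]; ring
  case r_init =>
    intro y hy
    have := mul_le_mul_of_nonneg_left hy.2 ha.le
    exact hr0 0 y (mul_nonneg ha.le hy.1) (by linarith)
  case r_init_deriv =>
    intro y hy
    have m1 : ((0 : ℝ), y) ∈ triU := ⟨le_rfl, hy.1.le, hy.2.le⟩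
    have := mul_lt_mul_of_pos_left hy.2 ha
    have hn := (nr0 (0, y) (mul_pos ha hy.1) (by simp only; linarith)).filter_mono
      (nhdsWithin_le_nhds (s := triU))
    rw [dX_eq_pd1 uniqueDiffOn_triU m1 (c0.differentiable two_ne_zero) hn, dX0]

/-! ### The kernel family for a reaction coefficient given on `[-1, 1]`. -/

lemma matLambda_congr {y₀ : ℝ} (hy : y₀ ∈ Ioc (-1 : ℝ) 0) {ℓ ℓ' : ℝ → ℝ}
    (h : EqOn ℓ ℓ' (Icc (-1) 1)) {x : ℝ} (hx : x ∈ Icc (0 : ℝ) 1) :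
    matLambda y₀ ℓ x = matLambda y₀ ℓ' x := by
  have h1 : 0 ≤ (1 + y₀) * x := mul_nonneg (by linarith [hy.1]) hx.1
  have h2 : 0 ≤ (1 - y₀) * x := mul_nonneg (by linarith [hy.2]) hx.1
  have h3 : (1 + y₀) * x ≤ 1 + y₀ := mul_le_of_le_one_right (by linarith [hy.1]) hx.2
  have h4 : (1 - y₀) * x ≤ 1 - y₀ := mul_le_of_le_one_right (by linarith [hy.2]) hx.2
  unfold matLambda
  rw [h ⟨by linarith, by linarith [hy.2]⟩, h ⟨by linarith [hy.1], by linarith⟩]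

lemma IsFirstKernel.congr {ε y₀ c₁ c₂ : ℝ} (hy : y₀ ∈ Ioc (-1 : ℝ) 0) {ℓ ℓ' : ℝ → ℝ}
    (h : EqOn ℓ ℓ' (Icc (-1) 1)) {K : ℝ → ℝ → Matrix (Fin 2) (Fin 2) ℝ}
    (hK : IsFirstKernel ε y₀ c₁ c₂ ℓ K) : IsFirstKernel ε y₀ c₁ c₂ ℓ' K :=
  { hK with
    pde := fun x y h1 h2 h3 h4 => by
      rw [hK.pde x y h1 h2 h3 h4, matLambda_congr hy h ⟨h1.le, (h2.trans h3).le⟩]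
    diag := fun x hx => by
      rw [hK.diag x hx, matLambda_congr hy h ⟨hx.1.le, hx.2.le⟩] }

lemma contDiffOn_reducedReaction {ε : ℝ} {ν lam : ℝ → ℝ}
    (hν : ContDiffOn ℝ 2 ν (Icc (-1) 1)) (hlam : ContDiffOn ℝ 1 lam (Icc (-1) 1)) :
    ContDiffOn ℝ 1 (reducedReaction ε ν lam) (Icc (-1) 1) := by
  have h1 : ContDiffOn ℝ 1 (derivWithin ν (Icc (-1) 1)) (Icc (-1) 1) :=
    hν.derivWithin (uniqueDiffOn_Icc (by norm_num)) (by norm_num)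
  have h2 : ContDiffOn ℝ 1 ν (Icc (-1) 1) := hν.of_le (by norm_num)
  unfold reducedReaction
  exact (hlam.sub (h1.div_const 2)).sub ((h2.pow 2).div_const _)

theorem exists_kernelFamily {ε y₀ c₁ c₂ : ℝ} (hε : 0 < ε) (hy : y₀ ∈ Ioc (-1 : ℝ) 0) {ℓ : ℝ → ℝ}
    (hℓ : ContDiffOn ℝ 1 ℓ (Icc (-1) 1)) :
    ∃ (K : ℝ → ℝ → Matrix (Fin 2) (Fin 2) ℝ) (p : ℝ → ℝ) (q r : ℝ → ℝ → ℝ),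
      IsKernelFamily ε y₀ c₁ c₂ ℓ K p q r := by
  -- The construction uses a coefficient on the whole line; the kernel equations see it only on
  -- `[-1, 1]`.
  obtain ⟨L, hL, hLℓ⟩ := exists_contDiff_one_extension (by norm_num) hℓ
  obtain ⟨K, hK, g, hg, hgK⟩ := exists_firstKernel (c₁ := c₁) (c₂ := c₂) hε hy hL
  obtain ⟨p, q, r, h⟩ := exists_secondKernel (c₁ := c₁) (c₂ := c₂) hε hy hg hgK
    (fun h0 x _ => by subst h0; simp [gCoef, eps1, eps2])
  exact ⟨K, p, q, r, hK.congr hy hLℓ, h⟩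

/-! ### Leibniz rules over regions between two graphs. -/

lemma hasDerivAt_integral_param_on {H H' : ℝ → ℝ → ℝ} {I : Set ℝ} (hI : IsOpen I) {a b : ℝ}
    (hab : a ≤ b) (hH : ContinuousOn (fun z : ℝ × ℝ => H z.1 z.2) (I ×ˢ Icc a b))
    (hH' : ContinuousOn (fun z : ℝ × ℝ => H' z.1 z.2) (I ×ˢ Icc a b))
    (hd : ∀ t ∈ I, ∀ s ∈ Icc a b, HasDerivAt (fun t => H t s) (H' t s) t) {t₀ : ℝ} (ht₀ : t₀ ∈ I) :
    HasDerivAt (fun t => ∫ s in a..b, H t s) (∫ s in a..b, H' t₀ s) t₀ := by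
  obtain ⟨δ, hδ, hδI⟩ := Metric.isOpen_iff.1 hI t₀ ht₀
  have hsub : Icc (t₀ - δ / 2) (t₀ + δ / 2) ⊆ I := fun t ht => hδI (by
    rw [Metric.mem_ball, Real.dist_eq, abs_lt]
    constructor <;> linarith [ht.1, ht.2])
  have hnb : Icc (t₀ - δ / 2) (t₀ + δ / 2) ∈ 𝓝 t₀ := Icc_mem_nhds (by linarith) (by linarith)
  obtain ⟨M, hM⟩ := ((isCompact_Icc (a := t₀ - δ / 2) (b := t₀ + δ / 2)).prod
    (isCompact_Icc (a := a) (b := b))).exists_bound_of_continuousOn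
      (hH'.mono (prod_mono_left hsub))
  have slice : ∀ {H : ℝ → ℝ → ℝ}, ContinuousOn (fun z : ℝ × ℝ => H z.1 z.2) (I ×ˢ Icc a b) →
      ∀ t ∈ I, ContinuousOn (fun s => H t s) (Icc a b) := fun hH t ht =>
    hH.comp (f := fun s => (t, s)) (by fun_prop) fun s hs => ⟨ht, hs⟩
  have hIoc : uIoc a b ⊆ Icc a b := by rw [uIoc_of_le hab]; exact Ioc_subset_Icc_self
  refine (intervalIntegral.hasDerivAt_integral_of_dominated_loc_of_deriv_le
    (F := H) (F' := H') (μ := volume) (bound := fun _ => M) hnb ?_ ?_ ?_ ?_ ?_ ?_).2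
  · filter_upwards [hnb] with t ht
    exact ((slice hH t (hsub ht)).mono hIoc).aestronglyMeasurable measurableSet_uIoc
  · exact ContinuousOn.intervalIntegrable (by rw [uIcc_of_le hab]; exact slice hH t₀ ht₀)
  · exact ((slice hH' t₀ ht₀).mono hIoc).aestronglyMeasurable measurableSet_uIoc
  · exact Eventually.of_forall fun s hs t ht => hM (t, s) ⟨ht, hIoc hs⟩
  · exact intervalIntegrable_const
  · exact Eventually.of_forall fun s hs t ht => hd t (hsub ht) s (hIoc hs)

lemma integral_rescale (f : ℝ → ℝ) (b c : ℝ) :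
    ∫ y in b..c, f y = (c - b) * ∫ s in (0 : ℝ)..1, f ((c - b) * s + b) := by
  rw [intervalIntegral.mul_integral_comp_mul_add]
  simp

/-- Leibniz rule over a region between two graphs, for a function differentiable up to the boundary
of the region. -/
lemma hasDerivAt_integral_piece {P : Set (ℝ × ℝ)} {f f1 f2 : ℝ × ℝ → ℝ}
    (hf : ∀ z ∈ P, HasFDerivWithinAt f (planeForm (f1 z) (f2 z)) P z)
    (c1 : ContinuousOn f1 P) (c2 : ContinuousOn f2 P) {I : Set ℝ} (hI : IsOpen I) {b c : ℝ → ℝ}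
    {b₁ c₁ : ℝ} (hb : ∀ x, HasDerivAt b b₁ x) (hc : ∀ x, HasDerivAt c c₁ x)
    (hbc : ∀ x ∈ I, b x ≤ c x) (hP : ∀ x ∈ I, ∀ y ∈ Icc (b x) (c x), (x, y) ∈ P) {x : ℝ}
    (hx : x ∈ I) :
    HasDerivAt (fun x => ∫ y in (b x)..(c x), f (x, y))
      (c₁ * f (x, c x) - b₁ * f (x, b x) + ∫ y in (b x)..(c x), f1 (x, y)) x := by
  have hbC : Continuous b := continuous_iff_continuousAt.2 fun x => (hb x).continuousAt
  have hcC : Continuous c := continuous_iff_continuousAt.2 fun x => (hc x).continuousAt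
  have hmem : ∀ x ∈ I, ∀ s ∈ Icc (0 : ℝ) 1, (x, (c x - b x) * s + b x) ∈ P := by
    intro x hx s hs
    have h0 : 0 ≤ c x - b x := by linarith [hbc x hx]
    have h1 := mul_nonneg h0 hs.1
    have h2 := mul_le_of_le_one_right h0 hs.2
    exact hP x hx _ ⟨by linarith, by linarith⟩
  have hfc : ContinuousOn f P := fun z hz => (hf z hz).continuousWithinAt
  have hmaps : MapsTo (fun z : ℝ × ℝ => (z.1, (c z.1 - b z.1) * z.2 + b z.1)) (I ×ˢ Icc 0 1) P :=
    fun z hz => hmem z.1 hz.1 z.2 hz.2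
  have hcomp : ∀ {h : ℝ × ℝ → ℝ}, ContinuousOn h P →
      ContinuousOn (fun z : ℝ × ℝ => h (z.1, (c z.1 - b z.1) * z.2 + b z.1)) (I ×ˢ Icc 0 1) :=
    fun hh => hh.comp (by fun_prop) hmaps
  -- The section is rescaled to `[0, 1]`. The domain of integration is then fixed and `f` is
  -- evaluated only inside `P`.
  have hpar := hasDerivAt_integral_param_on (H := fun x s => f (x, (c x - b x) * s + b x))
    (H' := fun x s => f1 (x, (c x - b x) * s + b x) +
      f2 (x, (c x - b x) * s + b x) * ((c₁ - b₁) * s + b₁)) hI zero_le_one (hcomp hfc)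
    ((hcomp c1).add ((hcomp c2).mul (by fun_prop))) (fun t ht s hs => by
      have h1 : HasDerivAt (fun t => (t, (c t - b t) * s + b t)) ((1 : ℝ), (c₁ - b₁) * s + b₁) t :=
        (hasDerivAt_id t).prodMk ((((hc t).sub (hb t)).mul_const s).add (hb t))
      have h2 := (hf _ (hmem t ht s hs)).comp_hasDerivWithinAt t (h1.hasDerivWithinAt (s := I))
        (fun t' ht' => hmem t' ht' s hs)
      refine (h2.hasDerivAt (hI.mem_nhds ht)).congr_deriv ?_
      simp) hx
  have hprod := ((hc x).sub (hb x)).mul hpar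
  have e : (fun x => ∫ y in (b x)..(c x), f (x, y)) = fun x => (c x - b x) *
      ∫ s in (0 : ℝ)..1, f (x, (c x - b x) * s + b x) := by
    ext x; exact integral_rescale (fun y => f (x, y)) _ _
  rw [e]
  refine hprod.congr_deriv ?_
  have slice : ∀ {h : ℝ × ℝ → ℝ}, ContinuousOn h P →
      ContinuousOn (fun s : ℝ => h (x, (c x - b x) * s + b x)) (Icc 0 1) := fun hh =>
    hh.comp (by fun_prop) fun s hs => hmem x hx s hs
  have ii : ∀ {h : ℝ → ℝ}, ContinuousOn h (Icc 0 1) → IntervalIntegrable h volume 0 1 := fun hh =>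
    ContinuousOn.intervalIntegrable (by rwa [uIcc_of_le zero_le_one])
  -- The terms created by the moving section form an exact derivative in `s`; its end values are the
  -- boundary terms of the Leibniz rule.
  have hft := intervalIntegral.integral_eq_sub_of_hasDerivAt_of_le (a := (0 : ℝ)) (b := 1)
    (f := fun s => ((c₁ - b₁) * s + b₁) * f (x, (c x - b x) * s + b x))
    (f' := fun s => (c₁ - b₁) * f (x, (c x - b x) * s + b x) +
      ((c₁ - b₁) * s + b₁) * (f2 (x, (c x - b x) * s + b x) * (c x - b x))) zero_le_one
    (ContinuousOn.mul (by fun_prop) (slice hfc)) (fun s hs => by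
      have h1 : HasDerivAt (fun s : ℝ => (x, (c x - b x) * s + b x)) ((0 : ℝ), c x - b x) s :=
        (hasDerivAt_const s x).prodMk
          ((((hasDerivAt_id s).const_mul (c x - b x)).add_const (b x)).congr_deriv (by ring))
      have h2 := ((hf _ (hmem x hx s ⟨hs.1.le, hs.2.le⟩)).comp_hasDerivWithinAt s
        (h1.hasDerivWithinAt (s := Icc 0 1)) (fun s' hs' => hmem x hx s' hs')).hasDerivAt
        (Icc_mem_nhds hs.1 hs.2)
      have h3 : HasDerivAt (fun s : ℝ => (c₁ - b₁) * s + b₁) (c₁ - b₁) s :=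
        (((hasDerivAt_id s).const_mul (c₁ - b₁)).add_const b₁).congr_deriv (by ring)
      refine (h3.mul h2).congr_deriv ?_
      simp)
    (ii (((slice hfc).const_mul _).add (ContinuousOn.mul (by fun_prop) ((slice c2).mul_const _))))
  rw [integral_rescale (fun y => f1 (x, y))]
  have i2 : IntervalIntegrable (fun s => f2 (x, (c x - b x) * s + b x) * ((c₁ - b₁) * s + b₁))
      volume 0 1 := ii ((slice c2).mul (by fun_prop))
  have i3 : IntervalIntegrable (fun s => ((c₁ - b₁) * s + b₁) *
      (f2 (x, (c x - b x) * s + b x) * (c x - b x))) volume 0 1 :=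
    ii (ContinuousOn.mul (by fun_prop) ((slice c2).mul_const _))
  have s1 := intervalIntegral.integral_add (ii (slice c1)) i2
  have s2 := intervalIntegral.integral_add (ii ((slice hfc).const_mul (c₁ - b₁))) i3
  have s3 : ∫ s in (0 : ℝ)..1, ((c₁ - b₁) * s + b₁) * (f2 (x, (c x - b x) * s + b x) * (c x - b x)) =
      (c x - b x) * ∫ s in (0 : ℝ)..1, f2 (x, (c x - b x) * s + b x) * ((c₁ - b₁) * s + b₁) := by
    rw [← intervalIntegral.integral_const_mul]
    congr 1; ext s; ring
  rw [s2, s3, intervalIntegral.integral_const_mul] at hft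
  rw [s1, Pi.sub_apply]
  simp only [mul_zero, zero_add, mul_one, sub_add_cancel] at hft
  linarith [hft]

/-- A function with two continuous derivatives on `P`, up to the boundary. -/
structure HasPartials (P : Set (ℝ × ℝ)) (k k1 k2 : ℝ × ℝ → ℝ) : Prop where
  deriv : ∀ z ∈ P, HasFDerivWithinAt k (planeForm (k1 z) (k2 z)) P z
  cont1 : ContinuousOn k1 P
  cont2 : ContinuousOn k2 P

lemma HasPartials.cont {P : Set (ℝ × ℝ)} {k k1 k2 : ℝ × ℝ → ℝ} (h : HasPartials P k k1 k2) :
    ContinuousOn k P := fun z hz => (h.deriv z hz).continuousWithinAt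

/-- A function on `[0, 1]` with continuous first derivative. -/
structure HasDerivIcc (φ φ' : ℝ → ℝ) : Prop where
  deriv : ∀ y ∈ Icc (0 : ℝ) 1, HasDerivWithinAt φ (φ' y) (Icc 0 1) y
  cont : ContinuousOn φ' (Icc 0 1)

lemma HasDerivIcc.cont_fun {φ φ' : ℝ → ℝ} (h : HasDerivIcc φ φ') : ContinuousOn φ (Icc 0 1) :=
  fun y hy => (h.deriv y hy).continuousWithinAt

lemma HasPartials.mul_snd {P : Set (ℝ × ℝ)} {k k1 k2 : ℝ × ℝ → ℝ} (h : HasPartials P k k1 k2)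
    {φ φ' : ℝ → ℝ} (hφ : HasDerivIcc φ φ') (hP : ∀ z ∈ P, z.2 ∈ Icc (0 : ℝ) 1) :
    HasPartials P (fun z => k z * φ z.2) (fun z => k1 z * φ z.2)
      (fun z => k2 z * φ z.2 + k z * φ' z.2) where
  deriv z hz := by
    have h1 := h.deriv z hz
    have h2 : HasFDerivWithinAt (fun z : ℝ × ℝ => φ z.2) (planeForm 0 (φ' z.2)) P z := by
      have := (hφ.deriv z.2 (hP z hz)).hasFDerivWithinAt.comp z
        (hasFDerivAt_snd (𝕜 := ℝ) (p := z)).hasFDerivWithinAt (s := P) (fun w hw => hP w hw)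
      refine this.congr_fderiv ?_
      ext <;> simp
    refine (h1.mul h2).congr_fderiv ?_
    ext <;> simp <;> ring
  cont1 := h.cont1.mul (hφ.cont_fun.comp (by fun_prop) hP)
  cont2 := (h.cont2.mul (hφ.cont_fun.comp (by fun_prop) hP)).add
    (h.cont.mul (hφ.cont.comp (by fun_prop) hP))

/-- Two integrations by parts in a vertical section. -/
lemma integral_mul_second_deriv {P : Set (ℝ × ℝ)} {k k1 k2 k21 k22 : ℝ × ℝ → ℝ}
    (hk : HasPartials P k k1 k2) (hk2 : HasPartials P k2 k21 k22) {φ φ' φ'' : ℝ → ℝ}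
    (hφ : HasDerivIcc φ φ') (hφ' : HasDerivIcc φ' φ'') {x b c : ℝ} (hbc : b ≤ c)
    (hP : ∀ y ∈ Icc b c, (x, y) ∈ P) (hI : Icc b c ⊆ Icc 0 1) :
    ∫ y in b..c, k (x, y) * φ'' y = (k (x, c) * φ' c - k2 (x, c) * φ c) -
      (k (x, b) * φ' b - k2 (x, b) * φ b) + ∫ y in b..c, k22 (x, y) * φ y := by
  have sl : ∀ {h : ℝ × ℝ → ℝ}, ContinuousOn h P → ContinuousOn (fun y => h (x, y)) (Icc b c) :=
    fun hh => hh.comp (by fun_prop) hP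
  have ii : ∀ {h : ℝ → ℝ}, ContinuousOn h (Icc b c) → IntervalIntegrable h volume b c := fun hh =>
    ContinuousOn.intervalIntegrable (by rwa [uIcc_of_le hbc])
  have dk : ∀ {f f1 f2 : ℝ × ℝ → ℝ}, HasPartials P f f1 f2 → ∀ y ∈ Ioo b c,
      HasDerivAt (fun y => f (x, y)) (f2 (x, y)) y := by
    intro f f1 f2 hf y hy
    have h1 : HasDerivAt (fun s : ℝ => (x, s)) ((0 : ℝ), (1 : ℝ)) y :=
      (hasDerivAt_const y x).prodMk (hasDerivAt_id y)
    have h2 := ((hf.deriv _ (hP y ⟨hy.1.le, hy.2.le⟩)).comp_hasDerivWithinAt y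
      (h1.hasDerivWithinAt (s := Icc b c)) hP).hasDerivAt (Icc_mem_nhds hy.1 hy.2)
    exact h2.congr_deriv (by simp)
  have dφ : ∀ {f f' : ℝ → ℝ}, HasDerivIcc f f' → ∀ y ∈ Ioo b c, HasDerivAt f (f' y) y := by
    intro f f' hf y hy
    exact ((hf.deriv y (hI ⟨hy.1.le, hy.2.le⟩)).mono hI).hasDerivAt (Icc_mem_nhds hy.1 hy.2)
  have i1 : IntervalIntegrable (fun y => k (x, y) * φ'' y) volume b c :=
    ii ((sl hk.cont).mul (hφ'.cont.mono hI))
  have i2 : IntervalIntegrable (fun y => k22 (x, y) * φ y) volume b c :=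
    ii ((sl hk2.cont2).mul (hφ.cont_fun.mono hI))
  have := intervalIntegral.integral_eq_sub_of_hasDerivAt_of_le hbc
    (f := fun y => k (x, y) * φ' y - k2 (x, y) * φ y)
    (f' := fun y => k (x, y) * φ'' y - k22 (x, y) * φ y)
    (((sl hk.cont).mul (hφ.cont.mono hI)).sub ((sl hk.cont2).mul (hφ.cont_fun.mono hI)))
    (fun y hy => (((dk hk y hy).mul (dφ hφ' y hy)).sub ((dk hk2 y hy).mul (dφ hφ y hy))).congr_deriv
      (by ring)) (i1.sub i2)
  rw [intervalIntegral.integral_sub i1 i2] at this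
  linarith

/-- Second order Leibniz rule over a region between two graphs, for a kernel satisfying
`e₁ ∂ₓ² k - e₂ ∂_y² k = s`. -/
lemma piece_second_deriv {P : Set (ℝ × ℝ)} {k k1 k2 k11 k12 k21 k22 s : ℝ × ℝ → ℝ}
    (hk : HasPartials P k k1 k2) (hk1 : HasPartials P k1 k11 k12) (hk2 : HasPartials P k2 k21 k22)
    (hP01 : ∀ z ∈ P, z.2 ∈ Icc (0 : ℝ) 1) {φ φ' φ'' : ℝ → ℝ} (hφ : HasDerivIcc φ φ')
    (hφ' : HasDerivIcc φ' φ'') {I : Set ℝ} (hI : IsOpen I) {b c : ℝ → ℝ} {b₁ c₁ : ℝ}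
    (hb : ∀ x, HasDerivAt b b₁ x) (hc : ∀ x, HasDerivAt c c₁ x)
    (hbc : ∀ x ∈ I, b x ≤ c x) (hP : ∀ x ∈ I, ∀ y ∈ Icc (b x) (c x), (x, y) ∈ P) {e₁ e₂ x : ℝ}
    (hx : x ∈ I) (hs : ∀ y ∈ Ioo (b x) (c x), e₁ * k11 (x, y) - e₂ * k22 (x, y) = s (x, y)) :
    HasDerivAt (fun x => ∫ y in (b x)..(c x), k (x, y) * φ y)
      (c₁ * (k (x, c x) * φ (c x)) - b₁ * (k (x, b x) * φ (b x)) +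
        ∫ y in (b x)..(c x), k1 (x, y) * φ y) x ∧
    ∃ D, HasDerivAt (fun x => ∫ y in (b x)..(c x), k1 (x, y) * φ y) D x ∧
      e₁ * D - e₂ * ∫ y in (b x)..(c x), k (x, y) * φ'' y =
        (∫ y in (b x)..(c x), s (x, y) * φ y) +
        (e₁ * c₁ * k1 (x, c x) * φ (c x) + e₂ * k2 (x, c x) * φ (c x) -
          e₂ * k (x, c x) * φ' (c x)) -
        (e₁ * b₁ * k1 (x, b x) * φ (b x) + e₂ * k2 (x, b x) * φ (b x) -
          e₂ * k (x, b x) * φ' (b x)) := by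
  have p0 := hk.mul_snd hφ hP01
  have p1 := hk1.mul_snd hφ hP01
  refine ⟨hasDerivAt_integral_piece p0.deriv p0.cont1 p0.cont2 hI hb hc hbc hP hx, _,
    hasDerivAt_integral_piece p1.deriv p1.cont1 p1.cont2 hI hb hc hbc hP hx, ?_⟩
  have hsub : Icc (b x) (c x) ⊆ Icc 0 1 := fun y hy => hP01 _ (hP x hx y hy)
  rw [integral_mul_second_deriv hk hk2 hφ hφ' (hbc x hx) (hP x hx) hsub]
  have sl : ∀ {h : ℝ × ℝ → ℝ}, ContinuousOn h P →
      ContinuousOn (fun y => h (x, y)) (Icc (b x) (c x)) :=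
    fun hh => hh.comp (by fun_prop) (hP x hx)
  have ii : ∀ {h : ℝ → ℝ}, ContinuousOn h (Icc (b x) (c x)) →
      IntervalIntegrable h volume (b x) (c x) := fun hh =>
    ContinuousOn.intervalIntegrable (by rwa [uIcc_of_le (hbc x hx)])
  have i1 : IntervalIntegrable (fun y => k11 (x, y) * φ y) volume (b x) (c x) :=
    ii ((sl hk1.cont1).mul (hφ.cont_fun.mono hsub))
  have i2 : IntervalIntegrable (fun y => k22 (x, y) * φ y) volume (b x) (c x) :=
    ii ((sl hk2.cont2).mul (hφ.cont_fun.mono hsub))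
  have key : e₁ * (∫ y in (b x)..(c x), k11 (x, y) * φ y) -
      e₂ * (∫ y in (b x)..(c x), k22 (x, y) * φ y) = ∫ y in (b x)..(c x), s (x, y) * φ y := by
    rw [← intervalIntegral.integral_const_mul, ← intervalIntegral.integral_const_mul,
      ← intervalIntegral.integral_sub (i1.const_mul _) (i2.const_mul _)]
    refine intervalIntegral.integral_congr_Ioo_of_le (hbc x hx) fun y hy => ?_
    rw [← hs y hy]; ring
  linear_combination key

/-! ### Derivatives relative to pieces cut out by lines. -/

lemma hasPartials_of_contDiffOn {P : Set (ℝ × ℝ)} {f : ℝ → ℝ → ℝ}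
    (h : ContDiffOn ℝ 1 (fun z : ℝ × ℝ => f z.1 z.2) P) (hP : UniqueDiffOn ℝ P) :
    HasPartials P (fun z => f z.1 z.2) (fun z => dX P f z.1 z.2) (fun z => dY P f z.1 z.2) := by
  have hc : ContinuousOn (fderivWithin ℝ (fun z : ℝ × ℝ => f z.1 z.2) P) P :=
    h.continuousOn_fderivWithin hP le_rfl
  refine ⟨fun z hz => ?_, hc.clm_apply continuousOn_const, hc.clm_apply continuousOn_const⟩
  have := ((h.differentiableOn one_ne_zero) z hz).hasFDerivWithinAt
  rwa [eq_planeForm (fderivWithin ℝ (fun z : ℝ × ℝ => f z.1 z.2) P z)] at this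

lemma C2On.contDiffOn_dX {P : Set (ℝ × ℝ)} {f : ℝ → ℝ → ℝ} (h : C2On f P)
    (hP : UniqueDiffOn ℝ P) : ContDiffOn ℝ 1 (fun z : ℝ × ℝ => dX P f z.1 z.2) P :=
  (h.fderivWithin (m := 1) hP (by norm_num)).clm_apply contDiffOn_const

lemma C2On.contDiffOn_dY {P : Set (ℝ × ℝ)} {f : ℝ → ℝ → ℝ} (h : C2On f P)
    (hP : UniqueDiffOn ℝ P) : ContDiffOn ℝ 1 (fun z : ℝ × ℝ => dY P f z.1 z.2) P :=
  (h.fderivWithin (m := 1) hP (by norm_num)).clm_apply contDiffOn_const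

/-- Away from the separating lines a piece coincides near the point with the whole triangle. The
equations, stated with derivatives relative to the triangle, thereby hold with those relative to the
piece. -/
lemma dX_congr_set {P S : Set (ℝ × ℝ)} {f : ℝ → ℝ → ℝ} {x y : ℝ} (h : P =ᶠ[𝓝 (x, y)] S) :
    dX P f x y = dX S f x y := by
  unfold dX; rw [fderivWithin_congr_set h]

lemma dY_congr_set {P S : Set (ℝ × ℝ)} {f : ℝ → ℝ → ℝ} {x y : ℝ} (h : P =ᶠ[𝓝 (x, y)] S) :
    dY P f x y = dY S f x y := by
  unfold dY; rw [fderivWithin_congr_set h]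

lemma dX_dX_congr_set {P S : Set (ℝ × ℝ)} {f : ℝ → ℝ → ℝ} {x y : ℝ} (h : P =ᶠ[𝓝 (x, y)] S) :
    dX P (dX P f) x y = dX S (dX S f) x y := by
  have : (fun z : ℝ × ℝ => dX P f z.1 z.2) =ᶠ[𝓝 (x, y)] fun z => dX S f z.1 z.2 := by
    filter_upwards [h.eventuallyEq_nhds] with z hz
    exact dX_congr_set hz
  rw [dX_congr_set h]
  unfold dX at this ⊢
  rw [this.fderivWithin_eq_of_nhds]

lemma dY_dY_congr_set {P S : Set (ℝ × ℝ)} {f : ℝ → ℝ → ℝ} {x y : ℝ} (h : P =ᶠ[𝓝 (x, y)] S) :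
    dY P (dY P f) x y = dY S (dY S f) x y := by
  have : (fun z : ℝ × ℝ => dY P f z.1 z.2) =ᶠ[𝓝 (x, y)] fun z => dY S f z.1 z.2 := by
    filter_upwards [h.eventuallyEq_nhds] with z hz
    exact dY_congr_set hz
  rw [dY_congr_set h]
  unfold dY at this ⊢
  rw [this.fderivWithin_eq_of_nhds]

/-- Closed convex sets with interior points. -/
structure ConvexRegion (A : Set (ℝ × ℝ)) : Prop where
  convex : Convex ℝ A
  closed : IsClosed A
  interior : (interior A).Nonempty

lemma ConvexRegion.uniqueDiffOn {A : Set (ℝ × ℝ)} (h : ConvexRegion A) : UniqueDiffOn ℝ A :=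
  uniqueDiffOn_convex h.convex h.interior

lemma isClosed_triL : IsClosed triL := by
  have : triL = {z : ℝ × ℝ | 0 ≤ z.2} ∩ ({z | z.2 ≤ z.1} ∩ {z | z.1 ≤ 1}) := by ext z; rfl
  rw [this]
  exact (isClosed_le (by fun_prop) (by fun_prop)).inter ((isClosed_le (by fun_prop)
    (by fun_prop)).inter (isClosed_le (by fun_prop) (by fun_prop)))

lemma isClosed_triU : IsClosed triU := by
  have : triU = {z : ℝ × ℝ | 0 ≤ z.1} ∩ ({z | z.1 ≤ z.2} ∩ {z | z.2 ≤ 1}) := by ext z; rfl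
  rw [this]
  exact (isClosed_le (by fun_prop) (by fun_prop)).inter ((isClosed_le (by fun_prop)
    (by fun_prop)).inter (isClosed_le (by fun_prop) (by fun_prop)))

/-- The part of a set cut off by a closed half-plane. -/
lemma ConvexRegion.sep {S A : Set (ℝ × ℝ)} (hS : Convex ℝ S) (hc : IsClosed S) {p q r : ℝ}
    (hA : ∀ z, z ∈ A ↔ z ∈ S ∧ 0 ≤ p * z.1 + q * z.2 + r) {z₀ : ℝ × ℝ} (h0 : S ∈ 𝓝 z₀)
    (h1 : 0 < p * z₀.1 + q * z₀.2 + r) : ConvexRegion A := by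
  have e : A = S ∩ {z | 0 ≤ p * z.1 + q * z.2 + r} := by ext z; exact hA z
  refine ⟨?_, ?_, z₀, mem_interior_iff_mem_nhds.2 ?_⟩
  · rintro x hx y hy s t hs ht hst
    rw [hA] at *
    refine ⟨hS hx.1 hy.1 hs ht hst, ?_⟩
    have := mul_nonneg hs hx.2
    have := mul_nonneg ht hy.2
    simp only [Prod.fst_add, Prod.smul_fst, Prod.snd_add, Prod.smul_snd, smul_eq_mul]
    have e : r = s * r + t * r := by rw [← add_mul, hst, one_mul]
    rw [e]; linarith
  · rw [e]
    exact hc.inter (isClosed_le (by fun_prop) (by fun_prop))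
  · rw [e]
    have hcont : Continuous fun z : ℝ × ℝ => p * z.1 + q * z.2 + r := by fun_prop
    exact inter_mem h0 (mem_of_superset (continuousAt_const.eventually_lt hcont.continuousAt h1)
      fun z hz => by rw [mem_ofPred_eq]; exact le_of_lt hz)

lemma eventuallyEq_set_of_sep {S A : Set (ℝ × ℝ)} {p q r : ℝ}
    (hA : ∀ z, z ∈ A ↔ z ∈ S ∧ 0 ≤ p * z.1 + q * z.2 + r) {z₀ : ℝ × ℝ}
    (h1 : 0 < p * z₀.1 + q * z₀.2 + r) : A =ᶠ[𝓝 z₀] S := by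
  have hcont : Continuous fun z : ℝ × ℝ => p * z.1 + q * z.2 + r := by fun_prop
  filter_upwards [continuousAt_const.eventually_lt hcont.continuousAt h1] with z hz
  exact propext ((hA z).trans (and_iff_left hz.le))

/-- A continuous function whose derivative off a countable set extends continuously is the integral
of that extension. This passes over the abscissae where the arrangement of pieces changes, and over
the endpoints of the interval. -/
lemma hasDerivIcc_of_off_countable {f f' : ℝ → ℝ} {s : Set ℝ} (hs : s.Countable)
    (hf : ContinuousOn f (Icc 0 1)) (hf' : ContinuousOn f' (Icc 0 1))
    (h : ∀ x ∈ Ioo (0 : ℝ) 1, x ∉ s → HasDerivAt f (f' x) x) : HasDerivIcc f f' := by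
  obtain ⟨g, hg, hgf⟩ := exists_continuous_extension isClosed_Icc hf'
  have e : ∀ x ∈ Icc (0 : ℝ) 1, f x = f 0 + ∫ t in (0 : ℝ)..x, g t := by
    intro x hx
    have := MeasureTheory.integral_eq_of_hasDerivAt_off_countable_of_le f g hx.1 hs
      (hf.mono (Icc_subset_Icc_right hx.2)) (fun t ht => by
        have ht' : t ∈ Ioo (0 : ℝ) 1 := ⟨ht.1.1, ht.1.2.trans_le hx.2⟩
        rw [hgf ⟨ht'.1.le, ht'.2.le⟩]
        exact h t ht' ht.2) (hg.intervalIntegrable _ _)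
    linarith
  refine ⟨fun y hy => ?_, hf'⟩
  have := ((hasDerivAt_integral_upper hg 0 y).const_add (f 0)).hasDerivWithinAt (s := Icc 0 1)
  rw [hgf hy] at this
  exact this.congr e (e y hy)

lemma continuousOn_integral_region {P : Set (ℝ × ℝ)} (hP : IsClosed P) {h : ℝ × ℝ → ℝ}
    (hh : ContinuousOn h P) {φ : ℝ → ℝ} (hφ : ContinuousOn φ (Icc 0 1)) {b c : ℝ → ℝ}
    (hb : Continuous b) (hc : Continuous c)
    (hbc : ∀ x ∈ Icc (0 : ℝ) 1, b x ≤ c x ∧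
      ∀ y ∈ Ioo (b x) (c x), (x, y) ∈ P ∧ y ∈ Icc (0 : ℝ) 1) :
    ContinuousOn (fun x => ∫ y in (b x)..(c x), h (x, y) * φ y) (Icc 0 1) := by
  obtain ⟨H, hH, hHh⟩ := exists_continuous_extension hP hh
  obtain ⟨Φ, hΦ, hΦφ⟩ := exists_continuous_extension isClosed_Icc hφ
  have : Continuous fun x => ∫ y in (b x)..(c x), H (x, y) * Φ y :=
    continuous_integral_param (H := fun z => H z * Φ z.2) (by fun_prop) continuous_id hb hc
  refine this.continuousOn.congr fun x hx => ?_
  refine intervalIntegral.integral_congr_Ioo_of_le (hbc x hx).1 fun y hy => ?_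
  have := (hbc x hx).2 y hy
  rw [hHh this.1, hΦφ this.2]

lemma triL_snd_mem {z : ℝ × ℝ} (hz : z ∈ triL) : z.2 ∈ Icc (0 : ℝ) 1 :=
  ⟨hz.1, hz.2.1.trans hz.2.2⟩

lemma triU_snd_mem {z : ℝ × ℝ} (hz : z ∈ triU) : z.2 ∈ Icc (0 : ℝ) 1 :=
  ⟨hz.1.trans hz.2.1, hz.2.2⟩

/-! ### The second-order Leibniz rule for Volterra integrals. -/

/-- The conclusion on Volterra integrals `∫₀ˣ k(x,y) φ(y) dy` of a kernel with
`e₁ ∂ₓ² k - e₂ ∂_y² k = s`: second order Leibniz rule with its boundary terms. -/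
def VolterraLeibniz (e₁ e₂ : ℝ) (k s : ℝ → ℝ → ℝ) (φ φ' φ'' : ℝ → ℝ) : Prop :=
  ∃ D : ℝ → ℝ, ContinuousOn D (Icc 0 1) ∧ D 0 = 0 ∧ ∀ x ∈ Ioo (0 : ℝ) 1,
    HasDerivAt (fun x => ∫ y in (0 : ℝ)..x, k x y * φ y) (k x x * φ x + D x) x ∧
    ∃ D₂, HasDerivAt D D₂ x ∧
      e₁ * D₂ - e₂ * ∫ y in (0 : ℝ)..x, k x y * φ'' y = (∫ y in (0 : ℝ)..x, s x y * φ y) +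
        (e₁ * dX triL k x x * φ x + e₂ * dY triL k x x * φ x - e₂ * k x x * φ' x) -
        (e₂ * dY triL k x 0 * φ 0 - e₂ * k x 0 * φ' 0)

lemma volterraLeibniz_of_C2On {e₁ e₂ : ℝ} {k s : ℝ → ℝ → ℝ} (hk : C2On k triL)
    (hs : ∀ x y, 0 < y → y < x → x < 1 →
      e₁ * dX triL (dX triL k) x y - e₂ * dY triL (dY triL k) x y = s x y)
    {φ φ' φ'' : ℝ → ℝ} (hφ : HasDerivIcc φ φ') (hφ' : HasDerivIcc φ' φ'') :
    VolterraLeibniz e₁ e₂ k s φ φ' φ'' := by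
  have hu := uniqueDiffOn_triL
  have p0 := hasPartials_of_contDiffOn (hk.of_le (by norm_num)) hu
  have p1 := hasPartials_of_contDiffOn (hk.contDiffOn_dX hu) hu
  have p2 := hasPartials_of_contDiffOn (hk.contDiffOn_dY hu) hu
  refine ⟨fun x => ∫ y in (0 : ℝ)..x, dX triL k x y * φ y, ?_, by simp, fun x hx => ?_⟩
  · exact continuousOn_integral_region isClosed_triL p0.cont1 hφ.cont_fun continuous_const
      continuous_id fun x hx => ⟨hx.1, fun y hy => ⟨⟨hy.1.le, hy.2.le, hx.2⟩, hy.1.le,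
        hy.2.le.trans hx.2⟩⟩
  · obtain ⟨h1, D, h2, h3⟩ := piece_second_deriv p0 p1 p2 (fun z hz => triL_snd_mem hz) hφ hφ'
      (I := Ioo 0 1) isOpen_Ioo (b := fun _ => 0) (c := fun x => x) (b₁ := 0) (c₁ := 1)
      (fun x => hasDerivAt_const x 0) (fun x => hasDerivAt_id x) (fun x hx => hx.1.le)
      (fun x hx y hy => ⟨hy.1, hy.2, hx.2.le⟩) (e₁ := e₁) (e₂ := e₂) (s := fun z => s z.1 z.2) hx
      (fun y hy => hs x y hy.1 hy.2 hx.2)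
    refine ⟨h1.congr_deriv (by ring), D, h2, ?_⟩
    rw [h3]; ring

lemma HasPartials.hasDerivAt_line {P : Set (ℝ × ℝ)} {k k1 k2 : ℝ × ℝ → ℝ}
    (h : HasPartials P k k1 k2) {I : Set ℝ} (hI : IsOpen I) {e : ℝ → ℝ} {e₁ x : ℝ}
    (he : HasDerivAt e e₁ x) (hmem : ∀ t ∈ I, (t, e t) ∈ P) (hx : x ∈ I) :
    HasDerivAt (fun t => k (t, e t)) (k1 (x, e x) + k2 (x, e x) * e₁) x := by
  have h1 : HasDerivAt (fun t => (t, e t)) ((1 : ℝ), e₁) x := (hasDerivAt_id x).prodMk he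
  have h2 := (h.deriv _ (hmem x hx)).comp_hasDerivWithinAt x (h1.hasDerivWithinAt (s := I)) hmem
  refine (h2.hasDerivAt (hI.mem_nhds hx)).congr_deriv ?_
  simp

/-- Derivatives along a common edge of two regions agree. -/
lemma HasPartials.edge_eq {P Q : Set (ℝ × ℝ)} {k k1 k2 l l1 l2 : ℝ × ℝ → ℝ}
    (hk : HasPartials P k k1 k2) (hl : HasPartials Q l l1 l2) {I : Set ℝ} (hI : IsOpen I)
    {e : ℝ → ℝ} {e₁ x : ℝ} (he : HasDerivAt e e₁ x) (hP : ∀ t ∈ I, (t, e t) ∈ P)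
    (hQ : ∀ t ∈ I, (t, e t) ∈ Q) (hkl : ∀ t ∈ I, k (t, e t) = l (t, e t)) (hx : x ∈ I) :
    k1 (x, e x) + k2 (x, e x) * e₁ = l1 (x, e x) + l2 (x, e x) * e₁ := by
  refine (hk.hasDerivAt_line hI he hP hx).unique
    ((hl.hasDerivAt_line hI he hQ hx).congr_of_eventuallyEq ?_)
  filter_upwards [hI.mem_nhds hx] with t ht using hkl t ht

lemma integral_split {f : ℝ → ℝ} {b m d : ℝ} (hf : ContinuousOn f (Icc b d)) (h1 : b ≤ m)
    (h2 : m ≤ d) : ∫ y in b..d, f y = (∫ y in b..m, f y) + ∫ y in m..d, f y := by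
  have i : IntervalIntegrable f volume b d :=
    ContinuousOn.intervalIntegrable (by rwa [uIcc_of_le (h1.trans h2)])
  refine (intervalIntegral.integral_add_adjacent_intervals (i.mono_set ?_) (i.mono_set ?_)).symm
  · rw [uIcc_of_le h1, uIcc_of_le (h1.trans h2)]; exact Icc_subset_Icc_right h2
  · rw [uIcc_of_le h2, uIcc_of_le (h1.trans h2)]; exact Icc_subset_Icc_left h1

lemma continuousOn_section_mul {P : Set (ℝ × ℝ)} {h : ℝ × ℝ → ℝ} (hh : ContinuousOn h P)
    {φ : ℝ → ℝ} (hφ : ContinuousOn φ (Icc 0 1)) {x b c : ℝ}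
    (hP : ∀ y ∈ Icc b c, (x, y) ∈ P ∧ y ∈ Icc (0 : ℝ) 1) :
    ContinuousOn (fun y => h (x, y) * φ y) (Icc b c) :=
  (hh.comp (f := fun y => (x, y)) (by fun_prop) fun y hy => (hP y hy).1).mul
    (hφ.mono fun y hy => (hP y hy).2)

/-- A kernel that is `C²` on either side of the characteristic line `y = a x`. -/
lemma volterraLeibniz_of_split {a e₁ e₂ : ℝ} (ha : 0 < a) (ha1 : a < 1) (he : e₂ = a ^ 2 * e₁)
    {k s : ℝ → ℝ → ℝ} (hk : ContinuousOn (fun z : ℝ × ℝ => k z.1 z.2) triL)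
    (hkL : C2On k {z ∈ triL | z.2 ≤ a * z.1}) (hkU : C2On k {z ∈ triL | a * z.1 ≤ z.2})
    (hsc : ContinuousOn (fun z : ℝ × ℝ => s z.1 z.2) triL)
    (hs : ∀ x y, 0 < y → y < x → x < 1 → y ≠ a * x →
      e₁ * dX triL (dX triL k) x y - e₂ * dY triL (dY triL k) x y = s x y)
    {φ φ' φ'' : ℝ → ℝ} (hφ : HasDerivIcc φ φ') (hφ' : HasDerivIcc φ' φ'') :
    VolterraLeibniz e₁ e₂ k s φ φ' φ'' := by
  set L : Set (ℝ × ℝ) := {z ∈ triL | z.2 ≤ a * z.1} with hL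
  set U : Set (ℝ × ℝ) := {z ∈ triL | a * z.1 ≤ z.2} with hU
  have memL : ∀ z, z ∈ L ↔ z ∈ triL ∧ 0 ≤ a * z.1 + (-1) * z.2 + 0 := fun z =>
    and_congr_right fun _ => by constructor <;> intro <;> linarith
  have memU : ∀ z, z ∈ U ↔ z ∈ triL ∧ 0 ≤ -a * z.1 + 1 * z.2 + 0 := fun z =>
    and_congr_right fun _ => by constructor <;> intro <;> linarith
  have RL : ConvexRegion L := ConvexRegion.sep convex_triL isClosed_triL memL (z₀ := (1 / 2, a / 4))
    (mem_nhds_triL (by positivity) (by linarith) (by norm_num)) (by simp only; linarith)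
  have RU : ConvexRegion U := ConvexRegion.sep convex_triL isClosed_triL memU
    (z₀ := (1 / 2, (1 + a) / 4))
    (mem_nhds_triL (by positivity) (by linarith) (by norm_num)) (by simp only; linarith)
  have hax : ∀ {x}, 0 ≤ x → a * x ≤ x := fun hx => mul_le_of_le_one_left hx ha1.le
  have inL : ∀ x y, x ∈ Icc (0 : ℝ) 1 → 0 ≤ y → y ≤ a * x → (x, y) ∈ L := fun x y hx h1 h2 =>
    ⟨⟨h1, h2.trans (hax hx.1), hx.2⟩, h2⟩
  have inU : ∀ x y, x ∈ Icc (0 : ℝ) 1 → a * x ≤ y → y ≤ x → (x, y) ∈ U := fun x y hx h1 h2 =>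
    ⟨⟨(mul_nonneg ha.le hx.1).trans h1, h2, hx.2⟩, h1⟩
  have p0 := hasPartials_of_contDiffOn (hkL.of_le (by norm_num)) RL.uniqueDiffOn
  have p1 := hasPartials_of_contDiffOn (hkL.contDiffOn_dX RL.uniqueDiffOn) RL.uniqueDiffOn
  have p2 := hasPartials_of_contDiffOn (hkL.contDiffOn_dY RL.uniqueDiffOn) RL.uniqueDiffOn
  have q0 := hasPartials_of_contDiffOn (hkU.of_le (by norm_num)) RU.uniqueDiffOn
  have q1 := hasPartials_of_contDiffOn (hkU.contDiffOn_dX RU.uniqueDiffOn) RU.uniqueDiffOn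
  have q2 := hasPartials_of_contDiffOn (hkU.contDiffOn_dY RU.uniqueDiffOn) RU.uniqueDiffOn
  have hda : ∀ x, HasDerivAt (fun x => a * x) a x := fun x =>
    ((hasDerivAt_id x).const_mul a).congr_deriv (mul_one a)
  refine ⟨fun x => (∫ y in (0 : ℝ)..(a * x), dX L k x y * φ y) + ∫ y in (a * x)..x, dX U k x y * φ y,
    ?_, by simp, fun x hx => ?_⟩
  · refine ContinuousOn.add ?_ ?_
    · exact continuousOn_integral_region RL.closed p0.cont1 hφ.cont_fun continuous_const
        (by fun_prop) fun x hx => ⟨mul_nonneg ha.le hx.1, fun y hy => ⟨inL x y hx hy.1.le hy.2.le,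
          hy.1.le, hy.2.le.trans ((hax hx.1).trans hx.2)⟩⟩
    · exact continuousOn_integral_region RU.closed q0.cont1 hφ.cont_fun (by fun_prop)
        continuous_id fun x hx => ⟨hax hx.1, fun y hy => ⟨inU x y hx hy.1.le hy.2.le,
          (mul_nonneg ha.le hx.1).trans hy.1.le, hy.2.le.trans hx.2⟩⟩
  have hx' : x ∈ Icc (0 : ℝ) 1 := ⟨hx.1.le, hx.2.le⟩
  have hax0 : 0 ≤ a * x := mul_nonneg ha.le hx.1.le
  obtain ⟨f1, DL, f2, f3⟩ := piece_second_deriv p0 p1 p2 (fun z hz => triL_snd_mem hz.1) hφ hφ'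
    (I := Ioo 0 1) isOpen_Ioo (b := fun _ => 0) (c := fun x => a * x) (b₁ := 0) (c₁ := a)
    (fun x => hasDerivAt_const x 0) hda (fun x hx => mul_nonneg ha.le hx.1.le)
    (fun x hx y hy => inL x y ⟨hx.1.le, hx.2.le⟩ hy.1 hy.2) (e₁ := e₁) (e₂ := e₂)
    (s := fun z => s z.1 z.2) hx (fun y hy => by
      have hyx := hy.2.trans_le (hax hx.1.le)
      have hn := eventuallyEq_set_of_sep memL (z₀ := (x, y)) (by simp only; linarith [hy.2])
      rw [← hs x y hy.1 hyx hx.2 hy.2.ne, ← dX_dX_congr_set hn, ← dY_dY_congr_set hn])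
  obtain ⟨g1, DU, g2, g3⟩ := piece_second_deriv q0 q1 q2 (fun z hz => triL_snd_mem hz.1) hφ hφ'
    (I := Ioo 0 1) isOpen_Ioo (b := fun x => a * x) (c := fun x => x) (b₁ := a) (c₁ := 1)
    hda (fun x => hasDerivAt_id x) (fun x hx => hax hx.1.le)
    (fun x hx y hy => inU x y ⟨hx.1.le, hx.2.le⟩ hy.1 hy.2) (e₁ := e₁) (e₂ := e₂)
    (s := fun z => s z.1 z.2) hx (fun y hy => by
      have hn := eventuallyEq_set_of_sep memU (z₀ := (x, y)) (by simp only; linarith [hy.1])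
      rw [← hs x y (hax0.trans_lt hy.1) hy.2 hx.2 hy.1.ne', ← dX_dX_congr_set hn,
        ← dY_dY_congr_set hn])
  have hsplit : ∀ {h : ℝ × ℝ → ℝ} {ψ : ℝ → ℝ}, ContinuousOn h triL → ContinuousOn ψ (Icc 0 1) →
      ∀ t ∈ Ioo (0 : ℝ) 1, ∫ y in (0 : ℝ)..t, h (t, y) * ψ y =
        (∫ y in (0 : ℝ)..(a * t), h (t, y) * ψ y) + ∫ y in (a * t)..t, h (t, y) * ψ y :=
    fun hh hψ t ht => integral_split (continuousOn_section_mul hh hψ fun y hy =>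
      ⟨⟨hy.1, hy.2, ht.2.le⟩, hy.1, hy.2.trans ht.2.le⟩) (mul_nonneg ha.le ht.1.le) (hax ht.1.le)
  refine ⟨((f1.add g1).congr_of_eventuallyEq ?_).congr_deriv ?_, _, f2.add g2, ?_⟩
  · filter_upwards [Ioo_mem_nhds hx.1 hx.2] with t ht
    exact hsplit hk hφ.cont_fun t ht
  · ring
  -- On `y = a x` each side leaves `e₁ a k_x + e₂ k_y = e₁ a (k_x + a k_y)`, a multiple of the
  -- derivative along the line because `e₂ = a² e₁`. As `k` is continuous, the two sides cancel.
  · have edge := p0.edge_eq q0 isOpen_Ioo (hda x) (I := Ioo 0 1)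
      (fun t ht => inL t _ ⟨ht.1.le, ht.2.le⟩ (mul_nonneg ha.le ht.1.le) le_rfl)
      (fun t ht => inU t _ ⟨ht.1.le, ht.2.le⟩ le_rfl (hax ht.1.le)) (fun _ _ => rfl) hx
    have d1 : dX triL k x x = dX U k x x := by
      refine (dX_congr_set (eventuallyEq_set_of_sep memU (z₀ := (x, x)) ?_)).symm
      have := mul_lt_of_lt_one_left hx.1 ha1
      simp only; linarith
    have d2 : dY triL k x x = dY U k x x := by
      refine (dY_congr_set (eventuallyEq_set_of_sep memU (z₀ := (x, x)) ?_)).symm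
      have := mul_lt_of_lt_one_left hx.1 ha1
      simp only; linarith
    have d3 : dY triL k x 0 = dY L k x 0 := by
      refine (dY_congr_set (eventuallyEq_set_of_sep memL (z₀ := (x, 0)) ?_)).symm
      have := mul_pos ha hx.1
      simp only; linarith
    have s1 := hsplit hk hφ'.cont x hx
    have s2 := hsplit hsc hφ.cont_fun x hx
    simp only at s1 s2 edge f3 g3
    rw [s1, s2, d1, d2, d3]
    subst he
    linear_combination f3 + g3 + e₁ * a * φ (a * x) * edge

/-! ### The second-order Leibniz rule for the second transformation. -/

/-- The second order Leibniz rule for `∫₀ˣ q(x,y) φ(y) dy + ∫ₓ¹ r(x,y) φ(y) dy`, with the boundary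
terms that remain after the interface conditions are used. -/
def FredholmLeibniz (e₁ e₂ : ℝ) (E : Set ℝ) (q r sq sr : ℝ → ℝ → ℝ) (g φ φ' φ'' : ℝ → ℝ) : Prop :=
  ∃ D : ℝ → ℝ, ContinuousOn D (Icc 0 1) ∧ D 0 = 0 ∧ ∀ x ∈ Ioo (0 : ℝ) 1, x ∉ E →
    HasDerivAt (fun x => (∫ y in (0 : ℝ)..x, q x y * φ y) + ∫ y in x..1, r x y * φ y) (D x) x ∧
    ∃ D₂, HasDerivAt D D₂ x ∧
      e₁ * D₂ - e₂ * ((∫ y in (0 : ℝ)..x, q x y * φ'' y) + ∫ y in x..1, r x y * φ'' y) =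
        (∫ y in (0 : ℝ)..x, sq x y * φ y) + (∫ y in x..1, sr x y * φ y) - g x * φ x -
        (e₂ * dY triL q x 0 * φ 0 - e₂ * q x 0 * φ' 0)

section

variable {ε y₀ c₁ c₂ : ℝ} {g p : ℝ → ℝ} {q r : ℝ → ℝ → ℝ} {φ φ' φ'' : ℝ → ℝ}

lemma continuousOn_secondSource (h : IsSecondKernel ε y₀ c₁ c₂ g p q r)
    (hg : ContinuousOn g (Icc 0 1)) :
    ContinuousOn (fun z : ℝ × ℝ => (c₂ - c₁) * q z.1 z.2 + g z.2 * p (z.1 - z.2)) triL := by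
  have hp : ContinuousOn p (Icc 0 1) := by
    refine ContinuousOn.congr (f := fun x => (aCoef y₀)⁻¹ * q x 0) ?_ fun x hx => h.p_eq x hx
    exact continuousOn_const.mul (h.cont_q.comp (f := fun x : ℝ => (x, (0 : ℝ))) (by fun_prop)
      fun x hx => ⟨le_rfl, hx.1, hx.2⟩)
  refine (continuousOn_const.mul h.cont_q).add ((hg.comp continuousOn_snd
    fun z hz => triL_snd_mem hz).mul (hp.comp (by fun_prop) fun z hz => ?_))
  exact ⟨by linarith [hz.2.1], by linarith [hz.1, hz.2.2]⟩

lemma triL_section_split {h : ℝ × ℝ → ℝ} {ψ : ℝ → ℝ} (hh : ContinuousOn h triL)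
    (hψ : ContinuousOn ψ (Icc 0 1)) {x m : ℝ} (hx : x ≤ 1) (h1 : 0 ≤ m) (h2 : m ≤ x) :
    ∫ y in (0 : ℝ)..x, h (x, y) * ψ y =
      (∫ y in (0 : ℝ)..m, h (x, y) * ψ y) + ∫ y in m..x, h (x, y) * ψ y :=
  integral_split (continuousOn_section_mul hh hψ fun _ hy => ⟨⟨hy.1, hy.2, hx⟩, hy.1,
    hy.2.trans hx⟩) h1 h2

lemma triU_section_split {h : ℝ × ℝ → ℝ} {ψ : ℝ → ℝ} (hh : ContinuousOn h triU)
    (hψ : ContinuousOn ψ (Icc 0 1)) {x m : ℝ} (hx : 0 ≤ x) (h1 : x ≤ m) (h2 : m ≤ 1) :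
    ∫ y in x..1, h (x, y) * ψ y =
      (∫ y in x..m, h (x, y) * ψ y) + ∫ y in m..1, h (x, y) * ψ y :=
  integral_split (continuousOn_section_mul hh hψ fun _ hy => ⟨⟨hx, hy.1, hy.2⟩,
    hx.trans hy.1, hy.2⟩) h1 h2

/-- The case of equal diffusion coefficients, where the characteristic lines are the diagonals. -/
lemma fredholmLeibniz_symmetric (h : IsSecondKernel ε 0 c₁ c₂ g p q r)
    (hφ : HasDerivIcc φ φ') (hφ' : HasDerivIcc φ' φ'') (h1 : φ 1 = 0) (E : Set ℝ) :
    FredholmLeibniz (eps2 ε 0) (eps1 ε 0) E q r (fun x y => (c₂ - c₁) * q x y + g y * p (x - y))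
      (fun x y => (c₂ - c₁) * r x y) g φ φ' φ'' := by
  have ha : aCoef 0 = 1 := by simp [aCoef]
  have he : eps1 ε 0 = ε := by simp [eps1]
  have he' : eps2 ε 0 = ε := by simp [eps2]
  have hq : C2On q triL := by
    have := h.reg_q_left
    rw [ha] at this
    refine this.mono fun z hz => ⟨hz, ?_⟩
    have := hz.2.1; have := hz.2.2; linarith
  have hr : C2On r triU := by
    have := h.reg_r_left
    rw [ha] at this
    exact this.mono fun z hz => ⟨hz, by linarith [hz.2.1]⟩
  have p0 := hasPartials_of_contDiffOn (hq.of_le (by norm_num)) uniqueDiffOn_triL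
  have p1 := hasPartials_of_contDiffOn (hq.contDiffOn_dX uniqueDiffOn_triL) uniqueDiffOn_triL
  have p2 := hasPartials_of_contDiffOn (hq.contDiffOn_dY uniqueDiffOn_triL) uniqueDiffOn_triL
  have q0 := hasPartials_of_contDiffOn (hr.of_le (by norm_num)) uniqueDiffOn_triU
  have q1 := hasPartials_of_contDiffOn (hr.contDiffOn_dX uniqueDiffOn_triU) uniqueDiffOn_triU
  have q2 := hasPartials_of_contDiffOn (hr.contDiffOn_dY uniqueDiffOn_triU) uniqueDiffOn_triU
  refine ⟨fun x => (∫ y in (0 : ℝ)..x, dX triL q x y * φ y) + ∫ y in x..1, dX triU r x y * φ y,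
    ?_, ?_, fun x hx _ => ?_⟩
  · refine ContinuousOn.add ?_ ?_
    · exact continuousOn_integral_region isClosed_triL p0.cont1 hφ.cont_fun continuous_const
        continuous_id fun x hx => ⟨hx.1, fun y hy => ⟨⟨hy.1.le, hy.2.le, hx.2⟩,
          hy.1.le, hy.2.le.trans hx.2⟩⟩
    · exact continuousOn_integral_region isClosed_triU q0.cont1 hφ.cont_fun continuous_id
        continuous_const fun x hx => ⟨hx.2, fun y hy => ⟨⟨hx.1, hy.1.le, hy.2.le⟩,
          hx.1.trans hy.1.le, hy.2.le⟩⟩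
  · simp only [intervalIntegral.integral_same, zero_add]
    rw [intervalIntegral.integral_congr_Ioo_of_le (g := fun _ => 0) zero_le_one fun y hy => by
      simp only; rw [h.r_init_deriv y hy, zero_mul]]
    simp
  obtain ⟨f1, DL, f2, f3⟩ := piece_second_deriv p0 p1 p2 (fun z hz => triL_snd_mem hz) hφ hφ'
    (I := Ioo 0 1) isOpen_Ioo (b := fun _ => 0) (c := fun x => x) (b₁ := 0) (c₁ := 1)
    (fun x => hasDerivAt_const x 0) (fun x => hasDerivAt_id x) (fun x hx => hx.1.le)
    (fun x hx y hy => ⟨hy.1, hy.2, hx.2.le⟩) (e₁ := ε) (e₂ := ε)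
    (s := fun z => (c₂ - c₁) * q z.1 z.2 + g z.2 * p (z.1 - z.2)) hx (fun y hy => by
      have := h.pde_q x y hy.1 hy.2 hx.2 (by rw [ha]; linarith [hy.2, hx.2])
      rwa [he, he'] at this)
  obtain ⟨g1, DU, g2, g3⟩ := piece_second_deriv q0 q1 q2 (fun z hz => triU_snd_mem hz) hφ hφ'
    (I := Ioo 0 1) isOpen_Ioo (b := fun x => x) (c := fun _ => 1) (b₁ := 1) (c₁ := 0)
    (fun x => hasDerivAt_id x) (fun x => hasDerivAt_const x 1) (fun x hx => hx.2.le)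
    (fun x hx y hy => ⟨hx.1.le, hy.1, hy.2⟩) (e₁ := ε) (e₂ := ε)
    (s := fun z => (c₂ - c₁) * r z.1 z.2) hx (fun y hy => by
      have := h.pde_r x y hx.1 hy.1 hy.2 (by rw [ha]; linarith [hy.1])
        (by rw [ha]; linarith [hy.2, hx.2])
      rwa [he, he'] at this)
  have hx' : x ∈ Icc (0 : ℝ) 1 := ⟨hx.1.le, hx.2.le⟩
  refine ⟨(f1.add g1).congr_deriv ?_, _, f2.add g2, ?_⟩
  · rw [h.interface x hx']; ring
  -- `q = r` on the diagonal, so the derivatives along it agree; only the prescribed jump of `∂_y`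
  -- remains.
  · have edge := p0.edge_eq q0 isOpen_Ioo (hasDerivAt_id x) (I := Ioo 0 1)
      (fun t ht => ⟨ht.1.le, le_rfl, ht.2.le⟩) (fun t ht => ⟨ht.1.le, le_rfl, ht.2.le⟩)
      (fun t ht => (h.interface t ⟨ht.1.le, ht.2.le⟩).symm) hx
    have hint := h.interface x hx'
    have hend := h.r_end x hx'
    have hj := h.jump x hx (by rw [ha]; linarith [hx.2])
    rw [he, he'] at hj
    simp only [id] at edge f3 g3
    rw [he, he', ← hj]
    rw [h1, hend] at g3
    rw [hint] at g3
    linear_combination f3 + g3 + ε * φ x * edge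

/-- Up to three pieces lie above a given `x`. The exceptional abscissae are those where `x = a y`
reaches `y = 1`, and where `x + a y = 2a` meets the diagonal and the side `y = 0`. Between them,
contributions on characteristic lines cancel as in the Volterra case, and the diagonal leaves `g`
through the jump condition. -/
lemma fredholmLeibniz_asymmetric (hy : y₀ ∈ Ioo (-1 : ℝ) 0)
    (h : IsSecondKernel ε y₀ c₁ c₂ g p q r) (hg : ContinuousOn g (Icc 0 1))
    (hφ : HasDerivIcc φ φ') (hφ' : HasDerivIcc φ' φ'') (hφ1 : φ 1 = 0) :
    FredholmLeibniz (eps2 ε y₀) (eps1 ε y₀)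
      {aCoef y₀, 2 * aCoef y₀ / (1 + aCoef y₀), 2 * aCoef y₀} q r
      (fun x y => (c₂ - c₁) * q x y + g y * p (x - y))
      (fun x y => (c₂ - c₁) * r x y) g φ φ' φ'' := by
  have hy' : y₀ ∈ Ioc (-1 : ℝ) 0 := ⟨hy.1, hy.2.le⟩
  have ha : 0 < aCoef y₀ := aCoef_pos hy'
  have ha1 : aCoef y₀ < 1 := by
    rw [aCoef, div_lt_one (by linarith [hy.2])]; linarith [hy.2]
  have hsc := continuousOn_secondSource h hg
  have hrc : ContinuousOn (fun z : ℝ × ℝ => (c₂ - c₁) * r z.1 z.2) triU :=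
    continuousOn_const.mul h.cont_r
  have he12 := eps2_eq (ε := ε) hy'
  have hpq := h.pde_q
  have hpr := h.pde_r
  have hjump := h.jump
  have cq := h.cont_q
  have cr := h.cont_r
  have hqL := h.reg_q_left
  have hqR := h.reg_q_right
  have hrL := h.reg_r_left
  have hrM := h.reg_r_mid
  have hrR := h.reg_r_right
  generalize aCoef y₀ = a at *
  generalize eps1 ε y₀ = e₁ at *
  generalize eps2 ε y₀ = e₂ at *
  -- The separating lines are written as the graphs `y = μ x` and `y = 2 - μ x`; `e₁ = e₂ μ²` says
  -- that they are characteristic.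
  set μ : ℝ := a⁻¹ with hμ
  have hμa : μ * a = 1 := inv_mul_cancel₀ ha.ne'
  have hμ0 : 0 < μ := inv_pos.2 ha
  have hμ1 : 1 < μ := (one_lt_inv₀ ha).2 ha1
  have he : e₁ = e₂ * μ ^ 2 := by
    rw [he12]; linear_combination -e₁ * (μ * a + 1) * hμa
  have le1 : ∀ x y, x ≤ a * y ↔ μ * x ≤ y := fun x y => by
    rw [hμ, inv_mul_le_iff₀ ha]
  have le2 : ∀ x y, a * y ≤ x ↔ y ≤ μ * x := fun x y => by
    rw [hμ, le_inv_mul_iff₀ ha]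
  have le3 : ∀ x y, x + a * y ≤ 2 * a ↔ y ≤ 2 - μ * x := fun x y => by
    have : a * (2 - μ * x - y) = 2 * a - (x + a * y) := by linear_combination -x * hμa
    rw [← sub_nonneg, ← this, mul_nonneg_iff_of_pos_left ha, sub_nonneg]
  have le4 : ∀ x y, 2 * a ≤ x + a * y ↔ 2 - μ * x ≤ y := fun x y => by
    have : a * (y - (2 - μ * x)) = x + a * y - 2 * a := by linear_combination x * hμa
    rw [← sub_nonneg, ← this, mul_nonneg_iff_of_pos_left ha, sub_nonneg]
  have ne1 : ∀ x y, y ≠ μ * x → x ≠ a * y := fun x y h1 h2 =>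
    h1 (le_antisymm ((le2 x y).1 h2.ge) ((le1 x y).1 h2.le))
  have ne2 : ∀ x y, y ≠ 2 - μ * x → x + a * y ≠ 2 * a := fun x y h1 h2 =>
    h1 (le_antisymm ((le3 x y).1 h2.le) ((le4 x y).1 h2.ge))
  set QL : Set (ℝ × ℝ) := {z ∈ triL | z.1 + a * z.2 ≤ 2 * a} with hQL
  set QR : Set (ℝ × ℝ) := {z ∈ triL | 2 * a ≤ z.1 + a * z.2} with hQR
  set RL : Set (ℝ × ℝ) := {z ∈ triU | z.1 ≤ a * z.2} with hRL
  set RM : Set (ℝ × ℝ) := {z ∈ triU | a * z.2 ≤ z.1 ∧ z.1 + a * z.2 ≤ 2 * a} with hRM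
  set RR : Set (ℝ × ℝ) := {z ∈ triU | 2 * a ≤ z.1 + a * z.2} with hRR
  set RM' : Set (ℝ × ℝ) := {z ∈ triU | a * z.2 ≤ z.1} with hRM'
  have mQL : ∀ z, z ∈ QL ↔ z ∈ triL ∧ 0 ≤ -μ * z.1 + (-1) * z.2 + 2 := fun z =>
    and_congr_right fun _ => by rw [le3]; constructor <;> intro <;> linarith
  have mQR : ∀ z, z ∈ QR ↔ z ∈ triL ∧ 0 ≤ μ * z.1 + 1 * z.2 + -2 := fun z =>
    and_congr_right fun _ => by rw [le4]; constructor <;> intro <;> linarith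
  have mRL : ∀ z, z ∈ RL ↔ z ∈ triU ∧ 0 ≤ -μ * z.1 + 1 * z.2 + 0 := fun z =>
    and_congr_right fun _ => by rw [le1]; constructor <;> intro <;> linarith
  have mRM' : ∀ z, z ∈ RM' ↔ z ∈ triU ∧ 0 ≤ μ * z.1 + (-1) * z.2 + 0 := fun z =>
    and_congr_right fun _ => by rw [le2]; constructor <;> intro <;> linarith
  have mRM : ∀ z, z ∈ RM ↔ z ∈ RM' ∧ 0 ≤ -μ * z.1 + (-1) * z.2 + 2 := fun z => by
    rw [hRM, hRM']
    constructor
    · rintro ⟨k1, k2, k3⟩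
      rw [le3] at k3
      exact ⟨⟨k1, k2⟩, by linarith⟩
    · rintro ⟨⟨k1, k2⟩, k3⟩
      exact ⟨k1, k2, (le3 _ _).2 (by linarith)⟩
  have mRR : ∀ z, z ∈ RR ↔ z ∈ triU ∧ 0 ≤ μ * z.1 + 1 * z.2 + -2 := fun z =>
    and_congr_right fun _ => by rw [le4]; constructor <;> intro <;> linarith
  have kQL : ConvexRegion QL := ConvexRegion.sep convex_triL isClosed_triL mQL (z₀ := (a / 2, a / 4))
    (mem_nhds_triL (by positivity) (by linarith) (by linarith))
    (by simp only; linarith)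
  -- `2a / (1 + a)` is the abscissa at which `x + a y = 2a` meets the diagonal; the test point lies
  -- to its right, just below the diagonal.
  have kQR : ConvexRegion QR := ConvexRegion.sep convex_triL isClosed_triL mQR
    (z₀ := ((1 + 2 * a / (1 + a)) / 2, (1 / 2 + (3 / 2) * (2 * a / (1 + a))) / 2))
    (by
      have : 2 * a / (1 + a) < 1 := by rw [div_lt_one (by linarith)]; linarith
      have : 0 < 2 * a / (1 + a) := by positivity
      exact mem_nhds_triL (by linarith) (by linarith) (by linarith))
    (by
      set t := 2 * a / (1 + a) with ht
      have h1 : t * (1 + a) = 2 * a := by rw [ht]; field_simp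
      have h2 : t < 1 := by rw [ht, div_lt_one (by linarith)]; linarith
      have h3 : t * (1 + μ) = 2 := by linear_combination μ * h1 + (2 - t) * hμa
      simp only
      nlinarith [mul_pos (sub_pos.2 hμ1) (sub_pos.2 h2)])
  have kRL : ConvexRegion RL := ConvexRegion.sep convex_triU isClosed_triU mRL (z₀ := (a / 4, 1 / 2))
    (mem_nhds_triU (by positivity) (by linarith) (by linarith)) (by simp only; linarith)
  have kRM' : ConvexRegion RM' := ConvexRegion.sep convex_triU isClosed_triU mRM'
    (z₀ := (a / 2, (1 + a) / 4)) (mem_nhds_triU (by positivity) (by linarith) (by linarith))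
    (by simp only; linarith)
  have nRM' : RM' ∈ 𝓝 (a / 2, (1 + a) / 4) := by
    have := eventuallyEq_set_of_sep mRM' (z₀ := (a / 2, (1 + a) / 4)) (by simp only; linarith)
    have h2 := mem_nhds_triU (x := a / 2) (y := (1 + a) / 4) (by positivity) (by linarith)
      (by linarith)
    filter_upwards [this, h2] with z hz hz'
    rw [show (z ∈ RM') = (z ∈ triU) from hz]; exact hz'
  have kRM : ConvexRegion RM := ConvexRegion.sep kRM'.convex kRM'.closed mRM nRM'
    (by simp only; linarith)
  have kRR : ConvexRegion RR := ConvexRegion.sep convex_triU isClosed_triU mRR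
    (z₀ := ((1 + a) / 2, (3 + a) / 4)) (mem_nhds_triU (by positivity) (by linarith) (by linarith))
    (by
      have h1 : 0 < (1 - a) * (2 - a) * μ :=
        mul_pos (mul_pos (by linarith) (by linarith)) hμ0
      have h2 : (1 - a) * (2 - a) * μ = 2 * μ - 3 + a := by linear_combination (a - 3) * hμa
      simp only; linarith)
  have a0 := hasPartials_of_contDiffOn (hqL.of_le (by norm_num)) kQL.uniqueDiffOn
  have a1 := hasPartials_of_contDiffOn (hqL.contDiffOn_dX kQL.uniqueDiffOn) kQL.uniqueDiffOn
  have a2 := hasPartials_of_contDiffOn (hqL.contDiffOn_dY kQL.uniqueDiffOn) kQL.uniqueDiffOn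
  have b0 := hasPartials_of_contDiffOn (hqR.of_le (by norm_num)) kQR.uniqueDiffOn
  have b1 := hasPartials_of_contDiffOn (hqR.contDiffOn_dX kQR.uniqueDiffOn) kQR.uniqueDiffOn
  have b2 := hasPartials_of_contDiffOn (hqR.contDiffOn_dY kQR.uniqueDiffOn) kQR.uniqueDiffOn
  have l0 := hasPartials_of_contDiffOn (hrL.of_le (by norm_num)) kRL.uniqueDiffOn
  have l1 := hasPartials_of_contDiffOn (hrL.contDiffOn_dX kRL.uniqueDiffOn) kRL.uniqueDiffOn
  have l2 := hasPartials_of_contDiffOn (hrL.contDiffOn_dY kRL.uniqueDiffOn) kRL.uniqueDiffOn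
  have m0 := hasPartials_of_contDiffOn (hrM.of_le (by norm_num)) kRM.uniqueDiffOn
  have m1 := hasPartials_of_contDiffOn (hrM.contDiffOn_dX kRM.uniqueDiffOn) kRM.uniqueDiffOn
  have m2 := hasPartials_of_contDiffOn (hrM.contDiffOn_dY kRM.uniqueDiffOn) kRM.uniqueDiffOn
  have r0 := hasPartials_of_contDiffOn (hrR.of_le (by norm_num)) kRR.uniqueDiffOn
  have r1 := hasPartials_of_contDiffOn (hrR.contDiffOn_dX kRR.uniqueDiffOn) kRR.uniqueDiffOn
  have r2 := hasPartials_of_contDiffOn (hrR.contDiffOn_dY kRR.uniqueDiffOn) kRR.uniqueDiffOn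
  have nQL : ∀ x y, y < 2 - μ * x → QL =ᶠ[𝓝 (x, y)] triL := fun x y h =>
    eventuallyEq_set_of_sep mQL (by simp only; linarith)
  have nQR : ∀ x y, 2 - μ * x < y → QR =ᶠ[𝓝 (x, y)] triL := fun x y h =>
    eventuallyEq_set_of_sep mQR (by simp only; linarith)
  have nRL : ∀ x y, μ * x < y → RL =ᶠ[𝓝 (x, y)] triU := fun x y h =>
    eventuallyEq_set_of_sep mRL (by simp only; linarith)
  have nRM : ∀ x y, y < μ * x → y < 2 - μ * x → RM =ᶠ[𝓝 (x, y)] triU := fun x y h h' =>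
    (eventuallyEq_set_of_sep mRM (by simp only; linarith)).trans
      (eventuallyEq_set_of_sep mRM' (by simp only; linarith))
  have nRR : ∀ x y, 2 - μ * x < y → RR =ᶠ[𝓝 (x, y)] triU := fun x y h =>
    eventuallyEq_set_of_sep mRR (by simp only; linarith)
  -- the equations in the pieces
  have sQL : ∀ x y, 0 < y → y < x → x < 1 → y < 2 - μ * x →
      e₂ * dX QL (dX QL q) x y - e₁ * dY QL (dY QL q) x y =
        (c₂ - c₁) * q x y + g y * p (x - y) := fun x y h1 h2 h3 h4 => by
    rw [dX_dX_congr_set (nQL x y h4), dY_dY_congr_set (nQL x y h4)]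
    exact hpq x y h1 h2 h3 (ne2 x y h4.ne)
  have sQR : ∀ x y, 0 < y → y < x → x < 1 → 2 - μ * x < y →
      e₂ * dX QR (dX QR q) x y - e₁ * dY QR (dY QR q) x y =
        (c₂ - c₁) * q x y + g y * p (x - y) := fun x y h1 h2 h3 h4 => by
    rw [dX_dX_congr_set (nQR x y h4), dY_dY_congr_set (nQR x y h4)]
    exact hpq x y h1 h2 h3 (ne2 x y h4.ne')
  have sRL : ∀ x y, 0 < x → x < y → y < 1 → μ * x < y → y < 2 - μ * x →
      e₂ * dX RL (dX RL r) x y - e₁ * dY RL (dY RL r) x y = (c₂ - c₁) * r x y :=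
    fun x y h1 h2 h3 h4 h5 => by
    rw [dX_dX_congr_set (nRL x y h4), dY_dY_congr_set (nRL x y h4)]
    exact hpr x y h1 h2 h3 (ne1 x y h4.ne') (ne2 x y h5.ne)
  have sRM : ∀ x y, 0 < x → x < y → y < 1 → y < μ * x → y < 2 - μ * x →
      e₂ * dX RM (dX RM r) x y - e₁ * dY RM (dY RM r) x y = (c₂ - c₁) * r x y :=
    fun x y h1 h2 h3 h4 h5 => by
    rw [dX_dX_congr_set (nRM x y h4 h5), dY_dY_congr_set (nRM x y h4 h5)]
    exact hpr x y h1 h2 h3 (ne1 x y h4.ne) (ne2 x y h5.ne)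
  have sRR : ∀ x y, 0 < x → x < y → y < 1 → y < μ * x → 2 - μ * x < y →
      e₂ * dX RR (dX RR r) x y - e₁ * dY RR (dY RR r) x y = (c₂ - c₁) * r x y :=
    fun x y h1 h2 h3 h4 h5 => by
    rw [dX_dX_congr_set (nRR x y h5), dY_dY_congr_set (nRR x y h5)]
    exact hpr x y h1 h2 h3 (ne1 x y h4.ne) (ne2 x y h5.ne')
  -- membership
  have iQL : ∀ x y, 0 ≤ y → y ≤ x → x ≤ 1 → y ≤ 2 - μ * x → (x, y) ∈ QL := fun x y h1 h2 h3 h4 =>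
    ⟨⟨h1, h2, h3⟩, (le3 x y).2 h4⟩
  have iQR : ∀ x y, 0 ≤ y → y ≤ x → x ≤ 1 → 2 - μ * x ≤ y → (x, y) ∈ QR := fun x y h1 h2 h3 h4 =>
    ⟨⟨h1, h2, h3⟩, (le4 x y).2 h4⟩
  have iRL : ∀ x y, 0 ≤ x → x ≤ y → y ≤ 1 → μ * x ≤ y → (x, y) ∈ RL := fun x y h1 h2 h3 h4 =>
    ⟨⟨h1, h2, h3⟩, (le1 x y).2 h4⟩
  have iRM : ∀ x y, 0 ≤ x → x ≤ y → y ≤ 1 → y ≤ μ * x → y ≤ 2 - μ * x → (x, y) ∈ RM :=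
    fun x y h1 h2 h3 h4 h5 => ⟨⟨h1, h2, h3⟩, (le2 x y).2 h4, (le3 x y).2 h5⟩
  have iRR : ∀ x y, 0 ≤ x → x ≤ y → y ≤ 1 → 2 - μ * x ≤ y → (x, y) ∈ RR := fun x y h1 h2 h3 h4 =>
    ⟨⟨h1, h2, h3⟩, (le4 x y).2 h4⟩
  have hμx : ∀ x, 0 ≤ x → x ≤ μ * x := fun x hx => le_mul_of_one_le_left hx hμ1.le
  -- the breakpoints
  obtain ⟨B, hB⟩ : ∃ B : ℝ → ℝ, B = fun x => max 0 (min x (2 - μ * x)) := ⟨_, rfl⟩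
  obtain ⟨M, hM⟩ : ∃ M : ℝ → ℝ, M = fun x => min (μ * x) 1 := ⟨_, rfl⟩
  obtain ⟨N, hN⟩ : ∃ N : ℝ → ℝ, N = fun x => max x (min 1 (2 - μ * x)) := ⟨_, rfl⟩
  have Bc : Continuous B := by rw [hB]; fun_prop
  have Mc : Continuous M := by rw [hM]; fun_prop
  have Nc : Continuous N := by rw [hN]; fun_prop
  have Bi : ∀ x ∈ Icc (0 : ℝ) 1, 0 ≤ B x ∧ B x ≤ x := fun x hx => by
    rw [hB]; exact ⟨le_max_left _ _, max_le hx.1 (min_le_left _ _)⟩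
  have Mi : ∀ x ∈ Icc (0 : ℝ) 1, x ≤ M x ∧ M x ≤ 1 := fun x hx => by
    rw [hM]; exact ⟨le_min (hμx x hx.1) hx.2, min_le_right _ _⟩
  have Ni : ∀ x ∈ Icc (0 : ℝ) 1, x ≤ N x ∧ N x ≤ 1 := fun x hx => by
    rw [hN]; exact ⟨le_max_left _ _, max_le hx.2 (min_le_left _ _)⟩
  -- The clamped breakpoints shrink the interval of any piece absent above `x` to a point. One
  -- formula then serves all `x` and is continuous at the exceptional abscissae.
  obtain ⟨D, hD⟩ : ∃ D : ℝ → ℝ, ∀ x, D x = (∫ y in (0 : ℝ)..(B x), dX QL q x y * φ y) +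
      (∫ y in (B x)..x, dX QR q x y * φ y) + (∫ y in x..(min (M x) (N x)), dX RM r x y * φ y) +
      (∫ y in (M x)..1, dX RL r x y * φ y) + ∫ y in (N x)..1, dX RR r x y * φ y :=
    ⟨_, fun _ => rfl⟩
  refine ⟨D, ?_, ?_, ?_⟩
  · rw [funext hD]
    refine (((ContinuousOn.add ?_ ?_).add ?_).add ?_).add ?_
    · refine continuousOn_integral_region kQL.closed a0.cont1 hφ.cont_fun continuous_const Bc
        fun x hx => ⟨(Bi x hx).1, fun y hy => ⟨iQL x y hy.1.le (hy.2.le.trans (Bi x hx).2) hx.2 ?_,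
          hy.1.le, (hy.2.le.trans (Bi x hx).2).trans hx.2⟩⟩
      have h2 := hy.2
      rw [hB] at h2
      rcases lt_max_iff.1 h2 with h | h
      · linarith [hy.1]
      · exact (h.trans_le (min_le_right _ _)).le
    · refine continuousOn_integral_region kQR.closed b0.cont1 hφ.cont_fun Bc continuous_id
        fun x hx => ⟨(Bi x hx).2, fun y hy => ⟨iQR x y ((Bi x hx).1.trans hy.1.le) hy.2.le hx.2 ?_,
          (Bi x hx).1.trans hy.1.le, hy.2.le.trans hx.2⟩⟩
      have h2 := hy.1
      rw [hB] at h2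
      rcases min_lt_iff.1 ((le_max_right _ _).trans_lt h2) with h | h
      · exact absurd hy.2 (not_lt.2 h.le)
      · exact h.le
    · refine continuousOn_integral_region kRM.closed m0.cont1 hφ.cont_fun continuous_id
        (Mc.min Nc) fun x hx => ⟨le_min (Mi x hx).1 (Ni x hx).1, fun y hy => ?_⟩
      have hyM := hy.2.trans_le (min_le_left _ _)
      have hyN := hy.2.trans_le (min_le_right _ _)
      have hy1 : y ≤ 1 := hyM.le.trans (Mi x hx).2
      refine ⟨iRM x y hx.1 hy.1.le hy1 ?_ ?_, hx.1.trans hy.1.le, hy1⟩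
      · rw [hM] at hyM; exact (hyM.trans_le (min_le_left _ _)).le
      · rw [hN] at hyN
        rcases lt_max_iff.1 hyN with h | h
        · exact absurd hy.1 (not_lt.2 h.le)
        · exact (h.trans_le (min_le_right _ _)).le
    · refine continuousOn_integral_region kRL.closed l0.cont1 hφ.cont_fun Mc continuous_const
        fun x hx => ⟨(Mi x hx).2, fun y hy => ⟨iRL x y hx.1 ((Mi x hx).1.trans hy.1.le) hy.2.le ?_,
          hx.1.trans ((Mi x hx).1.trans hy.1.le), hy.2.le⟩⟩
      have h2 := hy.1
      rw [hM] at h2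
      rcases min_lt_iff.1 h2 with h | h
      · exact h.le
      · exact absurd hy.2 (not_lt.2 h.le)
    · refine continuousOn_integral_region kRR.closed r0.cont1 hφ.cont_fun Nc continuous_const
        fun x hx => ⟨(Ni x hx).2, fun y hy => ⟨iRR x y hx.1 ((Ni x hx).1.trans hy.1.le) hy.2.le ?_,
          hx.1.trans ((Ni x hx).1.trans hy.1.le), hy.2.le⟩⟩
      have h2 := hy.1
      rw [hN] at h2
      rcases min_lt_iff.1 ((le_max_right _ _).trans_lt h2) with h | h
      · exact absurd hy.2 (not_lt.2 h.le)
      · exact h.le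
  -- At `x = 0` only the sector `x ≤ a y` remains, and `∂_x r(0, y) = 0` there.
  · have e1 : B 0 = 0 := by simp [hB]
    have e2 : M 0 = 0 := by simp [hM]
    have e3 : N 0 = 1 := by simp [hN]
    rw [hD, e1, e2, e3, min_eq_left zero_le_one]
    simp only [intervalIntegral.integral_same, zero_add, add_zero]
    rw [intervalIntegral.integral_congr_Ioo_of_le (g := fun _ => 0) zero_le_one fun y hy => by
      simp only
      rw [dX_congr_set (nRL 0 y (by rw [mul_zero]; exact hy.1)), h.r_init_deriv y hy, zero_mul]]
    simp
  intro x hx hxE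
  have hx' : x ∈ Icc (0 : ℝ) 1 := ⟨hx.1.le, hx.2.le⟩
  have hO1 : IsOpen (Ioo (0 : ℝ) 1) := isOpen_Ioo
  have ho : ∀ {f : ℝ → ℝ} {c : ℝ}, Continuous f → IsOpen {x | f x < c} := fun hf =>
    isOpen_lt hf continuous_const
  have ho' : ∀ {f : ℝ → ℝ} {c : ℝ}, Continuous f → IsOpen {x | c < f x} := fun hf =>
    isOpen_lt continuous_const hf
  have x1 : μ * x ≠ 1 := fun h0 => hxE (Or.inl (by
    rw [hμ, inv_mul_eq_one₀ ha.ne'] at h0; exact h0.symm))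
  have x2 : x + μ * x ≠ 2 := fun h0 => hxE (Or.inr (Or.inl (by
    rw [eq_div_iff (by linarith)]; linear_combination a * h0 - x * hμa)))
  have x3 : μ * x ≠ 2 := fun h0 => hxE (Or.inr (Or.inr (by
    change x = 2 * a
    linear_combination a * h0 - x * hμa)))
  have dβ : ∀ x, HasDerivAt (fun x => 2 - μ * x) (-μ) x := fun x =>
    (((hasDerivAt_id x).const_mul μ).const_sub 2).congr_deriv (by ring)
  have dμ : ∀ x, HasDerivAt (fun x => μ * x) μ x := fun x =>
    ((hasDerivAt_id x).const_mul μ).congr_deriv (mul_one μ)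
  have dx : ∀ x : ℝ, HasDerivAt (fun x => x) 1 x := fun x => hasDerivAt_id x
  have d0 : ∀ c x : ℝ, HasDerivAt (fun _ => c) 0 x := fun c x => hasDerivAt_const x c
  have t1 : ∀ z ∈ QL, z.2 ∈ Icc (0 : ℝ) 1 := fun z hz => triL_snd_mem hz.1
  have t2 : ∀ z ∈ QR, z.2 ∈ Icc (0 : ℝ) 1 := fun z hz => triL_snd_mem hz.1
  have t3 : ∀ z ∈ RL, z.2 ∈ Icc (0 : ℝ) 1 := fun z hz => triU_snd_mem hz.1
  have t4 : ∀ z ∈ RM, z.2 ∈ Icc (0 : ℝ) 1 := fun z hz => triU_snd_mem hz.1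
  have t5 : ∀ z ∈ RR, z.2 ∈ Icc (0 : ℝ) 1 := fun z hz => triU_snd_mem hz.1
  set s₁ : ℝ × ℝ → ℝ := fun z => (c₂ - c₁) * q z.1 z.2 + g z.2 * p (z.1 - z.2) with hs₁
  set s₂ : ℝ × ℝ → ℝ := fun z => (c₂ - c₁) * r z.1 z.2 with hs₂
  have hint := h.interface x hx'
  have hend := h.r_end x hx'
  have hj := hjump x hx (ne2 x x fun h0 => x2 (by linarith))
  have hμx0 := mul_pos hμ0 hx.1
  have hμxx : x < μ * x := lt_mul_of_one_lt_left hx.1 hμ1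
  rcases lt_or_gt_of_ne x3 with k3 | k3
  · rcases lt_or_gt_of_ne x2 with k2 | k2
    · rcases lt_or_gt_of_ne x1 with k1 | k1
      -- Case `x < a`: all of `q` left of its line, then the middle and left pieces of `r`.
      · set I : Set ℝ := Ioo 0 1 ∩ {x | μ * x < 1} with hI
        have hIo : IsOpen I := hO1.inter (ho (by fun_prop))
        have hxI : x ∈ I := ⟨hx, k1⟩
        have fI : ∀ t ∈ I, 0 < t ∧ t < 1 ∧ μ * t < 1 ∧ t ≤ μ * t := fun t ht =>
          ⟨ht.1.1, ht.1.2, ht.2, hμx t ht.1.1.le⟩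
        obtain ⟨f1, D1, f2, f3⟩ := piece_second_deriv a0 a1 a2 t1 hφ hφ' hIo (d0 0) dx
          (fun t ht => (fI t ht).1.le) (fun t ht y hy => by
            obtain ⟨i1, i2, i3, i4⟩ := fI t ht
            exact iQL t y hy.1 hy.2 i2.le (by linarith [hy.2])) (e₁ := e₂) (e₂ := e₁) (s := s₁) hxI
          (fun y hy => sQL x y hy.1 hy.2 hx.2 (by linarith [hy.2, hx.2]))
        obtain ⟨g1, D2, g2, g3⟩ := piece_second_deriv m0 m1 m2 t4 hφ hφ' hIo dx dμ
          (fun t ht => (fI t ht).2.2.2) (fun t ht y hy => by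
            obtain ⟨i1, i2, i3, i4⟩ := fI t ht
            exact iRM t y i1.le hy.1 (by linarith [hy.2]) hy.2 (by linarith [hy.2]))
          (e₁ := e₂) (e₂ := e₁) (s := s₂) hxI
          (fun y hy => sRM x y hx.1 hy.1 (by linarith [hy.2]) hy.2 (by linarith [hy.2]))
        obtain ⟨l1, D3, l2, l3⟩ := piece_second_deriv l0 l1 l2 t3 hφ hφ' hIo dμ (d0 1)
          (fun t ht => (fI t ht).2.2.1.le) (fun t ht y hy => by
            obtain ⟨i1, i2, i3, i4⟩ := fI t ht
            exact iRL t y i1.le (by linarith [hy.1]) hy.2 hy.1)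
          (e₁ := e₂) (e₂ := e₁) (s := s₂) hxI
          (fun y hy => sRL x y hx.1 (by linarith [hy.1]) hy.2 hy.1 (by linarith [hy.2]))
        have hDeq : ∀ t ∈ I, D t = (∫ y in (0 : ℝ)..t, dX QL q t y * φ y) +
            (∫ y in t..(μ * t), dX RM r t y * φ y) + ∫ y in (μ * t)..1, dX RL r t y * φ y := by
          intro t ht
          obtain ⟨i1, i2, i3, i4⟩ := fI t ht
          have w1 : B t = t := by
            rw [hB]; simp only; rw [min_eq_left (by linarith), max_eq_right i1.le]
          have w2 : M t = μ * t := by rw [hM]; exact min_eq_left i3.le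
          have w3 : N t = 1 := by
            rw [hN]; simp only; rw [min_eq_left (by linarith), max_eq_right i2.le]
          rw [hD, w1, w2, w3, min_eq_left i3.le]
          simp only [intervalIntegral.integral_same, add_zero]
        have hJ : ∀ {h : ℝ × ℝ → ℝ} {ψ : ℝ → ℝ}, ContinuousOn h triU → ContinuousOn ψ (Icc 0 1) →
            ∀ t ∈ I, ∫ y in t..1, h (t, y) * ψ y =
            (∫ y in t..(μ * t), h (t, y) * ψ y) + ∫ y in (μ * t)..1, h (t, y) * ψ y :=
          fun hh hψ t ht => triU_section_split hh hψ ht.1.1.le (fI t ht).2.2.2 (fI t ht).2.2.1.le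
        refine ⟨(((f1.add g1).add l1).congr_of_eventuallyEq ?_).congr_deriv ?_, _,
          ((f2.add g2).add l2).congr_of_eventuallyEq ?_, ?_⟩
        · filter_upwards [hIo.mem_nhds hxI] with t ht
          rw [hJ cr hφ.cont_fun t ht]
          exact (add_assoc _ _ _).symm
        · rw [hDeq x hxI, hint]; ring
        · filter_upwards [hIo.mem_nhds hxI] with t ht using hDeq t ht
        · have E1 := m0.edge_eq l0 hIo (dμ x) (fun t ht => iRM t _ (fI t ht).1.le (fI t ht).2.2.2
            (fI t ht).2.2.1.le le_rfl (by linarith [(fI t ht).2.2.1]))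
            (fun t ht => iRL t _ (fI t ht).1.le (fI t ht).2.2.2 (fI t ht).2.2.1.le le_rfl)
            (fun _ _ => rfl) hxI
          have E2 := a0.edge_eq m0 hIo (dx x) (fun t ht => iQL t t (fI t ht).1.le le_rfl
            (fI t ht).2.1.le (by linarith [(fI t ht).2.1, (fI t ht).2.2.1]))
            (fun t ht => iRM t t (fI t ht).1.le le_rfl (fI t ht).2.1.le (fI t ht).2.2.2
            (by linarith [(fI t ht).2.1, (fI t ht).2.2.1]))
            (fun t ht => (h.interface t ⟨ht.1.1.le, ht.1.2.le⟩).symm) hxI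
          have s1 := hJ cr hφ'.cont x hxI
          have s2 := hJ hrc hφ.cont_fun x hxI
          rw [← dY_congr_set (nQL x x (by linarith)), ← dY_congr_set (nRM x x hμxx (by linarith))]
            at hj
          rw [← dY_congr_set (nQL x 0 (by linarith))]
          simp only [hs₁, hs₂] at s1 s2 E1 E2 f3 g3 l3
          rw [s1, s2, ← hj]
          rw [hint] at g3
          rw [hφ1, hend] at l3
          subst he
          linear_combination f3 + g3 + l3 + e₂ * φ x * E2 + e₂ * μ * φ (μ * x) * E1
      -- Case `a < x < 2a / (1 + a)`: all of `q` left of its line, then the middle and right pieces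
      -- of `r`.
      · set I : Set ℝ := Ioo 0 1 ∩ ({x | 1 < μ * x} ∩ {x | x + μ * x < 2}) with hI
        have hIo : IsOpen I := hO1.inter ((ho' (by fun_prop)).inter (ho (by fun_prop)))
        have hxI : x ∈ I := ⟨hx, k1, k2⟩
        have fI : ∀ t ∈ I, 0 < t ∧ t < 1 ∧ 1 < μ * t ∧ t + μ * t < 2 := fun t ht =>
          ⟨ht.1.1, ht.1.2, ht.2⟩
        obtain ⟨f1, D1, f2, f3⟩ := piece_second_deriv a0 a1 a2 t1 hφ hφ' hIo (d0 0) dx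
          (fun t ht => (fI t ht).1.le) (fun t ht y hy => by
            obtain ⟨i1, i2, i3, i4⟩ := fI t ht
            exact iQL t y hy.1 hy.2 i2.le (by linarith [hy.2])) (e₁ := e₂) (e₂ := e₁) (s := s₁) hxI
          (fun y hy => sQL x y hy.1 hy.2 hx.2 (by linarith [hy.2]))
        obtain ⟨g1, D2, g2, g3⟩ := piece_second_deriv m0 m1 m2 t4 hφ hφ' hIo dx dβ
          (fun t ht => by linarith [(fI t ht).2.2.2]) (fun t ht y hy => by
            obtain ⟨i1, i2, i3, i4⟩ := fI t ht
            exact iRM t y i1.le hy.1 (by linarith [hy.2]) (by linarith [hy.2]) hy.2)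
          (e₁ := e₂) (e₂ := e₁) (s := s₂) hxI
          (fun y hy => sRM x y hx.1 hy.1 (by linarith [hy.2]) (by linarith [hy.2]) hy.2)
        obtain ⟨l1, D3, l2, l3⟩ := piece_second_deriv r0 r1 r2 t5 hφ hφ' hIo dβ (d0 1)
          (fun t ht => by linarith [(fI t ht).2.2.1]) (fun t ht y hy => by
            obtain ⟨i1, i2, i3, i4⟩ := fI t ht
            exact iRR t y i1.le (by linarith [hy.1]) hy.2 hy.1)
          (e₁ := e₂) (e₂ := e₁) (s := s₂) hxI
          (fun y hy => sRR x y hx.1 (by linarith [hy.1]) hy.2 (by linarith [hy.2]) hy.1)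
        have hDeq : ∀ t ∈ I, D t = (∫ y in (0 : ℝ)..t, dX QL q t y * φ y) +
            (∫ y in t..(2 - μ * t), dX RM r t y * φ y) +
              ∫ y in (2 - μ * t)..1, dX RR r t y * φ y := by
          intro t ht
          obtain ⟨i1, i2, i3, i4⟩ := fI t ht
          have w1 : B t = t := by
            rw [hB]; simp only; rw [min_eq_left (by linarith), max_eq_right i1.le]
          have w2 : M t = 1 := by rw [hM]; exact min_eq_right i3.le
          have w3 : N t = 2 - μ * t := by
            rw [hN]; simp only; rw [min_eq_right (by linarith), max_eq_right (by linarith)]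
          rw [hD, w1, w2, w3, min_eq_right (by linarith : 2 - μ * t ≤ 1)]
          simp only [intervalIntegral.integral_same, add_zero]
        have hJ : ∀ {h : ℝ × ℝ → ℝ} {ψ : ℝ → ℝ}, ContinuousOn h triU → ContinuousOn ψ (Icc 0 1) →
            ∀ t ∈ I, ∫ y in t..1, h (t, y) * ψ y =
            (∫ y in t..(2 - μ * t), h (t, y) * ψ y) + ∫ y in (2 - μ * t)..1, h (t, y) * ψ y :=
          fun hh hψ t ht => triU_section_split hh hψ ht.1.1.le (by linarith [(fI t ht).2.2.2])
            (by linarith [(fI t ht).2.2.1])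
        refine ⟨(((f1.add g1).add l1).congr_of_eventuallyEq ?_).congr_deriv ?_, _,
          ((f2.add g2).add l2).congr_of_eventuallyEq ?_, ?_⟩
        · filter_upwards [hIo.mem_nhds hxI] with t ht
          rw [hJ cr hφ.cont_fun t ht]
          exact (add_assoc _ _ _).symm
        · rw [hDeq x hxI, hint]; ring
        · filter_upwards [hIo.mem_nhds hxI] with t ht using hDeq t ht
        · have E1 := m0.edge_eq r0 hIo (dβ x) (fun t ht => by
              obtain ⟨i1, i2, i3, i4⟩ := fI t ht
              exact iRM t _ i1.le (by linarith) (by linarith) (by linarith) le_rfl)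
            (fun t ht => by
              obtain ⟨i1, i2, i3, i4⟩ := fI t ht
              exact iRR t _ i1.le (by linarith) (by linarith) le_rfl)
            (fun _ _ => rfl) hxI
          have E2 := a0.edge_eq m0 hIo (dx x) (fun t ht => iQL t t (fI t ht).1.le le_rfl
            (fI t ht).2.1.le (by linarith [(fI t ht).2.2.2]))
            (fun t ht => iRM t t (fI t ht).1.le le_rfl (fI t ht).2.1.le (hμx t (fI t ht).1.le)
            (by linarith [(fI t ht).2.2.2]))
            (fun t ht => (h.interface t ⟨ht.1.1.le, ht.1.2.le⟩).symm) hxI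
          have s1 := hJ cr hφ'.cont x hxI
          have s2 := hJ hrc hφ.cont_fun x hxI
          rw [← dY_congr_set (nQL x x (by linarith)), ← dY_congr_set (nRM x x hμxx (by linarith))]
            at hj
          rw [← dY_congr_set (nQL x 0 (by linarith))]
          simp only [hs₁, hs₂] at s1 s2 E1 E2 f3 g3 l3
          rw [s1, s2, ← hj]
          rw [hint] at g3
          rw [hφ1, hend] at l3
          subst he
          linear_combination f3 + g3 + l3 + e₂ * φ x * E2 - e₂ * μ * φ (2 - μ * x) * E1
    -- Case `2a / (1 + a) < x < 2a`: both pieces of `q`, then the right piece of `r`.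
    · set I : Set ℝ := Ioo 0 1 ∩ ({x | μ * x < 2} ∩ {x | 2 < x + μ * x}) with hI
      have hIo : IsOpen I := hO1.inter ((ho (by fun_prop)).inter (ho' (by fun_prop)))
      have hxI : x ∈ I := ⟨hx, k3, k2⟩
      have fI : ∀ t ∈ I, 0 < t ∧ t < 1 ∧ μ * t < 2 ∧ 2 < t + μ * t := fun t ht =>
        ⟨ht.1.1, ht.1.2, ht.2⟩
      obtain ⟨f1, D1, f2, f3⟩ := piece_second_deriv a0 a1 a2 t1 hφ hφ' hIo (d0 0) dβ
        (fun t ht => by linarith [(fI t ht).2.2.1]) (fun t ht y hy => by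
          obtain ⟨i1, i2, i3, i4⟩ := fI t ht
          exact iQL t y hy.1 (by linarith [hy.2]) i2.le hy.2) (e₁ := e₂) (e₂ := e₁) (s := s₁) hxI
        (fun y hy => sQL x y hy.1 (by linarith [hy.2]) hx.2 hy.2)
      obtain ⟨g1, D2, g2, g3⟩ := piece_second_deriv b0 b1 b2 t2 hφ hφ' hIo dβ dx
        (fun t ht => by linarith [(fI t ht).2.2.2]) (fun t ht y hy => by
          obtain ⟨i1, i2, i3, i4⟩ := fI t ht
          exact iQR t y (by linarith [hy.1]) hy.2 i2.le hy.1)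
        (e₁ := e₂) (e₂ := e₁) (s := s₁) hxI
        (fun y hy => sQR x y (by linarith [hy.1]) hy.2 hx.2 hy.1)
      obtain ⟨l1, D3, l2, l3⟩ := piece_second_deriv r0 r1 r2 t5 hφ hφ' hIo dx (d0 1)
        (fun t ht => (fI t ht).2.1.le) (fun t ht y hy => by
          obtain ⟨i1, i2, i3, i4⟩ := fI t ht
          exact iRR t y i1.le hy.1 hy.2 (by linarith [hy.1]))
        (e₁ := e₂) (e₂ := e₁) (s := s₂) hxI
        (fun y hy => sRR x y hx.1 hy.1 hy.2 (by linarith [hy.2, hx.2]) (by linarith [hy.1]))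
      have hDeq : ∀ t ∈ I, D t = (∫ y in (0 : ℝ)..(2 - μ * t), dX QL q t y * φ y) +
          (∫ y in (2 - μ * t)..t, dX QR q t y * φ y) + ∫ y in t..1, dX RR r t y * φ y := by
        intro t ht
        obtain ⟨i1, i2, i3, i4⟩ := fI t ht
        have w1 : B t = 2 - μ * t := by
          rw [hB]; simp only; rw [min_eq_right (by linarith), max_eq_right (by linarith)]
        have w2 : M t = 1 := by rw [hM]; exact min_eq_right (by linarith)
        have w3 : N t = t := by
          rw [hN]; simp only; rw [min_eq_right (by linarith), max_eq_left (by linarith)]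
        rw [hD, w1, w2, w3, min_eq_right i2.le]
        simp only [intervalIntegral.integral_same, add_zero]
      have hJ : ∀ {h : ℝ × ℝ → ℝ} {ψ : ℝ → ℝ}, ContinuousOn h triL → ContinuousOn ψ (Icc 0 1) →
          ∀ t ∈ I, ∫ y in (0 : ℝ)..t, h (t, y) * ψ y =
          (∫ y in (0 : ℝ)..(2 - μ * t), h (t, y) * ψ y) + ∫ y in (2 - μ * t)..t, h (t, y) * ψ y :=
        fun hh hψ t ht => triL_section_split hh hψ ht.1.2.le (by linarith [(fI t ht).2.2.1])
          (by linarith [(fI t ht).2.2.2])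
      refine ⟨(((f1.add g1).add l1).congr_of_eventuallyEq ?_).congr_deriv ?_, _,
        ((f2.add g2).add l2).congr_of_eventuallyEq ?_, ?_⟩
      · filter_upwards [hIo.mem_nhds hxI] with t ht
        rw [hJ cq hφ.cont_fun t ht]
        rfl
      · rw [hDeq x hxI, hint]; ring
      · filter_upwards [hIo.mem_nhds hxI] with t ht using hDeq t ht
      · have E1 := a0.edge_eq b0 hIo (dβ x) (fun t ht => by
            obtain ⟨i1, i2, i3, i4⟩ := fI t ht
            exact iQL t _ (by linarith) (by linarith) i2.le le_rfl)
          (fun t ht => by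
            obtain ⟨i1, i2, i3, i4⟩ := fI t ht
            exact iQR t _ (by linarith) (by linarith) i2.le le_rfl)
          (fun _ _ => rfl) hxI
        have E2 := b0.edge_eq r0 hIo (dx x) (fun t ht => iQR t t (fI t ht).1.le le_rfl
          (fI t ht).2.1.le (by linarith [(fI t ht).2.2.2]))
          (fun t ht => iRR t t (fI t ht).1.le le_rfl (fI t ht).2.1.le
          (by linarith [(fI t ht).2.2.2]))
          (fun t ht => (h.interface t ⟨ht.1.1.le, ht.1.2.le⟩).symm) hxI
        have s1 := hJ cq hφ'.cont x hxI
        have s2 := hJ hsc hφ.cont_fun x hxI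
        rw [← dY_congr_set (nQR x x (by linarith)), ← dY_congr_set (nRR x x (by linarith))]
          at hj
        rw [← dY_congr_set (nQL x 0 (by linarith))]
        simp only [hs₁, hs₂] at s1 s2 E1 E2 f3 g3 l3
        rw [s1, s2, ← hj]
        rw [hint] at l3
        rw [hφ1, hend] at l3
        subst he
        linear_combination f3 + g3 + l3 + e₂ * φ x * E2 - e₂ * μ * φ (2 - μ * x) * E1
  -- Case `2a < x`: only the right pieces of `q` and `r`.
  · set I : Set ℝ := Ioo 0 1 ∩ {x | 2 < μ * x} with hI
    have hIo : IsOpen I := hO1.inter (ho' (by fun_prop))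
    have hxI : x ∈ I := ⟨hx, k3⟩
    have fI : ∀ t ∈ I, 0 < t ∧ t < 1 ∧ 2 < μ * t := fun t ht => ⟨ht.1.1, ht.1.2, ht.2⟩
    obtain ⟨f1, D1, f2, f3⟩ := piece_second_deriv b0 b1 b2 t2 hφ hφ' hIo (d0 0) dx
      (fun t ht => (fI t ht).1.le) (fun t ht y hy => by
        obtain ⟨i1, i2, i3⟩ := fI t ht
        exact iQR t y hy.1 hy.2 i2.le (by linarith [hy.1])) (e₁ := e₂) (e₂ := e₁) (s := s₁) hxI
      (fun y hy => sQR x y hy.1 hy.2 hx.2 (by linarith [hy.1]))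
    obtain ⟨l1, D3, l2, l3⟩ := piece_second_deriv r0 r1 r2 t5 hφ hφ' hIo dx (d0 1)
      (fun t ht => (fI t ht).2.1.le) (fun t ht y hy => by
        obtain ⟨i1, i2, i3⟩ := fI t ht
        exact iRR t y i1.le hy.1 hy.2 (by linarith [hy.1]))
      (e₁ := e₂) (e₂ := e₁) (s := s₂) hxI
      (fun y hy => sRR x y hx.1 hy.1 hy.2 (by linarith [hy.2]) (by linarith [hy.1, hx.1]))
    have hDeq : ∀ t ∈ I, D t = (∫ y in (0 : ℝ)..t, dX QR q t y * φ y) +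
        ∫ y in t..1, dX RR r t y * φ y := by
      intro t ht
      obtain ⟨i1, i2, i3⟩ := fI t ht
      have w1 : B t = 0 := by
        rw [hB]; simp only; rw [min_eq_right (by linarith), max_eq_left (by linarith)]
      have w2 : M t = 1 := by rw [hM]; exact min_eq_right (by linarith)
      have w3 : N t = t := by
        rw [hN]; simp only; rw [min_eq_right (by linarith), max_eq_left (by linarith)]
      rw [hD, w1, w2, w3, min_eq_right i2.le]
      simp only [intervalIntegral.integral_same, add_zero, zero_add]
    refine ⟨(f1.add l1).congr_deriv ?_, _, (f2.add l2).congr_of_eventuallyEq ?_, ?_⟩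
    · rw [hDeq x hxI, hint]; ring
    · filter_upwards [hIo.mem_nhds hxI] with t ht using hDeq t ht
    · have E2 := b0.edge_eq r0 hIo (dx x) (fun t ht => iQR t t (fI t ht).1.le le_rfl
        (fI t ht).2.1.le (by linarith [(fI t ht).2.2, (fI t ht).1]))
        (fun t ht => iRR t t (fI t ht).1.le le_rfl (fI t ht).2.1.le
        (by linarith [(fI t ht).2.2, (fI t ht).1]))
        (fun t ht => (h.interface t ⟨ht.1.1.le, ht.1.2.le⟩).symm) hxI
      rw [← dY_congr_set (nQR x x (by linarith [hx.1])), ← dY_congr_set (nRR x x (by linarith [hx.1]))]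
        at hj
      rw [← dY_congr_set (nQR x 0 (by linarith))]
      simp only [hs₁, hs₂] at E2 f3 l3
      rw [← hj]
      rw [hint] at l3
      rw [hφ1, hend] at l3
      subst he
      linear_combination f3 + l3 + e₂ * φ x * E2

end

/-! ### The first transformation. -/

/-- One row `v(x) - ∫₀ˣ (k(x,y) u₁(y) + l(x,y) u₂(y)) dy` of the first transformation. -/
def rowState (k l : ℝ → ℝ → ℝ) (v u₁ u₂ : ℝ → ℝ) (x : ℝ) : ℝ :=
  v x - ∫ y in (0 : ℝ)..x, (k x y * u₁ y + l x y * u₂ y)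

section

variable {k l : ℝ → ℝ → ℝ} {v u₁ u₂ : ℝ → ℝ}

lemma intervalIntegrable_section {k : ℝ → ℝ → ℝ} {u : ℝ → ℝ}
    (hk : ContinuousOn (fun z : ℝ × ℝ => k z.1 z.2) triL) (hu : ContinuousOn u (Icc 0 1)) {x : ℝ}
    (hx : x ∈ Icc (0 : ℝ) 1) : IntervalIntegrable (fun y => k x y * u y) volume 0 x :=
  ContinuousOn.intervalIntegrable_of_Icc hx.1 (continuousOn_section_mul hk hu fun _ hy =>
    ⟨⟨hy.1, hy.2, hx.2⟩, hy.1, hy.2.trans hx.2⟩)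

lemma rowState_eq (hk : ContinuousOn (fun z : ℝ × ℝ => k z.1 z.2) triL)
    (hl : ContinuousOn (fun z : ℝ × ℝ => l z.1 z.2) triL) (h1 : ContinuousOn u₁ (Icc 0 1))
    (h2 : ContinuousOn u₂ (Icc 0 1)) {x : ℝ} (hx : x ∈ Icc (0 : ℝ) 1) :
    rowState k l v u₁ u₂ x = v x - (∫ y in (0 : ℝ)..x, k x y * u₁ y) -
      ∫ y in (0 : ℝ)..x, l x y * u₂ y := by
  rw [rowState, intervalIntegral.integral_add (intervalIntegrable_section hk h1 hx)
    (intervalIntegrable_section hl h2 hx)]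
  ring

lemma continuousOn_volterra {k : ℝ → ℝ → ℝ} {u : ℝ → ℝ}
    (hk : ContinuousOn (fun z : ℝ × ℝ => k z.1 z.2) triL) (hu : ContinuousOn u (Icc 0 1)) :
    ContinuousOn (fun x => ∫ y in (0 : ℝ)..x, k x y * u y) (Icc 0 1) :=
  continuousOn_integral_region isClosed_triL hk hu continuous_const continuous_id
    fun _ hx => ⟨hx.1, fun _ hy => ⟨⟨hy.1.le, hy.2.le, hx.2⟩, hy.1.le, hy.2.le.trans hx.2⟩⟩

lemma continuousOn_rowState (hk : ContinuousOn (fun z : ℝ × ℝ => k z.1 z.2) triL)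
    (hl : ContinuousOn (fun z : ℝ × ℝ => l z.1 z.2) triL) (hv : ContinuousOn v (Icc 0 1))
    (h1 : ContinuousOn u₁ (Icc 0 1)) (h2 : ContinuousOn u₂ (Icc 0 1)) :
    ContinuousOn (rowState k l v u₁ u₂) (Icc 0 1) :=
  ((hv.sub (continuousOn_volterra hk h1)).sub (continuousOn_volterra hl h2)).congr
    fun _ hx => rowState_eq hk hl h1 h2 hx

/-- A row of the first transformation turns the reaction into damping. -/
lemma exists_hasDerivIcc_rowState {k' l' : ℝ → ℝ → ℝ} {e e₁ e₂ c : ℝ} {θ₁ θ₂ θ γ δ : ℝ → ℝ}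
    {κ κ' v' v'' u₁' u₁'' u₂' u₂'' : ℝ → ℝ} (he : 0 < e)
    (hk : ContinuousOn (fun z : ℝ × ℝ => k z.1 z.2) triL)
    (hl : ContinuousOn (fun z : ℝ × ℝ => l z.1 z.2) triL)
    (hk' : ContinuousOn (fun z : ℝ × ℝ => k' z.1 z.2) triL)
    (hl' : ContinuousOn (fun z : ℝ × ℝ => l' z.1 z.2) triL)
    (hθ₁ : ContinuousOn θ₁ (Icc 0 1)) (hθ₂ : ContinuousOn θ₂ (Icc 0 1))
    (hθ : ContinuousOn θ (Icc 0 1))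
    (hγ : ContinuousOn γ (Icc 0 1)) (hδ : ContinuousOn δ (Icc 0 1))
    (hv : HasDerivIcc v v') (hv' : HasDerivIcc v' v'')
    (h1 : HasDerivIcc u₁ u₁') (h1' : HasDerivIcc u₁' u₁'')
    (h2 : HasDerivIcc u₂ u₂') (h2' : HasDerivIcc u₂' u₂'')
    (L1 : VolterraLeibniz e e₁ k (fun x y => (θ₁ y + c) * k x y - γ x * k' x y) u₁ u₁' u₁'')
    (L2 : VolterraLeibniz e e₂ l (fun x y => (θ₂ y + c) * l x y - γ x * l' x y) u₂ u₂' u₂'')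
    (hκ : ContinuousOn κ (Icc 0 1)) (hκ0 : κ 0 = 0) (hκ' : ∀ x ∈ Ioo (0 : ℝ) 1, HasDerivAt κ (κ' x) x)
    (hdiag : ∀ x ∈ Ioo (0 : ℝ) 1, k x x * u₁ x + l x x * u₂ x = κ x * v x)
    (hdiag' : ∀ x ∈ Ioo (0 : ℝ) 1, e₁ * k x x * u₁' x + e₂ * l x x * u₂' x = e * κ x * v' x)
    (hdd : ∀ x ∈ Ioo (0 : ℝ) 1, (e * dX triL k x x + e₁ * dY triL k x x) * u₁ x +
      (e * dX triL l x x + e₂ * dY triL l x x) * u₂ x = -(e * κ' x + θ x + c) * v x + δ x)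
    (hbot : ∀ x ∈ Ioo (0 : ℝ) 1, (e₁ * dY triL k x 0 * u₁ 0 - e₁ * k x 0 * u₁' 0) +
      (e₂ * dY triL l x 0 * u₂ 0 - e₂ * l x 0 * u₂' 0) = 0) :
    ∃ w' w'' : ℝ → ℝ, HasDerivIcc (rowState k l v u₁ u₂) w' ∧ HasDerivIcc w' w'' ∧ w' 0 = v' 0 ∧
      ∀ x ∈ Icc (0 : ℝ) 1, rowState k l (fun x => e * v'' x + θ x * v x)
        (fun x => e₁ * u₁'' x + θ₁ x * u₁ x) (fun x => e₂ * u₂'' x + θ₂ x * u₂ x) x =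
        e * w'' x - c * rowState k l v u₁ u₂ x + δ x -
          γ x * ∫ y in (0 : ℝ)..x, (k' x y * u₁ y + l' x y * u₂ y) := by
  obtain ⟨D1, D1c, D10, H1⟩ := L1
  obtain ⟨D2, D2c, D20, H2⟩ := L2
  have cV : ContinuousOn (fun x => e * v'' x + θ x * v x) (Icc 0 1) :=
    (continuousOn_const.mul hv'.cont).add (hθ.mul hv.cont_fun)
  have cV1 : ContinuousOn (fun x => e₁ * u₁'' x + θ₁ x * u₁ x) (Icc 0 1) :=
    (continuousOn_const.mul h1'.cont).add (hθ₁.mul h1.cont_fun)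
  have cV2 : ContinuousOn (fun x => e₂ * u₂'' x + θ₂ x * u₂ x) (Icc 0 1) :=
    (continuousOn_const.mul h2'.cont).add (hθ₂.mul h2.cont_fun)
  have cw := continuousOn_rowState hk hl hv.cont_fun h1.cont_fun h2.cont_fun
  have cW := continuousOn_rowState hk hl cV cV1 cV2
  have cI : ContinuousOn (fun x => ∫ y in (0 : ℝ)..x, (k' x y * u₁ y + l' x y * u₂ y)) (Icc 0 1) :=
    ((continuousOn_volterra hk' h1.cont_fun).add (continuousOn_volterra hl' h2.cont_fun)).congr
      fun x hx => intervalIntegral.integral_add (intervalIntegrable_section hk' h1.cont_fun hx)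
        (intervalIntegrable_section hl' h2.cont_fun hx)
  set w' : ℝ → ℝ := fun x => v' x - κ x * v x - D1 x - D2 x with hw'
  -- The second derivative is defined by solving the target identity for it. Its continuity is then
  -- immediate, and the Leibniz rules are needed only in the open interval.
  set w'' : ℝ → ℝ := fun x => e⁻¹ * (rowState k l (fun x => e * v'' x + θ x * v x)
        (fun x => e₁ * u₁'' x + θ₁ x * u₁ x) (fun x => e₂ * u₂'' x + θ₂ x * u₂ x) x +
        c * rowState k l v u₁ u₂ x - δ x +
          γ x * ∫ y in (0 : ℝ)..x, (k' x y * u₁ y + l' x y * u₂ y)) with hw''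
  have dv : ∀ {f f' : ℝ → ℝ}, HasDerivIcc f f' → ∀ x ∈ Ioo (0 : ℝ) 1, HasDerivAt f (f' x) x :=
    fun h x hx => (h.deriv x ⟨hx.1.le, hx.2.le⟩).hasDerivAt (Icc_mem_nhds hx.1 hx.2)
  refine ⟨w', w'', hasDerivIcc_of_off_countable countable_empty cw ?_ fun x hx _ => ?_,
    hasDerivIcc_of_off_countable countable_empty ?_ ?_ fun x hx _ => ?_, ?_, fun x hx => ?_⟩
  · exact ((hv.cont.sub (hκ.mul hv.cont_fun)).sub D1c).sub D2c
  · refine ((((dv hv x hx).sub (H1 x hx).1).sub (H2 x hx).1).congr_of_eventuallyEq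
      ?_).congr_deriv ?_
    · filter_upwards [Ioo_mem_nhds hx.1 hx.2] with t ht
      exact rowState_eq hk hl h1.cont_fun h2.cont_fun ⟨ht.1.le, ht.2.le⟩
    · rw [hw']; linear_combination -hdiag x hx
  · exact ((hv.cont.sub (hκ.mul hv.cont_fun)).sub D1c).sub D2c
  · exact continuousOn_const.mul (((cW.add (continuousOn_const.mul cw)).sub hδ).add (hγ.mul cI))
  · have hx' : x ∈ Icc (0 : ℝ) 1 := ⟨hx.1.le, hx.2.le⟩
    obtain ⟨-, E1, d1, f1⟩ := H1 x hx
    obtain ⟨-, E2, d2, f2⟩ := H2 x hx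
    refine ((((dv hv' x hx).sub ((hκ' x hx).mul (dv hv x hx))).sub d1).sub d2).congr_deriv ?_
    rw [hw'', eq_inv_mul_iff_mul_eq₀ he.ne', rowState_eq hk hl cV1 cV2 hx',
      rowState_eq hk hl h1.cont_fun h2.cont_fun hx',
      intervalIntegral.integral_add (intervalIntegrable_section hk' h1.cont_fun hx')
        (intervalIntegrable_section hl' h2.cont_fun hx')]
    have split : ∀ {k k' : ℝ → ℝ → ℝ} {u u'' θ : ℝ → ℝ} (ε : ℝ),
        ContinuousOn (fun z : ℝ × ℝ => k z.1 z.2) triL →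
        ContinuousOn (fun z : ℝ × ℝ => k' z.1 z.2) triL → ContinuousOn u (Icc 0 1) →
        ContinuousOn u'' (Icc 0 1) → ContinuousOn θ (Icc 0 1) →
        (∫ y in (0 : ℝ)..x, k x y * (ε * u'' y + θ y * u y)) =
          ε * (∫ y in (0 : ℝ)..x, k x y * u'' y) + (∫ y in (0 : ℝ)..x, k x y * (θ y * u y)) ∧
        (∫ y in (0 : ℝ)..x, ((θ y + c) * k x y - γ x * k' x y) * u y) =
          (∫ y in (0 : ℝ)..x, k x y * (θ y * u y)) + c * (∫ y in (0 : ℝ)..x, k x y * u y) -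
          γ x * ∫ y in (0 : ℝ)..x, k' x y * u y := by
      intro k k' u u'' θ ε hk hk' hu hu'' hθ
      have i1 := intervalIntegrable_section hk hu'' hx'
      have i2 : IntervalIntegrable (fun y => k x y * (θ y * u y)) volume 0 x :=
        intervalIntegrable_section hk (hθ.mul hu) hx'
      have i3 := intervalIntegrable_section hk hu hx'
      have i4 := intervalIntegrable_section hk' hu hx'
      constructor
      · rw [← intervalIntegral.integral_const_mul,
          ← intervalIntegral.integral_add (i1.const_mul ε) i2]
        exact intervalIntegral.integral_congr fun y _ => by ring
      · rw [← intervalIntegral.integral_const_mul, ← intervalIntegral.integral_const_mul,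
          ← intervalIntegral.integral_add i2 (i3.const_mul c),
          ← intervalIntegral.integral_sub (i2.add (i3.const_mul c)) (i4.const_mul (γ x))]
        exact intervalIntegral.integral_congr fun y _ => by ring
    obtain ⟨s1, s2⟩ := split e₁ hk hk' h1.cont_fun h1'.cont hθ₁
    obtain ⟨s3, s4⟩ := split e₂ hl hl' h2.cont_fun h2'.cont hθ₂
    rw [s1, s3]
    rw [s2] at f1
    rw [s4] at f2
    linear_combination -f1 - f2 - hdd x hx + hdiag' x hx + hbot x hx
  · rw [hw']; simp only; rw [hκ0, D10, D20]; ring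
  · rw [hw'']; field_simp; ring

end

lemma HasPartials.continuousOn_diag {k k1 k2 : ℝ × ℝ → ℝ} (h : HasPartials triL k k1 k2) :
    ContinuousOn (fun x : ℝ => k2 (x, x)) (Icc 0 1) :=
  h.cont2.comp (f := fun x : ℝ => (x, x)) (by fun_prop) fun _ hx => ⟨hx.1, le_rfl, hx.2⟩

section

variable {ε y₀ c₁ c₂ : ℝ} {ℓ : ℝ → ℝ} {K : ℝ → ℝ → Matrix (Fin 2) (Fin 2) ℝ}

lemma IsFirstKernel.continuousOn_gCoef (hK : IsFirstKernel ε y₀ c₁ c₂ ℓ K) :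
    ContinuousOn (gCoef ε y₀ K) (Icc 0 1) :=
  continuousOn_const.mul (hasPartials_of_contDiffOn (hK.reg21.of_le (by norm_num))
    uniqueDiffOn_triL).continuousOn_diag

/-- The fold condition gives `k_{i1}(x,0) = a k_{i2}(x,0)` for `x > 0`; in the limit `x → 0` the
off-diagonal entry vanishes. Consequently the transformation keeps the derivatives at `x = 0`, and
with them the flux balance. -/
lemma IsFirstKernel.corner (hε : 0 < ε) (hy : y₀ ∈ Ioc (-1 : ℝ) 0)
    (hK : IsFirstKernel ε y₀ c₁ c₂ ℓ K) : K 0 0 0 0 = 0 ∧ K 0 0 1 1 = 0 := by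
  have ha := aCoef_pos hy
  have hf : ∀ x ∈ Ioo (0 : ℝ) 1, ∀ i, K x 0 i 0 - aCoef y₀ * K x 0 i 1 = 0 := fun x hx i =>
    sub_eq_zero.2 (((fold_iff hε hy).1 (hK.fold x hx)) i).1
  have lim : ∀ i, ContinuousOn (fun z : ℝ × ℝ => K z.1 z.2 i 0) triL →
      ContinuousOn (fun z : ℝ × ℝ => K z.1 z.2 i 1) triL → K 0 0 i 0 - aCoef y₀ * K 0 0 i 1 = 0 := by
    intro i h0 h1
    have hc : ContinuousOn (fun x : ℝ => K x 0 i 0 - aCoef y₀ * K x 0 i 1) (Icc 0 1) :=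
      ContinuousOn.comp (g := fun z : ℝ × ℝ => K z.1 z.2 i 0 - aCoef y₀ * K z.1 z.2 i 1)
        (f := fun x : ℝ => (x, (0 : ℝ))) (h0.sub (continuousOn_const.mul h1)) (by fun_prop)
        fun x hx => ⟨le_rfl, hx.1, hx.2⟩
    have t1 := ((hc 0 ⟨le_rfl, zero_le_one⟩).mono (Ioo_subset_Icc_self)).tendsto
    have : (𝓝[Ioo (0 : ℝ) 1] 0).NeBot := by
      rw [nhdsWithin_Ioo_eq_nhdsGT zero_lt_one]; infer_instance
    refine tendsto_nhds_unique t1 (tendsto_const_nhds.congr' ?_)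
    filter_upwards [self_mem_nhdsWithin] with x hx using (hf x hx i).symm
  have z : (0 : ℝ) ∈ Icc (0 : ℝ) 1 := ⟨le_rfl, zero_le_one⟩
  constructor
  · have := lim 0 hK.reg11.continuousOn hK.cont12
    rw [hK.offdiag12 0 z] at this; linarith
  · have := lim 1 hK.reg21.continuousOn hK.reg22.continuousOn
    rw [hK.offdiag21 0 z] at this
    have : aCoef y₀ * K 0 0 1 1 = 0 := by linarith
    exact (mul_eq_zero.1 this).resolve_left ha.ne'

/-- For `a < 1` the kink of `k₁₂` lies inside the triangle; for `a = 1` the lower piece is the whole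
triangle. -/
lemma IsFirstKernel.volterraLeibniz12 (hy : y₀ ∈ Ioc (-1 : ℝ) 0)
    (hK : IsFirstKernel ε y₀ c₁ c₂ ℓ K) {s : ℝ → ℝ → ℝ}
    (hsc : ContinuousOn (fun z : ℝ × ℝ => s z.1 z.2) triL)
    (hs : ∀ x y, 0 < y → y < x → x < 1 → y ≠ aCoef y₀ * x →
      eps1 ε y₀ * dX triL (dX triL (entry K 0 1)) x y -
        eps2 ε y₀ * dY triL (dY triL (entry K 0 1)) x y = s x y)
    {φ φ' φ'' : ℝ → ℝ} (hφ : HasDerivIcc φ φ') (hφ' : HasDerivIcc φ' φ'') :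
    VolterraLeibniz (eps1 ε y₀) (eps2 ε y₀) (entry K 0 1) s φ φ' φ'' := by
  rcases (aCoef_le_one hy).lt_or_eq with h | h
  · exact volterraLeibniz_of_split (aCoef_pos hy) h (eps2_eq hy) hK.cont12 hK.reg12_lower
      hK.reg12_upper hsc hs hφ hφ'
  · have hC : C2On (entry K 0 1) triL := ContDiffOn.mono hK.reg12_lower fun z hz => ⟨hz, by
      rw [h, one_mul]; exact hz.2.1⟩
    exact volterraLeibniz_of_C2On hC (fun x y h1 h2 h3 => hs x y h1 h2 h3 (by
      rw [h, one_mul]; exact h2.ne)) hφ hφ'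

/-- The first transformation maps the folded system to a cascade: the state `w₁` is damped, and
it enters the equation for `w₂` through the coupling coefficient. -/
lemma IsFirstKernel.transform (hε : 0 < ε) (hy : y₀ ∈ Ioc (-1 : ℝ) 0)
    (hℓ : ContinuousOn ℓ (Icc (-1) 1)) (hK : IsFirstKernel ε y₀ c₁ c₂ ℓ K)
    {u₁ u₁' u₁'' u₂ u₂' u₂'' : ℝ → ℝ} (h1 : HasDerivIcc u₁ u₁') (h1' : HasDerivIcc u₁' u₁'')
    (h2 : HasDerivIcc u₂ u₂') (h2' : HasDerivIcc u₂' u₂'') (h0 : u₁ 0 = u₂ 0)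
    (h0' : u₁' 0 + aCoef y₀ * u₂' 0 = 0) :
    ∃ w₁' w₁'' w₂' w₂'' : ℝ → ℝ,
      HasDerivIcc (rowState (entry K 0 0) (entry K 0 1) u₁ u₁ u₂) w₁' ∧ HasDerivIcc w₁' w₁'' ∧
      HasDerivIcc (rowState (entry K 1 0) (entry K 1 1) u₂ u₁ u₂) w₂' ∧ HasDerivIcc w₂' w₂'' ∧
      w₁' 0 = u₁' 0 ∧ w₂' 0 = u₂' 0 ∧
      (∀ x ∈ Icc (0 : ℝ) 1, rowState (entry K 0 0) (entry K 0 1)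
        (fun x => eps1 ε y₀ * u₁'' x + ℓ (y₀ - (1 + y₀) * x) * u₁ x)
        (fun x => eps1 ε y₀ * u₁'' x + ℓ (y₀ - (1 + y₀) * x) * u₁ x)
        (fun x => eps2 ε y₀ * u₂'' x + ℓ (y₀ + (1 - y₀) * x) * u₂ x) x =
        eps1 ε y₀ * w₁'' x - c₁ * rowState (entry K 0 0) (entry K 0 1) u₁ u₁ u₂ x) ∧
      ∀ x ∈ Icc (0 : ℝ) 1, rowState (entry K 1 0) (entry K 1 1)
        (fun x => eps2 ε y₀ * u₂'' x + ℓ (y₀ + (1 - y₀) * x) * u₂ x)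
        (fun x => eps1 ε y₀ * u₁'' x + ℓ (y₀ - (1 + y₀) * x) * u₁ x)
        (fun x => eps2 ε y₀ * u₂'' x + ℓ (y₀ + (1 - y₀) * x) * u₂ x) x =
        eps2 ε y₀ * w₂'' x - c₂ * rowState (entry K 1 0) (entry K 1 1) u₂ u₁ u₂ x +
          gCoef ε y₀ K x * rowState (entry K 0 0) (entry K 0 1) u₁ u₁ u₂ x := by
  have he1 := eps1_pos hε hy
  have he2 := eps2_pos hε hy
  have hθ₁ : ContinuousOn (fun x => ℓ (y₀ - (1 + y₀) * x)) (Icc 0 1) :=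
    hℓ.comp (by fun_prop) fun x hx => ⟨by nlinarith [hx.1, hx.2, hy.1], by
      nlinarith [hx.1, hx.2, hy.1, hy.2]⟩
  have hθ₂ : ContinuousOn (fun x => ℓ (y₀ + (1 - y₀) * x)) (Icc 0 1) :=
    hℓ.comp (by fun_prop) fun x hx => ⟨by nlinarith [hx.1, hx.2, hy.1, hy.2], by
      nlinarith [hx.1, hx.2, hy.1, hy.2]⟩
  have p11 : ContinuousOn (fun z : ℝ × ℝ => entry K 0 0 z.1 z.2) triL := hK.reg11.continuousOn
  have p12 : ContinuousOn (fun z : ℝ × ℝ => entry K 0 1 z.1 z.2) triL := hK.cont12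
  have p21 : ContinuousOn (fun z : ℝ × ℝ => entry K 1 0 z.1 z.2) triL := hK.reg21.continuousOn
  have p22 : ContinuousOn (fun z : ℝ × ℝ => entry K 1 1 z.1 z.2) triL := hK.reg22.continuousOn
  have q11 := hasPartials_of_contDiffOn (f := entry K 0 0) (hK.reg11.of_le (by norm_num)) uniqueDiffOn_triL
  have q22 := hasPartials_of_contDiffOn (f := entry K 1 1) (hK.reg22.of_le (by norm_num)) uniqueDiffOn_triL
  have gc := hK.continuousOn_gCoef
  have diagc : ∀ i j, ContinuousOn (fun z : ℝ × ℝ => entry K i j z.1 z.2) triL →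
      ContinuousOn (fun x => K x x i j) (Icc 0 1) := fun i j h =>
    h.comp (f := fun x : ℝ => (x, x)) (by fun_prop) fun x hx => ⟨hx.1, le_rfl, hx.2⟩
  have pde0 := fun x y (h1 : 0 < y) (h2 : y < x) (h3 : x < 1) (h4 : y ≠ aCoef y₀ * x) =>
    pde_iff.1 (hK.pde x y h1 h2 h3 h4)
  -- The equations are assumed only off `y = a x`; for the entries that are `C²` across this line
  -- they extend to it by continuity.
  have pdeC : ∀ {e e' : ℝ} {k s : ℝ → ℝ → ℝ}, C2On k triL →
      ContinuousOn (fun z : ℝ × ℝ => s z.1 z.2) triL →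
      (∀ x y, 0 < y → y < x → x < 1 → y ≠ aCoef y₀ * x →
        e * dX triL (dX triL k) x y - e' * dY triL (dY triL k) x y = s x y) →
      ∀ x y, 0 < y → y < x → x < 1 →
        e * dX triL (dX triL k) x y - e' * dY triL (dY triL k) x y = s x y := by
    intro e e' k s hk hs h x y a1 a2 a3
    by_cases hxy : y = aCoef y₀ * x
    swap
    · exact h x y a1 a2 a3 hxy
    have c1 := (hasPartials_of_contDiffOn (hk.contDiffOn_dX uniqueDiffOn_triL)
      uniqueDiffOn_triL).cont1
    have c2 := (hasPartials_of_contDiffOn (hk.contDiffOn_dY uniqueDiffOn_triL)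
      uniqueDiffOn_triL).cont2
    have cc : ContinuousOn (fun z : ℝ × ℝ => e * dX triL (dX triL k) z.1 z.2 -
        e' * dY triL (dY triL k) z.1 z.2 - s z.1 z.2) triL :=
      ((continuousOn_const.mul c1).sub (continuousOn_const.mul c2)).sub hs
    have ct := (cc.continuousAt (mem_nhds_triL a1 a2 a3)).tendsto
    have lim : Tendsto (fun t : ℝ => (x, t)) (𝓝[≠] y) (𝓝 (x, y)) :=
      ((by fun_prop : Continuous fun t : ℝ => (x, t)).tendsto y).mono_left nhdsWithin_le_nhds
    have ev : ∀ᶠ t in 𝓝[≠] y, (0 : ℝ) = e * dX triL (dX triL k) x t -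
        e' * dY triL (dY triL k) x t - s x t := by
      filter_upwards [mem_nhdsWithin_of_mem_nhds (Ioo_mem_nhds a1 a2), self_mem_nhdsWithin]
        with t ht hne
      exact (sub_eq_zero.2 (h x t ht.1 ht.2 a3 fun h => hne (h.trans hxy.symm))).symm
    exact sub_eq_zero.1 (tendsto_nhds_unique (ct.comp lim) (tendsto_const_nhds.congr' ev))
  have zero_deriv : ∀ i j, (∀ x ∈ Icc (0 : ℝ) 1, K x x i j = 0) → ∀ x ∈ Ioo (0 : ℝ) 1,
      deriv (fun s => K s s i j) x = 0 := fun i j h x hx => by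
    have : (fun s => K s s i j) =ᶠ[𝓝 x] fun _ => 0 := by
      filter_upwards [Ioo_mem_nhds hx.1 hx.2] with s hs using h s ⟨hs.1.le, hs.2.le⟩
    rw [this.deriv_eq, deriv_const]
  obtain ⟨z1, z2⟩ := hK.corner hε hy
  have sc : ∀ {θ γ : ℝ → ℝ} {k k' : ℝ → ℝ → ℝ} (c : ℝ), ContinuousOn θ (Icc 0 1) →
      ContinuousOn γ (Icc 0 1) → ContinuousOn (fun z : ℝ × ℝ => k z.1 z.2) triL →
      ContinuousOn (fun z : ℝ × ℝ => k' z.1 z.2) triL → ContinuousOn (fun z : ℝ × ℝ =>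
        (θ z.2 + c) * k z.1 z.2 - γ z.1 * k' z.1 z.2) triL := fun c hθ hγ hk hk' =>
    (((hθ.comp continuousOn_snd fun z hz => triL_snd_mem hz).add continuousOn_const).mul hk).sub
      ((hγ.comp continuousOn_fst fun z hz => ⟨hz.1.trans hz.2.1, hz.2.2⟩).mul hk')
  have fold := fun x hx => (fold_iff hε hy).1 (hK.fold x hx)
  have he := eps2_eq (ε := ε) hy
  have z0 : ContinuousOn (fun _ : ℝ => (0 : ℝ)) (Icc 0 1) := continuousOn_const
  -- The boundary terms at `y = 0` cancel: the fold conditions on the kernel are dual to those on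
  -- the state.
  have bot : ∀ i, ∀ x ∈ Ioo (0 : ℝ) 1,
      (eps1 ε y₀ * dY triL (entry K i 0) x 0 * u₁ 0 - eps1 ε y₀ * entry K i 0 x 0 * u₁' 0) +
      (eps2 ε y₀ * dY triL (entry K i 1) x 0 * u₂ 0 - eps2 ε y₀ * entry K i 1 x 0 * u₂' 0) = 0 := by
    intro i x hx
    obtain ⟨f1, f2⟩ := fold x hx i
    have f1' : entry K i 0 x 0 = aCoef y₀ * entry K i 1 x 0 := f1
    rw [he, ← h0, f1']
    linear_combination eps1 ε y₀ * u₁ 0 * f2 - eps1 ε y₀ * aCoef y₀ * entry K i 1 x 0 * h0'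
  obtain ⟨w₁', w₁'', A1, A2, A3, A4⟩ := exists_hasDerivIcc_rowState (γ := fun _ => 0)
    (δ := fun _ => 0) (κ := fun x => K x x 0 0) (κ' := fun x => deriv (fun s => K s s 0 0) x)
    (θ₁ := fun x => ℓ (y₀ - (1 + y₀) * x)) (θ₂ := fun x => ℓ (y₀ + (1 - y₀) * x))
    (θ := fun x => ℓ (y₀ - (1 + y₀) * x)) (c := c₁) he1 p11 p12 p11 p12 hθ₁ hθ₂ hθ₁ z0 z0
    h1 h1' h1 h1' h2 h2'
    (volterraLeibniz_of_C2On (e₂ := eps1 ε y₀) hK.reg11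
      (pdeC hK.reg11 (sc c₁ hθ₁ z0 p11 p11) fun x y a1 a2 a3 a4 => by
        rw [zero_mul, sub_zero]; exact (pde0 x y a1 a2 a3 a4).1) h1 h1')
    (hK.volterraLeibniz12 hy (sc c₁ hθ₂ z0 p12 p12) (fun x y a1 a2 a3 a4 => by
        rw [zero_mul, sub_zero]; exact (pde0 x y a1 a2 a3 a4).2.1) h2 h2')
    (diagc 0 0 p11) z1 (fun x hx => (q11.hasDerivAt_line isOpen_Ioo (hasDerivAt_id x)
      (fun t ht => ⟨ht.1.le, le_rfl, ht.2.le⟩) hx).differentiableAt.hasDerivAt)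
    (fun x hx => by
      have := hK.offdiag12 x ⟨hx.1.le, hx.2.le⟩
      simp only [entry]; rw [this]; ring)
    (fun x hx => by
      have := hK.offdiag12 x ⟨hx.1.le, hx.2.le⟩
      simp only [entry]; rw [this]; ring)
    (fun x hx => by
      obtain ⟨d1, d2, -, -⟩ := diag_iff.1 (hK.diag x hx)
      rw [zero_deriv 0 1 hK.offdiag12 x hx] at d2
      linear_combination u₁ x * d1 + u₂ x * d2)
    (bot 0)
  -- `γ` comes from `-G K` in the kernel equation and `δ = g u₁` from `G` on the diagonal; together
  -- they produce `g` times the first row of the transformed state.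
  obtain ⟨w₂', w₂'', B1, B2, B3, B4⟩ := exists_hasDerivIcc_rowState (γ := gCoef ε y₀ K)
    (δ := fun x => gCoef ε y₀ K x * u₁ x) (κ := fun x => K x x 1 1)
    (κ' := fun x => deriv (fun s => K s s 1 1) x)
    (θ₁ := fun x => ℓ (y₀ - (1 + y₀) * x)) (θ₂ := fun x => ℓ (y₀ + (1 - y₀) * x))
    (θ := fun x => ℓ (y₀ + (1 - y₀) * x)) (c := c₂) he2 p21 p22 p11 p12 hθ₁ hθ₂ hθ₂ gc
    (gc.mul h1.cont_fun) h2 h2' h1 h1' h2 h2'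
    (volterraLeibniz_of_C2On (e₂ := eps1 ε y₀) hK.reg21
      (pdeC hK.reg21 (sc c₂ hθ₁ gc p21 p11) fun x y a1 a2 a3 a4 =>
        (pde0 x y a1 a2 a3 a4).2.2.1) h1 h1')
    (volterraLeibniz_of_C2On (e₂ := eps2 ε y₀) hK.reg22
      (pdeC hK.reg22 (sc c₂ hθ₂ gc p22 p12) fun x y a1 a2 a3 a4 =>
        (pde0 x y a1 a2 a3 a4).2.2.2) h2 h2')
    (diagc 1 1 p22) z2 (fun x hx => (q22.hasDerivAt_line isOpen_Ioo (hasDerivAt_id x)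
      (fun t ht => ⟨ht.1.le, le_rfl, ht.2.le⟩) hx).differentiableAt.hasDerivAt)
    (fun x hx => by
      have := hK.offdiag21 x ⟨hx.1.le, hx.2.le⟩
      simp only [entry]; rw [this]; ring)
    (fun x hx => by
      have := hK.offdiag21 x ⟨hx.1.le, hx.2.le⟩
      simp only [entry]; rw [this]; ring)
    (fun x hx => by
      obtain ⟨-, -, d1, d2⟩ := diag_iff.1 (hK.diag x hx)
      rw [zero_deriv 1 0 hK.offdiag21 x hx] at d1
      linear_combination u₁ x * d1 + u₂ x * d2)
    (bot 1)
  refine ⟨w₁', w₁'', w₂', w₂'', A1, A2, B1, B2, A3, B3, fun x hx => ?_, fun x hx => ?_⟩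
  · rw [A4 x hx]; ring
  · rw [B4 x hx]
    simp only [rowState]
    ring

end

/-! ### The second transformation. -/

lemma HasDerivIcc.hasDerivAt {φ φ' : ℝ → ℝ} (h : HasDerivIcc φ φ') {x : ℝ}
    (hx : x ∈ Ioo (0 : ℝ) 1) : HasDerivAt φ (φ' x) x :=
  (h.deriv x ⟨hx.1.le, hx.2.le⟩).hasDerivAt (Icc_mem_nhds hx.1 hx.2)

lemma HasDerivIcc.eq_integral {φ φ' : ℝ → ℝ} (h : HasDerivIcc φ φ') {x : ℝ}
    (hx : x ∈ Icc (0 : ℝ) 1) : φ x = φ 0 + ∫ s in (0 : ℝ)..x, φ' s := by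
  have hs : Icc 0 x ⊆ Icc (0 : ℝ) 1 := Icc_subset_Icc le_rfl hx.2
  rw [integral_eq_sub_of_hasDerivAt_of_le hx.1 (h.cont_fun.mono hs)
    (fun t ht => h.hasDerivAt ⟨ht.1, ht.2.trans_le hx.2⟩)
    ((h.cont.mono hs).intervalIntegrable_of_Icc hx.1)]
  ring

/-- Substituting `s = x - y` places the derivative on `φ`, so continuity of `p` suffices. -/
lemma hasDerivAt_convolution {p φ φ' : ℝ → ℝ} (hp : ContinuousOn p (Icc 0 1))
    (hφ : HasDerivIcc φ φ') {x : ℝ} (hx : x ∈ Ioo (0 : ℝ) 1) :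
    HasDerivAt (fun x => ∫ y in (0 : ℝ)..x, p (x - y) * φ y)
      (p x * φ 0 + ∫ y in (0 : ℝ)..x, p (x - y) * φ' y) x := by
  obtain ⟨P, hP, hPp⟩ := exists_continuous_extension isClosed_Icc hp
  obtain ⟨Ψ, hΨ, hΨφ⟩ := exists_continuous_extension isClosed_Icc hφ.cont
  obtain ⟨Φ, hΦ⟩ : ∃ Φ : ℝ → ℝ, ∀ t, Φ t = φ 0 + ∫ s in (0 : ℝ)..t, Ψ s := ⟨_, fun _ => rfl⟩
  have dΦ : ∀ t, HasDerivAt Φ (Ψ t) t := fun t =>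
    ((hasDerivAt_integral_upper hΨ 0 t).const_add (φ 0)).congr_of_eventuallyEq
      (Eventually.of_forall hΦ)
  have cΦ : Continuous Φ := continuous_iff_continuousAt.2 fun t => (dΦ t).continuousAt
  have eΦ : ∀ t ∈ Icc (0 : ℝ) 1, Φ t = φ t := fun t ht => by
    rw [hΦ, hφ.eq_integral ht]
    congr 1
    refine intervalIntegral.integral_congr fun s hs => ?_
    rw [uIcc_of_le ht.1] at hs
    exact hΨφ ⟨hs.1, hs.2.trans ht.2⟩
  have conv : ∀ {f F : ℝ → ℝ}, (∀ t ∈ Icc (0 : ℝ) 1, F t = f t) → ∀ t ∈ Ioo (0 : ℝ) 1,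
      ∫ y in (0 : ℝ)..t, p (t - y) * f y = ∫ s in (0 : ℝ)..t, P s * F (t - s) := by
    intro f F hF t ht
    have := intervalIntegral.integral_comp_sub_left (a := 0) (b := t)
      (fun s => P s * F (t - s)) t
    rw [sub_self, sub_zero] at this
    rw [← this]
    refine intervalIntegral.integral_congr fun y hy => ?_
    rw [uIcc_of_le ht.1.le] at hy
    have m1 : t - y ∈ Icc (0 : ℝ) 1 := ⟨by linarith [hy.2], by linarith [hy.1, ht.2]⟩
    simp only [sub_sub_cancel]
    rw [hPp m1, hF y ⟨hy.1, hy.2.trans ht.2.le⟩]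
  have main := hasDerivAt_integral_limits (H := fun z => P z.2 * Φ (z.1 - z.2))
    (H' := fun z => P z.2 * Ψ (z.1 - z.2)) (by fun_prop) (by fun_prop)
    (fun t s => (((dΦ (t - s)).comp t ((hasDerivAt_id t).sub_const s)).const_mul
      (P s)).congr_deriv (by ring)) (hasDerivAt_const x (0 : ℝ)) (hasDerivAt_id x)
  refine (main.congr_of_eventuallyEq ?_).congr_deriv ?_
  · filter_upwards [Ioo_mem_nhds hx.1 hx.2] with t ht using conv eΦ t ht
  · have k := conv (fun t ht => hΨφ ht) x hx
    have hx' : x ∈ Icc (0 : ℝ) 1 := ⟨hx.1.le, hx.2.le⟩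
    rw [k, ← hPp hx', ← eΦ 0 ⟨le_rfl, zero_le_one⟩]
    simp only [id, sub_self]
    ring

/-- The second component of the second transformation. -/
def secondState (p : ℝ → ℝ) (q r : ℝ → ℝ → ℝ) (w₁ w₂ : ℝ → ℝ) (x : ℝ) : ℝ :=
  w₂ x - ((∫ y in (0 : ℝ)..x, q x y * w₁ y) + ∫ y in x..1, r x y * w₁ y) -
    ∫ y in (0 : ℝ)..x, p (x - y) * w₂ y

section

variable {ε y₀ c₁ c₂ : ℝ} {g p : ℝ → ℝ} {q r : ℝ → ℝ → ℝ} {w₁ w₁' w₁'' w₂ w₂' w₂'' : ℝ → ℝ}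

lemma exists_fredholmLeibniz (hy : y₀ ∈ Ioc (-1 : ℝ) 0)
    (h : IsSecondKernel ε y₀ c₁ c₂ g p q r) (hg : ContinuousOn g (Icc 0 1))
    (hφ : HasDerivIcc w₁ w₁') (hφ' : HasDerivIcc w₁' w₁'') (h1 : w₁ 1 = 0) :
    ∃ E : Set ℝ, E.Countable ∧ FredholmLeibniz (eps2 ε y₀) (eps1 ε y₀) E q r
      (fun x y => (c₂ - c₁) * q x y + g y * p (x - y))
      (fun x y => (c₂ - c₁) * r x y) g w₁ w₁' w₁'' := by
  rcases hy.2.lt_or_eq with hlt | rfl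
  · exact ⟨_, (Set.toFinite _).countable, fredholmLeibniz_asymmetric ⟨hy.1, hlt⟩ h hg hφ hφ' h1⟩
  · exact ⟨∅, countable_empty, fredholmLeibniz_symmetric h hφ hφ' h1 ∅⟩

lemma IsSecondKernel.continuousOn_p (h : IsSecondKernel ε y₀ c₁ c₂ g p q r) :
    ContinuousOn p (Icc 0 1) := by
  refine ContinuousOn.congr (f := fun x => (aCoef y₀)⁻¹ * q x 0) ?_ fun x hx => h.p_eq x hx
  exact continuousOn_const.mul (h.cont_q.comp (f := fun x : ℝ => (x, (0 : ℝ))) (by fun_prop)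
    fun x hx => ⟨le_rfl, hx.1, hx.2⟩)

lemma hasDerivAt_edge_of_C2On {k : ℝ → ℝ → ℝ} {A : Set (ℝ × ℝ)} (hk : C2On k A) {x : ℝ}
    (hx : x ∈ Ioo (0 : ℝ) 1) (hA : A =ᶠ[𝓝 (x, 0)] triL) :
    HasDerivAt (fun x => k x 0) (dX triL k x 0) x := by
  have m0 : (x, (0 : ℝ)) ∈ triL := ⟨le_rfl, hx.1.le, hx.2.le⟩
  have hd : DifferentiableWithinAt ℝ (fun z : ℝ × ℝ => k z.1 z.2) A (x, 0) :=
    (hk.differentiableOn (by norm_num)) _ (hA.mem_iff.self_of_nhds.2 m0)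
  have hd' : DifferentiableWithinAt ℝ (fun z : ℝ × ℝ => k z.1 z.2) triL (x, 0) :=
    (differentiableWithinAt_congr_set hA).1 hd
  have hl : HasDerivWithinAt (fun t : ℝ => (t, (0 : ℝ))) ((1 : ℝ), (0 : ℝ)) (Ioo 0 1) x :=
    ((hasDerivAt_id x).prodMk (hasDerivAt_const x 0)).hasDerivWithinAt
  have hm : MapsTo (fun t : ℝ => (t, (0 : ℝ))) (Ioo 0 1) triL :=
    fun t ht => ⟨le_rfl, ht.1.le, ht.2.le⟩
  exact (hd'.hasFDerivWithinAt.comp_hasDerivWithinAt x hl hm).hasDerivAt (Ioo_mem_nhds hx.1 hx.2)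

lemma IsSecondKernel.hasDerivAt_edge (h : IsSecondKernel ε y₀ c₁ c₂ g p q r) {x : ℝ}
    (hx : x ∈ Ioo (0 : ℝ) 1) (hxa : x ≠ 2 * aCoef y₀) :
    HasDerivAt (fun x => q x 0) (dX triL q x 0) x := by
  have hc : ContinuousAt (fun z : ℝ × ℝ => z.1 + aCoef y₀ * z.2) (x, 0) := by fun_prop
  rcases hxa.lt_or_gt with hlt | hlt
  · refine hasDerivAt_edge_of_C2On h.reg_q_left hx ?_
    filter_upwards [hc.eventually_lt continuousAt_const (by simpa using hlt)] with z hz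
    exact propext ⟨fun k => k.1, fun k => ⟨k, hz.le⟩⟩
  · refine hasDerivAt_edge_of_C2On h.reg_q_right hx ?_
    filter_upwards [continuousAt_const.eventually_lt hc (by simpa using hlt)] with z hz
    exact propext ⟨fun k => k.1, fun k => ⟨k, hz.le⟩⟩

lemma continuousOn_secondState (h : IsSecondKernel ε y₀ c₁ c₂ g p q r)
    (h1 : ContinuousOn w₁ (Icc 0 1)) (h2 : ContinuousOn w₂ (Icc 0 1)) :
    ContinuousOn (secondState p q r w₁ w₂) (Icc 0 1) := by
  refine (h2.sub ((continuousOn_volterra h.cont_q h1).add ?_)).sub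
    (continuousOn_volterra (k := fun x y => p (x - y)) (h.continuousOn_p.comp (by fun_prop)
      fun z hz => ⟨by linarith [hz.2.1], by linarith [hz.1, hz.2.2]⟩) h2)
  exact continuousOn_integral_region isClosed_triU h.cont_r h1 continuous_id continuous_const
    fun x hx => ⟨hx.2, fun y hy => ⟨⟨hx.1, hy.1.le, hy.2.le⟩, hx.1.trans hy.1.le, hy.2.le⟩⟩

/-- The second transformation removes the coupling. -/
lemma IsSecondKernel.transform (hε : 0 < ε) (hy : y₀ ∈ Ioc (-1 : ℝ) 0)
    (h : IsSecondKernel ε y₀ c₁ c₂ g p q r) (hg : ContinuousOn g (Icc 0 1))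
    (h1 : HasDerivIcc w₁ w₁') (h1' : HasDerivIcc w₁' w₁'') (h2 : HasDerivIcc w₂ w₂')
    (h2' : HasDerivIcc w₂' w₂'') (hw1 : w₁ 1 = 0) (h0 : w₁ 0 = w₂ 0)
    (h0' : w₁' 0 + aCoef y₀ * w₂' 0 = 0) {v₁ v₂ : ℝ → ℝ}
    (hv₁ : ∀ x ∈ Icc (0 : ℝ) 1, v₁ x = eps1 ε y₀ * w₁'' x - c₁ * w₁ x)
    (hv₂ : ∀ x ∈ Icc (0 : ℝ) 1, v₂ x = eps2 ε y₀ * w₂'' x - c₂ * w₂ x + g x * w₁ x) :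
    ∃ ω' ω'' : ℝ → ℝ, HasDerivIcc (secondState p q r w₁ w₂) ω' ∧ HasDerivIcc ω' ω'' ∧
      ω' 0 = w₂' 0 ∧ ∀ x ∈ Icc (0 : ℝ) 1, secondState p q r v₁ v₂ x =
        eps2 ε y₀ * ω'' x - c₂ * secondState p q r w₁ w₂ x := by
  obtain ⟨E, hE, D, Dc, D0, HD⟩ := exists_fredholmLeibniz hy h hg h1 h1' hw1
  have ha := aCoef_pos hy
  have he := eps2_eq (ε := ε) hy
  have he2 := eps2_pos hε hy
  have pc := h.continuousOn_p
  have pk : ContinuousOn (fun z : ℝ × ℝ => p (z.1 - z.2)) triL := pc.comp (by fun_prop)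
    fun z hz => ⟨by linarith [hz.2.1], by linarith [hz.1, hz.2.2]⟩
  have p0 : p 0 = 0 := by
    have m : (0 : ℝ) ∈ Icc (0 : ℝ) 1 := ⟨le_rfl, zero_le_one⟩
    rw [h.p_eq 0 m, ← h.interface 0 m, h.r_init 0 m, mul_zero]
  have cv₁ : ContinuousOn v₁ (Icc 0 1) :=
    ((continuousOn_const.mul h1'.cont).sub (continuousOn_const.mul h1.cont_fun)).congr hv₁
  have cv₂ : ContinuousOn v₂ (Icc 0 1) :=
    (((continuousOn_const.mul h2'.cont).sub (continuousOn_const.mul h2.cont_fun)).add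
      (hg.mul h1.cont_fun)).congr hv₂
  have cω := continuousOn_secondState h h1.cont_fun h2.cont_fun
  set ω' : ℝ → ℝ := fun x => w₂' x - D x - (p x * w₂ 0 + ∫ y in (0 : ℝ)..x, p (x - y) * w₂' y)
    with hω'
  set ω'' : ℝ → ℝ := fun x => (eps2 ε y₀)⁻¹ *
    (secondState p q r v₁ v₂ x + c₂ * secondState p q r w₁ w₂ x) with hω''
  have cω' : ContinuousOn ω' (Icc 0 1) := (h2'.cont_fun.sub Dc).sub
    ((pc.mul continuousOn_const).add (continuousOn_volterra (k := fun x y => p (x - y)) pk h2.cont))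
  -- At `x = 2a` the edge trace `q(x, 0)`, and with it `p`, may have a kink.
  have hE' : (E ∪ {2 * aCoef y₀}).Countable := hE.union (countable_singleton _)
  refine ⟨ω', ω'', hasDerivIcc_of_off_countable hE' cω cω' fun x hx hxE => ?_,
    hasDerivIcc_of_off_countable hE' cω' ?_ fun x hx hxE => ?_, ?_, fun x hx => ?_⟩
  · exact ((h2.hasDerivAt hx).sub (HD x hx fun k => hxE (Or.inl k)).1).sub
      (hasDerivAt_convolution pc h2 hx)
  · exact continuousOn_const.mul
      ((continuousOn_secondState h cv₁ cv₂).add (continuousOn_const.mul cω))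
  · obtain ⟨-, D₂, d, f⟩ := HD x hx fun k => hxE (Or.inl k)
    have hxa : x ≠ 2 * aCoef y₀ := fun k => hxE (Or.inr k)
    have hx' : x ∈ Icc (0 : ℝ) 1 := ⟨hx.1.le, hx.2.le⟩
    have dp : HasDerivAt p ((aCoef y₀)⁻¹ * dX triL q x 0) x := by
      refine ((h.hasDerivAt_edge hx hxa).const_mul _).congr_of_eventuallyEq ?_
      filter_upwards [Ioo_mem_nhds hx.1 hx.2] with t ht using h.p_eq t ⟨ht.1.le, ht.2.le⟩
    refine (((h2'.hasDerivAt hx).sub d).sub ((dp.mul_const (w₂ 0)).add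
      (hasDerivAt_convolution pc h2' hx))).congr_deriv ?_
    rw [hω'', eq_inv_mul_iff_mul_eq₀ he2.ne']
    have i : ∀ {k : ℝ → ℝ → ℝ} {u : ℝ → ℝ}, ContinuousOn (fun z : ℝ × ℝ => k z.1 z.2) triL →
        ContinuousOn u (Icc 0 1) → IntervalIntegrable (fun y => k x y * u y) volume 0 x :=
      fun hk hu => intervalIntegrable_section hk hu hx'
    have j : ∀ {u : ℝ → ℝ}, ContinuousOn u (Icc 0 1) →
        IntervalIntegrable (fun y => r x y * u y) volume x 1 := fun hu =>
      (continuousOn_section_mul h.cont_r hu fun y hy =>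
        ⟨⟨hx'.1, hy.1, hy.2⟩, hx'.1.trans hy.1, hy.2⟩).intervalIntegrable_of_Icc hx'.2
    have e1 : ∫ y in (0 : ℝ)..x, q x y * v₁ y =
        eps1 ε y₀ * (∫ y in (0 : ℝ)..x, q x y * w₁'' y) - c₁ * ∫ y in (0 : ℝ)..x, q x y * w₁ y := by
      rw [← intervalIntegral.integral_const_mul, ← intervalIntegral.integral_const_mul,
        ← intervalIntegral.integral_sub ((i h.cont_q h1'.cont).const_mul _)
          ((i h.cont_q h1.cont_fun).const_mul _)]
      refine intervalIntegral.integral_congr fun y hy => ?_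
      rw [uIcc_of_le hx'.1] at hy
      rw [hv₁ y ⟨hy.1, hy.2.trans hx'.2⟩]; ring
    have e2 : ∫ y in x..1, r x y * v₁ y =
        eps1 ε y₀ * (∫ y in x..1, r x y * w₁'' y) - c₁ * ∫ y in x..1, r x y * w₁ y := by
      rw [← intervalIntegral.integral_const_mul, ← intervalIntegral.integral_const_mul,
        ← intervalIntegral.integral_sub ((j h1'.cont).const_mul _)
          ((j h1.cont_fun).const_mul _)]
      refine intervalIntegral.integral_congr fun y hy => ?_
      rw [uIcc_of_le hx'.2] at hy
      rw [hv₁ y ⟨hx'.1.trans hy.1, hy.2⟩]; ring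
    have k1 := i (k := fun x y => p (x - y)) pk h2'.cont
    have k2 := i (k := fun x y => p (x - y)) pk h2.cont_fun
    have k3 : IntervalIntegrable (fun y => p (x - y) * (g y * w₁ y)) volume 0 x :=
      i (k := fun x y => p (x - y)) pk (hg.mul h1.cont_fun)
    have e3 : ∫ y in (0 : ℝ)..x, p (x - y) * v₂ y =
        eps2 ε y₀ * (∫ y in (0 : ℝ)..x, p (x - y) * w₂'' y) -
          c₂ * (∫ y in (0 : ℝ)..x, p (x - y) * w₂ y) +
          ∫ y in (0 : ℝ)..x, p (x - y) * (g y * w₁ y) := by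
      rw [← intervalIntegral.integral_const_mul, ← intervalIntegral.integral_const_mul,
        ← intervalIntegral.integral_sub (k1.const_mul _) (k2.const_mul _),
        ← intervalIntegral.integral_add ((k1.const_mul _).sub (k2.const_mul _)) k3]
      refine intervalIntegral.integral_congr fun y hy => ?_
      rw [uIcc_of_le hx'.1] at hy
      rw [hv₂ y ⟨hy.1, hy.2.trans hx'.2⟩]; ring
    have e4 : ∫ y in (0 : ℝ)..x, ((c₂ - c₁) * q x y + g y * p (x - y)) * w₁ y =
        (c₂ - c₁) * (∫ y in (0 : ℝ)..x, q x y * w₁ y) +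
          ∫ y in (0 : ℝ)..x, p (x - y) * (g y * w₁ y) := by
      rw [← intervalIntegral.integral_const_mul,
        ← intervalIntegral.integral_add ((i h.cont_q h1.cont_fun).const_mul _) k3]
      exact intervalIntegral.integral_congr fun y _ => by ring
    have e5 : ∫ y in x..1, (c₂ - c₁) * r x y * w₁ y = (c₂ - c₁) * ∫ y in x..1, r x y * w₁ y := by
      rw [← intervalIntegral.integral_const_mul]
      exact intervalIntegral.integral_congr fun y _ => by ring
    simp only [secondState]
    rw [e4, e5] at f
    rw [e1, e2, e3, hv₂ x hx']
    have fold := h.fold x hx hxa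
    have pe := h.p_eq x hx'
    have aa : aCoef y₀ * (aCoef y₀)⁻¹ = 1 := mul_inv_cancel₀ ha.ne'
    -- The edge terms `p' w₂(0) + p w₂'(0)` of the convolution cancel those of `q` at `y = 0`. This
    -- is the reason for `p = a⁻¹ q(·, 0)` and `∂_y q = a ∂_x q` on the edge.
    have b1 : eps2 ε y₀ * ((aCoef y₀)⁻¹ * dX triL q x 0) = eps1 ε y₀ * dY triL q x 0 := by
      rw [he, fold]; linear_combination eps1 ε y₀ * aCoef y₀ * dX triL q x 0 * aa
    have b2 : eps2 ε y₀ * p x = aCoef y₀ * eps1 ε y₀ * q x 0 := by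
      rw [he, pe]; linear_combination eps1 ε y₀ * aCoef y₀ * q x 0 * aa
    linear_combination -f - w₂ 0 * b1 - w₂' 0 * b2 + eps1 ε y₀ * dY triL q x 0 * h0 - eps1 ε y₀ * q x 0 * h0'
  · rw [hω']; simp only; rw [D0, p0, intervalIntegral.integral_same]; ring
  · rw [hω'']; field_simp; ring

end

lemma uIcc_zero_one : uIcc (0 : ℝ) 1 = Icc 0 1 := uIcc_of_le zero_le_one

lemma intervalIntegrable_Icc {f : ℝ → ℝ} (hf : ContinuousOn f (Icc 0 1)) :
    IntervalIntegrable f volume 0 1 := hf.intervalIntegrable_of_Icc zero_le_one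

lemma integral_mono_Icc {f g : ℝ → ℝ} (hf : ContinuousOn f (Icc 0 1))
    (hg : ContinuousOn g (Icc 0 1)) (h : ∀ x ∈ Icc (0 : ℝ) 1, f x ≤ g x) :
    ∫ x in (0 : ℝ)..1, f x ≤ ∫ x in (0 : ℝ)..1, g x :=
  intervalIntegral.integral_mono_on zero_le_one (intervalIntegrable_Icc hf)
    (intervalIntegrable_Icc hg) h

/-! ### Dissipation -/

lemma integral_mul_deriv_deriv {f f' f'' : ℝ → ℝ} (h : HasDerivIcc f f') (h' : HasDerivIcc f' f'')
    (h1 : f 1 = 0) :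
    ∫ x in (0 : ℝ)..1, f x * f'' x = -(f 0 * f' 0) - ∫ x in (0 : ℝ)..1, f' x ^ 2 := by
  have i1 : IntervalIntegrable (fun x => f x * f'' x) volume 0 1 :=
    intervalIntegrable_Icc (h.cont_fun.mul h'.cont)
  have i2 : IntervalIntegrable (fun x => f' x ^ 2) volume 0 1 :=
    intervalIntegrable_Icc (h.cont.pow 2)
  have := integral_eq_sub_of_hasDerivAt_of_le (f := fun x => f x * f' x)
    (f' := fun x => f' x ^ 2 + f x * f'' x) zero_le_one (h.cont_fun.mul h'.cont_fun)
    (fun x hx => ((h.hasDerivAt hx).mul (h'.hasDerivAt hx)).congr_deriv (by ring)) (i2.add i1)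
  rw [intervalIntegral.integral_add i2 i1, h1] at this
  linarith

/-- Poincaré's inequality for functions that vanish at one end of `[0, 1]`. -/
lemma integral_sq_le_four_mul {f f' : ℝ → ℝ} (h : HasDerivIcc f f') (h1 : f 1 = 0) :
    ∫ x in (0 : ℝ)..1, f x ^ 2 ≤ 4 * ∫ x in (0 : ℝ)..1, f' x ^ 2 := by
  have i1 : IntervalIntegrable (fun x => f x ^ 2) volume 0 1 :=
    intervalIntegrable_Icc (h.cont_fun.pow 2)
  have c2 : ContinuousOn (fun x => 2 * x * f x * f' x) (Icc 0 1) :=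
    ((by fun_prop : ContinuousOn (fun x : ℝ => 2 * x) (Icc 0 1)).mul h.cont_fun).mul h.cont
  -- With the multiplier `x` the boundary terms vanish at both ends: `f 1 = 0` and `x = 0`.
  have e1 := integral_eq_sub_of_hasDerivAt_of_le (f := fun x => x * f x ^ 2)
    (f' := fun x => f x ^ 2 + 2 * x * f x * f' x) zero_le_one
    (continuousOn_id.mul (h.cont_fun.pow 2))
    (fun x hx => ((hasDerivAt_id x).mul ((h.hasDerivAt hx).pow 2)).congr_deriv (by simp; ring))
    (i1.add (intervalIntegrable_Icc c2))
  rw [intervalIntegral.integral_add i1 (intervalIntegrable_Icc c2), h1] at e1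
  have e2 : ∫ x in (0 : ℝ)..1, -(2 * x * f x * f' x) ≤
      ∫ x in (0 : ℝ)..1, (1 / 2 * f x ^ 2 + 2 * f' x ^ 2) := by
    refine integral_mono_Icc c2.neg ((continuousOn_const.mul (h.cont_fun.pow 2)).add
      (continuousOn_const.mul (h.cont.pow 2))) fun x hx => ?_
    have hx2 : x ^ 2 ≤ 1 := pow_le_one₀ hx.1 hx.2
    nlinarith [sq_nonneg (f x + 2 * x * f' x), mul_le_mul_of_nonneg_right hx2 (sq_nonneg (f' x))]
  have i3 : IntervalIntegrable (fun x => f' x ^ 2) volume 0 1 :=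
    intervalIntegrable_Icc (h.cont.pow 2)
  rw [intervalIntegral.integral_neg, intervalIntegral.integral_add (i1.const_mul _)
    (i3.const_mul _), intervalIntegral.integral_const_mul, intervalIntegral.integral_const_mul] at e2
  linarith

lemma dissipation {f f' f'' : ℝ → ℝ} (h : HasDerivIcc f f') (h' : HasDerivIcc f' f'')
    (h1 : f 1 = 0) {e c : ℝ} (he : 0 ≤ e) :
    ∫ x in (0 : ℝ)..1, f x * (e * f'' x - c * f x) ≤
      -(e * (f 0 * f' 0)) - (e / 4 + c) * ∫ x in (0 : ℝ)..1, f x ^ 2 := by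
  have i1 : IntervalIntegrable (fun x => f x * f'' x) volume 0 1 :=
    intervalIntegrable_Icc (h.cont_fun.mul h'.cont)
  have i2 : IntervalIntegrable (fun x => f x ^ 2) volume 0 1 :=
    intervalIntegrable_Icc (h.cont_fun.pow 2)
  have e1 : ∫ x in (0 : ℝ)..1, f x * (e * f'' x - c * f x) =
      e * (∫ x in (0 : ℝ)..1, f x * f'' x) - c * ∫ x in (0 : ℝ)..1, f x ^ 2 := by
    rw [← intervalIntegral.integral_const_mul, ← intervalIntegral.integral_const_mul,
      ← intervalIntegral.integral_sub (i1.const_mul _) (i2.const_mul _)]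
    exact intervalIntegral.integral_congr fun x _ => by ring
  rw [e1, integral_mul_deriv_deriv h h' h1]
  nlinarith [mul_le_mul_of_nonneg_left (integral_sq_le_four_mul h h1) he]

/-- `exp (2 γ t) E(t)` is nonincreasing. The comparison starts at some `s > t₀` because `E` need not
be regular at `t₀`. -/
lemma exp_decay {E E' : ℝ → ℝ} {t₀ γ : ℝ} (hE : ∀ t > t₀, HasDerivAt E (E' t) t)
    (h : ∀ t > t₀, E' t ≤ -(2 * γ) * E t) {s t : ℝ} (hs : t₀ < s) (hst : s ≤ t) :
    E t ≤ Real.exp (-(2 * γ) * (t - s)) * E s := by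
  have hd : ∀ r > t₀, HasDerivAt (fun r => Real.exp (2 * γ * r) * E r)
      (Real.exp (2 * γ * r) * (2 * γ * E r + E' r)) r := fun r hr =>
    ((((hasDerivAt_id r).const_mul (2 * γ)).exp).mul (hE r hr)).congr_deriv (by simp; ring)
  have anti : AntitoneOn (fun r => Real.exp (2 * γ * r) * E r) (Ioi t₀) := by
    refine antitoneOn_of_deriv_nonpos (convex_Ioi t₀)
      (fun r hr => (hd r hr).continuousAt.continuousWithinAt)
      (fun r hr => (hd r (interior_subset hr)).differentiableAt.differentiableWithinAt)
      fun r hr => ?_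
    rw [(hd r (interior_subset hr)).deriv]
    exact mul_nonpos_of_nonneg_of_nonpos (Real.exp_pos _).le
      (by linarith [h r (interior_subset hr)])
  have := anti (mem_Ioi.2 hs) (mem_Ioi.2 (hs.trans_le hst)) hst
  simp only at this
  have e1 : Real.exp (-(2 * γ) * (t - s)) = Real.exp (-(2 * γ * t)) * Real.exp (2 * γ * s) := by
    rw [← Real.exp_add]; congr 1; ring
  calc E t = Real.exp (-(2 * γ * t)) * (Real.exp (2 * γ * t) * E t) := by
        rw [← mul_assoc, ← Real.exp_add]; simp
    _ ≤ Real.exp (-(2 * γ * t)) * (Real.exp (2 * γ * s) * E s) :=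
        mul_le_mul_of_nonneg_left this (Real.exp_pos _).le
    _ = _ := by rw [e1]; ring

/-! ### Bounds -/

/-- The variance `∫ (|f| - m)²` with `m = ∫ |f|` is nonnegative on an interval of length one. -/
lemma sq_integral_abs_le {f : ℝ → ℝ} (hf : ContinuousOn f (Icc 0 1)) :
    (∫ x in (0 : ℝ)..1, |f x|) ^ 2 ≤ ∫ x in (0 : ℝ)..1, f x ^ 2 := by
  set m := ∫ x in (0 : ℝ)..1, |f x| with hm
  have i1 : IntervalIntegrable (fun x => f x ^ 2) volume 0 1 := intervalIntegrable_Icc (hf.pow 2)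
  have i2 : IntervalIntegrable (fun x => |f x|) volume 0 1 := intervalIntegrable_Icc hf.abs
  have h0 : 0 ≤ ∫ x in (0 : ℝ)..1, (f x ^ 2 - 2 * m * |f x| + m ^ 2) :=
    intervalIntegral.integral_nonneg zero_le_one fun x _ => by
      nlinarith [sq_nonneg (|f x| - m), sq_abs (f x)]
  rw [intervalIntegral.integral_add (i1.sub (i2.const_mul _)) (by simp),
    intervalIntegral.integral_sub i1 (i2.const_mul _), intervalIntegral.integral_const_mul,
    intervalIntegral.integral_const, ← hm] at h0
  simp only [sub_zero, one_smul] at h0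
  nlinarith

lemma integral_sq_le_of_abs_le {f g : ℝ → ℝ} (hf : ContinuousOn f (Icc 0 1))
    (hg : ContinuousOn g (Icc 0 1)) {c : ℝ} (h : ∀ x ∈ Icc (0 : ℝ) 1, |f x| ≤ |g x| + c) :
    ∫ x in (0 : ℝ)..1, f x ^ 2 ≤ 2 * (∫ x in (0 : ℝ)..1, g x ^ 2) + 2 * c ^ 2 := by
  have i1 : IntervalIntegrable (fun x => g x ^ 2) volume 0 1 := intervalIntegrable_Icc (hg.pow 2)
  have := integral_mono_Icc (hf.pow 2) (g := fun x => 2 * g x ^ 2 + 2 * c ^ 2)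
    ((continuousOn_const.mul (hg.pow 2)).add continuousOn_const) fun x hx => by
      have h1 := abs_nonneg (f x)
      have h2 : |f x| ^ 2 ≤ (|g x| + c) ^ 2 := pow_le_pow_left₀ h1 (h x hx) 2
      rw [sq_abs] at h2
      change f x ^ 2 ≤ _
      nlinarith [sq_nonneg (|g x| - c), sq_abs (g x)]
  rw [intervalIntegral.integral_add (i1.const_mul _) (by simp),
    intervalIntegral.integral_const_mul, intervalIntegral.integral_const] at this
  simpa using this

lemma abs_integral_mul_le {k u : ℝ → ℝ} {b c M : ℝ} (hbc : b ≤ c) (hu : ContinuousOn u (Icc b c))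
    (hk : ∀ y ∈ Icc b c, |k y| ≤ M) :
    |∫ y in b..c, k y * u y| ≤ M * ∫ y in b..c, |u y| := by
  rw [← intervalIntegral.integral_const_mul]
  have hi : IntervalIntegrable (fun y => M * |u y|) volume b c :=
    (hu.abs.intervalIntegrable_of_Icc hbc).const_mul M
  rw [← Real.norm_eq_abs]
  refine intervalIntegral.norm_integral_le_of_norm_le hbc (ae_of_all _ fun y hy => ?_) hi
  rw [Real.norm_eq_abs, abs_mul]
  exact mul_le_mul_of_nonneg_right (hk y ⟨hy.1.le, hy.2⟩) (abs_nonneg _)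

lemma integral_abs_mono {u : ℝ → ℝ} (hu : ContinuousOn u (Icc 0 1)) {b c : ℝ} (hb : 0 ≤ b)
    (hbc : b ≤ c) (hc : c ≤ 1) : ∫ y in b..c, |u y| ≤ ∫ y in (0 : ℝ)..1, |u y| :=
  intervalIntegral.integral_mono_interval hb hbc hc (ae_of_all _ fun _ => abs_nonneg _)
    (intervalIntegrable_Icc hu.abs)

/-- Grönwall's inequality in `L²`. -/
lemma integral_sq_le_of_volterra {z h : ℝ → ℝ} (hz : ContinuousOn z (Icc 0 1))
    (hh : ContinuousOn h (Icc 0 1)) (z0 : ∀ x ∈ Icc (0 : ℝ) 1, 0 ≤ z x)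
    (h0 : ∀ x ∈ Icc (0 : ℝ) 1, 0 ≤ h x) {M : ℝ} (hM : 0 ≤ M)
    (hzh : ∀ x ∈ Icc (0 : ℝ) 1, z x ≤ h x + M * ∫ y in (0 : ℝ)..x, z y) :
    ∫ x in (0 : ℝ)..1, z x ^ 2 ≤
      (2 + 2 * (M * Real.exp M) ^ 2) * ∫ x in (0 : ℝ)..1, h x ^ 2 := by
  obtain ⟨Z, hZ, hZz⟩ := exists_continuous_extension isClosed_Icc hz
  obtain ⟨H, hH, hHh⟩ := exists_continuous_extension isClosed_Icc hh
  have eq : ∀ x ∈ Icc (0 : ℝ) 1, ∫ y in (0 : ℝ)..x, z y = ∫ y in (0 : ℝ)..x, Z y := fun x hx =>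
    intervalIntegral.integral_congr fun y hy => by
      rw [uIcc_of_le hx.1] at hy
      exact (hZz ⟨hy.1, hy.2.trans hx.2⟩).symm
  -- Integrating factor: `exp (-M x) ∫₀ˣ z` grows no faster than `∫₀ˣ h`.
  have hd : ∀ x, HasDerivAt (fun x => Real.exp (-(M * x)) * (∫ y in (0 : ℝ)..x, Z y) -
      ∫ y in (0 : ℝ)..x, H y) (Real.exp (-(M * x)) * (Z x - M * ∫ y in (0 : ℝ)..x, Z y) - H x) x :=
    fun x => (((((hasDerivAt_id x).const_mul M).neg).exp.mul
      (hasDerivAt_integral_upper hZ 0 x)).sub (hasDerivAt_integral_upper hH 0 x)).congr_deriv (by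
        simp; ring)
  have anti : AntitoneOn (fun x => Real.exp (-(M * x)) * (∫ y in (0 : ℝ)..x, Z y) -
      ∫ y in (0 : ℝ)..x, H y) (Icc 0 1) := by
    refine antitoneOn_of_deriv_nonpos (convex_Icc 0 1)
      (fun r _ => (hd r).continuousAt.continuousWithinAt)
      (fun r _ => (hd r).differentiableAt.differentiableWithinAt) fun r hr => ?_
    have hr' : r ∈ Icc (0 : ℝ) 1 := interior_subset hr
    rw [(hd r).deriv, hZz hr', hHh hr', ← eq r hr']
    have k1 : Real.exp (-(M * r)) ≤ 1 := Real.exp_le_one_iff.2 (by nlinarith [hr'.1])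
    have k2 := hzh r hr'
    have k3 := h0 r hr'
    have k4 := (Real.exp_pos (-(M * r))).le
    nlinarith [mul_le_mul_of_nonneg_left k2 k4, mul_le_mul_of_nonneg_right k1 k3]
  have bound : ∀ x ∈ Icc (0 : ℝ) 1, ∫ y in (0 : ℝ)..x, z y ≤
      Real.exp M * ∫ y in (0 : ℝ)..1, |h y| := fun x hx => by
    have := anti ⟨le_rfl, zero_le_one⟩ hx hx.1
    simp only [intervalIntegral.integral_same, mul_zero, sub_zero] at this
    have e2 : ∫ y in (0 : ℝ)..x, H y ≤ ∫ y in (0 : ℝ)..1, |h y| := by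
      refine le_trans (le_of_eq ?_) (integral_abs_mono hh le_rfl hx.1 hx.2)
      refine intervalIntegral.integral_congr fun y hy => ?_
      rw [uIcc_of_le hx.1] at hy
      have m : y ∈ Icc (0 : ℝ) 1 := ⟨hy.1, hy.2.trans hx.2⟩
      rw [hHh m, abs_of_nonneg (h0 y m)]
    rw [eq x hx]
    have e3 : 0 ≤ ∫ y in (0 : ℝ)..1, |h y| :=
      intervalIntegral.integral_nonneg zero_le_one fun _ _ => abs_nonneg _
    calc ∫ y in (0 : ℝ)..x, Z y
        = Real.exp (M * x) * (Real.exp (-(M * x)) * ∫ y in (0 : ℝ)..x, Z y) := by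
          rw [← mul_assoc, ← Real.exp_add]; simp
      _ ≤ Real.exp (M * x) * ∫ y in (0 : ℝ)..1, |h y| :=
          mul_le_mul_of_nonneg_left (by linarith) (Real.exp_pos _).le
      _ ≤ _ := mul_le_mul_of_nonneg_right (Real.exp_le_exp.2 (by nlinarith [hx.2])) e3
  have fin := integral_sq_le_of_abs_le hz hh (c := M * (Real.exp M * ∫ y in (0 : ℝ)..1, |h y|))
    fun x hx => by
      rw [abs_of_nonneg (z0 x hx), abs_of_nonneg (h0 x hx)]
      linarith [hzh x hx, mul_le_mul_of_nonneg_left (bound x hx) hM]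
  have sq := mul_le_mul_of_nonneg_left (sq_integral_abs_le hh) (sq_nonneg (M * Real.exp M))
  nlinarith

/-! ### Bounded invertibility of the transformations in `L²`. -/

lemma isCompact_triL : IsCompact triL :=
  (isCompact_Icc (a := ((0 : ℝ), (0 : ℝ))) (b := (1, 1))).of_isClosed_subset isClosed_triL
    fun _ hz => ⟨⟨hz.1.trans hz.2.1, hz.1⟩, ⟨hz.2.2, hz.2.1.trans hz.2.2⟩⟩

lemma isCompact_triU : IsCompact triU :=
  (isCompact_Icc (a := ((0 : ℝ), (0 : ℝ))) (b := (1, 1))).of_isClosed_subset isClosed_triU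
    fun _ hz => ⟨⟨hz.1, hz.1.trans hz.2.1⟩, ⟨hz.2.1.trans hz.2.2, hz.2.2⟩⟩

lemma exists_bound {S : Set (ℝ × ℝ)} (hS : IsCompact S) {k : ℝ → ℝ → ℝ}
    (hk : ContinuousOn (fun z : ℝ × ℝ => k z.1 z.2) S) :
    ∃ M : ℝ, 0 ≤ M ∧ ∀ M' ≥ M, ∀ x y, (x, y) ∈ S → |k x y| ≤ M' := by
  obtain ⟨M, hM⟩ := hS.exists_bound_of_continuousOn hk
  exact ⟨max M 0, le_max_right _ _, fun M' hM' x y h =>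
    (hM (x, y) h).trans ((le_max_left _ _).trans hM')⟩

lemma integral_sq_add_le {f g h : ℝ → ℝ} (hf : ContinuousOn f (Icc 0 1))
    (hg : ContinuousOn g (Icc 0 1)) (hh : ContinuousOn h (Icc 0 1))
    (hfg : ∀ x ∈ Icc (0 : ℝ) 1, |h x| ≤ |f x| + |g x|) :
    ∫ x in (0 : ℝ)..1, h x ^ 2 ≤
      2 * ((∫ x in (0 : ℝ)..1, f x ^ 2) + ∫ x in (0 : ℝ)..1, g x ^ 2) := by
  have i1 : IntervalIntegrable (fun x => f x ^ 2) volume 0 1 := intervalIntegrable_Icc (hf.pow 2)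
  have i2 : IntervalIntegrable (fun x => g x ^ 2) volume 0 1 := intervalIntegrable_Icc (hg.pow 2)
  rw [← intervalIntegral.integral_add i1 i2, ← intervalIntegral.integral_const_mul]
  refine integral_mono_Icc (hh.pow 2) (continuousOn_const.mul ((hf.pow 2).add (hg.pow 2)))
    fun x hx => ?_
  have h2 : |h x| ^ 2 ≤ (|f x| + |g x|) ^ 2 := pow_le_pow_left₀ (abs_nonneg _) (hfg x hx) 2
  rw [sq_abs] at h2
  change h x ^ 2 ≤ 2 * (f x ^ 2 + g x ^ 2)
  nlinarith [sq_nonneg (|f x| - |g x|), sq_abs (f x), sq_abs (g x)]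

lemma integral_sq_nonneg (f : ℝ → ℝ) : 0 ≤ ∫ x in (0 : ℝ)..1, f x ^ 2 :=
  intervalIntegral.integral_nonneg zero_le_one fun _ _ => sq_nonneg _

/-- The first transformation is bounded with bounded inverse in `L²`. -/
lemma exists_rowState_bound {k l k' l' : ℝ → ℝ → ℝ}
    (hk : ContinuousOn (fun z : ℝ × ℝ => k z.1 z.2) triL)
    (hl : ContinuousOn (fun z : ℝ × ℝ => l z.1 z.2) triL)
    (hk' : ContinuousOn (fun z : ℝ × ℝ => k' z.1 z.2) triL)
    (hl' : ContinuousOn (fun z : ℝ × ℝ => l' z.1 z.2) triL) :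
    ∃ C : ℝ, 0 ≤ C ∧ ∀ u₁ u₂ : ℝ → ℝ, ContinuousOn u₁ (Icc 0 1) → ContinuousOn u₂ (Icc 0 1) →
      (∫ x in (0 : ℝ)..1, rowState k l u₁ u₁ u₂ x ^ 2) +
        (∫ x in (0 : ℝ)..1, rowState k' l' u₂ u₁ u₂ x ^ 2) ≤
        C * ((∫ x in (0 : ℝ)..1, u₁ x ^ 2) + ∫ x in (0 : ℝ)..1, u₂ x ^ 2) ∧
      (∫ x in (0 : ℝ)..1, u₁ x ^ 2) + (∫ x in (0 : ℝ)..1, u₂ x ^ 2) ≤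
        C * ((∫ x in (0 : ℝ)..1, rowState k l u₁ u₁ u₂ x ^ 2) +
          ∫ x in (0 : ℝ)..1, rowState k' l' u₂ u₁ u₂ x ^ 2) := by
  obtain ⟨M₁, p1, b1⟩ := exists_bound isCompact_triL hk
  obtain ⟨M₂, p2, b2⟩ := exists_bound isCompact_triL hl
  obtain ⟨M₃, p3, b3⟩ := exists_bound isCompact_triL hk'
  obtain ⟨M₄, p4, b4⟩ := exists_bound isCompact_triL hl'
  obtain ⟨M, hM⟩ : ∃ M : ℝ, M = M₁ + M₂ + M₃ + M₄ := ⟨_, rfl⟩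
  have M0 : 0 ≤ M := by linarith
  set G := 2 + 2 * (2 * M * Real.exp (2 * M)) ^ 2 with hG
  have G0 : 0 ≤ G := by positivity
  refine ⟨max (2 + 8 * M ^ 2) (4 * G), le_max_of_le_left (by positivity), fun u₁ u₂ h1 h2 => ?_⟩
  have row : ∀ {k l : ℝ → ℝ → ℝ} {v : ℝ → ℝ}, ContinuousOn (fun z : ℝ × ℝ => k z.1 z.2) triL →
      ContinuousOn (fun z : ℝ × ℝ => l z.1 z.2) triL → (∀ x y, (x, y) ∈ triL → |k x y| ≤ M) →
      (∀ x y, (x, y) ∈ triL → |l x y| ≤ M) → ∀ x ∈ Icc (0 : ℝ) 1,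
      |v x - rowState k l v u₁ u₂ x| ≤
        M * (∫ y in (0 : ℝ)..x, |u₁ y|) + M * ∫ y in (0 : ℝ)..x, |u₂ y| := by
    intro k l v hk hl bk bl x hx
    have hs : Icc 0 x ⊆ Icc (0 : ℝ) 1 := Icc_subset_Icc le_rfl hx.2
    rw [rowState_eq hk hl h1 h2 hx]
    have e1 := abs_integral_mul_le (k := k x) hx.1 (h1.mono hs)
      fun y hy => bk x y ⟨hy.1, hy.2, hx.2⟩
    have e2 := abs_integral_mul_le (k := l x) hx.1 (h2.mono hs)
      fun y hy => bl x y ⟨hy.1, hy.2, hx.2⟩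
    have e3 : v x - (v x - (∫ y in (0 : ℝ)..x, k x y * u₁ y) - ∫ y in (0 : ℝ)..x, l x y * u₂ y) =
      (∫ y in (0 : ℝ)..x, k x y * u₁ y) + ∫ y in (0 : ℝ)..x, l x y * u₂ y := by ring
    rw [e3]
    exact (abs_add_le _ _).trans (add_le_add e1 e2)
  have r1 := row (v := u₁) hk hl (b1 M (by linarith)) (b2 M (by linarith))
  have r2 := row (v := u₂) hk' hl' (b3 M (by linarith)) (b4 M (by linarith))
  have c1 := continuousOn_rowState hk hl h1 h1 h2
  have c2 := continuousOn_rowState hk' hl' h2 h1 h2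
  set w₁ := rowState k l u₁ u₁ u₂
  set w₂ := rowState k' l' u₂ u₁ u₂
  have s1 := sq_integral_abs_le h1
  have s2 := sq_integral_abs_le h2
  have n1 := integral_sq_nonneg u₁
  have n2 := integral_sq_nonneg u₂
  have n3 := integral_sq_nonneg w₁
  have n4 := integral_sq_nonneg w₂
  constructor
  · have fw : ∀ {u w : ℝ → ℝ}, ContinuousOn u (Icc 0 1) → ContinuousOn w (Icc 0 1) →
        (∀ x ∈ Icc (0 : ℝ) 1, |u x - w x| ≤
          M * (∫ y in (0 : ℝ)..x, |u₁ y|) + M * ∫ y in (0 : ℝ)..x, |u₂ y|) →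
        ∫ x in (0 : ℝ)..1, w x ^ 2 ≤ 2 * (∫ x in (0 : ℝ)..1, u x ^ 2) +
          4 * M ^ 2 * ((∫ x in (0 : ℝ)..1, u₁ x ^ 2) + ∫ x in (0 : ℝ)..1, u₂ x ^ 2) := by
      intro u w hu hw huw
      have := integral_sq_le_of_abs_le hw hu
        (c := M * ((∫ y in (0 : ℝ)..1, |u₁ y|) + ∫ y in (0 : ℝ)..1, |u₂ y|)) fun x hx => by
          have t1 := abs_sub_abs_le_abs_sub (w x) (u x)
          rw [abs_sub_comm] at t1
          have t2 := huw x hx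
          have t3 := mul_le_mul_of_nonneg_left (integral_abs_mono h1 le_rfl hx.1 hx.2) M0
          have t4 := mul_le_mul_of_nonneg_left (integral_abs_mono h2 le_rfl hx.1 hx.2) M0
          linarith
      have sq : ((∫ y in (0 : ℝ)..1, |u₁ y|) + ∫ y in (0 : ℝ)..1, |u₂ y|) ^ 2 ≤
          2 * ((∫ x in (0 : ℝ)..1, u₁ x ^ 2) + ∫ x in (0 : ℝ)..1, u₂ x ^ 2) := by
        nlinarith [sq_nonneg ((∫ y in (0 : ℝ)..1, |u₁ y|) - ∫ y in (0 : ℝ)..1, |u₂ y|)]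
      rw [mul_pow] at this
      linarith [mul_le_mul_of_nonneg_left sq (sq_nonneg M)]
    refine le_trans ?_ (mul_le_mul_of_nonneg_right (le_max_left _ _) (add_nonneg n1 n2))
    linarith [fw h1 c1 r1, fw h2 c2 r2]
  · have cz : ContinuousOn (fun x => |u₁ x| + |u₂ x|) (Icc 0 1) := h1.abs.add h2.abs
    have ch : ContinuousOn (fun x => |w₁ x| + |w₂ x|) (Icc 0 1) := c1.abs.add c2.abs
    -- Adding the absolute values of both rows gives a scalar Volterra inequality for `|u₁| + |u₂|`,
    -- with constant `2 M`.
    have key := integral_sq_le_of_volterra cz ch (fun _ _ => by positivity)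
      (fun _ _ => by positivity) (M := 2 * M) (by linarith) fun x hx => by
        have hs : Icc 0 x ⊆ Icc (0 : ℝ) 1 := Icc_subset_Icc le_rfl hx.2
        rw [intervalIntegral.integral_add ((h1.abs.mono hs).intervalIntegrable_of_Icc hx.1)
          ((h2.abs.mono hs).intervalIntegrable_of_Icc hx.1)]
        have t1 := abs_sub_abs_le_abs_sub (u₁ x) (w₁ x)
        have t2 := abs_sub_abs_le_abs_sub (u₂ x) (w₂ x)
        linarith [r1 x hx, r2 x hx]
    have a1 := integral_mono_Icc (h1.pow 2) (cz.pow 2) fun x _ => by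
      change u₁ x ^ 2 ≤ (|u₁ x| + |u₂ x|) ^ 2
      nlinarith [abs_nonneg (u₁ x), abs_nonneg (u₂ x), sq_abs (u₁ x),
        mul_nonneg (abs_nonneg (u₁ x)) (abs_nonneg (u₂ x))]
    have a2 := integral_mono_Icc (h2.pow 2) (cz.pow 2) fun x _ => by
      change u₂ x ^ 2 ≤ (|u₁ x| + |u₂ x|) ^ 2
      nlinarith [abs_nonneg (u₁ x), abs_nonneg (u₂ x), sq_abs (u₂ x),
        mul_nonneg (abs_nonneg (u₁ x)) (abs_nonneg (u₂ x))]
    have a3 := integral_sq_add_le c1 c2 ch fun x _ => by rw [abs_of_nonneg (by positivity)]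
    simp only [Pi.pow_apply] at a1 a2
    have a4 := mul_le_mul_of_nonneg_left a3 G0
    refine le_trans ?_ (mul_le_mul_of_nonneg_right (le_max_right _ _) (add_nonneg n3 n4))
    linarith

section

variable {ε y₀ c₁ c₂ : ℝ} {g p : ℝ → ℝ} {q r : ℝ → ℝ → ℝ}

/-- The second transformation is bounded with bounded inverse in `L²`. -/
lemma IsSecondKernel.exists_bound (h : IsSecondKernel ε y₀ c₁ c₂ g p q r) :
    ∃ C : ℝ, 0 ≤ C ∧ ∀ w₁ w₂ : ℝ → ℝ, ContinuousOn w₁ (Icc 0 1) → ContinuousOn w₂ (Icc 0 1) →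
      (∫ x in (0 : ℝ)..1, w₁ x ^ 2) + (∫ x in (0 : ℝ)..1, secondState p q r w₁ w₂ x ^ 2) ≤
        C * ((∫ x in (0 : ℝ)..1, w₁ x ^ 2) + ∫ x in (0 : ℝ)..1, w₂ x ^ 2) ∧
      (∫ x in (0 : ℝ)..1, w₁ x ^ 2) + (∫ x in (0 : ℝ)..1, w₂ x ^ 2) ≤
        C * ((∫ x in (0 : ℝ)..1, w₁ x ^ 2) +
          ∫ x in (0 : ℝ)..1, secondState p q r w₁ w₂ x ^ 2) := by
  obtain ⟨M₁, p1, b1⟩ := Folding.exists_bound isCompact_triL h.cont_q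
  obtain ⟨M₂, p2, b2⟩ := Folding.exists_bound isCompact_triU h.cont_r
  have pk : ContinuousOn (fun z : ℝ × ℝ => p (z.1 - z.2)) triL :=
    h.continuousOn_p.comp (by fun_prop)
      fun z hz => ⟨by linarith [hz.2.1], by linarith [hz.1, hz.2.2]⟩
  obtain ⟨M₃, p3, b3⟩ := Folding.exists_bound (k := fun x y => p (x - y)) isCompact_triL pk
  obtain ⟨M, hM⟩ : ∃ M : ℝ, M = M₁ + M₂ + M₃ := ⟨_, rfl⟩
  have M0 : 0 ≤ M := by linarith
  set G := 2 + 2 * (M * Real.exp M) ^ 2 with hG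
  have G0 : 0 ≤ G := by positivity
  refine ⟨max (3 + 16 * M ^ 2) (1 + G * (2 + 8 * M ^ 2)), le_max_of_le_left (by positivity),
    fun w₁ w₂ h1 h2 => ?_⟩
  have row : ∀ x ∈ Icc (0 : ℝ) 1, |w₂ x - secondState p q r w₁ w₂ x| ≤
      2 * M * (∫ y in (0 : ℝ)..1, |w₁ y|) + M * ∫ y in (0 : ℝ)..x, |w₂ y| := by
    intro x hx
    have hs : Icc 0 x ⊆ Icc (0 : ℝ) 1 := Icc_subset_Icc le_rfl hx.2
    have hs' : Icc x 1 ⊆ Icc (0 : ℝ) 1 := Icc_subset_Icc hx.1 le_rfl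
    have e1 := abs_integral_mul_le (k := q x) hx.1 (h1.mono hs)
      fun y hy => b1 M (by linarith) x y ⟨hy.1, hy.2, hx.2⟩
    have e2 := abs_integral_mul_le (k := r x) hx.2 (h1.mono hs')
      fun y hy => b2 M (by linarith) x y ⟨hx.1, hy.1, hy.2⟩
    have e3 := abs_integral_mul_le (k := fun y => p (x - y)) hx.1 (h2.mono hs)
      fun y hy => b3 M (by linarith) x y ⟨hy.1, hy.2, hx.2⟩
    have t1 := mul_le_mul_of_nonneg_left (integral_abs_mono h1 le_rfl hx.1 hx.2) M0
    have t2 := mul_le_mul_of_nonneg_left (integral_abs_mono h1 hx.1 hx.2 le_rfl) M0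
    have e4 : w₂ x - secondState p q r w₁ w₂ x = ((∫ y in (0 : ℝ)..x, q x y * w₁ y) +
        ∫ y in x..1, r x y * w₁ y) + ∫ y in (0 : ℝ)..x, p (x - y) * w₂ y := by
      rw [secondState]; ring
    rw [e4]
    refine (abs_add_le _ _).trans ?_
    have := abs_add_le (∫ y in (0 : ℝ)..x, q x y * w₁ y) (∫ y in x..1, r x y * w₁ y)
    linarith
  have c2 := continuousOn_secondState h h1 h2
  set ω := secondState p q r w₁ w₂
  have s1 := sq_integral_abs_le h1
  have s2 := sq_integral_abs_le h2
  have n1 := integral_sq_nonneg w₁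
  have n2 := integral_sq_nonneg w₂
  have n3 := integral_sq_nonneg ω
  have m1 : 0 ≤ ∫ y in (0 : ℝ)..1, |w₁ y| :=
    intervalIntegral.integral_nonneg zero_le_one fun _ _ => abs_nonneg _
  constructor
  · have := integral_sq_le_of_abs_le c2 h2
        (c := M * (2 * (∫ y in (0 : ℝ)..1, |w₁ y|) + ∫ y in (0 : ℝ)..1, |w₂ y|)) fun x hx => by
      have t1 := abs_sub_abs_le_abs_sub (ω x) (w₂ x)
      rw [abs_sub_comm] at t1
      have t4 := mul_le_mul_of_nonneg_left (integral_abs_mono h2 le_rfl hx.1 hx.2) M0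
      linarith [row x hx]
    have sq : (2 * (∫ y in (0 : ℝ)..1, |w₁ y|) + ∫ y in (0 : ℝ)..1, |w₂ y|) ^ 2 ≤
        8 * ((∫ x in (0 : ℝ)..1, w₁ x ^ 2) + ∫ x in (0 : ℝ)..1, w₂ x ^ 2) := by
      nlinarith [sq_nonneg (2 * (∫ y in (0 : ℝ)..1, |w₁ y|) - ∫ y in (0 : ℝ)..1, |w₂ y|)]
    rw [mul_pow] at this
    refine le_trans ?_ (mul_le_mul_of_nonneg_right (le_max_left _ _) (add_nonneg n1 n2))
    linarith [mul_le_mul_of_nonneg_left sq (sq_nonneg M)]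
  -- The state `w₁` is unchanged, so its integrals, including the Fredholm part with `r`, count as
  -- data; only the convolution with `w₂` has to be inverted.
  · set d := 2 * M * ∫ y in (0 : ℝ)..1, |w₁ y| with hd
    have d0 : 0 ≤ d := by positivity
    have ch : ContinuousOn (fun x => |ω x| + d) (Icc 0 1) := c2.abs.add continuousOn_const
    have key := integral_sq_le_of_volterra h2.abs ch (fun _ _ => abs_nonneg _)
      (fun _ _ => by positivity) M0 fun x hx => by
        have t1 := abs_sub_abs_le_abs_sub (w₂ x) (ω x)
        linarith [row x hx]
    have a1 := integral_sq_le_of_abs_le ch c2 (c := d) fun x _ => by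
      rw [abs_of_nonneg (by positivity)]
    simp only [sq_abs] at key
    have a2 : d ^ 2 ≤ 4 * M ^ 2 * ∫ x in (0 : ℝ)..1, w₁ x ^ 2 := by
      rw [hd, mul_pow, mul_pow]
      nlinarith [mul_le_mul_of_nonneg_left s1 (sq_nonneg M)]
    have a4 := mul_le_mul_of_nonneg_left a1 G0
    have a5 := mul_le_mul_of_nonneg_left a2 G0
    refine le_trans ?_ (mul_le_mul_of_nonneg_right (le_max_right _ _) (add_nonneg n1 n3))
    nlinarith [mul_nonneg G0 (mul_nonneg (sq_nonneg M) n3), mul_nonneg G0 n1]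

end

/-! ### Families of profiles that depend differentiably on time -/

/-- Tietze extension requires closed sets, so continuity on the open time interval is proved on each
closed half-line inside it. -/
lemma continuousOn_Ioi_of_Ici {S : Set ℝ} {F : ℝ × ℝ → ℝ} {t₀ : ℝ}
    (h : ∀ s > t₀, ContinuousOn F (S ×ˢ Ici s)) : ContinuousOn F (S ×ˢ Ioi t₀) := by
  rintro ⟨y, t⟩ ⟨hy, ht⟩
  have ht' : t₀ < t := ht
  refine (h ((t₀ + t) / 2) (by linarith) (y, t) ⟨hy, mem_Ici.2 (by simp only; linarith)⟩
    ).mono_of_mem_nhdsWithin ?_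
  have : {z : ℝ × ℝ | (t₀ + t) / 2 < z.2} ∈ 𝓝 (y, t) :=
    (isOpen_lt continuous_const continuous_snd).mem_nhds (by
      change (t₀ + t) / 2 < t; linarith)
  filter_upwards [self_mem_nhdsWithin, mem_nhdsWithin_of_mem_nhds this] with z hz hz'
  exact ⟨hz.1, mem_Ici.2 (le_of_lt hz')⟩

lemma continuous_integral_limits {X : Type*} [TopologicalSpace X] {H : X → ℝ → ℝ}
    (hH : Continuous fun z : X × ℝ => H z.1 z.2) {a b : X → ℝ} (ha : Continuous a)
    (hb : Continuous b) : Continuous fun x => ∫ s in (a x)..(b x), H x s := by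
  have hc : ∀ x, Continuous fun s => H x s := fun x =>
    hH.comp (by fun_prop : Continuous fun s : ℝ => (x, s))
  have h : ∀ x, ∫ s in (a x)..(b x), H x s =
      (∫ s in (0 : ℝ)..(b x), H x s) - ∫ s in (0 : ℝ)..(a x), H x s := fun x => by
    rw [intervalIntegral.integral_interval_sub_left] <;> exact (hc x).intervalIntegrable _ _
  simp_rw [h]
  exact (continuous_parametric_intervalIntegral_of_continuous hH hb).sub
    (continuous_parametric_intervalIntegral_of_continuous hH ha)

/-- A family of functions on `[0, 1]` with a jointly continuous time derivative for `t > t₀`. -/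
structure TimeFamily (t₀ : ℝ) (f f' : ℝ → ℝ → ℝ) : Prop where
  cont : ContinuousOn (fun z : ℝ × ℝ => f z.1 z.2) (Icc 0 1 ×ˢ Ioi t₀)
  cont' : ContinuousOn (fun z : ℝ × ℝ => f' z.1 z.2) (Icc 0 1 ×ˢ Ioi t₀)
  deriv : ∀ x ∈ Icc (0 : ℝ) 1, ∀ t > t₀, HasDerivAt (f x) (f' x t) t

lemma TimeFamily.section_cont {t₀ : ℝ} {f : ℝ → ℝ → ℝ}
    (h : ContinuousOn (fun z : ℝ × ℝ => f z.1 z.2) (Icc 0 1 ×ˢ Ioi t₀)) {t : ℝ} (ht : t₀ < t) :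
    ContinuousOn (fun x => f x t) (Icc 0 1) :=
  h.comp (f := fun x : ℝ => (x, t)) (by fun_prop) fun _ hx => ⟨hx, ht⟩

lemma TimeFamily.sub {t₀ : ℝ} {f f' g g' : ℝ → ℝ → ℝ} (hf : TimeFamily t₀ f f')
    (hg : TimeFamily t₀ g g') :
    TimeFamily t₀ (fun x t => f x t - g x t) (fun x t => f' x t - g' x t) where
  cont := hf.cont.sub hg.cont
  cont' := hf.cont'.sub hg.cont'
  deriv x hx t ht := (hf.deriv x hx t ht).sub (hg.deriv x hx t ht)

lemma TimeFamily.congr {t₀ : ℝ} {f f' g g' : ℝ → ℝ → ℝ} (hf : TimeFamily t₀ f f')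
    (h : ∀ x ∈ Icc (0 : ℝ) 1, ∀ t > t₀, g x t = f x t)
    (h' : ∀ x ∈ Icc (0 : ℝ) 1, ∀ t > t₀, g' x t = f' x t) : TimeFamily t₀ g g' where
  cont := hf.cont.congr fun z hz => h z.1 hz.1 z.2 hz.2
  cont' := hf.cont'.congr fun z hz => h' z.1 hz.1 z.2 hz.2
  deriv x hx t ht := ((hf.deriv x hx t ht).congr_of_eventuallyEq (by
    filter_upwards [Ioi_mem_nhds ht] with s hs using h x hx s hs)).congr_deriv (h' x hx t ht).symm

lemma continuousOn_integral_family {P : Set (ℝ × ℝ)} (hP : IsClosed P) {k : ℝ → ℝ → ℝ}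
    (hk : ContinuousOn (fun z : ℝ × ℝ => k z.1 z.2) P) {t₀ : ℝ} {f : ℝ → ℝ → ℝ}
    (hf : ContinuousOn (fun z : ℝ × ℝ => f z.1 z.2) (Icc 0 1 ×ˢ Ioi t₀)) {b c : ℝ → ℝ}
    (hb : Continuous b) (hc : Continuous c) (hbc : ∀ x ∈ Icc (0 : ℝ) 1, b x ≤ c x ∧
      ∀ y ∈ Icc (b x) (c x), (x, y) ∈ P ∧ y ∈ Icc (0 : ℝ) 1) :
    ContinuousOn (fun z : ℝ × ℝ => ∫ y in (b z.1)..(c z.1), k z.1 y * f y z.2)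
      (Icc 0 1 ×ˢ Ioi t₀) := by
  refine continuousOn_Ioi_of_Ici fun s hs => ?_
  obtain ⟨K, hK, hKk⟩ := exists_continuous_extension hP hk
  obtain ⟨F, hF, hFf⟩ := exists_continuous_extension (isClosed_Icc.prod isClosed_Ici)
    (hf.mono (prod_mono_right (Ici_subset_Ioi.2 hs)))
  have : Continuous fun z : ℝ × ℝ => ∫ y in (b z.1)..(c z.1), K (z.1, y) * F (y, z.2) :=
    continuous_integral_limits (H := fun z y => K (z.1, y) * F (y, z.2)) (by fun_prop)
      (hb.comp continuous_fst) (hc.comp continuous_fst)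
  refine this.continuousOn.congr fun z hz => ?_
  obtain ⟨h1, h2⟩ := hbc z.1 hz.1
  refine intervalIntegral.integral_congr fun y hy => ?_
  rw [uIcc_of_le h1] at hy
  have e1 := hKk (h2 y hy).1
  have e2 := hFf (show (y, z.2) ∈ Icc (0 : ℝ) 1 ×ˢ Ici s from ⟨(h2 y hy).2, hz.2⟩)
  simp only at e1 e2 ⊢
  rw [e1, e2]

lemma TimeFamily.integral {P : Set (ℝ × ℝ)} (hP : IsClosed P) {k : ℝ → ℝ → ℝ}
    (hk : ContinuousOn (fun z : ℝ × ℝ => k z.1 z.2) P) {t₀ : ℝ} {f f' : ℝ → ℝ → ℝ}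
    (hf : TimeFamily t₀ f f') {b c : ℝ → ℝ} (hb : Continuous b) (hc : Continuous c)
    (hbc : ∀ x ∈ Icc (0 : ℝ) 1, b x ≤ c x ∧
      ∀ y ∈ Icc (b x) (c x), (x, y) ∈ P ∧ y ∈ Icc (0 : ℝ) 1) :
    TimeFamily t₀ (fun x t => ∫ y in (b x)..(c x), k x y * f y t)
      (fun x t => ∫ y in (b x)..(c x), k x y * f' y t) where
  cont := continuousOn_integral_family hP hk hf.cont hb hc hbc
  cont' := continuousOn_integral_family hP hk hf.cont' hb hc hbc
  deriv x hx t ht := by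
    obtain ⟨h1, h2⟩ := hbc x hx
    have ck : ContinuousOn (fun z : ℝ × ℝ => k x z.2) (Ioi t₀ ×ˢ Icc (b x) (c x)) :=
      hk.comp (f := fun z : ℝ × ℝ => (x, z.2)) (by fun_prop) fun z hz => (h2 z.2 hz.2).1
    refine hasDerivAt_integral_param_on (H := fun t y => k x y * f y t)
      (H' := fun t y => k x y * f' y t) isOpen_Ioi h1 (ck.mul ?_) (ck.mul ?_)
      (fun t ht y hy => (hf.deriv y (h2 y hy).2 t ht).const_mul (k x y)) ht
    · exact hf.cont.comp (f := fun z : ℝ × ℝ => (z.2, z.1)) (by fun_prop)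
        fun z hz => ⟨(h2 z.2 hz.2).2, hz.1⟩
    · exact hf.cont'.comp (f := fun z : ℝ × ℝ => (z.2, z.1)) (by fun_prop)
        fun z hz => ⟨(h2 z.2 hz.2).2, hz.1⟩

lemma TimeFamily.volterra {k : ℝ → ℝ → ℝ} (hk : ContinuousOn (fun z : ℝ × ℝ => k z.1 z.2) triL)
    {t₀ : ℝ} {f f' : ℝ → ℝ → ℝ} (hf : TimeFamily t₀ f f') :
    TimeFamily t₀ (fun x t => ∫ y in (0 : ℝ)..x, k x y * f y t)
      (fun x t => ∫ y in (0 : ℝ)..x, k x y * f' y t) :=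
  hf.integral isClosed_triL hk continuous_const continuous_id
    fun _ hx => ⟨hx.1, fun _ hy => ⟨⟨hy.1, hy.2, hx.2⟩, hy.1, hy.2.trans hx.2⟩⟩

lemma TimeFamily.rowState {k l : ℝ → ℝ → ℝ}
    (hk : ContinuousOn (fun z : ℝ × ℝ => k z.1 z.2) triL)
    (hl : ContinuousOn (fun z : ℝ × ℝ => l z.1 z.2) triL) {t₀ : ℝ} {v v' u₁ u₁' u₂ u₂' : ℝ → ℝ → ℝ}
    (hv : TimeFamily t₀ v v') (h1 : TimeFamily t₀ u₁ u₁') (h2 : TimeFamily t₀ u₂ u₂') :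
    TimeFamily t₀
      (fun x t => rowState k l (fun x => v x t) (fun x => u₁ x t) (fun x => u₂ x t) x)
      (fun x t => rowState k l (fun x => v' x t) (fun x => u₁' x t) (fun x => u₂' x t) x) :=
  ((hv.sub (h1.volterra hk)).sub (h2.volterra hl)).congr
    (fun _ hx _ ht => rowState_eq hk hl (section_cont h1.cont ht) (section_cont h2.cont ht) hx)
    (fun _ hx _ ht => rowState_eq hk hl (section_cont h1.cont' ht) (section_cont h2.cont' ht) hx)

lemma rowState_congr {k l : ℝ → ℝ → ℝ} {v v' u₁ u₁' u₂ u₂' : ℝ → ℝ} {x : ℝ}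
    (hx : x ∈ Icc (0 : ℝ) 1) (hv : ∀ x ∈ Icc (0 : ℝ) 1, v x = v' x)
    (h1 : ∀ x ∈ Icc (0 : ℝ) 1, u₁ x = u₁' x) (h2 : ∀ x ∈ Icc (0 : ℝ) 1, u₂ x = u₂' x) :
    rowState k l v u₁ u₂ x = rowState k l v' u₁' u₂' x := by
  rw [rowState, rowState, hv x hx]
  congr 1
  refine intervalIntegral.integral_congr fun y hy => ?_
  rw [uIcc_of_le hx.1] at hy
  have m : y ∈ Icc (0 : ℝ) 1 := ⟨hy.1, hy.2.trans hx.2⟩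
  rw [h1 y m, h2 y m]

/-! ### Boundary values and feedback gains. -/

/-- With the outer corner moved to `x`, both iterated integrals have the derivative `∫₀ˣ G(x, y) dy`
in `x` and vanish at `x = 0`. -/
lemma integral_triangle_swap {F : ℝ → ℝ → ℝ}
    (hF : ContinuousOn (fun z : ℝ × ℝ => F z.1 z.2) triL) :
    ∫ z in (0 : ℝ)..1, ∫ y in (0 : ℝ)..z, F z y = ∫ y in (0 : ℝ)..1, ∫ z in y..1, F z y := by
  obtain ⟨G, hG, hGF⟩ := exists_continuous_extension isClosed_triL hF
  have c1 : Continuous fun x => ∫ y in (0 : ℝ)..x, G (x, y) :=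
    continuous_integral_param hG continuous_id continuous_const continuous_id
  have c2 : Continuous fun z : ℝ × ℝ => ∫ s in z.2..z.1, G (s, z.2) :=
    continuous_integral_param (H := fun z => G (z.2, z.1)) (by fun_prop) continuous_snd
      continuous_snd continuous_fst
  have dA : ∀ x, HasDerivAt (fun x => ∫ z in (0 : ℝ)..x, ∫ y in (0 : ℝ)..z, G (z, y))
      (∫ y in (0 : ℝ)..x, G (x, y)) x := fun x => hasDerivAt_integral_upper c1 0 x
  have dB : ∀ x, HasDerivAt (fun x => ∫ y in (0 : ℝ)..x, ∫ z in y..x, G (z, y))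
      (∫ y in (0 : ℝ)..x, G (x, y)) x := fun x => by
    have := hasDerivAt_integral_limits (H := fun z => ∫ s in z.2..z.1, G (s, z.2))
      (H' := fun z => G z) c2 hG (fun t s => hasDerivAt_integral_upper (f := fun r => G (r, s))
        (by fun_prop) s t) (hasDerivAt_const x (0 : ℝ)) (hasDerivAt_id x)
    simpa using this
  have key := is_const_of_deriv_eq_zero (fun x => ((dA x).sub (dB x)).differentiableAt)
    (fun x => by rw [((dA x).sub (dB x)).deriv, sub_self]) 1 0
  simp only [Pi.sub_apply, intervalIntegral.integral_same, sub_self] at key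
  have e1 : ∫ z in (0 : ℝ)..1, ∫ y in (0 : ℝ)..z, F z y =
      ∫ z in (0 : ℝ)..1, ∫ y in (0 : ℝ)..z, G (z, y) := by
    refine intervalIntegral.integral_congr fun z hz => ?_
    rw [uIcc_zero_one] at hz
    refine intervalIntegral.integral_congr fun y hy => ?_
    rw [uIcc_of_le hz.1] at hy
    exact (hGF (show (z, y) ∈ triL from ⟨hy.1, hy.2, hz.2⟩)).symm
  have e2 : ∫ y in (0 : ℝ)..1, ∫ z in y..1, F z y = ∫ y in (0 : ℝ)..1, ∫ z in y..1, G (z, y) := by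
    refine intervalIntegral.integral_congr fun y hy => ?_
    rw [uIcc_zero_one] at hy
    refine intervalIntegral.integral_congr fun z hz => ?_
    rw [uIcc_of_le hy.2] at hz
    exact (hGF (show (z, y) ∈ triL from ⟨hy.1, hz.1, hz.2⟩)).symm
  rw [e1, e2]
  linarith

lemma continuousOn_integral_fst {F : ℝ → ℝ → ℝ}
    (hF : ContinuousOn (fun z : ℝ × ℝ => F z.1 z.2) triL) :
    ContinuousOn (fun y => ∫ z in y..1, F z y) (Icc 0 1) := by
  obtain ⟨G, hG, hGF⟩ := exists_continuous_extension isClosed_triL hF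
  have : Continuous fun y => ∫ z in y..1, G (z, y) :=
    continuous_integral_param (H := fun z => G (z.2, z.1)) (by fun_prop) continuous_id
      continuous_id continuous_const
  refine this.continuousOn.congr fun y hy => intervalIntegral.integral_congr fun z hz => ?_
  rw [uIcc_of_le hy.2] at hz
  exact (hGF (show (z, y) ∈ triL from ⟨hy.1, hz.1, hz.2⟩)).symm

section

variable {ε y₀ c₁ c₂ : ℝ} {ℓ p : ℝ → ℝ} {q r : ℝ → ℝ → ℝ} {K : ℝ → ℝ → Matrix (Fin 2) (Fin 2) ℝ}

lemma IsFirstKernel.continuousOn_entry (hK : IsFirstKernel ε y₀ c₁ c₂ ℓ K) (i j : Fin 2) :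
    ContinuousOn (fun z : ℝ × ℝ => entry K i j z.1 z.2) triL := by
  fin_cases i <;> fin_cases j
  · exact hK.reg11.continuousOn
  · exact hK.cont12
  · exact hK.reg21.continuousOn
  · exact hK.reg22.continuousOn

lemma continuousOn_bottom {k : ℝ → ℝ → ℝ} (hk : ContinuousOn (fun z : ℝ × ℝ => k z.1 z.2) triL) :
    ContinuousOn (k 1) (Icc 0 1) :=
  hk.comp (f := fun y : ℝ => ((1 : ℝ), y)) (by fun_prop) fun _ hy => ⟨hy.1, hy.2, le_rfl⟩

lemma IsKernelFamily.continuousOn_gains (h : IsKernelFamily ε y₀ c₁ c₂ ℓ K p q r) :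
    ContinuousOn (h1 K p q) (Icc 0 1) ∧ ContinuousOn (h2 K p q) (Icc 0 1) := by
  have hk := h.first.continuousOn_entry
  have hp := h.second.continuousOn_p
  have hq1 := continuousOn_bottom h.second.cont_q
  have pf : ContinuousOn (fun z : ℝ × ℝ => p (1 - z.1)) triL := hp.comp (by fun_prop)
    fun z hz => ⟨by linarith [hz.2.2], by linarith [hz.1, hz.2.1]⟩
  have qf : ContinuousOn (fun z : ℝ × ℝ => q 1 z.1) triL := hq1.comp continuousOn_fst
    fun z hz => ⟨hz.1.trans hz.2.1, hz.2.2⟩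
  have pr : ContinuousOn (fun y : ℝ => p (1 - y)) (Icc 0 1) := hp.comp (by fun_prop)
    fun y hy => ⟨by linarith [hy.2], by linarith [hy.1]⟩
  exact ⟨((continuousOn_bottom (hk 1 0)).add hq1).sub (continuousOn_integral_fst
      (F := fun z y => p (1 - z) * K z y 1 0 + q 1 z * K z y 0 0)
      ((pf.mul (hk 1 0)).add (qf.mul (hk 0 0)))),
    ((continuousOn_bottom (hk 1 1)).add pr).sub (continuousOn_integral_fst
      (F := fun z y => p (1 - z) * K z y 1 1 + q 1 z * K z y 0 1)
      ((pf.mul (hk 1 1)).add (qf.mul (hk 0 1))))⟩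

/-- The controlled boundary value of the target state. -/
lemma IsKernelFamily.secondState_one (h : IsKernelFamily ε y₀ c₁ c₂ ℓ K p q r) {u₁ u₂ : ℝ → ℝ}
    (hu₁ : ContinuousOn u₁ (Icc 0 1)) (hu₂ : ContinuousOn u₂ (Icc 0 1)) :
    secondState p q r (rowState (entry K 0 0) (entry K 0 1) u₁ u₁ u₂)
      (rowState (entry K 1 0) (entry K 1 1) u₂ u₁ u₂) 1 =
      u₂ 1 - ∫ y in (0 : ℝ)..1, (h1 K p q y * u₁ y + h2 K p q y * u₂ y) := by
  have hk := h.first.continuousOn_entry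
  have hp := h.second.continuousOn_p
  have hq1 := continuousOn_bottom h.second.cont_q
  have pf : ContinuousOn (fun z : ℝ × ℝ => p (1 - z.1)) triL := hp.comp (by fun_prop)
    fun z hz => ⟨by linarith [hz.2.2], by linarith [hz.1, hz.2.1]⟩
  have qf : ContinuousOn (fun z : ℝ × ℝ => q 1 z.1) triL := hq1.comp continuousOn_fst
    fun z hz => ⟨hz.1.trans hz.2.1, hz.2.2⟩
  have pr : ContinuousOn (fun y : ℝ => p (1 - y)) (Icc 0 1) := hp.comp (by fun_prop)
    fun y hy => ⟨by linarith [hy.2], by linarith [hy.1]⟩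
  have u1f : ContinuousOn (fun z : ℝ × ℝ => u₁ z.2) triL := hu₁.comp continuousOn_snd
    fun z hz => triL_snd_mem hz
  have u2f : ContinuousOn (fun z : ℝ × ℝ => u₂ z.2) triL := hu₂.comp continuousOn_snd
    fun z hz => triL_snd_mem hz
  set A : ℝ → ℝ → ℝ := fun z y => p (1 - z) * K z y 1 0 + q 1 z * K z y 0 0 with hA
  set B : ℝ → ℝ → ℝ := fun z y => p (1 - z) * K z y 1 1 + q 1 z * K z y 0 1 with hB
  have cA : ContinuousOn (fun z : ℝ × ℝ => A z.1 z.2) triL :=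
    (pf.mul (hk 1 0)).add (qf.mul (hk 0 0))
  have cB : ContinuousOn (fun z : ℝ × ℝ => B z.1 z.2) triL :=
    (pf.mul (hk 1 1)).add (qf.mul (hk 0 1))
  -- Composing the transformations gives an iterated integral with the state innermost; exchanging
  -- the order isolates the state and produces the integral terms of `h1` and `h2`.
  have swap := integral_triangle_swap (F := fun z y => A z y * u₁ y + B z y * u₂ y)
    ((cA.mul u1f).add (cB.mul u2f))
  have cA' : ContinuousOn (fun y => (∫ z in y..1, A z y) * u₁ y) (Icc 0 1) :=
    (continuousOn_integral_fst cA).mul hu₁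
  have cB' : ContinuousOn (fun y => (∫ z in y..1, B z y) * u₂ y) (Icc 0 1) :=
    (continuousOn_integral_fst cB).mul hu₂
  have cAB : ContinuousOn (fun y => (∫ z in y..1, A z y) * u₁ y + (∫ z in y..1, B z y) * u₂ y)
    (Icc 0 1) := cA'.add cB'
  have inner : ∫ y in (0 : ℝ)..1, ∫ z in y..1, (A z y * u₁ y + B z y * u₂ y) =
      ∫ y in (0 : ℝ)..1, ((∫ z in y..1, A z y) * u₁ y + (∫ z in y..1, B z y) * u₂ y) := by
    refine intervalIntegral.integral_congr fun y hy => ?_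
    rw [uIcc_zero_one] at hy
    have sec : ∀ {F : ℝ → ℝ → ℝ}, ContinuousOn (fun z : ℝ × ℝ => F z.1 z.2) triL →
        IntervalIntegrable (fun z => F z y) volume y 1 := fun hF =>
      (hF.comp (f := fun z : ℝ => (z, y)) (by fun_prop)
        fun z hz => ⟨hy.1, hz.1, hz.2⟩).intervalIntegrable_of_Icc hy.2
    rw [intervalIntegral.integral_add ((sec cA).mul_const _) ((sec cB).mul_const _),
      intervalIntegral.integral_mul_const, intervalIntegral.integral_mul_const]
  have cw1 := continuousOn_rowState (hk 0 0) (hk 0 1) hu₁ hu₁ hu₂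
  have cw2 := continuousOn_rowState (hk 1 0) (hk 1 1) hu₂ hu₁ hu₂
  have i1 : IntervalIntegrable (fun y => q 1 y * rowState (entry K 0 0) (entry K 0 1) u₁ u₁ u₂ y)
    volume 0 1 := intervalIntegrable_Icc (hq1.mul cw1)
  have i2 : IntervalIntegrable (fun y => p (1 - y) *
    rowState (entry K 1 0) (entry K 1 1) u₂ u₁ u₂ y) volume 0 1 :=
    intervalIntegrable_Icc (pr.mul cw2)
  have cD : ContinuousOn (fun z => ∫ y in (0 : ℝ)..z, (A z y * u₁ y + B z y * u₂ y)) (Icc 0 1) :=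
    ((continuousOn_volterra cA hu₁).add (continuousOn_volterra cB hu₂)).congr fun z hz =>
      intervalIntegral.integral_add (intervalIntegrable_section cA hu₁ hz)
        (intervalIntegrable_section cB hu₂ hz)
  have cQ : ContinuousOn (fun z => q 1 z * u₁ z + p (1 - z) * u₂ z) (Icc 0 1) :=
    (hq1.mul hu₁).add (pr.mul hu₂)
  have cR : ContinuousOn (fun y => K 1 y 1 0 * u₁ y + K 1 y 1 1 * u₂ y) (Icc 0 1) :=
    ((continuousOn_bottom (hk 1 0)).mul hu₁).add ((continuousOn_bottom (hk 1 1)).mul hu₂)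
  have sum : (∫ y in (0 : ℝ)..1, q 1 y * rowState (entry K 0 0) (entry K 0 1) u₁ u₁ u₂ y) +
      (∫ y in (0 : ℝ)..1, p (1 - y) * rowState (entry K 1 0) (entry K 1 1) u₂ u₁ u₂ y) =
      (∫ z in (0 : ℝ)..1, (q 1 z * u₁ z + p (1 - z) * u₂ z)) -
      ∫ z in (0 : ℝ)..1, ∫ y in (0 : ℝ)..z, (A z y * u₁ y + B z y * u₂ y) := by
    rw [← intervalIntegral.integral_add i1 i2, ← intervalIntegral.integral_sub
      (intervalIntegrable_Icc cQ) (intervalIntegrable_Icc cD)]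
    refine intervalIntegral.integral_congr fun z hz => ?_
    rw [uIcc_zero_one] at hz
    have e : ∫ y in (0 : ℝ)..z, (A z y * u₁ y + B z y * u₂ y) =
        q 1 z * (∫ y in (0 : ℝ)..z, (entry K 0 0 z y * u₁ y + entry K 0 1 z y * u₂ y)) +
        p (1 - z) * ∫ y in (0 : ℝ)..z, (entry K 1 0 z y * u₁ y + entry K 1 1 z y * u₂ y) := by
      have s : ∀ i, IntervalIntegrable
          (fun y => entry K i 0 z y * u₁ y + entry K i 1 z y * u₂ y) volume 0 z := fun i =>
        (intervalIntegrable_section (hk i 0) hu₁ hz).add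
          (intervalIntegrable_section (hk i 1) hu₂ hz)
      rw [← intervalIntegral.integral_const_mul, ← intervalIntegral.integral_const_mul,
        ← intervalIntegral.integral_add ((s 0).const_mul _) ((s 1).const_mul _)]
      refine intervalIntegral.integral_congr fun y _ => ?_
      simp only [hA, hB, entry]
      ring
    simp only [rowState]
    rw [e]
    ring
  have gains : ∫ y in (0 : ℝ)..1, (h1 K p q y * u₁ y + h2 K p q y * u₂ y) =
      (∫ y in (0 : ℝ)..1, (K 1 y 1 0 * u₁ y + K 1 y 1 1 * u₂ y)) +
      (∫ z in (0 : ℝ)..1, (q 1 z * u₁ z + p (1 - z) * u₂ z)) -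
      ∫ y in (0 : ℝ)..1, ((∫ z in y..1, A z y) * u₁ y + (∫ z in y..1, B z y) * u₂ y) := by
    rw [← intervalIntegral.integral_add (intervalIntegrable_Icc cR) (intervalIntegrable_Icc cQ),
      ← intervalIntegral.integral_sub ((intervalIntegrable_Icc cR).add (intervalIntegrable_Icc cQ))
        (intervalIntegrable_Icc cAB)]
    refine intervalIntegral.integral_congr fun y _ => ?_
    simp only [h1, h2, hA, hB]
    ring
  rw [gains, ← inner, ← swap]
  rw [secondState, intervalIntegral.integral_same, add_zero, sub_sub, sum]
  simp only [rowState, entry]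
  ring

end

/-! ### Exponential stability in the folded coordinates. -/

/-- A solution of the folded closed loop for `t > t₀`, where the advection has been removed. -/
structure IsFoldedSolution (ε y₀ : ℝ) (ℓ : ℝ → ℝ) (K : ℝ → ℝ → Matrix (Fin 2) (Fin 2) ℝ)
    (p : ℝ → ℝ) (q : ℝ → ℝ → ℝ) (t₀ : ℝ) (u₁ u₁t u₂ u₂t : ℝ → ℝ → ℝ) : Prop where
  family₁ : TimeFamily t₀ u₁ u₁t
  family₂ : TimeFamily t₀ u₂ u₂t
  evolution : ∀ t > t₀, ∃ u₁' u₁'' u₂' u₂'' : ℝ → ℝ,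
    HasDerivIcc (fun x => u₁ x t) u₁' ∧ HasDerivIcc u₁' u₁'' ∧
    HasDerivIcc (fun x => u₂ x t) u₂' ∧ HasDerivIcc u₂' u₂'' ∧
    u₁' 0 + aCoef y₀ * u₂' 0 = 0 ∧
    (∀ x ∈ Icc (0 : ℝ) 1, u₁t x t = eps1 ε y₀ * u₁'' x + ℓ (y₀ - (1 + y₀) * x) * u₁ x t) ∧
    ∀ x ∈ Icc (0 : ℝ) 1, u₂t x t = eps2 ε y₀ * u₂'' x + ℓ (y₀ + (1 - y₀) * x) * u₂ x t
  fold : ∀ t > t₀, u₁ 0 t = u₂ 0 t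
  control₁ : ∀ t > t₀, u₁ 1 t = ∫ y in (0 : ℝ)..1, (K 1 y 0 0 * u₁ y t + K 1 y 0 1 * u₂ y t)
  control₂ : ∀ t > t₀, u₂ 1 t = ∫ y in (0 : ℝ)..1, (h1 K p q y * u₁ y t + h2 K p q y * u₂ y t)

section

variable {ε y₀ c₁ c₂ : ℝ} {ℓ p : ℝ → ℝ} {q r : ℝ → ℝ → ℝ} {K : ℝ → ℝ → Matrix (Fin 2) (Fin 2) ℝ}

lemma TimeFamily.secondState {g : ℝ → ℝ} (h : IsSecondKernel ε y₀ c₁ c₂ g p q r) {t₀ : ℝ}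
    {w₁ w₁' w₂ w₂' : ℝ → ℝ → ℝ} (h1 : TimeFamily t₀ w₁ w₁') (h2 : TimeFamily t₀ w₂ w₂') :
    TimeFamily t₀ (fun x t => secondState p q r (fun x => w₁ x t) (fun x => w₂ x t) x)
      (fun x t => secondState p q r (fun x => w₁' x t) (fun x => w₂' x t) x) := by
  have pk : ContinuousOn (fun z : ℝ × ℝ => p (z.1 - z.2)) triL :=
    h.continuousOn_p.comp (by fun_prop)
      fun z hz => ⟨by linarith [hz.2.1], by linarith [hz.1, hz.2.2]⟩
  have a1 := h1.volterra h.cont_q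
  have a2 := h1.integral isClosed_triU h.cont_r (b := fun x => x) (c := fun _ => 1) continuous_id
    continuous_const fun _ hx => ⟨hx.2, fun _ hy => ⟨⟨hx.1, hy.1, hy.2⟩, hx.1.trans hy.1, hy.2⟩⟩
  have a3 := h2.volterra (k := fun x y => p (x - y)) pk
  refine (((h2.sub a1).sub a2).sub a3).congr (fun x _ t _ => ?_) (fun x _ t _ => ?_) <;>
  · simp only [Folding.secondState]; ring

/-- `a ≤ 1` gives `ε₂ ≤ ε₁` and `a³ c₁ ≤ c₁`, so the stated rate is at most the dissipation rate of
either component. -/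
lemma le_of_decayRate (hε : 0 < ε) (hy : y₀ ∈ Ioc (-1 : ℝ) 0) (hc₁ : 0 < c₁) :
    decayRate ε y₀ c₁ c₂ ≤ eps1 ε y₀ / 4 + c₁ ∧ decayRate ε y₀ c₁ c₂ ≤ eps2 ε y₀ / 4 + c₂ := by
  have ha := aCoef_pos hy
  have ha1 := aCoef_le_one hy
  have h1 := eps1_pos hε hy
  have he : eps2 ε y₀ ≤ eps1 ε y₀ := by
    rw [eps2_eq hy]; exact mul_le_of_le_one_left h1.le (pow_le_one₀ ha.le ha1)
  have h3 : aCoef y₀ ^ 3 * c₁ ≤ c₁ := mul_le_of_le_one_left hc₁.le (pow_le_one₀ ha.le ha1)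
  have m1 := min_le_left (aCoef y₀ ^ 3 * c₁) c₂
  have m2 := min_le_right (aCoef y₀ ^ 3 * c₁) c₂
  unfold decayRate
  constructor <;> linarith

/-- The weighted energy of the target system decays exponentially. -/
lemma target_energy_decay (hε : 0 < ε) (hy : y₀ ∈ Ioc (-1 : ℝ) 0) (hc₁ : 0 < c₁) {t₀ : ℝ}
    {ω₁ ω₁t ω₂ ω₂t : ℝ → ℝ → ℝ} (F1 : TimeFamily t₀ ω₁ ω₁t) (F2 : TimeFamily t₀ ω₂ ω₂t)
    (hev : ∀ t > t₀, ∃ ω₁' ω₁'' ω₂' ω₂'' : ℝ → ℝ,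
      HasDerivIcc (fun x => ω₁ x t) ω₁' ∧ HasDerivIcc ω₁' ω₁'' ∧
      HasDerivIcc (fun x => ω₂ x t) ω₂' ∧ HasDerivIcc ω₂' ω₂'' ∧
      ω₁' 0 + aCoef y₀ * ω₂' 0 = 0 ∧
      (∀ x ∈ Icc (0 : ℝ) 1, ω₁t x t = eps1 ε y₀ * ω₁'' x - c₁ * ω₁ x t) ∧
      ∀ x ∈ Icc (0 : ℝ) 1, ω₂t x t = eps2 ε y₀ * ω₂'' x - c₂ * ω₂ x t)
    (h0 : ∀ t > t₀, ω₁ 0 t = ω₂ 0 t) (h1 : ∀ t > t₀, ω₁ 1 t = 0) (h2 : ∀ t > t₀, ω₂ 1 t = 0)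
    {s t : ℝ} (hs : t₀ < s) (hst : s ≤ t) :
    (1 + y₀) * (∫ x in (0 : ℝ)..1, ω₁ x t ^ 2) + (1 - y₀) * (∫ x in (0 : ℝ)..1, ω₂ x t ^ 2) ≤
      Real.exp (-(2 * decayRate ε y₀ c₁ c₂) * (t - s)) *
        ((1 + y₀) * (∫ x in (0 : ℝ)..1, ω₁ x s ^ 2) +
          (1 - y₀) * ∫ x in (0 : ℝ)..1, ω₂ x s ^ 2) := by
  have hA : 0 < 1 + y₀ := by linarith [hy.1]
  have hB : 0 < 1 - y₀ := by linarith [hy.2]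
  have sq : ∀ {ω ωt : ℝ → ℝ → ℝ}, TimeFamily t₀ ω ωt → ∀ t > t₀,
      HasDerivAt (fun t => ∫ x in (0 : ℝ)..1, ω x t ^ 2)
        (∫ x in (0 : ℝ)..1, 2 * (ω x t * ωt x t)) t := fun {ω ωt} hF t ht => by
    have c : ContinuousOn (fun z : ℝ × ℝ => (z.2, z.1)) (Ioi t₀ ×ˢ Icc (0 : ℝ) 1) := by fun_prop
    have m : MapsTo (fun z : ℝ × ℝ => (z.2, z.1)) (Ioi t₀ ×ˢ Icc (0 : ℝ) 1) (Icc 0 1 ×ˢ Ioi t₀) :=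
      fun z hz => ⟨hz.2, hz.1⟩
    exact hasDerivAt_integral_param_on (H := fun t x => ω x t ^ 2)
      (H' := fun t x => 2 * (ω x t * ωt x t)) isOpen_Ioi zero_le_one
      ((hF.cont.comp c m).pow 2)
      (continuousOn_const.mul ((hF.cont.comp c m).mul (hF.cont'.comp c m)))
      (fun t ht x hx => ((hF.deriv x hx t ht).pow 2).congr_deriv (by simp; ring)) ht
  refine exp_decay (E := fun t => (1 + y₀) * (∫ x in (0 : ℝ)..1, ω₁ x t ^ 2) +
    (1 - y₀) * ∫ x in (0 : ℝ)..1, ω₂ x t ^ 2)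
    (fun t ht => ((sq F1 t ht).const_mul _).add ((sq F2 t ht).const_mul _)) (fun t ht => ?_) hs hst
  obtain ⟨ω₁', ω₁'', ω₂', ω₂'', a1, a2, b1, b2, hf, e1, e2⟩ := hev t ht
  have d1 := dissipation a1 a2 (h1 t ht) (c := c₁) (eps1_pos hε hy).le
  have d2 := dissipation b1 b2 (h2 t ht) (c := c₂) (eps2_pos hε hy).le
  have g1 : ∫ x in (0 : ℝ)..1, 2 * (ω₁ x t * ω₁t x t) =
      2 * ∫ x in (0 : ℝ)..1, ω₁ x t * (eps1 ε y₀ * ω₁'' x - c₁ * ω₁ x t) := by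
    rw [intervalIntegral.integral_const_mul]
    congr 1
    refine intervalIntegral.integral_congr fun x hx => ?_
    rw [uIcc_zero_one] at hx
    rw [e1 x hx]
  have g2 : ∫ x in (0 : ℝ)..1, 2 * (ω₂ x t * ω₂t x t) =
      2 * ∫ x in (0 : ℝ)..1, ω₂ x t * (eps2 ε y₀ * ω₂'' x - c₂ * ω₂ x t) := by
    rw [intervalIntegral.integral_const_mul]
    congr 1
    refine intervalIntegral.integral_congr fun x hx => ?_
    rw [uIcc_zero_one] at hx
    rw [e2 x hx]
  rw [g1, g2]
  have n1 := integral_sq_nonneg fun x => ω₁ x t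
  have n2 := integral_sq_nonneg fun x => ω₂ x t
  obtain ⟨r1, r2⟩ := le_of_decayRate (c₂ := c₂) hε hy hc₁
  -- The weights make the flux through the fold cancel: `ω₁' = -a ω₂'`, `ε₂ = a² ε₁` and `1 + y₀ = a
  -- (1 - y₀)`.
  have bd : (1 + y₀) * (eps1 ε y₀ * (ω₁ 0 t * ω₁' 0)) +
      (1 - y₀) * (eps2 ε y₀ * (ω₂ 0 t * ω₂' 0)) = 0 := by
    have ab : aCoef y₀ * (1 - y₀) = 1 + y₀ := by unfold aCoef; field_simp
    rw [eps2_eq hy, h0 t ht]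
    linear_combination (1 + y₀) * eps1 ε y₀ * ω₂ 0 t * hf +
      aCoef y₀ * eps1 ε y₀ * ω₂ 0 t * ω₂' 0 * ab
  have k1 := mul_le_mul_of_nonneg_left d1 hA.le
  have k2 := mul_le_mul_of_nonneg_left d2 hB.le
  have k3 := mul_le_mul_of_nonneg_left (mul_le_mul_of_nonneg_right r1 n1) hA.le
  have k4 := mul_le_mul_of_nonneg_left (mul_le_mul_of_nonneg_right r2 n2) hB.le
  linarith

/-- The weighted and unweighted energies are comparable because `0 < 1 + y₀ ≤ 1 - y₀`; the remaining
factors are the norms of the transformations and of their inverses. -/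
lemma bound_of_chain {y₀ A B e a b c d m n : ℝ} (hy : y₀ ∈ Ioc (-1 : ℝ) 0) (hA : 0 ≤ A)
    (hB : 0 ≤ B) (he : 0 ≤ e) (hb : 0 ≤ b) (hc : 0 ≤ c)
    (h1 : m ≤ A * (B * (a + b)))
    (h2 : (1 + y₀) * a + (1 - y₀) * b ≤ e * ((1 + y₀) * c + (1 - y₀) * d))
    (h3 : c + d ≤ B * (A * n)) :
    m ≤ A * B * (1 + y₀)⁻¹ * (1 - y₀) * (B * A) * e * n := by
  have y1 : 0 < 1 + y₀ := by linarith [hy.1]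
  have y2 : 0 < 1 - y₀ := by linarith [hy.2]
  have k1 : (1 + y₀) * (a + b) ≤ (1 + y₀) * a + (1 - y₀) * b := by nlinarith [hy.2]
  have k2 : (1 + y₀) * c + (1 - y₀) * d ≤ (1 - y₀) * (c + d) := by nlinarith [hy.2]
  have k3 := mul_le_mul_of_nonneg_left (k2.trans (mul_le_mul_of_nonneg_left h3 y2.le)) he
  have k4 := (le_inv_mul_iff₀ y1).2 ((k1.trans h2).trans k3)
  refine h1.trans ((mul_le_mul_of_nonneg_left (mul_le_mul_of_nonneg_left k4 hB) hA).trans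
    (le_of_eq ?_))
  ring

/-- The composed transformation is an `L²` isomorphism onto the target system, whose energy decays;
the constant collects the bounds in both directions and the ratio of the energy weights. -/
theorem IsKernelFamily.exists_folded_decay (hε : 0 < ε) (hy : y₀ ∈ Ioc (-1 : ℝ) 0) (hc₁ : 0 < c₁)
    (hℓ : ContinuousOn ℓ (Icc (-1) 1)) (h : IsKernelFamily ε y₀ c₁ c₂ ℓ K p q r) :
    ∃ C : ℝ, 0 ≤ C ∧ ∀ (t₀ : ℝ) (u₁ u₁t u₂ u₂t : ℝ → ℝ → ℝ),
      IsFoldedSolution ε y₀ ℓ K p q t₀ u₁ u₁t u₂ u₂t → ∀ s t : ℝ, t₀ < s → s ≤ t →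
        (∫ x in (0 : ℝ)..1, u₁ x t ^ 2) + (∫ x in (0 : ℝ)..1, u₂ x t ^ 2) ≤
          C * Real.exp (-(2 * decayRate ε y₀ c₁ c₂) * (t - s)) *
            ((∫ x in (0 : ℝ)..1, u₁ x s ^ 2) + ∫ x in (0 : ℝ)..1, u₂ x s ^ 2) := by
  have hk := h.first.continuousOn_entry
  obtain ⟨A, A0, hA⟩ := exists_rowState_bound (hk 0 0) (hk 0 1) (hk 1 0) (hk 1 1)
  obtain ⟨B, B0, hB⟩ := h.second.exists_bound
  have y1 : 0 < 1 + y₀ := by linarith [hy.1]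
  have y2 : 0 < 1 - y₀ := by linarith [hy.2]
  refine ⟨A * B * (1 + y₀)⁻¹ * (1 - y₀) * (B * A), by positivity,
    fun t₀ u₁ u₁t u₂ u₂t hu s t hs hst => ?_⟩
  have W1 := TimeFamily.rowState (hk 0 0) (hk 0 1) hu.family₁ hu.family₁ hu.family₂
  have W2 := TimeFamily.rowState (hk 1 0) (hk 1 1) hu.family₂ hu.family₁ hu.family₂
  have O2 := W1.secondState h.second W2
  have cu : ∀ t > t₀, ContinuousOn (fun x => u₁ x t) (Icc 0 1) ∧
      ContinuousOn (fun x => u₂ x t) (Icc 0 1) := fun t ht =>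
    ⟨TimeFamily.section_cont hu.family₁.cont ht, TimeFamily.section_cont hu.family₂.cont ht⟩
  -- The first feedback law is exactly the vanishing of the transformed state at `x = 1`.
  have w1one : ∀ t > t₀, rowState (entry K 0 0) (entry K 0 1) (fun x => u₁ x t) (fun x => u₁ x t)
      (fun x => u₂ x t) 1 = 0 := fun t ht => sub_eq_zero.2 (hu.control₁ t ht)
  have dec := target_energy_decay (c₂ := c₂) hε hy hc₁ W1 O2 ?_ ?_ w1one ?_ hs hst
  · have Atw := hA _ _ (cu t (hs.trans_le hst)).1 (cu t (hs.trans_le hst)).2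
    have Asw := hA _ _ (cu s hs).1 (cu s hs).2
    have cw : ∀ t > t₀, ∀ i : Fin 2, ∀ v : ℝ → ℝ, ContinuousOn v (Icc 0 1) →
        ContinuousOn (rowState (entry K i 0) (entry K i 1) v (fun x => u₁ x t) (fun x => u₂ x t))
          (Icc 0 1) := fun t ht i v hv =>
      continuousOn_rowState (hk i 0) (hk i 1) hv (cu t ht).1 (cu t ht).2
    have Btw := hB _ _ (cw t (hs.trans_le hst) 0 _ (cu t (hs.trans_le hst)).1)
      (cw t (hs.trans_le hst) 1 _ (cu t (hs.trans_le hst)).2)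
    have Bsw := hB _ _ (cw s hs 0 _ (cu s hs).1) (cw s hs 1 _ (cu s hs).2)
    have hut := Atw.2.trans (mul_le_mul_of_nonneg_left Btw.2 A0)
    have hus := Bsw.1.trans (mul_le_mul_of_nonneg_left Asw.1 B0)
    exact bound_of_chain hy A0 B0 (Real.exp_pos _).le (integral_sq_nonneg _) (integral_sq_nonneg _)
      hut dec hus
  · intro t ht
    obtain ⟨u₁', u₁'', u₂', u₂'', a1, a2, b1, b2, hf, e1, e2⟩ := hu.evolution t ht
    obtain ⟨w₁', w₁'', w₂', w₂'', p1, p2, p3, p4, z1, z2, f1, f2⟩ :=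
      h.first.transform hε hy hℓ a1 a2 b1 b2 (hu.fold t ht) hf
    have V1 : ∀ x ∈ Icc (0 : ℝ) 1, rowState (entry K 0 0) (entry K 0 1) (fun x => u₁t x t)
        (fun x => u₁t x t) (fun x => u₂t x t) x = eps1 ε y₀ * w₁'' x - c₁ *
        rowState (entry K 0 0) (entry K 0 1) (fun x => u₁ x t) (fun x => u₁ x t)
          (fun x => u₂ x t) x := fun x hx => (rowState_congr hx e1 e1 e2).trans (f1 x hx)
    have V2 : ∀ x ∈ Icc (0 : ℝ) 1, rowState (entry K 1 0) (entry K 1 1) (fun x => u₂t x t)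
        (fun x => u₁t x t) (fun x => u₂t x t) x = eps2 ε y₀ * w₂'' x - c₂ *
        rowState (entry K 1 0) (entry K 1 1) (fun x => u₂ x t) (fun x => u₁ x t)
          (fun x => u₂ x t) x + gCoef ε y₀ K x *
        rowState (entry K 0 0) (entry K 0 1) (fun x => u₁ x t) (fun x => u₁ x t)
          (fun x => u₂ x t) x := fun x hx => (rowState_congr hx e2 e1 e2).trans (f2 x hx)
    obtain ⟨ω', ω'', q1, q2, q3, q4⟩ := h.second.transform hε hy h.first.continuousOn_gCoef
      p1 p2 p3 p4 (w1one t ht) (by simp [rowState, hu.fold t ht]) (by rw [z1, z2, hf]) V1 V2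
    exact ⟨w₁', w₁'', ω', ω'', p1, p2, q1, q2, by rw [z1, q3, z2, hf], V1, q4⟩
  · intro t ht
    -- At `x = 0` only the Fredholm integral could change the value, and `r(0, ·) = 0` removes it;
    -- continuity across the fold is preserved.
    have r0 : ∀ y ∈ Icc (0 : ℝ) 1, r 0 y = 0 := h.second.r_init
    have : ∀ w : ℝ → ℝ, ∫ y in (0 : ℝ)..1, r 0 y * w y = 0 := fun w => by
      rw [intervalIntegral.integral_congr (g := fun _ => 0) fun y hy => by
        rw [uIcc_zero_one] at hy
        simp only
        rw [r0 y hy, zero_mul]]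
      simp
    simp [secondState, rowState, this, hu.fold t ht]
  · intro t ht
    refine (h.secondState_one (cu t ht).1 (cu t ht).2).trans ?_
    rw [← hu.control₂ t ht, sub_self]

end

/-! ### Removal of the advection and folding of the solution. -/

lemma neg_one_le_one : (-1 : ℝ) ≤ 1 := by norm_num

lemma TimeFamily.continuousOn_section {t₀ : ℝ} {f f' : ℝ → ℝ → ℝ} (h : TimeFamily t₀ f f') {t : ℝ}
    (ht : t₀ < t) : ContinuousOn (fun x => f x t) (Icc 0 1) := section_cont h.cont ht

lemma HasDerivIcc.const_mul {f f' : ℝ → ℝ} (h : HasDerivIcc f f') (m : ℝ) :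
    HasDerivIcc (fun x => m * f x) (fun x => m * f' x) where
  deriv x hx := (h.deriv x hx).const_mul m
  cont := continuousOn_const.mul h.cont

lemma hasDerivIcc_comp {f f' σ : ℝ → ℝ} {m : ℝ} (hσ : ∀ x, HasDerivAt σ m x)
    (hm : MapsTo σ (Icc 0 1) (Icc (-1) 1))
    (hf : ∀ y ∈ Icc (-1 : ℝ) 1, HasDerivWithinAt f (f' y) (Icc (-1) 1) y)
    (hf' : ContinuousOn f' (Icc (-1) 1)) :
    HasDerivIcc (fun x => f (σ x)) (fun x => m * f' (σ x)) where
  deriv x hx := ((hf (σ x) (hm hx)).comp x (hσ x).hasDerivWithinAt hm).congr_deriv (mul_comm _ _)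
  cont := continuousOn_const.mul (hf'.comp
    (fun x _ => (hσ x).continuousAt.continuousWithinAt) hm)

/-- A function with continuous partial derivatives on `[-1, 1] × (t₀, ∞)` is continuous there. -/
lemma continuousOn_of_hasDeriv {u ut uy : ℝ → ℝ → ℝ} {t₀ : ℝ}
    (hy : ContinuousOn (fun z : ℝ × ℝ => uy z.1 z.2) (Icc (-1) 1 ×ˢ Ioi t₀))
    (h : ∀ y ∈ Icc (-1 : ℝ) 1, ∀ t > t₀, HasDerivAt (fun s => u y s) (ut y t) t ∧
      HasDerivWithinAt (fun z => u z t) (uy y t) (Icc (-1) 1) y) :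
    ContinuousOn (fun z : ℝ × ℝ => u z.1 z.2) (Icc (-1) 1 ×ˢ Ioi t₀) := by
  refine continuousOn_Ioi_of_Ici fun s hs => ?_
  obtain ⟨F, hF, hFu⟩ := exists_continuous_extension (isClosed_Icc.prod isClosed_Ici)
    (hy.mono (prod_mono_right (Ici_subset_Ioi.2 hs)))
  have c1 : Continuous fun z : ℝ × ℝ => ∫ r in (-1 : ℝ)..z.1, F (r, z.2) :=
    continuous_integral_limits (H := fun z r => F (r, z.2)) (by fun_prop) continuous_const
      continuous_fst
  have m : (-1 : ℝ) ∈ Icc (-1 : ℝ) 1 := ⟨le_rfl, neg_one_le_one⟩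
  have c2 : ContinuousOn (fun t => u (-1) t) (Ici s) := fun t ht =>
    (h _ m t (hs.trans_le ht)).1.continuousAt.continuousWithinAt
  refine ((c2.comp continuousOn_snd fun z hz => hz.2).add c1.continuousOn).congr fun z hz => ?_
  have ht : t₀ < z.2 := lt_of_lt_of_le hs hz.2
  have hsub : Icc (-1) z.1 ⊆ Icc (-1 : ℝ) 1 := Icc_subset_Icc le_rfl hz.1.2
  have ftc := integral_eq_sub_of_hasDerivAt_of_le (f := fun r => u r z.2)
    (f' := fun r => F (r, z.2)) hz.1.1
    (fun r hr => ((h r (hsub hr) z.2 ht).2.continuousWithinAt).mono hsub)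
    (fun r hr => by
      have hr' : r ∈ Icc (-1 : ℝ) 1 := hsub ⟨hr.1.le, hr.2.le⟩
      rw [hFu (show (r, z.2) ∈ Icc (-1 : ℝ) 1 ×ˢ Ici s from ⟨hr', hz.2⟩)]
      exact (h r hr' z.2 ht).2.hasDerivAt (Icc_mem_nhds hr.1 (hr.2.trans_le hz.1.2)))
    (Continuous.intervalIntegrable (by fun_prop) _ _)
  change u z.1 z.2 = u (-1) z.2 + ∫ r in (-1 : ℝ)..z.1, F (r, z.2)
  rw [ftc]
  ring

lemma hasDerivWithinAt_advPhase {ε : ℝ} {ν : ℝ → ℝ} (hν : ContinuousOn ν (Icc (-1) 1)) {y : ℝ}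
    (hy : y ∈ Icc (-1 : ℝ) 1) :
    HasDerivWithinAt (advPhase ε ν) (ν y / (2 * ε)) (Icc (-1) 1) y := by
  obtain ⟨N, hN, hNν⟩ := exists_continuous_extension isClosed_Icc hν
  have h := (hasDerivAt_integral_upper (f := fun z => N z / (2 * ε)) (by fun_prop) (-1) y)
  have e : ∀ x ∈ Icc (-1 : ℝ) 1, advPhase ε ν x = ∫ z in (-1)..x, N z / (2 * ε) := fun x hx =>
    intervalIntegral.integral_congr fun z hz => by
      rw [uIcc_of_le hx.1] at hz
      have := hNν (show z ∈ Icc (-1 : ℝ) 1 from ⟨hz.1, hz.2.trans hx.2⟩)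
      rw [this]
  rw [hNν hy] at h
  exact h.hasDerivWithinAt.congr e (e y hy)

section

variable {y₀ : ℝ}

lemma fold_left_mapsTo (hy : y₀ ∈ Ioc (-1 : ℝ) 0) :
    MapsTo (fun x : ℝ => y₀ - (1 + y₀) * x) (Icc 0 1) (Icc (-1) 1) := fun x hx =>
  ⟨by nlinarith [hx.1, hx.2, hy.1], by nlinarith [hx.1, hx.2, hy.1, hy.2]⟩

lemma fold_right_mapsTo (hy : y₀ ∈ Ioc (-1 : ℝ) 0) :
    MapsTo (fun x : ℝ => y₀ + (1 - y₀) * x) (Icc 0 1) (Icc (-1) 1) := fun x hx =>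
  ⟨by nlinarith [hx.1, hx.2, hy.1, hy.2], by nlinarith [hx.1, hx.2, hy.1, hy.2]⟩

/-- Integrals over `[-1, 1]` in the folded coordinates. -/
lemma integral_fold (hy : y₀ ∈ Ioc (-1 : ℝ) 0) {f f₁ f₂ : ℝ → ℝ} (h1 : ContinuousOn f₁ (Icc 0 1))
    (h2 : ContinuousOn f₂ (Icc 0 1)) (e1 : ∀ x ∈ Ioo (0 : ℝ) 1, f (y₀ - (1 + y₀) * x) = f₁ x)
    (e2 : ∀ x ∈ Ioo (0 : ℝ) 1, f (y₀ + (1 - y₀) * x) = f₂ x) :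
    ∫ y in (-1 : ℝ)..1, f y =
      (1 + y₀) * (∫ x in (0 : ℝ)..1, f₁ x) + (1 - y₀) * ∫ x in (0 : ℝ)..1, f₂ x := by
  have hA : 0 < 1 + y₀ := by linarith [hy.1]
  have hB : 0 < 1 - y₀ := by linarith [hy.2]
  have b1 : -1 ≤ y₀ := hy.1.le
  have b2 : y₀ ≤ 1 := by linarith [hy.2]
  have i1 : IntervalIntegrable f volume (-1) y₀ := by
    rw [intervalIntegrable_iff_integrableOn_Ioo_of_le b1]
    have c : ContinuousOn (fun y => f₁ ((y₀ - y) / (1 + y₀))) (Icc (-1) y₀) :=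
      h1.comp (by fun_prop) fun y hy => ⟨div_nonneg (by linarith [hy.2]) hA.le, by
        rw [div_le_one hA]; linarith [hy.1]⟩
    refine ((c.integrableOn_compact isCompact_Icc).mono_set Ioo_subset_Icc_self).congr_fun
      (fun y hy => ?_) measurableSet_Ioo
    have m : (y₀ - y) / (1 + y₀) ∈ Ioo (0 : ℝ) 1 := ⟨div_pos (by linarith [hy.2]) hA, by
      rw [div_lt_one hA]; linarith [hy.1]⟩
    simp only
    rw [← e1 _ m]
    congr 1
    field_simp
    ring
  have i2 : IntervalIntegrable f volume y₀ 1 := by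
    rw [intervalIntegrable_iff_integrableOn_Ioo_of_le b2]
    have c : ContinuousOn (fun y => f₂ ((y - y₀) / (1 - y₀))) (Icc y₀ 1) :=
      h2.comp (by fun_prop) fun y hy => ⟨div_nonneg (by linarith [hy.1]) hB.le, by
        rw [div_le_one hB]; linarith [hy.2]⟩
    refine ((c.integrableOn_compact isCompact_Icc).mono_set Ioo_subset_Icc_self).congr_fun
      (fun y hy => ?_) measurableSet_Ioo
    have m : (y - y₀) / (1 - y₀) ∈ Ioo (0 : ℝ) 1 := ⟨div_pos (by linarith [hy.1]) hB, by
      rw [div_lt_one hB]; linarith [hy.2]⟩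
    simp only
    rw [← e2 _ m]
    congr 1
    field_simp
    ring
  have s1 := intervalIntegral.integral_comp_sub_mul (a := 0) (b := 1) f hA.ne' y₀
  have s2 := intervalIntegral.integral_comp_add_mul (a := 0) (b := 1) f hB.ne' y₀
  rw [intervalIntegral.integral_congr_Ioo_of_le zero_le_one e1] at s1
  rw [intervalIntegral.integral_congr_Ioo_of_le zero_le_one e2] at s2
  rw [← intervalIntegral.integral_add_adjacent_intervals i1 i2, s1, s2,
    show y₀ - (1 + y₀) * 1 = -1 by ring, show y₀ - (1 + y₀) * 0 = y₀ by ring,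
    show y₀ + (1 - y₀) * 1 = 1 by ring, show y₀ + (1 - y₀) * 0 = y₀ by ring]
  simp only [smul_eq_mul]
  field_simp

end

section

variable {ε y₀ c₁ c₂ : ℝ} {ν lam p : ℝ → ℝ} {q r : ℝ → ℝ → ℝ}
  {K : ℝ → ℝ → Matrix (Fin 2) (Fin 2) ℝ}

lemma continuousOn_advPhase (hν : ContinuousOn ν (Icc (-1) 1)) :
    ContinuousOn (advPhase ε ν) (Icc (-1) 1) :=
  fun _ hy => (hasDerivWithinAt_advPhase hν hy).continuousWithinAt

lemma IsClosedLoopSolution.continuousOn {F₁ F₂ : ℝ → ℝ} {t₀ : ℝ} {u : ℝ → ℝ → ℝ}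
    (h : IsClosedLoopSolution ε ν lam F₁ F₂ t₀ u) :
    ContinuousOn (fun z : ℝ × ℝ => u z.1 z.2) (Icc (-1) 1 ×ˢ Ioi t₀) := by
  obtain ⟨ut, uy, uyy, -, h2, -, h4⟩ := h.evolution
  exact continuousOn_of_hasDeriv h2 fun y hy t ht => ⟨(h4 y hy t ht).1, (h4 y hy t ht).2.1⟩

/-- Removing the advection and folding turns closed loop solutions into folded ones. -/
lemma IsClosedLoopSolution.exists_isFoldedSolution (hε : 0 < ε) (hy : y₀ ∈ Ioc (-1 : ℝ) 0)
    (hν : ContDiffOn ℝ 2 ν (Icc (-1) 1))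
    (hK : IsKernelFamily ε y₀ c₁ c₂ (reducedReaction ε ν lam) K p q r) {t₀ : ℝ} {u : ℝ → ℝ → ℝ}
    (h : IsClosedLoopSolution ε ν lam (origGain1 ε y₀ ν K) (origGain2 ε y₀ ν K p q) t₀ u) :
    ∃ u₁t u₂t : ℝ → ℝ → ℝ, IsFoldedSolution ε y₀ (reducedReaction ε ν lam) K p q t₀
      (fun x t => Real.exp (advPhase ε ν (y₀ - (1 + y₀) * x)) * u (y₀ - (1 + y₀) * x) t) u₁t
      (fun x t => Real.exp (advPhase ε ν (y₀ + (1 - y₀) * x)) * u (y₀ + (1 - y₀) * x) t) u₂t := by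
  have uc := h.continuousOn
  obtain ⟨ut, uy, uyy, k1, k2, k3, k4⟩ := h.evolution
  set φ := advPhase ε ν with hφ
  have hA : 0 < 1 + y₀ := by linarith [hy.1]
  have hB : 0 < 1 - y₀ := by linarith [hy.2]
  have dφ : ∀ y ∈ Icc (-1 : ℝ) 1, HasDerivWithinAt φ (ν y / (2 * ε)) (Icc (-1) 1) y :=
    fun y hy => hasDerivWithinAt_advPhase hν.continuousOn hy
  have cφ : ContinuousOn φ (Icc (-1) 1) := continuousOn_advPhase hν.continuousOn
  have ce : ContinuousOn (fun y => Real.exp (φ y)) (Icc (-1) 1) := cφ.rexp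
  have dν : ∀ y ∈ Icc (-1 : ℝ) 1, HasDerivWithinAt ν (derivWithin ν (Icc (-1) 1) y)
      (Icc (-1) 1) y := fun y hy => (hν.differentiableOn (by norm_num) y hy).hasDerivWithinAt
  have cν' : ContinuousOn (derivWithin ν (Icc (-1) 1)) (Icc (-1) 1) :=
    hν.continuousOn_derivWithin (uniqueDiffOn_Icc (by norm_num)) (by norm_num)
  set vy : ℝ → ℝ → ℝ := fun y t => Real.exp (φ y) * (uy y t + ν y / (2 * ε) * u y t) with hvy
  set vyy : ℝ → ℝ → ℝ := fun y t => Real.exp (φ y) * (uyy y t + ν y / ε * uy y t +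
    (derivWithin ν (Icc (-1) 1) y / (2 * ε) + (ν y / (2 * ε)) ^ 2) * u y t) with hvyy
  have dv : ∀ t > t₀, ∀ y ∈ Icc (-1 : ℝ) 1,
      HasDerivWithinAt (fun y => Real.exp (φ y) * u y t) (vy y t) (Icc (-1) 1) y := by
    intro t ht y hy
    refine ((dφ y hy).exp.mul (k4 y hy t ht).2.1).congr_deriv ?_
    rw [hvy]; ring
  have dvy : ∀ t > t₀, ∀ y ∈ Icc (-1 : ℝ) 1,
      HasDerivWithinAt (fun y => vy y t) (vyy y t) (Icc (-1) 1) y := by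
    intro t ht y hy
    refine ((dφ y hy).exp.mul ((k4 y hy t ht).2.2.1.add
      (((dν y hy).div_const (2 * ε)).mul (k4 y hy t ht).2.1))).congr_deriv ?_
    simp only [hvyy, Pi.add_apply, Pi.mul_apply]
    field_simp
    ring
  have sec : ∀ {f : ℝ → ℝ → ℝ}, ContinuousOn (fun z : ℝ × ℝ => f z.1 z.2) (Icc (-1) 1 ×ˢ Ioi t₀) →
      ∀ t > t₀, ContinuousOn (fun y => f y t) (Icc (-1) 1) := fun hf t ht =>
    hf.comp (f := fun y : ℝ => (y, t)) (by fun_prop) fun _ hy => ⟨hy, ht⟩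
  have cvy : ∀ t > t₀, ContinuousOn (fun y => vy y t) (Icc (-1) 1) := fun t ht =>
    ce.mul ((sec k2 t ht).add ((hν.continuousOn.div_const _).mul (sec uc t ht)))
  have cvyy : ∀ t > t₀, ContinuousOn (fun y => vyy y t) (Icc (-1) 1) := fun t ht =>
    ce.mul (((sec k3 t ht).add ((hν.continuousOn.div_const _).mul (sec k2 t ht))).add
      (((cν'.div_const _).add ((hν.continuousOn.div_const _).pow 2)).mul (sec uc t ht)))
  -- `φ' = ν / (2 ε)` makes the first-order terms cancel; what is left of `ν` is the correction in
  -- `reducedReaction`.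
  have pde : ∀ y ∈ Icc (-1 : ℝ) 1, ∀ t > t₀, Real.exp (φ y) * ut y t =
      ε * vyy y t + reducedReaction ε ν lam y * (Real.exp (φ y) * u y t) := by
    intro y hy t ht
    rw [(k4 y hy t ht).2.2.2, hvyy, reducedReaction]
    field_simp
    ring
  have fam : ∀ {σ : ℝ → ℝ}, Continuous σ → MapsTo σ (Icc 0 1) (Icc (-1) 1) →
      TimeFamily t₀ (fun x t => Real.exp (φ (σ x)) * u (σ x) t)
        (fun x t => Real.exp (φ (σ x)) * ut (σ x) t) := by
    intro σ hσ hm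
    have c : ContinuousOn (fun z : ℝ × ℝ => (σ z.1, z.2)) (Icc 0 1 ×ˢ Ioi t₀) := by fun_prop
    have m : MapsTo (fun z : ℝ × ℝ => (σ z.1, z.2)) (Icc 0 1 ×ˢ Ioi t₀)
      (Icc (-1) 1 ×ˢ Ioi t₀) := fun z hz => ⟨hm hz.1, hz.2⟩
    have e : ContinuousOn (fun z : ℝ × ℝ => Real.exp (φ (σ z.1))) (Icc 0 1 ×ˢ Ioi t₀) :=
      ce.comp (f := fun z : ℝ × ℝ => σ z.1) (by fun_prop) fun z hz => hm hz.1
    exact ⟨e.mul (uc.comp c m), e.mul (k1.comp c m),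
      fun x hx t ht => (k4 (σ x) (hm hx) t ht).1.const_mul _⟩
  have m1 := fold_left_mapsTo hy
  have m2 := fold_right_mapsTo hy
  have d1 : ∀ x, HasDerivAt (fun x : ℝ => y₀ - (1 + y₀) * x) (-(1 + y₀)) x := fun x =>
    (((hasDerivAt_id x).const_mul (1 + y₀)).const_sub y₀).congr_deriv (by ring)
  have d2 : ∀ x, HasDerivAt (fun x : ℝ => y₀ + (1 - y₀) * x) (1 - y₀) x := fun x =>
    (((hasDerivAt_id x).const_mul (1 - y₀)).const_add y₀).congr_deriv (by ring)
  have F1 := fam (σ := fun x => y₀ - (1 + y₀) * x) (by fun_prop) m1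
  have F2 := fam (σ := fun x => y₀ + (1 - y₀) * x) (by fun_prop) m2
  have hk := hK.first.continuousOn_entry
  obtain ⟨g1, g2⟩ := hK.continuousOn_gains
  have left : ∀ x, (y₀ - (y₀ - (1 + y₀) * x)) / (1 + y₀) = x := fun x => by field_simp; ring
  have right : ∀ x, (y₀ + (1 - y₀) * x - y₀) / (1 - y₀) = x := fun x => by field_simp; ring
  have lle : ∀ x ∈ Ioo (0 : ℝ) 1, y₀ - (1 + y₀) * x ≤ y₀ := fun x hx => by nlinarith [hx.1]
  have rgt : ∀ x ∈ Ioo (0 : ℝ) 1, ¬ y₀ + (1 - y₀) * x ≤ y₀ := fun x hx => by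
    rw [not_le]; nlinarith [hx.1]
  refine ⟨_, _, F1, F2, fun t ht => ?_, fun t ht => ?_, fun t ht => ?_, fun t ht => ?_⟩
  · refine ⟨_, _, _, _, hasDerivIcc_comp d1 m1 (dv t ht) (cvy t ht),
      (hasDerivIcc_comp d1 m1 (dvy t ht) (cvyy t ht)).const_mul _,
      hasDerivIcc_comp d2 m2 (dv t ht) (cvy t ht),
      (hasDerivIcc_comp d2 m2 (dvy t ht) (cvyy t ht)).const_mul _, ?_, fun x hx => ?_,
      fun x hx => ?_⟩
    -- Both folded derivatives at `0` come from the same derivative at `y₀`, with factors `-(1 +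
    -- y₀)` and `1 - y₀`, and `a (1 - y₀) = 1 + y₀`.
    · rw [mul_zero, mul_zero, sub_zero, add_zero, aCoef]; field_simp; ring
    · have e : eps1 ε y₀ * (1 + y₀) ^ 2 = ε := by unfold eps1; field_simp
      have := pde _ (m1 hx) t ht
      simp only at this ⊢
      rw [this]
      linear_combination -vyy (y₀ - (1 + y₀) * x) t * e
    · have e : eps2 ε y₀ * (1 - y₀) ^ 2 = ε := by unfold eps2; field_simp
      have := pde _ (m2 hx) t ht
      simp only at this ⊢
      rw [this]
      linear_combination -vyy (y₀ + (1 - y₀) * x) t * e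
  · simp only [mul_zero, sub_zero, add_zero]
  · have s1 := F1.continuousOn_section ht
    have s2 := F2.continuousOn_section ht
    have c1 := (continuousOn_bottom (hk 0 0)).mul s1
    have c2 := (continuousOn_bottom (hk 0 1)).mul s2
    have key := integral_fold hy (f := fun y => origGain1 ε y₀ ν K y * u y t)
      (continuousOn_const (c := (1 + y₀)⁻¹) |>.mul c1)
      (continuousOn_const (c := (1 - y₀)⁻¹) |>.mul c2)
      (fun x hx => by
        simp only [origGain1, gain1, if_pos (lle x hx), left, Pi.mul_apply, entry]; ring)
      (fun x hx => by
        simp only [origGain1, gain1, if_neg (rgt x hx), right, Pi.mul_apply, entry]; ring)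
    have e0 : φ (-1) = 0 := by rw [hφ, advPhase, intervalIntegral.integral_same]
    rw [show y₀ - (1 + y₀) * 1 = -1 by ring, e0, Real.exp_zero, one_mul, h.left_control t ht, key]
    simp only [Pi.mul_apply, intervalIntegral.integral_const_mul]
    rw [mul_inv_cancel_left₀ hA.ne', mul_inv_cancel_left₀ hB.ne']
    exact (intervalIntegral.integral_add (intervalIntegrable_Icc c1)
      (intervalIntegrable_Icc c2)).symm
  · have s1 := F1.continuousOn_section ht
    have s2 := F2.continuousOn_section ht
    have c1 := g1.mul s1
    have c2 := g2.mul s2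
    -- The state without advection has the boundary value `exp (φ 1) ū(1)`; this factor cancels the
    -- normalisation in `origGain2`. At the left end no factor is needed since `φ (-1) = 0`.
    have key := integral_fold hy (f := fun y => Real.exp (φ 1) * (origGain2 ε y₀ ν K p q y * u y t))
      (continuousOn_const (c := (1 + y₀)⁻¹) |>.mul c1)
      (continuousOn_const (c := (1 - y₀)⁻¹) |>.mul c2)
      (fun x hx => by
        simp only [origGain2, gain2, if_pos (lle x hx), left, Pi.mul_apply, Real.exp_sub, ← hφ]
        field_simp)
      (fun x hx => by
        simp only [origGain2, gain2, if_neg (rgt x hx), right, Pi.mul_apply, Real.exp_sub, ← hφ]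
        field_simp)
    rw [intervalIntegral.integral_const_mul] at key
    rw [show y₀ + (1 - y₀) * 1 = 1 by ring, h.right_control t ht, key]
    simp only [Pi.mul_apply, intervalIntegral.integral_const_mul]
    rw [mul_inv_cancel_left₀ hA.ne', mul_inv_cancel_left₀ hB.ne']
    exact (intervalIntegral.integral_add (intervalIntegrable_Icc c1)
      (intervalIntegrable_Icc c2)).symm

end

/-! ### Exponential stability in `L²` of the original state. -/

lemma l2norm_sq (f : ℝ → ℝ) : l2norm f ^ 2 = ∫ y in (-1 : ℝ)..1, f y ^ 2 :=
  Real.sq_sqrt (intervalIntegral.integral_nonneg neg_one_le_one fun _ _ => sq_nonneg _)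

lemma MemLp.intervalIntegrable_sq {f : ℝ → ℝ} (hf : MemLp f 2 (volume.restrict (Icc (-1) 1))) :
    IntervalIntegrable (fun y => f y ^ 2) volume (-1) 1 :=
  (intervalIntegrable_iff_integrableOn_Icc_of_le neg_one_le_one).2 hf.integrable_sq

lemma sq_l2norm_le_of_sub {f g : ℝ → ℝ} (hf : MemLp f 2 (volume.restrict (Icc (-1) 1)))
    (hg : MemLp g 2 (volume.restrict (Icc (-1) 1))) :
    l2norm f ^ 2 ≤ 2 * l2norm g ^ 2 + 2 * l2norm (fun y => f y - g y) ^ 2 := by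
  have i1 := MemLp.intervalIntegrable_sq hf
  have i2 := MemLp.intervalIntegrable_sq hg
  have i3 : IntervalIntegrable (fun y => (f y - g y) ^ 2) volume (-1) 1 :=
    MemLp.intervalIntegrable_sq (hf.sub hg)
  rw [l2norm_sq, l2norm_sq, l2norm_sq, ← intervalIntegral.integral_const_mul,
    ← intervalIntegral.integral_const_mul,
    ← intervalIntegral.integral_add (i2.const_mul 2) (i3.const_mul 2)]
  refine intervalIntegral.integral_mono_on neg_one_le_one i1 ((i2.const_mul 2).add
    (i3.const_mul 2)) fun y _ => ?_
  nlinarith [sq_nonneg (f y - 2 * g y)]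

lemma integral_le_const_mul {f g : ℝ → ℝ} {G : ℝ} (hf : ContinuousOn f (Icc 0 1))
    (hg : ContinuousOn g (Icc 0 1)) (h : ∀ x ∈ Icc (0 : ℝ) 1, f x ≤ G * g x) :
    ∫ x in (0 : ℝ)..1, f x ≤ G * ∫ x in (0 : ℝ)..1, g x := by
  rw [← intervalIntegral.integral_const_mul]
  exact integral_mono_Icc hf (continuousOn_const.mul hg) h

section

variable {ε y₀ c₁ c₂ : ℝ} {ν lam p : ℝ → ℝ} {q r : ℝ → ℝ → ℝ}
  {K : ℝ → ℝ → Matrix (Fin 2) (Fin 2) ℝ}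

/-- The `L²` norm of a state in terms of the folded state without advection. -/
lemma exists_l2norm_equiv (hy : y₀ ∈ Ioc (-1 : ℝ) 0) {φ : ℝ → ℝ}
    (hφ : ContinuousOn φ (Icc (-1) 1)) :
    ∃ C : ℝ, 0 ≤ C ∧ ∀ f : ℝ → ℝ, ContinuousOn f (Icc (-1) 1) →
      l2norm f ^ 2 ≤ C * ((∫ x in (0 : ℝ)..1,
        (Real.exp (φ (y₀ - (1 + y₀) * x)) * f (y₀ - (1 + y₀) * x)) ^ 2) +
        ∫ x in (0 : ℝ)..1, (Real.exp (φ (y₀ + (1 - y₀) * x)) * f (y₀ + (1 - y₀) * x)) ^ 2) ∧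
      (∫ x in (0 : ℝ)..1, (Real.exp (φ (y₀ - (1 + y₀) * x)) * f (y₀ - (1 + y₀) * x)) ^ 2) +
        (∫ x in (0 : ℝ)..1, (Real.exp (φ (y₀ + (1 - y₀) * x)) * f (y₀ + (1 - y₀) * x)) ^ 2) ≤
        C * l2norm f ^ 2 := by
  have hA : 0 < 1 + y₀ := by linarith [hy.1]
  have hB : 0 < 1 - y₀ := by linarith [hy.2]
  obtain ⟨P, hP⟩ := isCompact_Icc.exists_bound_of_continuousOn hφ
  obtain ⟨G, hG⟩ : ∃ G : ℝ, G = Real.exp (2 * P) := ⟨_, rfl⟩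
  have G0 : 0 < G := hG ▸ Real.exp_pos _
  have up : ∀ y ∈ Icc (-1 : ℝ) 1, ∀ a : ℝ, (Real.exp (φ y) * a) ^ 2 ≤ G * a ^ 2 := by
    intro y hy a
    rw [mul_pow, ← Real.exp_nat_mul, hG]
    refine mul_le_mul_of_nonneg_right (Real.exp_le_exp.2 ?_) (sq_nonneg a)
    have := (abs_le.1 (hP y hy)).2
    push_cast; linarith
  have lo : ∀ y ∈ Icc (-1 : ℝ) 1, ∀ a : ℝ, a ^ 2 ≤ G * (Real.exp (φ y) * a) ^ 2 := by
    intro y hy a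
    rw [mul_pow, ← Real.exp_nat_mul, ← mul_assoc, hG, ← Real.exp_add]
    refine le_mul_of_one_le_left (sq_nonneg a) (Real.one_le_exp ?_)
    have := (abs_le.1 (hP y hy)).1
    push_cast; linarith
  refine ⟨max (2 * G) (G * (1 + y₀)⁻¹), le_max_of_le_left (by positivity), fun f hf => ?_⟩
  have c : ∀ {σ : ℝ → ℝ}, Continuous σ → MapsTo σ (Icc 0 1) (Icc (-1) 1) →
      ContinuousOn (fun x => f (σ x) ^ 2) (Icc 0 1) ∧
      ContinuousOn (fun x => (Real.exp (φ (σ x)) * f (σ x)) ^ 2) (Icc 0 1) := fun hσ hm =>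
    ⟨(hf.comp hσ.continuousOn hm).pow 2,
      (((hφ.comp hσ.continuousOn hm).rexp).mul (hf.comp hσ.continuousOn hm)).pow 2⟩
  have m1 := fold_left_mapsTo hy
  have m2 := fold_right_mapsTo hy
  obtain ⟨c1, d1⟩ := c (σ := fun x => y₀ - (1 + y₀) * x) (by fun_prop) m1
  obtain ⟨c2, d2⟩ := c (σ := fun x => y₀ + (1 - y₀) * x) (by fun_prop) m2
  rw [l2norm_sq, integral_fold hy c1 c2 (fun _ _ => rfl) (fun _ _ => rfl)]
  have u1 := integral_le_const_mul d1 c1 fun x hx => up _ (m1 hx) _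
  have u2 := integral_le_const_mul d2 c2 fun x hx => up _ (m2 hx) _
  have l1 := integral_le_const_mul c1 d1 fun x hx => lo _ (m1 hx) _
  have l2 := integral_le_const_mul c2 d2 fun x hx => lo _ (m2 hx) _
  have n1 := integral_sq_nonneg fun x => f (y₀ - (1 + y₀) * x)
  have n2 := integral_sq_nonneg fun x => f (y₀ + (1 - y₀) * x)
  have n3 := integral_sq_nonneg fun x =>
    Real.exp (φ (y₀ - (1 + y₀) * x)) * f (y₀ - (1 + y₀) * x)
  have n4 := integral_sq_nonneg fun x =>
    Real.exp (φ (y₀ + (1 - y₀) * x)) * f (y₀ + (1 - y₀) * x)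
  generalize (∫ x in (0 : ℝ)..1, f (y₀ - (1 + y₀) * x) ^ 2) = a at *
  generalize (∫ x in (0 : ℝ)..1, f (y₀ + (1 - y₀) * x) ^ 2) = b at *
  generalize (∫ x in (0 : ℝ)..1,
    (Real.exp (φ (y₀ - (1 + y₀) * x)) * f (y₀ - (1 + y₀) * x)) ^ 2) = a' at *
  generalize (∫ x in (0 : ℝ)..1,
    (Real.exp (φ (y₀ + (1 - y₀) * x)) * f (y₀ + (1 - y₀) * x)) ^ 2) = b' at *
  constructor
  · refine le_trans ?_ (mul_le_mul_of_nonneg_right (le_max_left _ _) (add_nonneg n3 n4))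
    have t1 : (1 + y₀) * a ≤ 2 * a := mul_le_mul_of_nonneg_right (by linarith [hy.2]) n1
    have t2 : (1 - y₀) * b ≤ 2 * b := mul_le_mul_of_nonneg_right (by linarith [hy.1]) n2
    linarith
  · have t0 : 0 ≤ (1 + y₀) * a + (1 - y₀) * b := by positivity
    refine le_trans ?_ (mul_le_mul_of_nonneg_right (le_max_right _ _) t0)
    have t2 : (1 + y₀) * b ≤ (1 - y₀) * b := mul_le_mul_of_nonneg_right (by linarith [hy.2]) n2
    have t3 : a + b ≤ (1 + y₀)⁻¹ * ((1 + y₀) * a + (1 - y₀) * b) := by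
      rw [le_inv_mul_iff₀ hA]; linarith
    have t4 := mul_le_mul_of_nonneg_left t3 G0.le
    linarith

/-- Exponential stability of the closed loop. -/
theorem IsKernelFamily.exists_decay (hε : 0 < ε) (hy : y₀ ∈ Ioc (-1 : ℝ) 0) (hc₁ : 0 < c₁)
    (hν : ContDiffOn ℝ 2 ν (Icc (-1) 1)) (hlam : ContDiffOn ℝ 1 lam (Icc (-1) 1))
    (hK : IsKernelFamily ε y₀ c₁ c₂ (reducedReaction ε ν lam) K p q r) :
    ∃ M : ℝ, 0 < M ∧ ∀ (t₀ : ℝ) (u : ℝ → ℝ → ℝ),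
      IsClosedLoopSolution ε ν lam (origGain1 ε y₀ ν K) (origGain2 ε y₀ ν K p q) t₀ u →
      ∀ t ≥ t₀, l2norm (fun y => u y t) ≤
        M * Real.exp (-decayRate ε y₀ c₁ c₂ * (t - t₀)) * l2norm (fun y => u y t₀) := by
  obtain ⟨C, C0, hC⟩ := hK.exists_folded_decay hε hy hc₁
    (contDiffOn_reducedReaction hν hlam).continuousOn
  obtain ⟨B, B0, hB⟩ := exists_l2norm_equiv hy (continuousOn_advPhase (ε := ε) hν.continuousOn)
  set γ := decayRate ε y₀ c₁ c₂ with hγ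
  -- With `D = B C B` the limit below gives the squared factor `2 D`, and `2 D ≤ (1 + 2 D)²`; the
  -- summand `1` also covers `t = t₀`.
  refine ⟨1 + 2 * (B * C * B), by positivity, fun t₀ u hu t ht => ?_⟩
  set n₀ := l2norm (fun y => u y t₀) with hn₀
  have n0 : 0 ≤ n₀ := Real.sqrt_nonneg _
  rcases (show t₀ ≤ t from ht).eq_or_lt with rfl | hlt
  · rw [sub_self, mul_zero, Real.exp_zero, mul_one]
    exact le_mul_of_one_le_left n0 (le_add_of_nonneg_right (by positivity))
  have uc : ∀ s > t₀, ContinuousOn (fun y => u y s) (Icc (-1) 1) := fun s hs =>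
    hu.continuousOn.comp (f := fun y : ℝ => (y, s)) (by fun_prop) fun _ hy => ⟨hy, hs⟩
  obtain ⟨u₁t, u₂t, hfold⟩ := hu.exists_isFoldedSolution hε hy hν hK
  -- The estimate starts at `s > t₀`, and the state at `s` is replaced by the initial state plus an
  -- `L²` error.
  have step : ∀ s, t₀ < s → s ≤ t → l2norm (fun y => u y t) ^ 2 ≤
      B * C * B * Real.exp (-(2 * γ) * (t - s)) *
        (2 * n₀ ^ 2 + 2 * l2norm (fun y => u y s - u y t₀) ^ 2) := by
    intro s hs hst
    have k1 := (hB _ (uc t hlt)).1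
    have k2 := hC t₀ _ _ _ _ hfold s t hs hst
    have k3 := (hB _ (uc s hs)).2
    have hms : MemLp (fun y => u y s) 2 (volume.restrict (Icc (-1) 1)) :=
      (memLp_two_iff_integrable_sq ((uc s hs).aestronglyMeasurable measurableSet_Icc)).2
        (((uc s hs).pow 2).integrableOn_compact isCompact_Icc)
    have k4 := sq_l2norm_le_of_sub hms hu.initial_mem
    have e0 := (Real.exp_pos (-(2 * γ) * (t - s))).le
    calc l2norm (fun y => u y t) ^ 2 ≤ _ := k1
      _ ≤ B * (C * Real.exp (-(2 * γ) * (t - s)) * (B * l2norm (fun y => u y s) ^ 2)) :=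
        mul_le_mul_of_nonneg_left (k2.trans (mul_le_mul_of_nonneg_left k3 (by positivity))) B0
      _ = B * C * B * Real.exp (-(2 * γ) * (t - s)) * l2norm (fun y => u y s) ^ 2 := by ring
      _ ≤ _ := mul_le_mul_of_nonneg_left k4 (by positivity)
  -- As `s ↓ t₀` the error vanishes by the `L²` attainment of the initial state.
  have lim : Tendsto (fun s => B * C * B * Real.exp (-(2 * γ) * (t - s)) *
      (2 * n₀ ^ 2 + 2 * l2norm (fun y => u y s - u y t₀) ^ 2)) (𝓝[>] t₀)
      (𝓝 (B * C * B * Real.exp (-(2 * γ) * (t - t₀)) * (2 * n₀ ^ 2 + 2 * 0 ^ 2))) := by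
    have ce : Continuous fun s => B * C * B * Real.exp (-(2 * γ) * (t - s)) := by fun_prop
    exact ((ce.tendsto t₀).mono_left nhdsWithin_le_nhds).mul
      (((hu.initial_lim.pow 2).const_mul 2).const_add _)
  have fin := ge_of_tendsto lim (by
    filter_upwards [Ioc_mem_nhdsGT hlt] with s hs using step s hs.1 hs.2)
  have e1 : Real.exp (-(2 * γ) * (t - t₀)) = Real.exp (-γ * (t - t₀)) ^ 2 := by
    rw [← Real.exp_nat_mul]; congr 1; push_cast; ring
  set e := Real.exp (-γ * (t - t₀)) with he
  have e0 : 0 < e := Real.exp_pos _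
  refine le_of_sq_le_sq ?_ (by positivity)
  refine fin.trans ?_
  rw [e1]
  set D := B * C * B
  have D0 : 0 ≤ D := by positivity
  have : D * 2 ≤ (1 + 2 * D) ^ 2 := by nlinarith
  nlinarith [mul_le_mul_of_nonneg_right this (sq_nonneg (e * n₀))]

end

end

end Folding

theorem theorem1 (ε y₀ c₁ c₂ : ℝ) (ν lam : ℝ → ℝ)
    (hε : 0 < ε) (hy₀ : y₀ ∈ Set.Ioc (-1 : ℝ) 0) (hc₁ : 0 < c₁) (hc₂ : 0 < c₂)
    (hν : ContDiffOn ℝ 2 ν (Set.Icc (-1) 1)) (hlam : ContDiffOn ℝ 1 lam (Set.Icc (-1) 1)) :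
    (∃ (K : ℝ → ℝ → Matrix (Fin 2) (Fin 2) ℝ) (p : ℝ → ℝ) (q r : ℝ → ℝ → ℝ),
      Folding.IsKernelFamily ε y₀ c₁ c₂ (Folding.reducedReaction ε ν lam) K p q r) ∧
    0 < Folding.decayRate ε y₀ c₁ c₂ ∧
    ∀ (K : ℝ → ℝ → Matrix (Fin 2) (Fin 2) ℝ) (p : ℝ → ℝ) (q r : ℝ → ℝ → ℝ),
      Folding.IsKernelFamily ε y₀ c₁ c₂ (Folding.reducedReaction ε ν lam) K p q r →
      ∃ M : ℝ, 0 < M ∧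
        ∀ (t₀ : ℝ) (u : ℝ → ℝ → ℝ),
          Folding.IsClosedLoopSolution ε ν lam
            (Folding.origGain1 ε y₀ ν K) (Folding.origGain2 ε y₀ ν K p q) t₀ u →
          ∀ t ≥ t₀,
            Folding.l2norm (fun y => u y t) ≤
              M * Real.exp (-Folding.decayRate ε y₀ c₁ c₂ * (t - t₀)) *
                Folding.l2norm (fun y => u y t₀) := by
  refine ⟨Folding.exists_kernelFamily hε hy₀ (Folding.contDiffOn_reducedReaction hν hlam), ?_,
    fun K p q r hK => hK.exists_decay hε hy₀ hc₁ hν hlam⟩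
  have ha := Folding.aCoef_pos hy₀
  have he := Folding.eps2_pos hε hy₀
  have hm : 0 < min (Folding.aCoef y₀ ^ 3 * c₁) c₂ := lt_min (by positivity) hc₂
  unfold Folding.decayRate
  positivity
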